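/- Let $(\Omega,\mathcal F,\mathsf P)$ be a probability space with a filtration $\mathbb F=(\mathcal F_s)_{s\ge 0}$ and let $W$ be a one-dimensional $\mathbb F$-Brownian motion (adapted, with increments after time $s$ independent of $\mathcal F_s$). Let $T\in(0,\infty)$, let $\mathcal O=\mathbb R$ or $\mathcal O=(0,\infty)$, and let $\mu,\sigma:\overline{\mathcal O}\to\mathbb R$ be locally Lipschitz with linear growth. When $\mathcal O=(0,\infty)$ assume moreover that $0$ is not attainable for the uncontrolled dynamics: for every $y\in\mathcal O$ the equation $Y_s=y+\int_0^s\mu(Y_u)\,du+\int_0^s\sigma(Y_u)\,dW_u$, $s\in[0,T]$, has a continuous $\mathbb F$-adapted solution with $Y_s\in\mathcal O$ for all $s\in[0,T]$, $\mathsf P$-a.s. Let $f:[0,T]\to\mathcal O$ be non-decreasing and left-continuous and let $(t,x)\in[0,T)\times\mathcal O$. A pair $(X,\nu)$ of processes on $[0,T-t]$ is called a solution of the SDE reflected at $f$ with initial condition $(t,x)$ if $(X,\nu)$ is $\mathbb F$-adapted and, $\mathsf P$-a.s., - $X_0=f(t)\wedge x$, the path $s\mapsto X_s\in\mathcal O$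 is continuous on $[0,T-t]$, and $X_s=x+\int_0^s\mu(X_u)\,du+\int_0^s\sigma(X_u)\,dW_u+\nu_s$ for all $s\in[0,T-t]$; - $\nu_0=-(x-f(t))^+$, and $s\mapsto\nu_s$ is continuous and non-increasing on $[0,T-t]$ (the only possible jump is from $\nu_{0-}=0$ to $\nu_0$); - $X_s\le f(t+s)$ for all $s\in[0,T-t]$, and $\int_{(0,T-t]}\mathbf 1_{\{X_s<f(t+s)\}}\,d\nu_s=0$. Then there is a solution $(X,\nu)$ of the SDE reflected at $f$ with initial condition $(t,x)$, and it is unique up to indistinguishability on $[0,T-t]$. Moreover, $\mathsf P$-a.s. for all $s\in[0,T-t]$, $$X_s=x+\int_0^s\mu(X_u)\,du+\int_0^s\sigma(X_u)\,dW_u+\nu_s,$$ $$\nu_s=-\sup_{0\le u\le s}\Big(x+\int_0^u\mu(X_v)\,dv+\int_0^u\sigma(X_v)\,dW_v-f(t+u)\Big)^+,$$ and $$\mathsf E\Big[\sup_{0\le s\le T-t}|X_s|^2\Big]+\mathsf E\big[|\nu_{T-t}|^2\big]<\infty .$$ -/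

import Mathlib

open MeasureTheory ProbabilityTheory Filter Set Topology
open scoped NNReal ENNReal

namespace ReflSDE

/-- `W` is a standard one-dimensional Brownian motion with respect to the filtration `F`
(time set `[0, ∞)`): it is a Brownian motion, it is adapted to `F`, and the increments after time
`s` are independent of `F s`. -/
structure IsFBrownian {Ω : Type*} {mΩ : MeasurableSpace Ω} (F : Filtration ℝ≥0 mΩ)
    (P : Measure Ω) (W : ℝ≥0 → Ω → ℝ) : Prop where
  brownian : IsBrownianReal W P
  adapted : ∀ s, Measurable[F s] (W s)
  indep : ∀ s u, s ≤ u →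
    Indep (MeasurableSpace.comap (fun ω => W u ω - W s ω) (borel ℝ)) (F s) P

/-- Simple integrands `∑_{i < n} ξ_i 1_{(t_i, t_{i+1}]}`, with `t_0 ≤ t_1 ≤ …` deterministic and
`ξ_i` bounded and `F (t_i)`-measurable. -/
structure SimpleIntegrand {Ω : Type*} {mΩ : MeasurableSpace Ω} (F : Filtration ℝ≥0 mΩ) where
  n : ℕ
  time : ℕ → ℝ≥0
  mono : Monotone time
  coef : ℕ → Ω → ℝ
  meas : ∀ i, Measurable[F (time i)] (coef i)
  bdd : ∀ i, ∃ C : ℝ, ∀ ω, |coef i ω| ≤ C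

/-- The value at `(u, ω)` of a simple integrand. -/
noncomputable def SimpleIntegrand.val {Ω : Type*} {mΩ : MeasurableSpace Ω}
    {F : Filtration ℝ≥0 mΩ} (h : SimpleIntegrand F) (u : ℝ≥0) (ω : Ω) : ℝ :=
  ∑ i ∈ Finset.range h.n, (Ioc (h.time i) (h.time (i + 1))).indicator (fun _ => h.coef i ω) u

/-- The elementary stochastic integral `∫_0^s h dW = ∑_i ξ_i (W_{t_{i+1} ∧ s} - W_{t_i ∧ s})`. -/
noncomputable def SimpleIntegrand.integral {Ω : Type*} {mΩ : MeasurableSpace Ω}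
    {F : Filtration ℝ≥0 mΩ} (h : SimpleIntegrand F) (W : ℝ≥0 → Ω → ℝ) (s : ℝ≥0) (ω : Ω) : ℝ :=
  ∑ i ∈ Finset.range h.n,
    h.coef i ω * (W (min (h.time (i + 1)) s) ω - W (min (h.time i) s) ω)

/-- `I` is (a version of) the Itô integral process `s ↦ ∫_0^s H_u dW_u` on `[0, S]`: there are
simple integrands `h k` with `∫_0^S |h k - H|² du → 0` in probability and
`sup_{s ≤ S} |∫_0^s h k dW - I_s| → 0` in probability. -/
def IsItoIntegral {Ω : Type*} {mΩ : MeasurableSpace Ω} (F : Filtration ℝ≥0 mΩ)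
    (P : Measure Ω) (W : ℝ≥0 → Ω → ℝ) (S : ℝ≥0) (H I : ℝ≥0 → Ω → ℝ) : Prop :=
  ∃ h : ℕ → SimpleIntegrand F,
    (∀ ε : ℝ≥0∞, 0 < ε → Tendsto (fun k => P {ω | ε ≤ ∫⁻ u in Icc (0 : ℝ) S,
        ‖(h k).val u.toNNReal ω - H u.toNNReal ω‖ₑ ^ 2}) atTop (𝓝 0)) ∧
    (∀ ε : ℝ≥0∞, 0 < ε → Tendsto (fun k => P {ω | ε ≤ ⨆ s ∈ Icc (0 : ℝ≥0) S,
        ‖(h k).integral W s ω - I s ω‖ₑ}) atTop (𝓝 0))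

/-- The process `s ↦ x + ∫_0^s μ(X_u) du + I_s`; with `I = ∫ σ(X) dW` this is the uncontrolled part
of the dynamics of `X`. -/
noncomputable def freePart {Ω : Type*} (μ : ℝ → ℝ) (x : ℝ) (X I : ℝ≥0 → Ω → ℝ)
    (s : ℝ≥0) (ω : Ω) : ℝ :=
  x + (∫ u in (0 : ℝ)..s, μ (X u.toNNReal ω)) + I s ω

/-- `X_s = x + ∫_0^s μ(X_u) du + ∫_0^s σ(X_u) dW_u + ν_s` for all `s ∈ [0, S]`, a.s. -/
def SolvesSDE {Ω : Type*} {mΩ : MeasurableSpace Ω} (F : Filtration ℝ≥0 mΩ)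
    (P : Measure Ω) (W : ℝ≥0 → Ω → ℝ) (μ σ : ℝ → ℝ) (S : ℝ≥0) (x : ℝ)
    (X ν : ℝ≥0 → Ω → ℝ) : Prop :=
  ∃ I : ℝ≥0 → Ω → ℝ, IsItoIntegral F P W S (fun u ω => σ (X u ω)) I ∧
    ∀ᵐ ω ∂P, ∀ s ∈ Icc 0 S, X s ω = freePart μ x X I s ω + ν s ω

/-- The end-points of `O` are not attained on `[0, T]` by the uncontrolled dynamics: for every
`y ∈ O`, the uncontrolled equation started at `y` has a continuous `F`-adapted solution on `[0, T]`
all of whose values lie in `O`. -/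
def NonAttainable {Ω : Type*} {mΩ : MeasurableSpace Ω} (F : Filtration ℝ≥0 mΩ)
    (P : Measure Ω) (W : ℝ≥0 → Ω → ℝ) (O : Set ℝ) (μ σ : ℝ → ℝ) (T : ℝ≥0) : Prop :=
  ∀ y ∈ O, ∃ Y : ℝ≥0 → Ω → ℝ,
    (∀ s ∈ Icc 0 T, Measurable[F s] (Y s)) ∧
    (∀ᵐ ω ∂P, ContinuousOn (fun s => Y s ω) (Icc 0 T) ∧ ∀ s ∈ Icc 0 T, Y s ω ∈ O) ∧
    SolvesSDE F P W μ σ T y Y (fun _ _ => 0)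

/-- `(X, ν)` is a solution of the SDE reflected downwards at `f`, on the time interval `[0, T - t]`,
with initial condition `(t, x)`. The control may jump at time `0`: by convention `X_{0-} = x` and
`ν_{0-} = 0`, while `X_0` and `ν_0` are the values after that jump. -/
structure IsReflectedSolution {Ω : Type*} {mΩ : MeasurableSpace Ω} (F : Filtration ℝ≥0 mΩ)
    (P : Measure Ω) (W : ℝ≥0 → Ω → ℝ) (O : Set ℝ) (μ σ : ℝ → ℝ) (T : ℝ≥0) (f : ℝ≥0 → ℝ)
    (t : ℝ≥0) (x : ℝ) (X ν : ℝ≥0 → Ω → ℝ) : Prop where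
  adapted : ∀ s ∈ Icc 0 (T - t), Measurable[F s] (X s) ∧ Measurable[F s] (ν s)
  X_zero : ∀ᵐ ω ∂P, X 0 ω = min (f t) x
  X_cont : ∀ᵐ ω ∂P, ContinuousOn (fun s => X s ω) (Icc 0 (T - t))
  X_mem : ∀ᵐ ω ∂P, ∀ s ∈ Icc 0 (T - t), X s ω ∈ O
  sde : SolvesSDE F P W μ σ (T - t) x X ν
  ν_zero : ∀ᵐ ω ∂P, ν 0 ω = -max (x - f t) 0
  ν_cont : ∀ᵐ ω ∂P, ContinuousOn (fun s => ν s ω) (Icc 0 (T - t))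
  ν_anti : ∀ᵐ ω ∂P, AntitoneOn (fun s => ν s ω) (Icc 0 (T - t))
  le_boundary : ∀ᵐ ω ∂P, ∀ s ∈ Icc 0 (T - t), X s ω ≤ f (t + s)
  /-- `∫_{(0, T - t]} 1_{X_s < f(t + s)} dν_s = 0`, where `dν` is minus the Stieltjes measure of any
  non-decreasing right-continuous function `G` that coincides with `-ν` on `[0, T - t]`. -/
  minimal : ∀ᵐ ω ∂P, ∃ G : StieltjesFunction ℝ≥0, (∀ s ∈ Icc 0 (T - t), G s = -ν s ω) ∧
    ∫⁻ s in Ioc 0 (T - t), {s | X s ω < f (t + s)}.indicator 1 s ∂G.measure = 0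

end ReflSDE

/-! The reflection is carried by the Skorokhod map, and a bound on the expectation of `1 / X` keeps
the process away from `0`.

For a continuous path `z` and a non-decreasing left-continuous `g`, the running maximum `k` of `(z -
g)⁺` is continuous, because `g` can only jump upwards. It is the only continuous non-decreasing `k`
with `k 0 = (z 0 - g 0)⁺`, `z - k ≤ g` and `dk` carried by `{z - k = g}` (`IsReflector.minimal`,
`IsReflector.of_minimal`). A reflected solution is therefore the same thing as a fixed point of `X =
Z - K`, with `Z = x + ∫ μ(X) ds + ∫ σ(X) dW` and `K` the running maximum of `(Z - f)⁺` (`ReflStep`),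
which already gives the formula for `ν`. The map `z ↦ z - k` is 2-Lipschitz for the uniform norm on
every `[0, s]`. Together with Doob's `L²` inequality this lets the Itô theory of strong solutions
carry over: Picard iteration for bounded Lipschitz coefficients
(`exists_reflStep_of_bdd_lipschitz`), truncation and patching for locally Lipschitz ones
(`exists_reflStep`), and a Gronwall argument localised by indicator processes for uniqueness and
moments (`stopped_gronwall`).

For `O = (0, ∞)` the coefficients are extended to the line through `y ↦ max y 0`, and it remains to
show `X > 0`. The hypothesis on the uncontrolled equation enters only through the coefficients at
`0`. A nonnegative solution started at `δ⁴` and observed at time `δ²` is so close to `0` that a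
nonzero `σ 0` or a negative `μ 0` would make it negative with positive probability; so `σ 0 = 0` and
`0 ≤ μ 0` (`coeff_zero_of_nonneg_solutions`). By the Lipschitz property `μ y ≥ -L y` and `|σ y| ≤ L
y` for `y ≥ 0`. An Itô process with such coefficients has `E[1 / Y]` growing at most exponentially,
at a rate independent of how close to `0` it may come (`integral_inv_le`). Below the level `f t / 2`
the reflection is inactive, so there `X` is such a process, and by Markov's inequality the
probability of descending from `ε₀` to `ε` without crossing that level is of order `ε / ε₀`
(`ReflStep.measure_exit_le`). A path that reached `0` would do so from some level `ε₀`, starting at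
one of countably many times (`ReflStep.ae_pos`).

The stochastic calculus is built from elementary integrals. Doob's inequality comes from a pathwise
inequality for running maxima, stopping is replaced by multiplication with left-continuous 0-1
processes and the locality of the integral (`IsItoIntegral.ae_eq_of_eq`), and Itô's formula for `1 /
y` by a Taylor expansion over short time steps. The filtration is not assumed complete, so adapted
versions of limits are defined at every `ω`, as upper limits or as suprema over dyadic times. -/

namespace ReflSDE

variable {Ω : Type*} {mΩ : MeasurableSpace Ω} {P : Measure Ω} {F : Filtration ℝ≥0 mΩ}
  {W : ℝ≥0 → Ω → ℝ}

/-! ### Random variables with all moments, and Brownian increments -/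

/-- `f` has finite moments of all orders. -/
def HasMoments (P : Measure Ω) (f : Ω → ℝ) : Prop := ∀ p : ℝ≥0∞, p ≠ ∞ → MemLp f p P

theorem HasMoments.add {f g : Ω → ℝ} (hf : HasMoments P f) (hg : HasMoments P g) :
    HasMoments P (fun ω => f ω + g ω) := fun _ hp => (hf _ hp).add (hg _ hp)

theorem HasMoments.sub {f g : Ω → ℝ} (hf : HasMoments P f) (hg : HasMoments P g) :
    HasMoments P (fun ω => f ω - g ω) := fun _ hp => (hf _ hp).sub (hg _ hp)

theorem HasMoments.mul {f g : Ω → ℝ} (hf : HasMoments P f) (hg : HasMoments P g) :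
    HasMoments P (fun ω => f ω * g ω) := fun p hp => by
  have : ENNReal.HolderTriple (2 * p) (2 * p) p := ⟨by
    rw [← two_mul, ENNReal.mul_inv (by simp) (by simp), ← mul_assoc,
      ENNReal.mul_inv_cancel (by simp) (by simp), one_mul]⟩
  have h2 : 2 * p ≠ ∞ := ENNReal.mul_ne_top (by simp) hp
  exact MemLp.mul' (p := 2 * p) (q := 2 * p) (hg _ h2) (hf _ h2)

theorem HasMoments.integrable {f : Ω → ℝ} (hf : HasMoments P f) : Integrable f P :=
  memLp_one_iff_integrable.1 (hf 1 (by simp))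

theorem HasMoments.abs {f : Ω → ℝ} (hf : HasMoments P f) : HasMoments P (fun ω => |f ω|) :=
  fun _ hp => (hf _ hp).abs

theorem HasMoments.of_bdd [IsProbabilityMeasure P] {f : Ω → ℝ} (hf : Measurable f) {C : ℝ}
    (hC : ∀ ω, |f ω| ≤ C) : HasMoments P f :=
  fun _ _ => MemLp.of_bound hf.aestronglyMeasurable C (ae_of_all _ hC)

theorem HasMoments.const [IsProbabilityMeasure P] (c : ℝ) : HasMoments P (fun _ => c) :=
  fun _ _ => memLp_const c

theorem HasMoments.pow [IsProbabilityMeasure P] {f : Ω → ℝ} (hf : HasMoments P f) (n : ℕ) :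
    HasMoments P (fun ω => f ω ^ n) := by
  induction n with
  | zero => simpa using HasMoments.const 1
  | succ n ih => simpa only [pow_succ] using ih.mul hf

theorem HasMoments.sum [IsProbabilityMeasure P] {f : ℕ → Ω → ℝ} (hf : ∀ i, HasMoments P (f i))
    (n : ℕ) : HasMoments P (fun ω => ∑ i ∈ Finset.range n, f i ω) := by
  induction n with
  | zero => simpa using HasMoments.const 0
  | succ n ih => simpa only [Finset.sum_range_succ] using ih.add (hf n)

namespace IsFBrownian

theorem measurable (hW : IsFBrownian F P W) (s : ℝ≥0) : Measurable (W s) :=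
  (hW.adapted s).mono (F.le s) le_rfl

theorem hasLaw_incr (hW : IsFBrownian F P W) {s u : ℝ≥0} (h : s ≤ u) :
    HasLaw (fun ω => W u ω - W s ω) (gaussianReal 0 (u - s)) P := by
  have := hW.brownian.hasLaw_sub u s
  have h2 : nndist u.1 s.1 = u - s := by
    rw [← NNReal.coe_inj, coe_nndist, Real.dist_eq, NNReal.coe_sub h, abs_of_nonneg]
    · rfl
    · exact sub_nonneg.2 (by exact_mod_cast h)
  rwa [h2] at this

theorem hasMoments_incr (hW : IsFBrownian F P W) (s u : ℝ≥0) :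
    HasMoments P (fun ω => W u ω - W s ω) := fun _ hp =>
  (hW.brownian.isGaussianProcess.hasGaussianLaw_sub (s := u) (t := s)).memLp hp

theorem indepFun_incr (hW : IsFBrownian F P W) {s u : ℝ≥0} (h : s ≤ u) {Y : Ω → ℝ}
    (hY : Measurable[F s] Y) : IndepFun Y (fun ω => W u ω - W s ω) P := by
  have h1 := (hW.indep s u h).symm
  rw [← BorelSpace.measurable_eq] at h1
  exact indep_of_indep_of_le_left h1 hY.comap_le

/-- Expectations factor into an `F s`-measurable part and a function of an increment after `s`. -/
theorem integral_mul_incr (hW : IsFBrownian F P W) {s u : ℝ≥0} (h : s ≤ u) {Y : Ω → ℝ}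
    (hY : Measurable[F s] Y) {g : ℝ → ℝ} (hg : Measurable g) :
    ∫ ω, Y ω * g (W u ω - W s ω) ∂P = (∫ ω, Y ω ∂P) * ∫ ω, g (W u ω - W s ω) ∂P := by
  have h1 := (hW.indepFun_incr h hY).comp measurable_id hg
  exact h1.integral_fun_mul_eq_mul_integral
    ((hY.mono (F.le s) le_rfl).aestronglyMeasurable)
    (hg.comp ((hW.measurable u).sub (hW.measurable s))).aestronglyMeasurable

theorem integral_incr (hW : IsFBrownian F P W) {s u : ℝ≥0} (h : s ≤ u) :
    ∫ ω, (W u ω - W s ω) ∂P = 0 := by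
  rw [(hW.hasLaw_incr h).integral_eq, integral_id_gaussianReal]

theorem integral_mul_incr_eq_zero (hW : IsFBrownian F P W) {s u : ℝ≥0} (h : s ≤ u) {Y : Ω → ℝ}
    (hY : Measurable[F s] Y) : ∫ ω, Y ω * (W u ω - W s ω) ∂P = 0 := by
  rw [hW.integral_mul_incr h hY (g := fun x => x) measurable_id, hW.integral_incr h, mul_zero]

theorem integral_comp_incr (hW : IsFBrownian F P W) {s u : ℝ≥0} (h : s ≤ u) {g : ℝ → ℝ}
    (hg : Measurable g) : ∫ ω, g (W u ω - W s ω) ∂P =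
      ∫ x, g (√((u : ℝ) - s) * x) ∂(gaussianReal 0 1) := by
  have h1 := (hW.hasLaw_incr h).integral_comp (f := g) hg.aestronglyMeasurable
  have hle : (s : ℝ) ≤ u := by exact_mod_cast h
  have h2 : gaussianReal 0 (u - s) = (gaussianReal 0 1).map (√((u : ℝ) - s) * ·) := by
    rw [gaussianReal_map_const_mul]
    congr 1
    · simp
    · rw [← NNReal.coe_inj]
      simp [Real.sq_sqrt (sub_nonneg.2 hle), NNReal.coe_sub h]
  rw [h2, integral_map (by fun_prop) hg.aestronglyMeasurable] at h1
  exact h1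

theorem integral_incr_sq (hW : IsFBrownian F P W) {s u : ℝ≥0} (h : s ≤ u) :
    ∫ ω, (W u ω - W s ω) ^ 2 ∂P = (u : ℝ) - s := by
  have hle : (s : ℝ) ≤ u := by exact_mod_cast h
  rw [hW.integral_comp_incr h (g := fun x => x ^ 2) (by fun_prop)]
  simp_rw [mul_pow, integral_const_mul, Real.sq_sqrt (sub_nonneg.2 hle)]
  have : ∫ x, x ^ 2 ∂(gaussianReal 0 1) = 1 := by
    have := variance_fun_id_gaussianReal (μ := 0) (v := 1)
    rw [variance_eq_integral (by fun_prop)] at this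
    simpa using this
  rw [this, mul_one]

end IsFBrownian

/-- The fourth moment of a standard Gaussian variable. -/
noncomputable def gaussMom4 : ℝ := ∫ x, x ^ 4 ∂(gaussianReal 0 1)

theorem gaussMom4_nonneg : 0 ≤ gaussMom4 := integral_nonneg fun x => by positivity

theorem IsFBrownian.integral_incr_pow_four (hW : IsFBrownian F P W) {s u : ℝ≥0} (h : s ≤ u) :
    ∫ ω, (W u ω - W s ω) ^ 4 ∂P = gaussMom4 * ((u : ℝ) - s) ^ 2 := by
  have hle : (s : ℝ) ≤ u := by exact_mod_cast h
  rw [hW.integral_comp_incr h (g := fun x => x ^ 4) (by fun_prop)]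
  simp_rw [mul_pow, integral_const_mul]
  rw [gaussMom4, mul_comm]
  congr 1
  rw [show (4 : ℕ) = 2 * 2 by norm_num, pow_mul, Real.sq_sqrt (sub_nonneg.2 hle)]

/-- The first absolute moment of a standard Gaussian variable. -/
noncomputable def gaussAbs : ℝ := ∫ x, |x| ∂(gaussianReal 0 1)

/-- A vanishing first absolute moment would make the variable almost surely zero, against variance
`1`. Strict positivity is what turns `|σ 0| * gaussAbs ≤ 0` into `σ 0 = 0`. -/
theorem gaussAbs_pos : 0 < gaussAbs := by
  have h0 : 0 ≤ gaussAbs := integral_nonneg fun x => abs_nonneg x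
  refine lt_of_le_of_ne h0 fun h => ?_
  have hi : Integrable (fun x : ℝ => |x|) (gaussianReal 0 1) :=
    (memLp_one_iff_integrable.1 (memLp_id_gaussianReal' 1 (by simp))).abs
  have h1 := (integral_eq_zero_iff_of_nonneg (fun x => abs_nonneg x) hi).1 h.symm
  have h2 := variance_fun_id_gaussianReal (μ := 0) (v := 1)
  rw [variance_eq_integral (by fun_prop)] at h2
  rw [integral_eq_zero_of_ae] at h2
  · simp at h2
  · filter_upwards [h1] with x hx
    have : x = 0 := by simpa using hx
    simp [this]

theorem IsFBrownian.integral_abs (hW : IsFBrownian F P W) (s : ℝ≥0) :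
    ∫ ω, |W s ω - W 0 ω| ∂P = √s * gaussAbs := by
  rw [hW.integral_comp_incr zero_le (g := fun x => |x|) (by fun_prop)]
  simp_rw [abs_mul, integral_const_mul, abs_of_nonneg (Real.sqrt_nonneg _)]
  simp [gaussAbs]

/-! ### Elementary stochastic integrals -/

/-- If `s ≤ a` both stopped values are at time `s` and the product is `0`; so it does not matter
that `ξ` is only known at the later time `a`. -/
theorem measurable_mul_stopped_sub {V : ℝ≥0 → Ω → ℝ} (hV : ∀ s, Measurable[F s] (V s))
    {a b s : ℝ≥0} (hab : a ≤ b) {ξ : Ω → ℝ} (hξ : Measurable[F a] ξ) :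
    Measurable[F s] (fun ω => ξ ω * (V (min b s) ω - V (min a s) ω)) := by
  rcases le_total a s with has | hsa
  · exact (hξ.mono (F.mono has) le_rfl).mul
      (((hV _).mono (F.mono (min_le_right _ _)) le_rfl).sub
        ((hV _).mono (F.mono (min_le_right _ _)) le_rfl))
  · simp only [min_eq_right hsa, min_eq_right (hsa.trans hab), sub_self, mul_zero]
    exact measurable_const

namespace IsFBrownian

theorem integral_mul_stopped_incr (hW : IsFBrownian F P W) {a b : ℝ≥0} (hab : a ≤ b) (s : ℝ≥0)
    {Y : Ω → ℝ} (hY : Measurable[F a] Y) :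
    ∫ ω, Y ω * (W (min b s) ω - W (min a s) ω) ∂P = 0 := by
  rcases le_total a s with has | hsa
  · rw [min_eq_left has]
    exact hW.integral_mul_incr_eq_zero (le_min hab has) hY
  · simp [min_eq_right hsa, min_eq_right (hsa.trans hab)]

theorem integral_mul_stopped_incr_sq (hW : IsFBrownian F P W) {a b : ℝ≥0} (hab : a ≤ b)
    (s : ℝ≥0) {Y : Ω → ℝ} (hY : Measurable[F a] Y) :
    ∫ ω, Y ω * (W (min b s) ω - W (min a s) ω) ^ 2 ∂P =
      (∫ ω, Y ω ∂P) * (((min b s : ℝ≥0) : ℝ) - (min a s : ℝ≥0)) := by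
  rcases le_total a s with has | hsa
  · rw [min_eq_left has, hW.integral_mul_incr (le_min hab has) hY (g := fun x => x ^ 2)
      (by fun_prop), hW.integral_incr_sq (le_min hab has)]
  · simp [min_eq_right hsa, min_eq_right (hsa.trans hab)]

theorem integral_mul_stopped_incr_pow_four (hW : IsFBrownian F P W) {a b : ℝ≥0} (hab : a ≤ b)
    (s : ℝ≥0) {Y : Ω → ℝ} (hY : Measurable[F a] Y) :
    ∫ ω, Y ω * (W (min b s) ω - W (min a s) ω) ^ 4 ∂P =
      (∫ ω, Y ω ∂P) * (gaussMom4 * (((min b s : ℝ≥0) : ℝ) - (min a s : ℝ≥0)) ^ 2) := by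
  rcases le_total a s with has | hsa
  · rw [min_eq_left has, hW.integral_mul_incr (le_min hab has) hY (g := fun x => x ^ 4)
      (by fun_prop), hW.integral_incr_pow_four (le_min hab has)]
  · simp [min_eq_right hsa, min_eq_right (hsa.trans hab)]

end IsFBrownian

namespace SimpleIntegrand

/-- The first `m` steps of a simple integrand. -/
def take (h : SimpleIntegrand F) (m : ℕ) : SimpleIntegrand F := { h with n := m }

theorem integral_take_succ (h : SimpleIntegrand F) (V : ℝ≥0 → Ω → ℝ) (m : ℕ) (s : ℝ≥0) (ω : Ω) :
    (h.take (m + 1)).integral V s ω = (h.take m).integral V s ω +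
      h.coef m ω * (V (min (h.time (m + 1)) s) ω - V (min (h.time m) s) ω) :=
  Finset.sum_range_succ _ _

theorem measurable_coef (h : SimpleIntegrand F) (i : ℕ) : Measurable (h.coef i) :=
  (h.meas i).mono (F.le _) le_rfl

theorem measurable_integral (h : SimpleIntegrand F) {V : ℝ≥0 → Ω → ℝ}
    (hV : ∀ s, Measurable[F s] (V s)) (s : ℝ≥0) : Measurable[F s] (h.integral V s) :=
  Finset.measurable_sum _ fun i _ =>
    measurable_mul_stopped_sub hV (h.mono (Nat.le_succ i)) (h.meas i)

theorem measurable_integral_take (h : SimpleIntegrand F) {V : ℝ≥0 → Ω → ℝ}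
    (hV : ∀ s, Measurable[F s] (V s)) (m : ℕ) (s : ℝ≥0) :
    Measurable[F (h.time m)] ((h.take m).integral V s) := by
  refine Finset.measurable_sum _ fun i hi => ?_
  have hi' : i < m := Finset.mem_range.1 hi
  have h1 : h.time i ≤ h.time m := h.mono hi'.le
  have h2 : h.time (i + 1) ≤ h.time m := h.mono hi'
  exact ((h.meas i).mono (F.mono h1) le_rfl).mul
    (((hV _).mono (F.mono ((min_le_left _ _).trans h2)) le_rfl).sub
      ((hV _).mono (F.mono ((min_le_left _ _).trans h1)) le_rfl))

theorem hasMoments_coef [IsProbabilityMeasure P] (h : SimpleIntegrand F) (i : ℕ) :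
    HasMoments P (h.coef i) := by
  obtain ⟨C, hC⟩ := h.bdd i
  exact HasMoments.of_bdd (h.measurable_coef i) hC

theorem hasMoments_integral [IsProbabilityMeasure P] (hW : IsFBrownian F P W)
    (h : SimpleIntegrand F) (s : ℝ≥0) : HasMoments P (h.integral W s) :=
  HasMoments.sum (fun i => (h.hasMoments_coef i).mul (hW.hasMoments_incr _ _)) h.n

/-- The pathwise value of `∫_0^s h_u² du`. -/
noncomputable def sq (h : SimpleIntegrand F) (s : ℝ≥0) (ω : Ω) : ℝ :=
  ∑ i ∈ Finset.range h.n,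
    h.coef i ω ^ 2 * (((min (h.time (i + 1)) s : ℝ≥0) : ℝ) - (min (h.time i) s : ℝ≥0))

theorem min_time_le (h : SimpleIntegrand F) (i : ℕ) (s : ℝ≥0) :
    ((min (h.time i) s : ℝ≥0) : ℝ) ≤ (min (h.time (i + 1)) s : ℝ≥0) := by
  exact_mod_cast min_le_min_right s (h.mono (Nat.le_succ i))

theorem hasMoments_sq [IsProbabilityMeasure P] (h : SimpleIntegrand F) (s : ℝ≥0) :
    HasMoments P (h.sq s) :=
  HasMoments.sum (fun i => ((h.hasMoments_coef i).pow 2).mul (HasMoments.const _)) h.n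

/-- The Itô isometry, by induction on the number of steps: the new increment is centred and
independent of everything before it, so the cross term vanishes and the square contributes its
variance. -/
theorem integral_integral_sq [IsProbabilityMeasure P] (hW : IsFBrownian F P W)
    (h : SimpleIntegrand F) (s : ℝ≥0) :
    ∫ ω, h.integral W s ω ^ 2 ∂P = ∫ ω, h.sq s ω ∂P := by
  suffices H : ∀ m, ∫ ω, (h.take m).integral W s ω ^ 2 ∂P = ∫ ω, (h.take m).sq s ω ∂P from H h.n
  intro m
  induction m with
  | zero => simp [take, SimpleIntegrand.integral, sq]
  | succ m ih =>
    have hA := (h.take m).hasMoments_integral hW s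
    have hξ := h.hasMoments_coef (P := P) m
    have hd := hW.hasMoments_incr (min (h.time m) s) (min (h.time (m + 1)) s)
    have hmono : h.time m ≤ h.time (m + 1) := h.mono (Nat.le_succ m)
    have e1 : ∀ ω, (h.take (m + 1)).integral W s ω ^ 2 = (h.take m).integral W s ω ^ 2
        + (2 * ((h.take m).integral W s ω * h.coef m ω *
          (W (min (h.time (m + 1)) s) ω - W (min (h.time m) s) ω))
        + h.coef m ω ^ 2 * (W (min (h.time (m + 1)) s) ω - W (min (h.time m) s) ω) ^ 2) := by
      intro ω
      rw [integral_take_succ]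
      ring
    have e2 : ∀ ω, (h.take (m + 1)).sq s ω = (h.take m).sq s ω + h.coef m ω ^ 2 *
        (((min (h.time (m + 1)) s : ℝ≥0) : ℝ) - (min (h.time m) s : ℝ≥0)) :=
      fun ω => Finset.sum_range_succ _ _
    simp_rw [e1, e2]
    rw [integral_add (hA.pow 2).integrable, integral_add, integral_const_mul,
      integral_add ((h.take m).hasMoments_sq s).integrable, integral_mul_const, ih,
      hW.integral_mul_stopped_incr hmono s
        (Y := fun ω => (h.take m).integral W s ω * h.coef m ω)
        ((h.measurable_integral_take hW.adapted m s).mul (h.meas m)),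
      hW.integral_mul_stopped_incr_sq hmono s ((h.meas m).pow_const 2)]
    · simp
    · exact ((hξ.pow 2).mul (HasMoments.const _)).integrable
    · exact ((HasMoments.const 2).mul ((hA.mul hξ).mul hd)).integrable
    · exact ((hξ.pow 2).mul (hd.pow 2)).integrable
    · exact (((HasMoments.const 2).mul ((hA.mul hξ).mul hd)).add
        ((hξ.pow 2).mul (hd.pow 2))).integrable

theorem integral_integral_eq_zero [IsProbabilityMeasure P] (hW : IsFBrownian F P W)
    (h : SimpleIntegrand F) (s : ℝ≥0) : ∫ ω, h.integral W s ω ∂P = 0 := by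
  unfold SimpleIntegrand.integral
  rw [integral_finsetSum _ fun i _ =>
    ((h.hasMoments_coef i).mul (hW.hasMoments_incr _ _)).integrable]
  exact Finset.sum_eq_zero fun i _ =>
    hW.integral_mul_stopped_incr (h.mono (Nat.le_succ i)) s (h.meas i)

/-- Second and fourth moments are bounded together by induction on the steps, since the mixed term
of the fourth power involves the second moment of the past. The quadratic dependence on the elapsed
time is what later makes the Taylor remainders of `1 / y` negligible. -/
theorem integral_integral_pow_four_le [IsProbabilityMeasure P] (hW : IsFBrownian F P W)
    (h : SimpleIntegrand F) (s : ℝ≥0) {C : ℝ} (hC : ∀ i ω, |h.coef i ω| ≤ C) :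
    ∫ ω, h.integral W s ω ^ 4 ∂P ≤
      (4 + 3 * gaussMom4) * C ^ 4 * (s - (min (h.time 0) s : ℝ≥0)) ^ 2 := by
  -- Passing from `τ` to `τ + Δ` adds at most `8 τ Δ + 3 gaussMom4 Δ²` (times `C⁴`), to be compared
  -- with `K (2 τ Δ + Δ²)`. This needs `K ≥ 4` and `K ≥ 3 gaussMom4`.
  set K := 4 + 3 * gaussMom4 with hK
  have hK0 : 4 ≤ K := by have := gaussMom4_nonneg; linarith
  have hm4 := gaussMom4_nonneg
  let τ : ℕ → ℝ := fun m => ((min (h.time m) s : ℝ≥0) : ℝ) - (min (h.time 0) s : ℝ≥0)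
  have hτ0 : ∀ m, 0 ≤ τ m := fun m => sub_nonneg.2 (by
    exact_mod_cast min_le_min_right s (h.mono (Nat.zero_le m)))
  have key : ∀ m, ∫ ω, (h.take m).integral W s ω ^ 2 ∂P ≤ C ^ 2 * τ m ∧
      ∫ ω, (h.take m).integral W s ω ^ 4 ∂P ≤ K * C ^ 4 * τ m ^ 2 := by
    intro m
    induction m with
    | zero => simp [take, SimpleIntegrand.integral, τ]
    | succ m ih =>
      obtain ⟨ih2, ih4⟩ := ih
      set Δ : ℝ := ((min (h.time (m + 1)) s : ℝ≥0) : ℝ) - (min (h.time m) s : ℝ≥0) with hΔ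
      have hΔ0 : 0 ≤ Δ := sub_nonneg.2 (h.min_time_le m s)
      have hτ : τ (m + 1) = τ m + Δ := by simp only [τ, hΔ]; ring
      have hA := (h.take m).hasMoments_integral hW s
      have hξ := h.hasMoments_coef (P := P) m
      have hd := hW.hasMoments_incr (min (h.time m) s) (min (h.time (m + 1)) s)
      have hmono : h.time m ≤ h.time (m + 1) := h.mono (Nat.le_succ m)
      have hmA := h.measurable_integral_take hW.adapted m s
      have hmξ := h.meas m
      have hξ2 : ∀ ω, h.coef m ω ^ 2 ≤ C ^ 2 := fun ω => sq_le_sq' (by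
        have := abs_le.1 (hC m ω); linarith) (abs_le.1 (hC m ω)).2
      have hE2 : ∫ ω, h.coef m ω ^ 2 ∂P ≤ C ^ 2 := by
        calc _ ≤ ∫ ω, C ^ 2 ∂P := integral_mono (hξ.pow 2).integrable (by fun_prop) hξ2
          _ = C ^ 2 := by simp
      have hE4 : ∫ ω, h.coef m ω ^ 4 ∂P ≤ C ^ 4 := by
        calc _ ≤ ∫ ω, C ^ 4 ∂P := integral_mono (hξ.pow 4).integrable (by fun_prop) fun ω => by
              have := pow_le_pow_left₀ (sq_nonneg _) (hξ2 ω) 2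
              nlinarith
          _ = C ^ 4 := by simp
      have hE22 : ∫ ω, (h.take m).integral W s ω ^ 2 * h.coef m ω ^ 2 ∂P ≤ C ^ 2 * (C ^ 2 * τ m) := by
        calc _ ≤ ∫ ω, C ^ 2 * (h.take m).integral W s ω ^ 2 ∂P :=
              integral_mono ((hA.pow 2).mul (hξ.pow 2)).integrable
                ((HasMoments.const _).mul (hA.pow 2)).integrable fun ω => by
                have := mul_le_mul_of_nonneg_left (hξ2 ω)
                  (sq_nonneg ((h.take m).integral W s ω))
                simpa [mul_comm] using this
          _ ≤ _ := by
              rw [integral_const_mul]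
              exact mul_le_mul_of_nonneg_left ih2 (sq_nonneg C)
      constructor
      · rw [(h.take (m + 1)).integral_integral_sq hW]
        have e2 : ∀ ω, (h.take (m + 1)).sq s ω = (h.take m).sq s ω + h.coef m ω ^ 2 * Δ :=
          fun ω => Finset.sum_range_succ _ _
        simp_rw [e2]
        rw [integral_add ((h.take m).hasMoments_sq s).integrable
          ((hξ.pow 2).mul (HasMoments.const _)).integrable, integral_mul_const,
          ← (h.take m).integral_integral_sq hW, hτ]
        nlinarith
      -- With `η = ξ d`, the term `4 A η³` has odd order in the increment and is removed by `4 A η³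
      -- ≤ 2 A² η² + 2 η⁴`, which changes the binomial coefficients `6` and `1` to `8` and `3`.
      · have e1 : ∀ ω, (h.take (m + 1)).integral W s ω ^ 4 ≤ (h.take m).integral W s ω ^ 4
            + (4 * ((h.take m).integral W s ω ^ 3 * h.coef m ω *
              (W (min (h.time (m + 1)) s) ω - W (min (h.time m) s) ω))
            + (8 * ((h.take m).integral W s ω ^ 2 * h.coef m ω ^ 2 *
              (W (min (h.time (m + 1)) s) ω - W (min (h.time m) s) ω) ^ 2)
            + 3 * (h.coef m ω ^ 4 *
              (W (min (h.time (m + 1)) s) ω - W (min (h.time m) s) ω) ^ 4))) := by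
          intro ω
          rw [integral_take_succ]
          generalize (h.take m).integral W s ω = A
          generalize W (min (h.time (m + 1)) s) ω - W (min (h.time m) s) ω = d
          generalize h.coef m ω = ξ
          nlinarith [sq_nonneg ((A - ξ * d) * (ξ * d))]
        have i1 := (hA.pow 4)
        have i2 := (HasMoments.const (P := P) 4).mul (((hA.pow 3).mul hξ).mul hd)
        have i3 := (HasMoments.const (P := P) 8).mul
          (((hA.pow 2).mul (hξ.pow 2)).mul (hd.pow 2))
        have i4 := (HasMoments.const (P := P) 3).mul ((hξ.pow 4).mul (hd.pow 4))
        refine (integral_mono (((h.take (m + 1)).hasMoments_integral hW s).pow 4).integrable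
          (i1.add (i2.add (i3.add i4))).integrable e1).trans ?_
        rw [integral_add i1.integrable (i2.add (i3.add i4)).integrable,
          integral_add i2.integrable (i3.add i4).integrable,
          integral_add i3.integrable i4.integrable, integral_const_mul, integral_const_mul,
          integral_const_mul,
          hW.integral_mul_stopped_incr hmono s
            (Y := fun ω => (h.take m).integral W s ω ^ 3 * h.coef m ω) ((hmA.pow_const 3).mul hmξ),
          hW.integral_mul_stopped_incr_sq hmono s
            (Y := fun ω => (h.take m).integral W s ω ^ 2 * h.coef m ω ^ 2) ((hmA.pow_const 2).mul (hmξ.pow_const 2)),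
          hW.integral_mul_stopped_incr_pow_four hmono s (hmξ.pow_const 4), hτ]
        have h1 := mul_le_mul_of_nonneg_right hE22 hΔ0
        have h2 := mul_le_mul_of_nonneg_right hE4 (mul_nonneg hm4 (sq_nonneg Δ))
        have h3 : 0 ≤ C ^ 4 * (τ m * Δ) := mul_nonneg (by positivity) (mul_nonneg (hτ0 m) hΔ0)
        have h4 : 0 ≤ C ^ 4 * Δ ^ 2 := by positivity
        have h5 := mul_le_mul_of_nonneg_right hK0 h3
        have h6 : 0 ≤ (K - 3 * gaussMom4) * (C ^ 4 * Δ ^ 2) := by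
          rw [hK]; nlinarith
        nlinarith
  refine (key h.n).2.trans ?_
  have : τ h.n ≤ s - (min (h.time 0) s : ℝ≥0) :=
    sub_le_sub_right (by exact_mod_cast min_le_right _ _) _
  gcongr
  exact hτ0 _

end SimpleIntegrand

/-! ### Operations on simple integrands -/

/-- Each summand is the increment of `G` along the grid clamped to `[e p, e q]`, so the sum
telescopes. Repeated grid points are allowed. -/
theorem clamp_telescope {e : ℕ → ℝ≥0} (he : Monotone e) {p q N : ℕ} (hq : q ≤ N)
    (hpq : e p ≤ e q) (G : ℝ≥0 → ℝ) :
    ∑ j ∈ Finset.range N, (if e p < e (j + 1) ∧ e (j + 1) ≤ e q then G (e (j + 1)) - G (e j) else 0)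
      = G (e q) - G (e p) := by
  have h1 : ∀ j, (if e p < e (j + 1) ∧ e (j + 1) ≤ e q then G (e (j + 1)) - G (e j) else 0) =
      G (max (e p) (min (e q) (e (j + 1)))) - G (max (e p) (min (e q) (e j))) := by
    intro j
    have hj : e j ≤ e (j + 1) := he (Nat.le_succ j)
    split_ifs with hc
    · have hpj : e p ≤ e j := by
        refine he (Nat.lt_succ_iff.1 ?_)
        by_contra hcon
        exact absurd (he (not_lt.1 hcon)) (not_le.2 hc.1)
      rw [min_eq_right hc.2, max_eq_right hc.1.le, min_eq_right (hj.trans hc.2), max_eq_right hpj]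
    · by_cases hc1 : e p < e (j + 1)
      · have hc2 : e q < e (j + 1) := not_le.1 fun h => hc ⟨hc1, h⟩
        have hqj : e q ≤ e j := by
          refine he (Nat.lt_succ_iff.1 ?_)
          by_contra hcon
          exact absurd (he (not_lt.1 hcon)) (not_le.2 hc2)
        rw [min_eq_left hc2.le, min_eq_left hqj, sub_self]
      · have h2 : e (j + 1) ≤ e p := not_lt.1 hc1
        rw [min_eq_right (h2.trans hpq), min_eq_right ((hj.trans h2).trans hpq), max_eq_left h2,
          max_eq_left (hj.trans h2), sub_self]
  simp_rw [h1]
  rw [Finset.sum_range_sub (fun j => G (max (e p) (min (e q) (e j)))),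
    min_eq_left (he hq), max_eq_right hpq, max_eq_left ((min_le_right _ _).trans (he (Nat.zero_le _)))]

/-- The indicator of `u ≤ a`, as a function of `a`. -/
noncomputable def stepFn (u a : ℝ≥0) : ℝ := if u ≤ a then 1 else 0

theorem exists_grid (T : Finset ℝ≥0) (hT : T.Nonempty) : ∃ (e : ℕ → ℝ≥0) (N : ℕ), Monotone e ∧
    (∀ a ∈ T, ∃ p ≤ N, e p = a) := by
  have hpos : 0 < T.card := hT.card_pos
  refine ⟨fun j => T.orderEmbOfFin rfl ⟨min j (T.card - 1), by omega⟩, T.card - 1, ?_, ?_⟩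
  · intro i j hij
    exact (T.orderEmbOfFin rfl).monotone (by
      simp only [Fin.mk_le_mk]
      exact min_le_min_right _ hij)
  · intro a ha
    have : a ∈ Set.range (T.orderEmbOfFin rfl) := by
      rw [Finset.range_orderEmbOfFin]; exact ha
    obtain ⟨⟨p, hp⟩, rfl⟩ := this
    exact ⟨p, by omega, congrArg _ (Fin.ext (by simp only; omega))⟩

namespace SimpleIntegrand

/-- In this form the value at `u` is the elementary integral against the function `stepFn u`. One
algebraic identity (`refine_sum`) then refines values and stochastic integrals alike. -/
theorem val_eq (h : SimpleIntegrand F) (u : ℝ≥0) (ω : Ω) : h.val u ω =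
    ∑ i ∈ Finset.range h.n, h.coef i ω * (stepFn u (h.time (i + 1)) - stepFn u (h.time i)) := by
  refine Finset.sum_congr rfl fun i _ => ?_
  have := h.mono (Nat.le_succ i)
  by_cases h1 : u ≤ h.time i
  · simp [stepFn, h1, h1.trans this]
  · by_cases h2 : u ≤ h.time (i + 1)
    · simp [stepFn, h1, h2, not_le.1 h1]
    · simp [stepFn, h1, h2]

theorem refine_sum (h : SimpleIntegrand F) {e : ℕ → ℝ≥0} (he : Monotone e) {N : ℕ}
    (hN : ∀ i ≤ h.n, ∃ p ≤ N, e p = h.time i) (G : ℝ≥0 → ℝ) (ω : Ω) :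
    ∑ j ∈ Finset.range N, h.val (e (j + 1)) ω * (G (e (j + 1)) - G (e j)) =
      ∑ i ∈ Finset.range h.n, h.coef i ω * (G (h.time (i + 1)) - G (h.time i)) := by
  unfold val
  simp_rw [Finset.sum_mul]
  rw [Finset.sum_comm]
  refine Finset.sum_congr rfl fun i hi => ?_
  have hi' := Finset.mem_range.1 hi
  obtain ⟨p, -, hpe⟩ := hN i hi'.le
  obtain ⟨q, hq, hqe⟩ := hN (i + 1) hi'
  have hpq : e p ≤ e q := by rw [hpe, hqe]; exact h.mono (Nat.le_succ i)
  rw [← hpe, ← hqe, ← clamp_telescope he hq hpq, Finset.mul_sum]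
  refine Finset.sum_congr rfl fun j _ => ?_
  by_cases hc : e p < e (j + 1) ∧ e (j + 1) ≤ e q
  · rw [if_pos hc, Set.indicator_of_mem (show e (j + 1) ∈ Ioc (e p) (e q) from hc)]
  · rw [if_neg hc, Set.indicator_of_notMem (show e (j + 1) ∉ Ioc (e p) (e q) from hc)]
    simp

/-- If `e (j + 1)` lies in `(t_i, t_{i+1}]` and `t_i` is itself a grid point, then `t_i ≤ e j`. The
value on the grid cell is therefore already known at its left end. -/
theorem measurable_val_grid (h : SimpleIntegrand F) {e : ℕ → ℝ≥0} (he : Monotone e) {N : ℕ}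
    (hN : ∀ i ≤ h.n, ∃ p ≤ N, e p = h.time i) (j : ℕ) :
    Measurable[F (e j)] (h.val (e (j + 1))) := by
  refine Finset.measurable_sum _ fun i hi => ?_
  by_cases hc : e (j + 1) ∈ Ioc (h.time i) (h.time (i + 1))
  · simp only [Set.indicator_of_mem hc]
    obtain ⟨p, hp, hpe⟩ := hN i (Finset.mem_range.1 hi).le
    refine (h.meas i).mono (F.mono ?_) le_rfl
    rw [← hpe]
    refine he (Nat.lt_succ_iff.1 ?_)
    by_contra hcon
    exact absurd (he (not_lt.1 hcon)) (not_le.2 (hpe ▸ hc.1))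
  · simp only [Set.indicator_of_notMem hc]
    exact measurable_const

theorem exists_val_bdd (h : SimpleIntegrand F) (u : ℝ≥0) : ∃ C, ∀ ω, |h.val u ω| ≤ C := by
  choose C hC using h.bdd
  refine ⟨∑ i ∈ Finset.range h.n, C i, fun ω => (Finset.abs_sum_le_sum_abs _ _).trans
    (Finset.sum_le_sum fun i _ => ?_)⟩
  by_cases hc : u ∈ Ioc (h.time i) (h.time (i + 1))
  · simpa [Set.indicator_of_mem hc] using hC i ω
  · simpa [Set.indicator_of_notMem hc] using (abs_nonneg _).trans (hC i ω)

/-- Both integrands are rewritten on the union of their partitions, where the coefficients can be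
subtracted. -/
theorem exists_sub (h h' : SimpleIntegrand F) : ∃ g : SimpleIntegrand F,
    (∀ u ω, g.val u ω = h.val u ω - h'.val u ω) ∧
    ∀ (V : ℝ≥0 → Ω → ℝ) s ω, g.integral V s ω = h.integral V s ω - h'.integral V s ω := by
  classical
  obtain ⟨e, N, he, hN⟩ := exists_grid
    ((Finset.range (h.n + 1)).image h.time ∪ (Finset.range (h'.n + 1)).image h'.time)
    ⟨h.time 0, by simp only [Finset.mem_union, Finset.mem_image]; exact Or.inl ⟨0, by simp⟩⟩
  have h1 : ∀ i ≤ h.n, ∃ p ≤ N, e p = h.time i := fun i hi => hN _ (by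
    simp only [Finset.mem_union, Finset.mem_image]
    exact Or.inl ⟨i, by simpa using Nat.lt_succ_of_le hi, rfl⟩)
  have h2 : ∀ i ≤ h'.n, ∃ p ≤ N, e p = h'.time i := fun i hi => hN _ (by
    simp only [Finset.mem_union, Finset.mem_image]
    exact Or.inr ⟨i, by simpa using Nat.lt_succ_of_le hi, rfl⟩)
  let g : SimpleIntegrand F :=
    { n := N
      time := e
      mono := he
      coef := fun j ω => h.val (e (j + 1)) ω - h'.val (e (j + 1)) ω
      meas := fun j => (h.measurable_val_grid he h1 j).sub (h'.measurable_val_grid he h2 j)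
      bdd := fun j => by
        obtain ⟨C, hC⟩ := h.exists_val_bdd (e (j + 1))
        obtain ⟨C', hC'⟩ := h'.exists_val_bdd (e (j + 1))
        exact ⟨C + C', fun ω => (abs_sub _ _).trans (add_le_add (hC ω) (hC' ω))⟩ }
  refine ⟨g, fun u ω => ?_, fun V s ω => ?_⟩
  · rw [g.val_eq, h.val_eq, h'.val_eq, ← h.refine_sum he h1, ← h'.refine_sum he h2,
      ← Finset.sum_sub_distrib]
    exact Finset.sum_congr rfl fun j _ => sub_mul _ _ _
  · unfold SimpleIntegrand.integral
    rw [← h.refine_sum he h1 (fun a => V (min a s) ω), ← h'.refine_sum he h2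
      (fun a => V (min a s) ω), ← Finset.sum_sub_distrib]
    exact Finset.sum_congr rfl fun j _ => sub_mul _ _ _

/-- The integrand `1_{(u, ∞)} c h`, for a bounded `F u`-measurable `c`. -/
def after (h : SimpleIntegrand F) (u : ℝ≥0) (c : Ω → ℝ) (hc : Measurable[F u] c)
    (hb : ∃ C, ∀ ω, |c ω| ≤ C) : SimpleIntegrand F where
  n := h.n
  time i := max (h.time i) u
  mono _ _ hij := max_le_max_right _ (h.mono hij)
  coef i ω := c ω * h.coef i ω
  meas i := (hc.mono (F.mono (le_max_right _ _)) le_rfl).mul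
    ((h.meas i).mono (F.mono (le_max_left _ _)) le_rfl)
  bdd i := by
    obtain ⟨C, hC⟩ := hb
    obtain ⟨D, hD⟩ := h.bdd i
    refine ⟨C * D, fun ω => ?_⟩
    rw [abs_mul]
    exact mul_le_mul (hC ω) (hD ω) (abs_nonneg _) ((abs_nonneg _).trans (hC ω))

theorem after_integral (h : SimpleIntegrand F) {u : ℝ≥0} {c : Ω → ℝ} (hc : Measurable[F u] c)
    (hb : ∃ C, ∀ ω, |c ω| ≤ C) (V : ℝ≥0 → Ω → ℝ) (s : ℝ≥0) (ω : Ω) :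
    (h.after u c hc hb).integral V s ω =
      c ω * (h.integral V s ω - h.integral V (min s u) ω) := by
  have key : ∀ a : ℝ≥0, V (min (max a u) s) ω =
      V (min a s) ω - V (min a (min s u)) ω + V (min s u) ω := by
    intro a
    rcases le_total a u with h1 | h1
    · rw [max_eq_right h1, min_comm u s, ← min_assoc, min_eq_left ((min_le_left a s).trans h1)]
      ring
    · rw [max_eq_left h1, min_eq_right ((min_le_right s u).trans h1)]
      ring
  unfold SimpleIntegrand.integral
  rw [← Finset.sum_sub_distrib, Finset.mul_sum]
  refine Finset.sum_congr rfl fun i _ => ?_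
  simp only [after, key]
  ring

theorem after_val (h : SimpleIntegrand F) {u : ℝ≥0} {c : Ω → ℝ} (hc : Measurable[F u] c)
    (hb : ∃ C, ∀ ω, |c ω| ≤ C) (r : ℝ≥0) (ω : Ω) :
    (h.after u c hc hb).val r ω = if u < r then c ω * h.val r ω else 0 := by
  rw [val_eq, val_eq]
  split_ifs with hr
  · rw [Finset.mul_sum]
    refine Finset.sum_congr rfl fun i _ => ?_
    simp only [after, stepFn, le_max_iff, not_le.2 hr, or_false]
    ring
  · refine Finset.sum_eq_zero fun i _ => ?_
    simp [after, stepFn, not_lt.1 hr]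

open Classical in
/-- The integrand `1_{[0, S]} h`. -/
noncomputable def trunc (h : SimpleIntegrand F) (S : ℝ≥0) : SimpleIntegrand F where
  n := h.n
  time i := min (h.time i) S
  mono _ _ hij := min_le_min_right _ (h.mono hij)
  -- When `h.time i > S` both truncated endpoints equal `S`, so the coefficient plays no role; it is
  -- set to `0` because the original one need not be measurable at time `S`.
  coef i := if h.time i ≤ S then h.coef i else 0
  meas i := by
    split_ifs with hi
    · rw [min_eq_left hi]; exact h.meas i
    · exact measurable_const
  bdd i := by
    split_ifs with hi
    · exact h.bdd i
    · exact ⟨0, by simp⟩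

theorem trunc_integral (h : SimpleIntegrand F) {S s : ℝ≥0} (hs : s ≤ S) (V : ℝ≥0 → Ω → ℝ) (ω : Ω) :
    (h.trunc S).integral V s ω = h.integral V s ω := by
  refine Finset.sum_congr rfl fun i _ => ?_
  have key : ∀ a : ℝ≥0, min (min a S) s = min a s := fun a => by
    rw [min_assoc, min_eq_right hs]
  simp only [trunc, key]
  split_ifs with hi
  · rfl
  · have h1 : s ≤ h.time i := hs.trans (not_le.1 hi).le
    simp [min_eq_right h1, min_eq_right (h1.trans (h.mono (Nat.le_succ i)))]

theorem trunc_sq (h : SimpleIntegrand F) {S s : ℝ≥0} (hs : s ≤ S) (ω : Ω) :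
    (h.trunc S).sq s ω = h.sq s ω := by
  refine Finset.sum_congr rfl fun i _ => ?_
  have key : ∀ a : ℝ≥0, min (min a S) s = min a s := fun a => by
    rw [min_assoc, min_eq_right hs]
  simp only [trunc, key]
  split_ifs with hi
  · rfl
  · have h1 : s ≤ h.time i := hs.trans (not_le.1 hi).le
    simp [min_eq_right h1, min_eq_right (h1.trans (h.mono (Nat.le_succ i)))]

theorem sq_nonneg' (h : SimpleIntegrand F) (s : ℝ≥0) (ω : Ω) : 0 ≤ h.sq s ω :=
  Finset.sum_nonneg fun i _ => mul_nonneg (sq_nonneg _) (sub_nonneg.2 (h.min_time_le i s))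

theorem measurable_val (h : SimpleIntegrand F) : Measurable (fun p : ℝ≥0 × Ω => h.val p.1 p.2) := by
  unfold val
  refine Finset.measurable_sum _ fun i _ => ?_
  have : (fun p : ℝ≥0 × Ω => (Ioc (h.time i) (h.time (i + 1))).indicator
      (fun _ => h.coef i p.2) p.1) =
      (Prod.fst ⁻¹' (Ioc (h.time i) (h.time (i + 1)))).indicator (fun p => h.coef i p.2) := by
    ext p
    simp only [Set.indicator, Set.mem_preimage]
  rw [this]
  exact ((h.measurable_coef i).comp measurable_snd).indicator
    (measurable_fst measurableSet_Ioc)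

theorem measurable_val_path (h : SimpleIntegrand F) (ω : Ω) :
    Measurable (fun u : ℝ => h.val u.toNNReal ω) :=
  h.measurable_val.comp ((measurable_real_toNNReal).prodMk measurable_const)

theorem lintegral_indicator_Ioc (a b S : ℝ≥0) (hab : a ≤ b) (c : ℝ≥0∞) :
    ∫⁻ u in Icc (0 : ℝ) S, (Ioc a b).indicator (fun _ => c) u.toNNReal =
      c * ENNReal.ofReal (((min b S : ℝ≥0) : ℝ) - (min a S : ℝ≥0)) := by
  have h1 : ∀ u ∈ Icc (0 : ℝ) S, (Ioc a b).indicator (fun _ => c) u.toNNReal =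
      (Ioc (a : ℝ) (min b S : ℝ≥0)).indicator (fun _ => c) u := by
    intro u hu
    have e : u.toNNReal ∈ Ioc a b ↔ u ∈ Ioc (a : ℝ) (min b S : ℝ≥0) := by
      lift u to ℝ≥0 using hu.1
      simp only [Real.toNNReal_coe, mem_Ioc, NNReal.coe_lt_coe, NNReal.coe_le_coe, le_min_iff]
      have : u ≤ S := by exact_mod_cast hu.2
      tauto
    by_cases hu' : u.toNNReal ∈ Ioc a b
    · rw [Set.indicator_of_mem hu', Set.indicator_of_mem (e.1 hu')]
    · rw [Set.indicator_of_notMem hu', Set.indicator_of_notMem (mt e.2 hu')]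
  rw [setLIntegral_congr_fun measurableSet_Icc h1, lintegral_indicator measurableSet_Ioc,
    lintegral_const, Measure.restrict_restrict measurableSet_Ioc, Measure.restrict_apply_univ,
    Set.inter_eq_left.2, Real.volume_Ioc]
  · rcases le_total a S with h2 | h2
    · rw [min_eq_left h2]
    · rw [min_eq_right h2, min_eq_right (h2.trans hab), sub_self,
        ENNReal.ofReal_of_nonpos (sub_nonpos.2 (by exact_mod_cast h2)), ENNReal.ofReal_zero]
  · intro u hu
    exact ⟨a.2.trans hu.1.le, hu.2.trans (by exact_mod_cast min_le_right b S)⟩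

/-- The intervals `(t_i, t_{i+1}]` are disjoint, so no cross terms appear when the sum is squared.
-/
theorem lintegral_val_sq (h : SimpleIntegrand F) (S : ℝ≥0) (ω : Ω) :
    ∫⁻ u in Icc (0 : ℝ) S, ‖h.val u.toNNReal ω‖ₑ ^ 2 = ENNReal.ofReal (h.sq S ω) := by
  suffices H : ∀ m, ∫⁻ u in Icc (0 : ℝ) S, ‖(h.take m).val u.toNNReal ω‖ₑ ^ 2 =
      ENNReal.ofReal ((h.take m).sq S ω) from H h.n
  intro m
  induction m with
  | zero => simp [take, val, sq]
  | succ m ih =>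
    have e2 : (h.take (m + 1)).sq S ω = (h.take m).sq S ω + h.coef m ω ^ 2 *
        (((min (h.time (m + 1)) S : ℝ≥0) : ℝ) - (min (h.time m) S : ℝ≥0)) :=
      Finset.sum_range_succ _ _
    have e1 : ∀ u, ‖(h.take (m + 1)).val u ω‖ₑ ^ 2 = ‖(h.take m).val u ω‖ₑ ^ 2 +
        (Ioc (h.time m) (h.time (m + 1))).indicator (fun _ => ‖h.coef m ω‖ₑ ^ 2) u := by
      intro u
      have e3 : (h.take (m + 1)).val u ω = (h.take m).val u ω +
          (Ioc (h.time m) (h.time (m + 1))).indicator (fun _ => h.coef m ω) u :=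
        Finset.sum_range_succ _ _
      rw [e3]
      by_cases hu : u ∈ Ioc (h.time m) (h.time (m + 1))
      · have : (h.take m).val u ω = 0 := by
          refine Finset.sum_eq_zero fun i hi => Set.indicator_of_notMem (fun hc => ?_) _
          have := h.mono (Nat.succ_le_of_lt (Finset.mem_range.1 hi))
          exact absurd (hc.2.trans this) (not_le.2 hu.1)
        simp [this, Set.indicator_of_mem hu]
      · simp [Set.indicator_of_notMem hu]
    simp_rw [e1]
    rw [lintegral_add_left ((((h.take m).measurable_val_path ω).enorm).pow_const 2), ih,
      lintegral_indicator_Ioc _ _ _ (h.mono (Nat.le_succ m)), e2,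
      ENNReal.ofReal_add ((h.take m).sq_nonneg' S ω)
        (mul_nonneg (sq_nonneg _) (sub_nonneg.2 (h.min_time_le m S))),
      ENNReal.ofReal_mul (sq_nonneg _)]
    congr 2
    rw [← sq_abs, ENNReal.ofReal_pow (abs_nonneg _), Real.enorm_eq_ofReal_abs]

end SimpleIntegrand

/-! ### Suprema over dyadic points -/

/-- The dyadic points of `[0, 1]`. -/
noncomputable def dyadic (p : ℕ × ℕ) : ℝ≥0 := min ((p.2 : ℝ≥0) / 2 ^ p.1) 1

theorem dyadic_mul_le (p : ℕ × ℕ) (s : ℝ≥0) : dyadic p * s ≤ s :=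
  mul_le_of_le_one_left zero_le (min_le_right _ _)

theorem exists_dyadic_mul {v u s : ℝ≥0} (hvu : v < u) (hus : u ≤ s) :
    ∃ p, v < dyadic p * s ∧ dyadic p * s ≤ u := by
  have hs : 0 < s := (zero_le.trans_lt hvu).trans_le hus
  obtain ⟨n, hn⟩ := exists_pow_lt_of_lt_one (show 0 < (u - v) / s from
    div_pos (tsub_pos_of_lt hvu) hs) (show (1 / 2 : ℝ≥0) < 1 by
      rw [← NNReal.coe_lt_coe]; norm_num)
  have h2 : (0 : ℝ≥0) < 2 ^ n := by positivity
  have hu1 : u / s ≤ 1 := div_le_one_of_le₀ hus zero_le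
  set j := ⌊u / s * 2 ^ n⌋₊
  have hj1 : (j : ℝ≥0) ≤ u / s * 2 ^ n := Nat.floor_le zero_le
  have hj2 : u / s * 2 ^ n < j + 1 := Nat.lt_floor_add_one _
  have hle : (j : ℝ≥0) / 2 ^ n ≤ u / s := (div_le_iff₀ h2).2 hj1
  have hd : dyadic (n, j) = (j : ℝ≥0) / 2 ^ n := min_eq_left (hle.trans hu1)
  refine ⟨(n, j), ?_, ?_⟩
  · rw [hd, ← div_lt_iff₀ hs, lt_div_iff₀ h2]
    have h3 : (1 : ℝ≥0) < (u - v) / s * 2 ^ n := by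
      rw [one_div, inv_pow, inv_lt_iff_one_lt_mul₀ h2] at hn
      exact hn
    have h4 : v / s + (u - v) / s = u / s := by
      rw [← add_div, add_tsub_cancel_of_le hvu.le]
    have h5 : v / s * 2 ^ n + 1 < j + 1 := by
      refine lt_of_lt_of_le ?_ hj2.le
      rw [← h4, add_mul]
      gcongr
    exact lt_of_add_lt_add_right h5
  · rw [hd]
    exact (mul_le_mul_left hle s).trans (by rw [div_mul_cancel₀ _ hs.ne'])

theorem dyadic_zero : dyadic (0, 0) = 0 := by simp [dyadic]

/-- Left-continuity suffices, because every interval `(v, u]` with `u ≤ s` contains a dyadic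
multiple of `s`; the point `0` is a dyadic multiple itself. -/
theorem iSup_Icc_eq_dyadic {g : ℝ≥0 → ℝ≥0∞} {s : ℝ≥0}
    (hg : ∀ u ≤ s, ContinuousWithinAt g (Iic u) u) :
    ⨆ u ∈ Icc (0 : ℝ≥0) s, g u = ⨆ p, g (dyadic p * s) := by
  apply le_antisymm
  · refine iSup₂_le fun u hu => ?_
    rcases eq_or_lt_of_le hu.1 with rfl | h0
    · refine le_trans (by simp [dyadic_zero]) (le_iSup _ (0, 0))
    · by_contra hcon
      rw [not_le] at hcon
      have h1 : ∀ᶠ v in 𝓝[≤] u, (⨆ p, g (dyadic p * s)) < g v :=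
        (hg u hu.2).eventually (lt_mem_nhds hcon)
      rw [eventually_nhdsWithin_iff] at h1
      obtain ⟨l, hl, h2⟩ := exists_Ioc_subset_of_mem_nhds h1 ⟨0, h0⟩
      obtain ⟨p, hp1, hp2⟩ := exists_dyadic_mul hl hu.2
      exact absurd (le_iSup (fun p => g (dyadic p * s)) p)
        (not_le.2 (h2 ⟨hp1, hp2⟩ hp2))
  · exact iSup_le fun p => le_iSup₂_of_le (dyadic p * s) ⟨zero_le, dyadic_mul_le p s⟩ le_rfl

/-- The supremum of `|X|` over `[0, S]`. -/
noncomputable def supNorm (S : ℝ≥0) (X : ℝ≥0 → Ω → ℝ) (ω : Ω) : ℝ≥0∞ :=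
  ⨆ s ∈ Icc (0 : ℝ≥0) S, ‖X s ω‖ₑ

theorem le_supNorm {S s : ℝ≥0} (hs : s ≤ S) (X : ℝ≥0 → Ω → ℝ) (ω : Ω) :
    ‖X s ω‖ₑ ≤ supNorm S X ω := le_iSup₂_of_le s ⟨zero_le, hs⟩ le_rfl

theorem supNorm_le {S : ℝ≥0} {X : ℝ≥0 → Ω → ℝ} {ω : Ω} {C : ℝ≥0∞}
    (h : ∀ s ≤ S, ‖X s ω‖ₑ ≤ C) : supNorm S X ω ≤ C := iSup₂_le fun s hs => h s hs.2

theorem supNorm_mono {S S' : ℝ≥0} (h : S ≤ S') (X : ℝ≥0 → Ω → ℝ) (ω : Ω) :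
    supNorm S X ω ≤ supNorm S' X ω := supNorm_le fun _ hs => le_supNorm (hs.trans h) X ω

/-- The supremum of `|X|` over the dyadic points of `[0, s]`. -/
noncomputable def dyadicSup (X : ℝ≥0 → Ω → ℝ) (s : ℝ≥0) (ω : Ω) : ℝ≥0∞ :=
  ⨆ p, ‖X (dyadic p * s) ω‖ₑ

theorem supNorm_eq_dyadicSup {X : ℝ≥0 → Ω → ℝ} {ω : Ω} {S : ℝ≥0}
    (hX : ∀ u ≤ S, ContinuousWithinAt (fun s => X s ω) (Iic u) u) :
    supNorm S X ω = dyadicSup X S ω :=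
  iSup_Icc_eq_dyadic fun u hu => (hX u hu).enorm

/-- The countable set consists of multiples of `s`, hence of times not exceeding `s`, and it
contains `s`. The supremum is thus measurable at time `s` itself, with no completion of the
filtration. -/
theorem measurable_dyadicSup {X : ℝ≥0 → Ω → ℝ} {s : ℝ≥0} (hX : ∀ u ≤ s, Measurable[F u] (X u)) :
    Measurable[F s] (dyadicSup X s) :=
  Measurable.iSup fun p =>
    measurable_enorm.comp ((hX _ (dyadic_mul_le p s)).mono (F.mono (dyadic_mul_le p s)) le_rfl)

/-- The dyadic supremum is an increasing limit of maxima over finite grids, the form in which Doob's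
discrete inequality applies. -/
theorem dyadicSup_eq_iSup (X : ℝ≥0 → Ω → ℝ) (s : ℝ≥0) (ω : Ω) :
    dyadicSup X s ω = ⨆ n : ℕ, ⨆ j ∈ Finset.range (2 ^ n + 1), ‖X ((j : ℝ≥0) / 2 ^ n * s) ω‖ₑ := by
  apply le_antisymm
  · refine iSup_le fun p => ?_
    rcases le_total p.2 (2 ^ p.1) with h | h
    · refine le_iSup_of_le p.1 (le_iSup₂_of_le p.2 (by simpa using Nat.lt_succ_of_le h) ?_)
      rw [dyadic, min_eq_left]
      exact div_le_one_of_le₀ (by exact_mod_cast h) zero_le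
    · refine le_iSup_of_le p.1 (le_iSup₂_of_le (2 ^ p.1) (by simp) ?_)
      rw [dyadic, min_eq_right]
      · simp
      · exact (one_le_div (by positivity)).2 (by exact_mod_cast h)
  · refine iSup_le fun n => iSup₂_le fun j hj => ?_
    refine le_trans (le_of_eq ?_) (le_iSup _ (n, j))
    rw [dyadic, min_eq_left]
    exact div_le_one_of_le₀ (by
      exact_mod_cast Nat.lt_succ_iff.1 (Finset.mem_range.1 hj)) zero_le

theorem monotone_dyadic_grid (X : ℝ≥0 → Ω → ℝ) (s : ℝ≥0) (ω : Ω) :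
    Monotone fun n : ℕ => ⨆ j ∈ Finset.range (2 ^ n + 1), ‖X ((j : ℝ≥0) / 2 ^ n * s) ω‖ₑ := by
  refine monotone_nat_of_le_succ fun n => iSup₂_le fun j hj => ?_
  refine le_iSup₂_of_le (2 * j) ?_ (le_of_eq ?_)
  · have := Finset.mem_range.1 hj
    rw [Finset.mem_range, pow_succ]
    omega
  · congr 3
    push_cast
    rw [pow_succ, mul_comm (2 ^ n : ℝ≥0) 2, mul_div_mul_left _ _ two_ne_zero]

/-! ### Doob's inequality for elementary integrals -/

/-- The running maximum of a real sequence. -/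
noncomputable def runningMax (x : ℕ → ℝ) : ℕ → ℝ
  | 0 => x 0
  | n + 1 => max (runningMax x n) (x (n + 1))

theorem le_runningMax (x : ℕ → ℝ) {i n : ℕ} (h : i ≤ n) : x i ≤ runningMax x n := by
  induction n with
  | zero => obtain rfl : i = 0 := by omega
            exact le_rfl
  | succ n ih =>
    rcases Nat.lt_or_ge n i with h1 | h1
    · obtain rfl : i = n + 1 := by omega
      exact le_max_right _ _
    · exact (ih h1).trans (le_max_left _ _)

/-- The pathwise core of Doob's `L²` inequality, a summation by parts: `runningMax` increases only
to the current value of `x`. For a submartingale the subtracted sum has nonnegative expectation,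
leaving `E[M²] ≤ 2 E[x M]`. -/
theorem runningMax_sq_le (x : ℕ → ℝ) (n : ℕ) :
    runningMax x n ^ 2 ≤ 2 * x n * runningMax x n -
      2 * ∑ j ∈ Finset.range n, runningMax x j * (x (j + 1) - x j) := by
  induction n with
  | zero => simp [runningMax]; nlinarith [sq_nonneg (x 0)]
  | succ n ih =>
    rw [Finset.sum_range_succ]
    have h0 : x n ≤ runningMax x n := le_runningMax x le_rfl
    simp only [runningMax]
    rcases le_total (runningMax x n) (x (n + 1)) with h | h
    · rw [max_eq_right h]
      nlinarith [sq_nonneg (x (n + 1) - runningMax x n)]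
    · rw [max_eq_left h]
      nlinarith

theorem runningMax_nonneg (x : ℕ → ℝ) (hx : ∀ i, 0 ≤ x i) (n : ℕ) : 0 ≤ runningMax x n :=
  (hx 0).trans (le_runningMax x (Nat.zero_le n))

namespace SimpleIntegrand

/-- The martingale property. The increment over `[u, v]` is the integral of the integrand restarted
at `u`, and in each of its terms the factor multiplying the Brownian increment is known at the left
endpoint. -/
theorem integral_mul_integral_sub_eq_zero [IsProbabilityMeasure P] (hW : IsFBrownian F P W)
    (h : SimpleIntegrand F) {u v : ℝ≥0} (huv : u ≤ v) {Y : Ω → ℝ} (hY : Measurable[F u] Y)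
    (hYm : HasMoments P Y) : ∫ ω, Y ω * (h.integral W v ω - h.integral W u ω) ∂P = 0 := by
  have e : ∀ ω, Y ω * (h.integral W v ω - h.integral W u ω) = ∑ i ∈ Finset.range h.n,
      Y ω * h.coef i ω * (W (min (max (h.time (i + 1)) u) v) ω -
        W (min (max (h.time i) u) v) ω) := by
    intro ω
    have h2 := h.after_integral (u := u) (c := fun _ => 1) measurable_const ⟨1, by simp⟩ W v ω
    rw [min_eq_right huv, one_mul] at h2
    rw [← h2, SimpleIntegrand.integral, Finset.mul_sum]
    refine Finset.sum_congr rfl fun i _ => ?_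
    simp only [after]
    ring
  simp_rw [e]
  rw [integral_finsetSum _ fun i _ =>
    ((hYm.mul (h.hasMoments_coef i)).mul (hW.hasMoments_incr _ _)).integrable]
  exact Finset.sum_eq_zero fun i _ =>
    hW.integral_mul_stopped_incr (Y := fun ω => Y ω * h.coef i ω)
      (max_le_max_right u (h.mono (Nat.le_succ i))) v
      ((hY.mono (F.mono (le_max_right _ _)) le_rfl).mul
        ((h.meas i).mono (F.mono (le_max_left _ _)) le_rfl))

theorem doob_runningMax [IsProbabilityMeasure P] (hW : IsFBrownian F P W)
    (h : SimpleIntegrand F) {r : ℕ → ℝ≥0} (hr : Monotone r) (N : ℕ) :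
    Measurable (fun ω => runningMax (fun j => |h.integral W (r j) ω|) N) ∧
    Integrable (fun ω => runningMax (fun j => |h.integral W (r j) ω|) N ^ 2) P ∧
    ∫ ω, runningMax (fun j => |h.integral W (r j) ω|) N ^ 2 ∂P ≤
      4 * ∫ ω, h.integral W (r N) ω ^ 2 ∂P := by
  set x : Ω → ℕ → ℝ := fun ω j => |h.integral W (r j) ω| with hx
  have hx0 : ∀ ω i, 0 ≤ x ω i := fun ω i => abs_nonneg _
  have hmI : ∀ s, Measurable[F s] (h.integral W s) := h.measurable_integral hW.adapted
  have hI : ∀ s, HasMoments P (h.integral W s) := h.hasMoments_integral hW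
  have hmx : ∀ j, Measurable[F (r j)] (fun ω => x ω j) := fun j =>
    measurable_abs.comp (hmI (r j))
  have hm : ∀ j, Measurable[F (r j)] (fun ω => runningMax (x ω) j) ∧
      HasMoments P (fun ω => runningMax (x ω) j) := by
    intro j
    induction j with
    | zero => exact ⟨hmx 0, (hI _).abs⟩
    | succ j ih =>
      refine ⟨(ih.1.mono (F.mono (hr (Nat.le_succ j))) le_rfl).max (hmx (j + 1)), fun p hp => ?_⟩
      exact (ih.2 p hp).sup ((hI _).abs p hp)
  -- The sign at the left end is a subgradient of the absolute value: `|a'| - |a| ≥ sgn(a) (a' -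
  -- a)`. This replaces increments of `|∫ h dW|` by martingale increments with a coefficient known
  -- in advance.
  set sg : ℕ → Ω → ℝ := fun j ω => if 0 ≤ h.integral W (r j) ω then 1 else -1 with hsg
  have hmsg : ∀ j, Measurable[F (r j)] (sg j) := fun j =>
    Measurable.ite (measurableSet_le measurable_const (hmI (r j))) measurable_const
      measurable_const
  have hsgm : ∀ j, HasMoments P (sg j) := fun j =>
    HasMoments.of_bdd ((hmsg j).mono (F.le _) le_rfl) (C := 1) fun ω => by
      simp only [hsg]; split_ifs <;> simp
  have hYm := fun j => (hm j).1.mul (hmsg j)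
  have hYM := fun j => (hm j).2.mul (hsgm j)
  have hterm := fun j => (hYM j).mul ((hI (r (j + 1))).sub (hI (r j)))
  refine ⟨(hm N).1.mono (F.le _) le_rfl, ((hm N).2.pow 2).integrable, ?_⟩
  have hpt : ∀ ω, runningMax (x ω) N ^ 2 ≤ 4 * h.integral W (r N) ω ^ 2 -
      4 * ∑ j ∈ Finset.range N, runningMax (x ω) j * sg j ω *
        (h.integral W (r (j + 1)) ω - h.integral W (r j) ω) := by
    intro ω
    have h1 := runningMax_sq_le (x ω) N
    have h2 : ∑ j ∈ Finset.range N, runningMax (x ω) j * sg j ω *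
        (h.integral W (r (j + 1)) ω - h.integral W (r j) ω) ≤
        ∑ j ∈ Finset.range N, runningMax (x ω) j * (x ω (j + 1) - x ω j) := by
      refine Finset.sum_le_sum fun j _ => ?_
      rw [mul_assoc]
      refine mul_le_mul_of_nonneg_left ?_ (runningMax_nonneg _ (hx0 ω) j)
      simp only [hsg, hx]
      split_ifs with hs
      · rw [abs_of_nonneg hs, one_mul]
        exact sub_le_sub_right (le_abs_self _) _
      · rw [abs_of_neg (not_le.1 hs)]
        linarith [neg_le_abs (h.integral W (r (j + 1)) ω)]
    have h3 : x ω N ^ 2 = h.integral W (r N) ω ^ 2 := sq_abs _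
    -- The product is split as `2 x M ≤ 2 x² + M² / 2`, which gives the constant `4` after absorbing
    -- half of `M²`.
    nlinarith [sq_nonneg (2 * x ω N - runningMax (x ω) N)]
  have hz : ∀ j, ∫ ω, runningMax (x ω) j * sg j ω *
      (h.integral W (r (j + 1)) ω - h.integral W (r j) ω) ∂P = 0 := fun j =>
    h.integral_mul_integral_sub_eq_zero hW (hr (Nat.le_succ j)) (hYm j) (hYM j)
  have hsum := HasMoments.sum (fun j => hterm j) N
  refine (integral_mono ((hm N).2.pow 2).integrable
    (((HasMoments.const 4).mul ((hI (r N)).pow 2)).sub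
      ((HasMoments.const 4).mul hsum)).integrable hpt).trans (le_of_eq ?_)
  rw [integral_sub ((HasMoments.const 4).mul ((hI (r N)).pow 2)).integrable
    ((HasMoments.const 4).mul hsum).integrable, integral_const_mul, integral_const_mul,
    integral_finsetSum _ fun j _ => (hterm j).integrable,
    Finset.sum_eq_zero fun j _ => hz j]
  simp

theorem ae_continuous_integral (hW : IsFBrownian F P W) (h : SimpleIntegrand F) :
    ∀ᵐ ω ∂P, Continuous fun s => h.integral W s ω := by
  filter_upwards [hW.brownian.cont] with ω hω
  refine continuous_finsetSum _ fun i _ => continuous_const.mul ?_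
  exact (hω.comp (by fun_prop)).sub (hω.comp (by fun_prop))

theorem aemeasurable_supNorm_integral (hW : IsFBrownian F P W) (h : SimpleIntegrand F) (S : ℝ≥0) :
    AEMeasurable (supNorm S (h.integral W)) P := by
  refine ⟨dyadicSup (h.integral W) S, (measurable_dyadicSup fun u _ =>
    h.measurable_integral hW.adapted u).mono (F.le S) le_rfl, ?_⟩
  filter_upwards [h.ae_continuous_integral hW] with ω hω
  exact supNorm_eq_dyadicSup fun u _ => hω.continuousWithinAt

theorem doob [IsProbabilityMeasure P] (hW : IsFBrownian F P W) (h : SimpleIntegrand F) (S : ℝ≥0) :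
    ∫⁻ ω, supNorm S (h.integral W) ω ^ 2 ∂P ≤ 4 * ∫⁻ ω, ENNReal.ofReal (h.sq S ω) ∂P := by
  have h1 : ∀ᵐ ω ∂P, supNorm S (h.integral W) ω ^ 2 = ⨆ n : ℕ,
      (⨆ j ∈ Finset.range (2 ^ n + 1), ‖h.integral W ((j : ℝ≥0) / 2 ^ n * S) ω‖ₑ) ^ 2 := by
    filter_upwards [h.ae_continuous_integral hW] with ω hω
    rw [supNorm_eq_dyadicSup fun u _ => hω.continuousWithinAt, dyadicSup_eq_iSup]
    exact Monotone.map_iSup_of_continuousAt (f := fun y : ℝ≥0∞ => y ^ 2)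
      (ENNReal.continuous_pow 2).continuousAt (fun a b hab => pow_le_pow_left₀ zero_le hab 2)
      (by simp)
  have hmeas : ∀ n : ℕ, Measurable fun ω => ⨆ j ∈ Finset.range (2 ^ n + 1),
      ‖h.integral W ((j : ℝ≥0) / 2 ^ n * S) ω‖ₑ := fun n =>
    Measurable.iSup fun j => Measurable.iSup fun _ =>
      ((h.measurable_integral hW.adapted _).mono (F.le _) le_rfl).enorm
  rw [lintegral_congr_ae h1, lintegral_iSup (fun n => (hmeas n).pow_const 2)
    fun m n hmn ω => pow_le_pow_left₀ zero_le (monotone_dyadic_grid _ S ω hmn) 2]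
  refine iSup_le fun n => ?_
  have hr : Monotone fun j : ℕ => (j : ℝ≥0) / 2 ^ n * S := fun i j hij => by
    have : (i : ℝ≥0) ≤ j := by exact_mod_cast hij
    dsimp only
    gcongr
  obtain ⟨-, hi, hle⟩ := h.doob_runningMax hW hr (2 ^ n)
  have hrN : ((2 ^ n : ℕ) : ℝ≥0) / 2 ^ n * S = S := by
    push_cast
    rw [div_self (by positivity), one_mul]
  rw [hrN, h.integral_integral_sq hW] at hle
  have h0 := fun ω => runningMax_nonneg (fun j : ℕ => |h.integral W ((j : ℝ≥0) / 2 ^ n * S) ω|)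
    (fun _ => abs_nonneg _) (2 ^ n)
  calc _ ≤ ∫⁻ ω, ENNReal.ofReal
        (runningMax (fun j : ℕ => |h.integral W ((j : ℝ≥0) / 2 ^ n * S) ω|) (2 ^ n) ^ 2) ∂P := by
        refine lintegral_mono fun ω => ?_
        rw [ENNReal.ofReal_pow (h0 ω)]
        refine pow_le_pow_left₀ zero_le (iSup₂_le fun j hj => ?_) 2
        rw [Real.enorm_eq_ofReal_abs]
        exact ENNReal.ofReal_le_ofReal (le_runningMax
          (fun j : ℕ => |h.integral W ((j : ℝ≥0) / 2 ^ n * S) ω|)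
          (Nat.lt_succ_iff.1 (Finset.mem_range.1 hj)))
    _ = ENNReal.ofReal (∫ ω, runningMax
          (fun j : ℕ => |h.integral W ((j : ℝ≥0) / 2 ^ n * S) ω|) (2 ^ n) ^ 2 ∂P) :=
        (ofReal_integral_eq_lintegral_ofReal hi (ae_of_all _ fun ω => sq_nonneg _)).symm
    _ ≤ ENNReal.ofReal (4 * ∫ ω, h.sq S ω ∂P) := ENNReal.ofReal_le_ofReal hle
    _ = _ := by
        rw [ENNReal.ofReal_mul (by norm_num), ofReal_integral_eq_lintegral_ofReal
          (h.hasMoments_sq S).integrable (ae_of_all _ fun ω => h.sq_nonneg' S ω)]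
        norm_num

/-! ### A maximal inequality in probability -/

/-- The sum of the first `m` terms of `∫ h²`. -/
noncomputable def sqSum (h : SimpleIntegrand F) (m : ℕ) (ω : Ω) : ℝ :=
  ∑ i ∈ Finset.range m, h.coef i ω ^ 2 * ((h.time (i + 1) : ℝ) - h.time i)

theorem sqSum_mono (h : SimpleIntegrand F) (ω : Ω) : Monotone fun m => h.sqSum m ω :=
  monotone_nat_of_le_succ fun m => by
    unfold sqSum
    rw [Finset.sum_range_succ]
    exact le_add_of_nonneg_right (mul_nonneg (sq_nonneg _)
      (sub_nonneg.2 (by exact_mod_cast h.mono (Nat.le_succ m))))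

theorem measurable_sqSum (h : SimpleIntegrand F) (i : ℕ) :
    Measurable[F (h.time i)] (h.sqSum (i + 1)) :=
  Finset.measurable_sum _ fun j hj => (((h.meas j).mono
    (F.mono (h.mono (Nat.lt_succ_iff.1 (Finset.mem_range.1 hj)))) le_rfl).pow_const 2).mul_const _

/-- The integrand `h`, stopped before `∫ h²` exceeds `δ`. -/
noncomputable def stopAt (h : SimpleIntegrand F) (δ : ℝ) : SimpleIntegrand F where
  n := h.n
  time := h.time
  mono := h.mono
  coef i ω := if h.sqSum (i + 1) ω ≤ δ then h.coef i ω else 0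
  meas i := Measurable.ite (measurableSet_le (h.measurable_sqSum i) measurable_const) (h.meas i)
    measurable_const
  bdd i := by
    obtain ⟨C, hC⟩ := h.bdd i
    refine ⟨C, fun ω => ?_⟩
    split_ifs
    · exact hC ω
    · simpa using (abs_nonneg _).trans (hC ω)

/-- The test for step `i` already includes the contribution of that step, which is known at `h.time
i`. The sum is therefore cut before it exceeds `δ`, without overshoot. -/
theorem stopAt_sq_le (h : SimpleIntegrand F) {δ : ℝ} (hδ : 0 ≤ δ) (s : ℝ≥0) (ω : Ω) :
    (h.stopAt δ).sq s ω ≤ δ := by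
  suffices H : ∀ m, ∑ i ∈ Finset.range m, (h.stopAt δ).coef i ω ^ 2 *
      (((min (h.time (i + 1)) s : ℝ≥0) : ℝ) - (min (h.time i) s : ℝ≥0)) ≤
      min (h.sqSum m ω) δ from (H h.n).trans (min_le_right _ _)
  intro m
  induction m with
  | zero => simp [sqSum, hδ]
  | succ m ih =>
    rw [Finset.sum_range_succ]
    simp only [stopAt] at ih ⊢
    split_ifs with hc
    · rw [min_eq_left hc, show h.sqSum (m + 1) ω = h.sqSum m ω + h.coef m ω ^ 2 *
        ((h.time (m + 1) : ℝ) - h.time m) from Finset.sum_range_succ _ _]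
      refine add_le_add (ih.trans (min_le_left _ _)) (mul_le_mul_of_nonneg_left ?_ (sq_nonneg _))
      have h1 : h.time m ≤ h.time (m + 1) := h.mono (Nat.le_succ m)
      have h1' : (h.time m : ℝ) ≤ h.time (m + 1) := h1
      rcases le_total (h.time m) s with h2 | h2
      · rw [min_eq_left h2]
        exact sub_le_sub_right (by exact_mod_cast min_le_left _ _) _
      · rw [min_eq_right h2, min_eq_right (h2.trans h1), sub_self]
        exact sub_nonneg.2 h1'
    · simp only [ne_eq, OfNat.ofNat_ne_zero, not_false_eq_true, zero_pow, zero_mul, add_zero]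
      exact ih.trans (min_le_min_right _ (h.sqSum_mono ω (Nat.le_succ m)))

theorem stopAt_integral (h : SimpleIntegrand F) {δ : ℝ} {ω : Ω} (hω : h.sqSum h.n ω ≤ δ)
    (V : ℝ≥0 → Ω → ℝ) (s : ℝ≥0) : (h.stopAt δ).integral V s ω = h.integral V s ω := by
  refine Finset.sum_congr rfl fun i hi => ?_
  have : h.sqSum (i + 1) ω ≤ δ := (h.sqSum_mono ω (Finset.mem_range.1 hi)).trans hω
  simp [stopAt, this]

theorem sqSum_trunc (h : SimpleIntegrand F) (S : ℝ≥0) (ω : Ω) :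
    (h.trunc S).sqSum (h.trunc S).n ω = h.sq S ω := by
  rw [← h.trunc_sq le_rfl]
  refine Finset.sum_congr rfl fun i _ => ?_
  simp [trunc]

/-- On the event `∫ h² ≤ δ` the integral of `h` agrees with that of the stopped integrand, to which
Doob and Chebyshev apply. No moment of `h` enters the bound. -/
theorem measure_supNorm_ge_le [IsProbabilityMeasure P] (hW : IsFBrownian F P W)
    (h : SimpleIntegrand F) (S : ℝ≥0) {ε : ℝ≥0∞} (hε : ε ≠ 0) {δ : ℝ≥0} :
    P {ω | ε ≤ supNorm S (h.integral W) ω ∧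
      ∫⁻ u in Icc (0 : ℝ) S, ‖h.val u.toNNReal ω‖ₑ ^ 2 ≤ δ} ≤ 4 * δ / ε ^ 2 := by
  -- For `ε = ∞` the right-hand side is `0`, and the claim is that the supremum is almost surely
  -- finite.
  rcases eq_or_ne ε ∞ with rfl | hε'
  · refine le_trans (le_of_eq ?_) zero_le
    have : ∀ᵐ ω ∂P, supNorm S (h.integral W) ω ≠ ∞ := by
      have h1 := h.doob hW S
      have h2 : ∫⁻ ω, ENNReal.ofReal (h.sq S ω) ∂P ≠ ∞ := by
        rw [← ofReal_integral_eq_lintegral_ofReal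
          (h.hasMoments_sq S).integrable (ae_of_all _ fun ω => h.sq_nonneg' S ω)]
        exact ENNReal.ofReal_ne_top
      have h3 := ae_lt_top' ((h.aemeasurable_supNorm_integral hW S).pow_const 2)
        (ne_top_of_le_ne_top (ENNReal.mul_ne_top (by simp) h2) h1)
      filter_upwards [h3] with ω hω hcon
      simp [hcon] at hω
    rw [ae_iff] at this
    refine measure_mono_null (fun ω hω => ?_) this
    simpa using top_le_iff.1 hω.1
  set g := (h.trunc S).stopAt δ with hg
  calc _ ≤ P {ω | ε ^ 2 ≤ supNorm S (g.integral W) ω ^ 2} := by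
        refine measure_mono fun ω hω => ?_
        have h1 : (h.trunc S).sqSum (h.trunc S).n ω ≤ δ := by
          have := hω.2
          rw [h.lintegral_val_sq, ← ENNReal.ofReal_coe_nnreal] at this
          rw [sqSum_trunc]
          exact (ENNReal.ofReal_le_ofReal_iff δ.2).1 this
        have h2 : supNorm S (g.integral W) ω = supNorm S (h.integral W) ω := by
          refine iSup_congr fun s => iSup_congr fun hs => ?_
          rw [hg, stopAt_integral _ h1, h.trunc_integral hs.2]
        show ε ^ 2 ≤ supNorm S (g.integral W) ω ^ 2
        rw [h2]
        exact pow_le_pow_left₀ zero_le hω.1 2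
    _ ≤ (∫⁻ ω, supNorm S (g.integral W) ω ^ 2 ∂P) / ε ^ 2 :=
        meas_ge_le_lintegral_div ((g.aemeasurable_supNorm_integral hW S).pow_const 2)
          (pow_ne_zero 2 hε) (ENNReal.pow_ne_top hε')
    _ ≤ _ := by
        gcongr
        refine (g.doob hW S).trans ?_
        gcongr
        calc _ ≤ ∫⁻ _, (δ : ℝ≥0∞) ∂P := lintegral_mono fun ω => by
              rw [← ENNReal.ofReal_coe_nnreal]
              exact ENNReal.ofReal_le_ofReal ((h.trunc S).stopAt_sq_le δ.2 S ω)
          _ = δ := by simp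

end SimpleIntegrand

/-! ### Left-continuous adapted processes and their discretisation -/

/-- `H` is adapted on `[0, S]`, with almost all paths left-continuous and bounded. -/
structure Caglad (F : Filtration ℝ≥0 mΩ) (P : Measure Ω) (S : ℝ≥0) (H : ℝ≥0 → Ω → ℝ) : Prop where
  adapted : ∀ s ≤ S, Measurable[F s] (H s)
  left_cont : ∀ᵐ ω ∂P, ∀ s ≤ S, ContinuousWithinAt (fun u => H u ω) (Iic s) s
  bdd : ∀ᵐ ω ∂P, ∃ C, ∀ s ≤ S, |H s ω| ≤ C

/-- `X` is adapted on `[0, S]`, with almost all paths continuous. -/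
structure ContAdapted (F : Filtration ℝ≥0 mΩ) (P : Measure Ω) (S : ℝ≥0) (X : ℝ≥0 → Ω → ℝ) :
    Prop where
  adapted : ∀ s ≤ S, Measurable[F s] (X s)
  cont : ∀ᵐ ω ∂P, ContinuousOn (fun s => X s ω) (Icc 0 S)

theorem continuousWithinAt_Iic_of_continuousOn {x : ℝ≥0 → ℝ} {S : ℝ≥0}
    (h : ContinuousOn x (Icc 0 S)) : ∀ s ≤ S, ContinuousWithinAt x (Iic s) s := fun s hs =>
  (h s ⟨zero_le, hs⟩).mono fun _ hu => ⟨zero_le, le_trans hu hs⟩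

theorem exists_abs_le_of_continuousOn {x : ℝ≥0 → ℝ} {S : ℝ≥0}
    (h : ContinuousOn x (Icc 0 S)) : ∃ C, ∀ s ≤ S, |x s| ≤ C := by
  obtain ⟨C, hC⟩ := isCompact_Icc.exists_bound_of_continuousOn h
  exact ⟨C, fun s hs => hC s ⟨zero_le, hs⟩⟩

theorem ContAdapted.caglad {S : ℝ≥0} {X : ℝ≥0 → Ω → ℝ} (h : ContAdapted F P S X) :
    Caglad F P S X where
  adapted := h.adapted
  left_cont := h.cont.mono fun _ => continuousWithinAt_Iic_of_continuousOn
  bdd := h.cont.mono fun _ => exists_abs_le_of_continuousOn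

theorem ContAdapted.mono {S S' : ℝ≥0} {X : ℝ≥0 → Ω → ℝ} (h : ContAdapted F P S X) (hS : S' ≤ S) :
    ContAdapted F P S' X where
  adapted s hs := h.adapted s (hs.trans hS)
  cont := h.cont.mono fun _ hc => hc.mono (Icc_subset_Icc_right hS)

theorem ContAdapted.comp {S : ℝ≥0} {X : ℝ≥0 → Ω → ℝ} (h : ContAdapted F P S X) {φ : ℝ → ℝ}
    (hφ : Continuous φ) : ContAdapted F P S (fun s ω => φ (X s ω)) where
  adapted s hs := hφ.measurable.comp (h.adapted s hs)
  cont := h.cont.mono fun _ hc => hφ.comp_continuousOn hc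

theorem ContAdapted.sub {S : ℝ≥0} {X Y : ℝ≥0 → Ω → ℝ} (h : ContAdapted F P S X)
    (h' : ContAdapted F P S Y) : ContAdapted F P S (fun s ω => X s ω - Y s ω) where
  adapted s hs := (h.adapted s hs).sub (h'.adapted s hs)
  cont := by filter_upwards [h.cont, h'.cont] with ω h1 h2 using h1.sub h2

theorem ContAdapted.add {S : ℝ≥0} {X Y : ℝ≥0 → Ω → ℝ} (h : ContAdapted F P S X)
    (h' : ContAdapted F P S Y) : ContAdapted F P S (fun s ω => X s ω + Y s ω) where
  adapted s hs := (h.adapted s hs).add (h'.adapted s hs)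
  cont := by filter_upwards [h.cont, h'.cont] with ω h1 h2 using h1.add h2

theorem ContAdapted.const (S : ℝ≥0) (c : ℝ) :
    ContAdapted F P S (fun (_ : ℝ≥0) (_ : Ω) => c) where
  adapted _ _ := measurable_const
  cont := ae_of_all _ fun _ => continuousOn_const

namespace Caglad

variable {S : ℝ≥0} {H H' : ℝ≥0 → Ω → ℝ}

theorem mono (h : Caglad F P S H) {S' : ℝ≥0} (hS : S' ≤ S) : Caglad F P S' H where
  adapted s hs := h.adapted s (hs.trans hS)
  left_cont := h.left_cont.mono fun _ hc s hs => hc s (hs.trans hS)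
  bdd := h.bdd.mono fun _ ⟨C, hC⟩ => ⟨C, fun s hs => hC s (hs.trans hS)⟩

theorem sub (h : Caglad F P S H) (h' : Caglad F P S H') :
    Caglad F P S (fun s ω => H s ω - H' s ω) where
  adapted s hs := (h.adapted s hs).sub (h'.adapted s hs)
  left_cont := by
    filter_upwards [h.left_cont, h'.left_cont] with ω h1 h2 s hs using (h1 s hs).sub (h2 s hs)
  bdd := by
    filter_upwards [h.bdd, h'.bdd] with ω ⟨C, hC⟩ ⟨D, hD⟩
    exact ⟨C + D, fun s hs => (abs_sub _ _).trans (add_le_add (hC s hs) (hD s hs))⟩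

theorem mul (h : Caglad F P S H) (h' : Caglad F P S H') :
    Caglad F P S (fun s ω => H s ω * H' s ω) where
  adapted s hs := (h.adapted s hs).mul (h'.adapted s hs)
  left_cont := by
    filter_upwards [h.left_cont, h'.left_cont] with ω h1 h2 s hs using (h1 s hs).mul (h2 s hs)
  bdd := by
    filter_upwards [h.bdd, h'.bdd] with ω ⟨C, hC⟩ ⟨D, hD⟩
    refine ⟨C * D, fun s hs => ?_⟩
    rw [abs_mul]
    exact mul_le_mul (hC s hs) (hD s hs) (abs_nonneg _) ((abs_nonneg _).trans (hC s hs))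

theorem comp (h : Caglad F P S H) {φ : ℝ → ℝ} (hφ : Continuous φ) :
    Caglad F P S (fun s ω => φ (H s ω)) where
  adapted s hs := hφ.measurable.comp (h.adapted s hs)
  left_cont := h.left_cont.mono fun _ hc s hs => hφ.continuousAt.comp_continuousWithinAt (hc s hs)
  bdd := h.bdd.mono fun ω ⟨C, hC⟩ => by
    obtain ⟨D, hD⟩ := (isCompact_Icc (a := -C) (b := C)).exists_bound_of_continuousOn
      hφ.continuousOn
    exact ⟨D, fun s hs => hD _ (abs_le.1 (hC s hs))⟩

theorem zero : Caglad F P S (fun (_ : ℝ≥0) (_ : Ω) => (0 : ℝ)) :=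
  (ContAdapted.const S 0).caglad

/-- The process `1_{(u, ∞)} c H`. -/
theorem after (h : Caglad F P S H) {u : ℝ≥0} {c : Ω → ℝ} (hc : Measurable[F u] c) :
    Caglad F P S (fun s ω => if u < s then c ω * H s ω else 0) where
  adapted s hs := by
    by_cases hus : u < s
    · simp only [if_pos hus]
      exact (hc.mono (F.mono hus.le) le_rfl).mul (h.adapted s hs)
    · simp only [if_neg hus]
      exact measurable_const
  left_cont := by
    filter_upwards [h.left_cont] with ω h1 s hs
    by_cases hus : u < s
    · refine ((continuousWithinAt_const (b := c ω)).mul (h1 s hs)).congr_of_eventuallyEq ?_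
        (if_pos hus)
      filter_upwards [mem_nhdsWithin_of_mem_nhds (lt_mem_nhds hus)] with r hr using if_pos hr
    · refine (continuousWithinAt_const (b := (0 : ℝ))).congr (fun r hr => if_neg ?_) (if_neg hus)
      exact fun hc => hus (hc.trans_le hr)
  bdd := by
    filter_upwards [h.bdd] with ω ⟨C, hC⟩
    refine ⟨|c ω| * C, fun s hs => ?_⟩
    split_ifs
    · rw [abs_mul]
      exact mul_le_mul_of_nonneg_left (hC s hs) (abs_nonneg _)
    · simpa using mul_nonneg (abs_nonneg (c ω)) ((abs_nonneg _).trans (hC s hs))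

end Caglad

theorem continuousWithinAt_stepFn (a s : ℝ≥0) :
    ContinuousWithinAt (fun u => stepFn u a) (Iic s) s := by
  by_cases h : s ≤ a
  · exact (continuousWithinAt_const (b := (1 : ℝ))).congr (fun r hr => if_pos (le_trans hr h))
      (if_pos h)
  · refine (continuousWithinAt_const (b := (0 : ℝ))).congr_of_eventuallyEq ?_ (if_neg h)
    filter_upwards [mem_nhdsWithin_of_mem_nhds (lt_mem_nhds (not_le.1 h))] with r hr
      using if_neg (not_le.2 hr)

theorem SimpleIntegrand.caglad (h : SimpleIntegrand F) (S : ℝ≥0) : Caglad F P S h.val where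
  adapted s _ := by
    refine Finset.measurable_sum _ fun i _ => ?_
    by_cases hc : s ∈ Ioc (h.time i) (h.time (i + 1))
    · simp only [Set.indicator_of_mem hc]
      exact (h.meas i).mono (F.mono hc.1.le) le_rfl
    · simp only [Set.indicator_of_notMem hc]
      exact measurable_const
  left_cont := ae_of_all _ fun ω s _ => by
    simp_rw [h.val_eq]
    exact tendsto_finsetSum _ fun i _ => (continuousWithinAt_const.mul
      ((continuousWithinAt_stepFn _ s).sub (continuousWithinAt_stepFn _ s)))
  bdd := ae_of_all _ fun ω => by
    choose C hC using h.bdd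
    refine ⟨∑ i ∈ Finset.range h.n, C i, fun u _ => (Finset.abs_sum_le_sum_abs _ _).trans
      (Finset.sum_le_sum fun i _ => ?_)⟩
    by_cases hc : u ∈ Ioc (h.time i) (h.time (i + 1))
    · simpa [Set.indicator_of_mem hc] using hC i ω
    · simpa [Set.indicator_of_notMem hc] using (abs_nonneg _).trans (hC i ω)

/-- Truncation of a real number to `[-L, L]`. -/
noncomputable def clamp (L x : ℝ) : ℝ := max (-L) (min L x)

theorem abs_clamp_le {L : ℝ} (hL : 0 ≤ L) (x : ℝ) : |clamp L x| ≤ L :=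
  abs_le.2 ⟨le_max_left _ _, max_le (by linarith) (min_le_left _ _)⟩

theorem clamp_eq {L x : ℝ} (h : |x| ≤ L) : clamp L x = x := by
  rw [clamp, min_eq_right (abs_le.1 h).2, max_eq_right (abs_le.1 h).1]

theorem continuous_clamp (L : ℝ) : Continuous (clamp L) :=
  continuous_const.max (continuous_const.min continuous_id)

theorem abs_clamp_le_abs {L : ℝ} (hL : 0 ≤ L) (x : ℝ) : |clamp L x| ≤ |x| := by
  rcases le_total |x| L with h | h
  · rw [clamp_eq h]
  · exact (abs_clamp_le hL x).trans h

theorem abs_clamp_sub_clamp_le (L x y : ℝ) : |clamp L x - clamp L y| ≤ |x - y| :=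
  (abs_max_sub_max_le_max _ _ _ _).trans (max_le (by simp)
    ((abs_min_sub_min_le_max _ _ _ _).trans (max_le (by simp) le_rfl)))

/-- The left-point discretisation of `H` on `[0, S]` with `k + 1` steps, truncated at level `L`. -/
noncomputable def Caglad.disc {S : ℝ≥0} {H : ℝ≥0 → Ω → ℝ} (hH : Caglad F P S H) (L : ℝ≥0) (k : ℕ) :
    SimpleIntegrand F where
  n := k + 1
  time i := min ((i : ℝ≥0) * (S / (k + 1))) S
  mono i j hij := min_le_min_right _ (by
    have : (i : ℝ≥0) ≤ j := by exact_mod_cast hij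
    gcongr)
  coef i ω := clamp L (H (min ((i : ℝ≥0) * (S / (k + 1))) S) ω)
  meas i := (continuous_clamp L).measurable.comp (hH.adapted _ (min_le_right _ _))
  bdd i := ⟨L, fun _ => abs_clamp_le L.2 _⟩

theorem Caglad.disc_val {S : ℝ≥0} {H : ℝ≥0 → Ω → ℝ} (hH : Caglad F P S H) (L : ℝ≥0) (k : ℕ)
    {u : ℝ≥0} (hu : u ∈ Ioc 0 S) : ∃ r < u, u ≤ r + S / (k + 1) ∧
      ∀ ω, (hH.disc L k).val u ω = clamp L (H r ω) := by
  have hS : 0 < S := hu.1.trans_le hu.2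
  set δ := S / (k + 1) with hδ
  have hδ0 : 0 < δ := by positivity
  have hx0 : 0 < u / δ := div_pos hu.1 hδ0
  -- The ceiling selects the half-open cell `(j δ, (j + 1) δ]`, so the left node is strictly before
  -- `u` even when `u` is a node.
  obtain ⟨j, hj⟩ : ∃ j, ⌈u / δ⌉₊ = j + 1 := Nat.exists_eq_succ_of_ne_zero (Nat.ceil_pos.2 hx0).ne'
  have hj1 : (j : ℝ≥0) * δ < u := by
    rw [← lt_div_iff₀ hδ0]
    exact Nat.lt_ceil.1 (by omega)
  have hj2 : u ≤ ((j + 1 : ℕ) : ℝ≥0) * δ := by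
    rw [← div_le_iff₀ hδ0, ← hj]
    exact Nat.le_ceil _
  have hjk : j < k + 1 := by
    have : u / δ ≤ ((k + 1 : ℕ) : ℝ≥0) := by
      rw [div_le_iff₀ hδ0, hδ]
      push_cast
      rw [mul_div_cancel₀ _ (by positivity)]
      exact hu.2
    have := Nat.ceil_le.2 this
    omega
  have ht : ∀ i, (hH.disc L k).time i = min ((i : ℝ≥0) * δ) S := fun i => rfl
  have htj : (hH.disc L k).time j = j * δ := by rw [ht, min_eq_left (hj1.le.trans hu.2)]
  have htj1 : u ≤ (hH.disc L k).time (j + 1) := by rw [ht]; exact le_min hj2 hu.2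
  refine ⟨j * δ, hj1, ?_, fun ω => ?_⟩
  · refine hj2.trans (le_of_eq ?_)
    push_cast
    ring
  · unfold SimpleIntegrand.val
    rw [Finset.sum_eq_single j]
    · have hmem : u ∈ Ioc ((hH.disc L k).time j) ((hH.disc L k).time (j + 1)) :=
        ⟨by rwa [htj], htj1⟩
      rw [Set.indicator_of_mem hmem]
      show clamp L (H ((hH.disc L k).time j) ω) = _
      rw [htj]
    · intro i _ hij
      refine Set.indicator_of_notMem (fun hc => ?_) _
      rcases lt_or_gt_of_ne hij with h | h
      · have := (hH.disc L k).mono (Nat.succ_le_of_lt h)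
        exact absurd (hc.2.trans this) (not_le.2 (by rwa [htj]))
      · have := (hH.disc L k).mono (Nat.succ_le_of_lt h)
        exact absurd (htj1.trans this) (not_le.2 hc.1)
    · exact fun h => absurd (Finset.mem_range.2 hjk) h

/-- The left nodes tend to `u` from the left, so left-continuity is enough. The truncation level
must eventually exceed the bound of the path, and how fast depends on `ω`. -/
theorem Caglad.tendsto_disc_val {S : ℝ≥0} {H : ℝ≥0 → Ω → ℝ} (hH : Caglad F P S H) (L : ℕ → ℝ≥0)
    {ω : Ω} (h1 : ∀ s ≤ S, ContinuousWithinAt (fun u => H u ω) (Iic s) s) {C : ℝ}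
    (h2 : ∀ s ≤ S, |H s ω| ≤ C) (hL : ∀ᶠ k in atTop, C ≤ L k) {u : ℝ≥0} (hu : u ∈ Ioc 0 S) :
    Tendsto (fun k => (hH.disc (L k) k).val u ω) atTop (𝓝 (H u ω)) := by
  choose r hr1 hr2 hr3 using fun k => hH.disc_val (L k) k hu
  have hlim : Tendsto r atTop (𝓝 u) := by
    have h0 : Tendsto (fun k : ℕ => S / ((k : ℝ≥0) + 1)) atTop (𝓝 0) := by
      have h3 := (tendsto_const_nhds (x := S)).mul (tendsto_one_div_add_atTop_nhds_zero_nat (𝕜 := ℝ≥0))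
      simpa [div_eq_mul_inv] using h3
    have h4 : Tendsto (fun k : ℕ => u - S / ((k : ℝ≥0) + 1)) atTop (𝓝 u) := by
      simpa using (tendsto_const_nhds (x := u)).sub h0
    exact tendsto_of_tendsto_of_tendsto_of_le_of_le h4 tendsto_const_nhds
      (fun k => tsub_le_iff_right.2 (hr2 k)) (fun k => (hr1 k).le)
  have hlim' : Tendsto r atTop (𝓝[≤] u) :=
    tendsto_nhdsWithin_iff.2 ⟨hlim, Eventually.of_forall fun k => (hr1 k).le⟩
  refine ((h1 u hu.2).tendsto.comp hlim').congr' ?_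
  filter_upwards [hL] with k hk
  rw [hr3 k, clamp_eq ((h2 _ ((hr1 k).le.trans hu.2)).trans hk)]
  rfl

theorem Caglad.abs_disc_val_le {S : ℝ≥0} {H : ℝ≥0 → Ω → ℝ} (hH : Caglad F P S H) (L : ℝ≥0) (k : ℕ)
    {u : ℝ≥0} (hu : u ∈ Ioc 0 S) (ω : Ω) : ‖(hH.disc L k).val u ω‖ₑ ≤ supNorm S H ω := by
  obtain ⟨r, hr1, -, hr3⟩ := hH.disc_val L k hu
  rw [hr3]
  refine le_trans ?_ (le_supNorm (hr1.le.trans hu.2) H ω)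
  rw [Real.enorm_eq_ofReal_abs, Real.enorm_eq_ofReal_abs]
  exact ENNReal.ofReal_le_ofReal (abs_clamp_le_abs L.2 _)

/-! ### Squared `L²` norms in time -/

/-- The pathwise value of `∫_0^S H_u² du`. -/
noncomputable def sqInt (S : ℝ≥0) (H : ℝ≥0 → Ω → ℝ) (ω : Ω) : ℝ≥0∞ :=
  ∫⁻ u in Icc (0 : ℝ) S, ‖H u.toNNReal ω‖ₑ ^ 2

/-- The path of `H` at `ω` is a.e. measurable on `[0, S]`. -/
def PathMeas (S : ℝ≥0) (H : ℝ≥0 → Ω → ℝ) (ω : Ω) : Prop :=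
  AEMeasurable (fun u : ℝ => H u.toNNReal ω) (volume.restrict (Icc (0 : ℝ) S))

theorem ae_restrict_Icc_Ioc {S : ℝ≥0} {p : ℝ≥0 → Prop} (h : ∀ u ∈ Ioc 0 S, p u) :
    ∀ᵐ u : ℝ ∂(volume.restrict (Icc (0 : ℝ) S)), p u.toNNReal := by
  rw [← restrict_Ioc_eq_restrict_Icc, ae_restrict_iff' measurableSet_Ioc]
  refine ae_of_all _ fun u hu => h _ ⟨Real.toNNReal_pos.2 hu.1, ?_⟩
  rw [← Real.toNNReal_coe (r := S)]
  exact Real.toNNReal_le_toNNReal hu.2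

theorem sqInt_congr {S : ℝ≥0} {H H' : ℝ≥0 → Ω → ℝ} {ω : Ω} (h : ∀ u ∈ Ioc 0 S, H u ω = H' u ω) :
    sqInt S H ω = sqInt S H' ω := by
  refine lintegral_congr_ae ?_
  filter_upwards [ae_restrict_Icc_Ioc h] with u hu
  rw [hu]

theorem ennreal_add_sq_le (a b : ℝ≥0∞) : (a + b) ^ 2 ≤ 2 * (a ^ 2 + b ^ 2) := by
  rcases eq_or_ne a ∞ with rfl | ha
  · simp
  rcases eq_or_ne b ∞ with rfl | hb
  · simp
  lift a to ℝ≥0 using ha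
  lift b to ℝ≥0 using hb
  have h : (a + b) ^ 2 ≤ 2 * (a ^ 2 + b ^ 2) := by
    rw [← NNReal.coe_le_coe]
    push_cast
    nlinarith [sq_nonneg ((a : ℝ) - b)]
  exact_mod_cast h

theorem enorm_add_sq_le (a b : ℝ) : ‖a + b‖ₑ ^ 2 ≤ 2 * (‖a‖ₑ ^ 2 + ‖b‖ₑ ^ 2) :=
  (pow_le_pow_left₀ zero_le (enorm_add_le a b) 2).trans (ennreal_add_sq_le _ _)

theorem sqInt_sub_le {S : ℝ≥0} {H G H' : ℝ≥0 → Ω → ℝ} {ω : Ω}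
    (hm : PathMeas S (fun u ω => H u ω - G u ω) ω) :
    sqInt S (fun u ω => H u ω - H' u ω) ω ≤ 2 * (sqInt S (fun u ω => H u ω - G u ω) ω +
      sqInt S (fun u ω => G u ω - H' u ω) ω) := by
  unfold sqInt
  rw [← lintegral_add_left' (hm.enorm.pow_const 2), ← lintegral_const_mul' _ _ (by simp)]
  refine lintegral_mono fun u => ?_
  have := enorm_add_sq_le (H u.toNNReal ω - G u.toNNReal ω) (G u.toNNReal ω - H' u.toNNReal ω)
  simpa using this

theorem sqInt_le {S : ℝ≥0} {H : ℝ≥0 → Ω → ℝ} {ω : Ω} {C : ℝ≥0∞}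
    (h : ∀ u ∈ Ioc 0 S, ‖H u ω‖ₑ ≤ C) : sqInt S H ω ≤ S * C ^ 2 := by
  calc sqInt S H ω ≤ ∫⁻ _ in Icc (0 : ℝ) S, C ^ 2 := by
        refine lintegral_mono_ae ?_
        filter_upwards [ae_restrict_Icc_Ioc h] with u hu using pow_le_pow_left₀ zero_le hu 2
    _ = S * C ^ 2 := by
        rw [lintegral_const, Measure.restrict_apply_univ, Real.volume_Icc, sub_zero,
          ENNReal.ofReal_coe_nnreal, mul_comm]

theorem sqInt_mono {S S' : ℝ≥0} (h : S ≤ S') (H : ℝ≥0 → Ω → ℝ) (ω : Ω) :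
    sqInt S H ω ≤ sqInt S' H ω :=
  lintegral_mono_set (Icc_subset_Icc_right (by exact_mod_cast h))

namespace Caglad

variable {S : ℝ≥0} {H : ℝ≥0 → Ω → ℝ}

/-- A jointly measurable version of the process. -/
theorem exists_measurable (hH : Caglad F P S H) : ∃ G : ℝ≥0 × Ω → ℝ, Measurable G ∧
    ∀ᵐ ω ∂P, ∀ u ∈ Ioc 0 S, H u ω = G (u, ω) := by
  refine ⟨fun p => limsup (fun k : ℕ => (hH.disc k k).val p.1 p.2) atTop,
    Measurable.limsup fun k => (hH.disc k k).measurable_val, ?_⟩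
  filter_upwards [hH.left_cont, hH.bdd] with ω h1 ⟨C, hC⟩ u hu
  refine (Tendsto.limsup_eq (hH.tendsto_disc_val (fun k => k) h1 hC ?_ hu)).symm
  filter_upwards [tendsto_natCast_atTop_atTop.eventually_ge_atTop C] with k hk
  simpa using hk

theorem ae_pathMeas (hH : Caglad F P S H) : ∀ᵐ ω ∂P, PathMeas S H ω := by
  obtain ⟨G, hG, h⟩ := hH.exists_measurable
  filter_upwards [h] with ω hω
  refine ⟨fun u => G (u.toNNReal, ω),
    hG.comp (measurable_real_toNNReal.prodMk measurable_const), ae_restrict_Icc_Ioc hω⟩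

theorem aemeasurable_sqInt [SFinite P] (hH : Caglad F P S H) : AEMeasurable (sqInt S H) P := by
  obtain ⟨G, hG, h⟩ := hH.exists_measurable
  refine ⟨fun ω => ∫⁻ u in Icc (0 : ℝ) S, ‖G (u.toNNReal, ω)‖ₑ ^ 2, ?_, ?_⟩
  · refine Measurable.lintegral_prod_right' (f := fun p : Ω × ℝ => ‖G (p.2.toNNReal, p.1)‖ₑ ^ 2) ?_
    exact ((hG.comp ((measurable_real_toNNReal.comp measurable_snd).prodMk
      measurable_fst)).enorm.pow_const 2)
  · filter_upwards [h] with ω hω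
    exact sqInt_congr (H' := fun u ω => G (u, ω)) hω

theorem aemeasurable_supNorm (hH : Caglad F P S H) : AEMeasurable (supNorm S H) P :=
  ⟨dyadicSup H S, (measurable_dyadicSup hH.adapted).mono (F.le S) le_rfl, by
    filter_upwards [hH.left_cont] with ω hω using supNorm_eq_dyadicSup hω⟩

theorem ae_supNorm_lt_top (hH : Caglad F P S H) : ∀ᵐ ω ∂P, supNorm S H ω < ∞ := by
  filter_upwards [hH.bdd] with ω ⟨C, hC⟩
  refine (supNorm_le (C := ENNReal.ofReal C) fun s hs => ?_).trans_lt ENNReal.ofReal_lt_top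
  rw [Real.enorm_eq_ofReal_abs]
  exact ENNReal.ofReal_le_ofReal (hC s hs)

theorem eventually_le_natCast (C : ℝ) : ∀ᶠ k : ℕ in atTop, C ≤ ((k : ℝ≥0) : ℝ) := by
  filter_upwards [tendsto_natCast_atTop_atTop.eventually_ge_atTop C] with k hk
  simpa using hk

theorem ae_tendsto_sqInt_disc (hH : Caglad F P S H) {G : ℝ≥0 → Ω → ℝ} (hG : Caglad F P S G) :
    ∀ᵐ ω ∂P, Tendsto (fun k : ℕ => sqInt S (fun u ω => (hH.disc k k).val u ω - G u ω) ω) atTop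
      (𝓝 (sqInt S (fun u ω => H u ω - G u ω) ω)) := by
  filter_upwards [hH.left_cont, hH.bdd, hG.ae_pathMeas, hH.ae_supNorm_lt_top,
    hG.ae_supNorm_lt_top] with ω h1 ⟨C, hC⟩ hm hs hs'
  refine tendsto_lintegral_of_dominated_convergence'
    (fun _ => (supNorm S H ω + supNorm S G ω) ^ 2) (fun k => ?_) (fun k => ?_) ?_ ?_
  · exact ((((hH.disc k k).measurable_val_path ω).aemeasurable.sub hm).enorm.pow_const 2)
  · filter_upwards [ae_restrict_Icc_Ioc (S := S) (p := fun u => u ∈ Ioc 0 S) fun u hu => hu]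
      with u hu
    refine pow_le_pow_left₀ zero_le (enorm_sub_le.trans
      (add_le_add (hH.abs_disc_val_le k k hu ω) (le_supNorm hu.2 G ω))) 2
  · rw [lintegral_const, Measure.restrict_apply_univ, Real.volume_Icc]
    exact ENNReal.mul_ne_top (ENNReal.pow_ne_top (ENNReal.add_ne_top.2 ⟨hs.ne, hs'.ne⟩))
      ENNReal.ofReal_ne_top
  · filter_upwards [ae_restrict_Icc_Ioc (S := S) (p := fun u => u ∈ Ioc 0 S) fun u hu => hu]
      with u hu
    have h3 := (hH.tendsto_disc_val (fun k => k) h1 hC (eventually_le_natCast C) hu).sub_const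
      (G u.toNNReal ω)
    exact ((ENNReal.continuous_pow 2).tendsto _).comp h3.enorm

theorem tendsto_lintegral_sqInt_disc [IsProbabilityMeasure P] (hH : Caglad F P S H)
    {G : ℝ≥0 → Ω → ℝ} (hG : Caglad F P S G) (h2 : ∫⁻ ω, supNorm S H ω ^ 2 ∂P ≠ ∞)
    (h2' : ∫⁻ ω, supNorm S G ω ^ 2 ∂P ≠ ∞) :
    Tendsto (fun k : ℕ => ∫⁻ ω, sqInt S (fun u ω => (hH.disc k k).val u ω - G u ω) ω ∂P) atTop
      (𝓝 (∫⁻ ω, sqInt S (fun u ω => H u ω - G u ω) ω ∂P)) := by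
  have hb : ∀ (k : ℕ) (ω : Ω), sqInt S (fun u ω => (hH.disc k k).val u ω - G u ω) ω ≤
      S * (2 * (supNorm S H ω ^ 2 + supNorm S G ω ^ 2)) := by
    intro k ω
    refine (sqInt_le (C := supNorm S H ω + supNorm S G ω) fun u hu => ?_).trans
      (mul_le_mul_right (ennreal_add_sq_le _ _) _)
    exact enorm_sub_le.trans (add_le_add (hH.abs_disc_val_le k k hu ω) (le_supNorm hu.2 G ω))
  refine tendsto_lintegral_of_dominated_convergence'
    (fun ω => S * (2 * (supNorm S H ω ^ 2 + supNorm S G ω ^ 2)))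
    (fun k => (((hH.disc k k).caglad S).sub hG).aemeasurable_sqInt)
    (fun k => ae_of_all _ (hb k)) ?_ (hH.ae_tendsto_sqInt_disc hG)
  · rw [lintegral_const_mul' _ _ (by simp), lintegral_const_mul' _ _ (by simp),
      lintegral_add_left' (hH.aemeasurable_supNorm.pow_const 2)]
    exact ENNReal.mul_ne_top (by simp) (ENNReal.mul_ne_top (by simp) (ENNReal.add_ne_top.2 ⟨h2, h2'⟩))

end Caglad

/-! ### Convergence to zero in probability -/

/-- `f k → 0` in probability, for `ℝ≥0∞`-valued `f k`. -/
def TendstoZeroInProb (P : Measure Ω) (f : ℕ → Ω → ℝ≥0∞) : Prop :=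
  ∀ ε : ℝ≥0∞, 0 < ε → Tendsto (fun k => P {ω | ε ≤ f k ω}) atTop (𝓝 0)

theorem isItoIntegral_iff {S : ℝ≥0} {H I : ℝ≥0 → Ω → ℝ} : IsItoIntegral F P W S H I ↔
    ∃ h : ℕ → SimpleIntegrand F,
      TendstoZeroInProb P (fun k => sqInt S (fun u ω => (h k).val u ω - H u ω)) ∧
      TendstoZeroInProb P (fun k => supNorm S (fun s ω => (h k).integral W s ω - I s ω)) := Iff.rfl

namespace TendstoZeroInProb

theorem of_ae [IsFiniteMeasure P] {f : ℕ → Ω → ℝ≥0∞} (hf : ∀ k, AEMeasurable (f k) P)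
    (h : ∀ᵐ ω ∂P, Tendsto (fun k => f k ω) atTop (𝓝 0)) : TendstoZeroInProb P f := by
  intro ε hε
  have hε' : 0 < min ε 1 := lt_min hε one_pos
  -- Truncating at `1` supplies the dominating function; the level `ε` is lowered to `min ε 1`
  -- accordingly.
  have h1 : Tendsto (fun k => ∫⁻ ω, min (f k ω) 1 ∂P) atTop (𝓝 (∫⁻ _, 0 ∂P)) := by
    refine tendsto_lintegral_of_dominated_convergence' (fun _ => 1)
      (fun k => (hf k).min aemeasurable_const) (fun k => ae_of_all _ fun ω => min_le_right _ _)
      (by simp) ?_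
    filter_upwards [h] with ω hω
    simpa using hω.min (tendsto_const_nhds (x := (1 : ℝ≥0∞)))
  rw [lintegral_zero] at h1
  have h2 := ENNReal.Tendsto.div_const h1 (Or.inr hε'.ne')
  rw [ENNReal.zero_div] at h2
  refine tendsto_of_tendsto_of_tendsto_of_le_of_le tendsto_const_nhds h2 (fun _ => zero_le)
    fun k => ?_
  refine (measure_mono fun ω hω => ?_).trans (meas_ge_le_lintegral_div
    ((hf k).min aemeasurable_const) hε'.ne' (ne_top_of_le_ne_top ENNReal.one_ne_top (min_le_right _ _)))
  have hω' : ε ≤ f k ω := hω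
  exact min_le_min_right 1 hω'

/-- Borel–Cantelli, along indices chosen so that level `2⁻ⁿ` is exceeded with probability at most
`2⁻ⁿ`. -/
theorem exists_subseq {f : ℕ → Ω → ℝ≥0∞} (h : TendstoZeroInProb P f) :
    ∃ φ : ℕ → ℕ, StrictMono φ ∧ ∀ᵐ ω ∂P, Tendsto (fun k => f (φ k) ω) atTop (𝓝 0) := by
  have hp : ∀ n : ℕ, (0 : ℝ≥0∞) < (2⁻¹) ^ n := fun n => ENNReal.pow_pos (by simp) n
  obtain ⟨φ, hφ, hφ'⟩ := extraction_forall_of_eventually'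
    (P := fun n k => P {ω | (2⁻¹ : ℝ≥0∞) ^ n ≤ f k ω} ≤ (2⁻¹) ^ n) fun n => by
      have := (ENNReal.tendsto_nhds_zero.1 (h _ (hp n))) _ (hp n)
      exact eventually_atTop.1 this
  refine ⟨φ, hφ, ?_⟩
  have hsum : ∑' n, P {ω | (2⁻¹ : ℝ≥0∞) ^ n ≤ f (φ n) ω} ≠ ∞ := by
    refine ne_top_of_le_ne_top ?_ (ENNReal.tsum_le_tsum hφ')
    rw [ENNReal.tsum_geometric]
    simp
  filter_upwards [ae_eventually_notMem hsum] with ω hω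
  refine tendsto_of_tendsto_of_tendsto_of_le_of_le' tendsto_const_nhds
    (ENNReal.tendsto_pow_atTop_nhds_zero_of_lt_one (r := 2⁻¹) (by simp))
    (Eventually.of_forall fun _ => zero_le) ?_
  filter_upwards [hω] with n hn
  exact (not_le.1 hn).le

theorem comp_strictMono {f : ℕ → Ω → ℝ≥0∞} (h : TendstoZeroInProb P f) {φ : ℕ → ℕ}
    (hφ : StrictMono φ) : TendstoZeroInProb P (fun k => f (φ k)) :=
  fun ε hε => (h ε hε).comp hφ.tendsto_atTop

theorem of_le {f a b : ℕ → Ω → ℝ≥0∞} (ha : TendstoZeroInProb P a) (hb : TendstoZeroInProb P b)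
    {C : ℝ≥0∞} (hC : C ≠ ∞) (h : ∀ᵐ ω ∂P, ∀ k, f k ω ≤ C * (a k ω + b k ω)) :
    TendstoZeroInProb P f := by
  intro ε hε
  have hε' : 0 < ε / (2 * C) := ENNReal.div_pos hε.ne' (ENNReal.mul_ne_top (by simp) hC)
  have h1 := (ha _ hε').add (hb _ hε')
  rw [add_zero] at h1
  refine tendsto_of_tendsto_of_tendsto_of_le_of_le tendsto_const_nhds h1 (fun _ => zero_le)
    fun k => ?_
  refine le_trans (measure_mono_ae ?_) (measure_union_le _ _)
  filter_upwards [h] with ω hω hε''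
  have h2 : ε ≤ max (a k ω) (b k ω) * (2 * C) := by
    refine (le_trans hε'' (hω k)).trans ?_
    rw [mul_comm (max _ _), mul_comm 2 C, mul_assoc, two_mul]
    gcongr
    · exact le_max_left _ _
    · exact le_max_right _ _
  rcases le_max_iff.1 (ENNReal.div_le_of_le_mul h2) with h3 | h3
  · exact Or.inl h3
  · exact Or.inr h3

end TendstoZeroInProb

theorem eq_zero_of_forall_le_mul {x c : ℝ≥0∞} (hc : c ≠ ∞) (h : ∀ δ : ℝ≥0, 0 < δ → x ≤ c * δ) :
    x = 0 := by
  have h1 := ENNReal.Tendsto.const_mul (a := c) ENNReal.tendsto_inv_nat_nhds_zero (Or.inr hc)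
  rw [mul_zero] at h1
  refine le_zero_iff.1 (ge_of_tendsto h1 ?_)
  filter_upwards [eventually_gt_atTop 0] with n hn
  have hn' : (n : ℝ≥0) ≠ 0 := by exact_mod_cast hn.ne'
  have := h (n : ℝ≥0)⁻¹ (by positivity)
  rwa [ENNReal.coe_inv hn', ENNReal.coe_natCast] at this

theorem sq_lintegral_le {α : Type*} {mα : MeasurableSpace α} (m : Measure α) {f : α → ℝ≥0∞}
    (hf : AEMeasurable f m) : (∫⁻ a, f a ∂m) ^ 2 ≤ m univ * ∫⁻ a, f a ^ 2 ∂m := by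
  have h := ENNReal.lintegral_mul_le_Lp_mul_Lq m Real.HolderConjugate.two_two
    (aemeasurable_const (b := (1 : ℝ≥0∞))) hf
  simp only [Pi.mul_apply, one_mul, ENNReal.one_rpow, lintegral_const] at h
  have h2 := pow_le_pow_left₀ zero_le h 2
  rw [mul_pow] at h2
  simp only [← ENNReal.rpow_natCast, ← ENNReal.rpow_mul] at h2 ⊢
  simpa using h2

/-- Fatou's lemma, arranged so that nothing is required of the measurability of `g`. It transfers
bounds to suprema of Itô integrals, for which only a version is known to be adapted. -/
theorem lintegral_le_of_le_liminf {f : ℕ → Ω → ℝ≥0∞} (hf : ∀ k, AEMeasurable (f k) P)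
    {g : Ω → ℝ≥0∞} (hg : ∀ᵐ ω ∂P, g ω ≤ liminf (fun k => f k ω) atTop) {C : ℕ → ℝ≥0∞} {c : ℝ≥0∞}
    (hC : ∀ k, ∫⁻ ω, f k ω ∂P ≤ C k) (hc : Tendsto C atTop (𝓝 c)) : ∫⁻ ω, g ω ∂P ≤ c :=
  calc ∫⁻ ω, g ω ∂P ≤ ∫⁻ ω, liminf (fun k => f k ω) atTop ∂P := lintegral_mono_ae hg
    _ ≤ liminf (fun k => ∫⁻ ω, f k ω ∂P) atTop := lintegral_liminf_le' hf
    _ ≤ liminf C atTop := liminf_le_liminf (Eventually.of_forall hC)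
    _ = c := hc.liminf_eq

/-! ### Uniform limits of adapted processes -/

section limits

variable {S : ℝ≥0} {g : ℕ → ℝ≥0 → Ω → ℝ} {I : ℝ≥0 → Ω → ℝ} {ω : Ω}

theorem tendsto_of_tendsto_supNorm
    (h : Tendsto (fun k => supNorm S (fun s ω => g k s ω - I s ω) ω) atTop (𝓝 0)) {s : ℝ≥0}
    (hs : s ≤ S) : Tendsto (fun k => g k s ω) atTop (𝓝 (I s ω)) := by
  rw [tendsto_iff_edist_tendsto_0]
  refine tendsto_of_tendsto_of_tendsto_of_le_of_le tendsto_const_nhds h (fun _ => zero_le)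
    fun k => ?_
  rw [edist_eq_enorm_sub]
  exact le_supNorm hs (fun s ω => g k s ω - I s ω) ω

theorem continuousOn_of_tendsto_supNorm (hc : ∀ k, ContinuousOn (fun s => g k s ω) (Icc 0 S))
    (h : Tendsto (fun k => supNorm S (fun s ω => g k s ω - I s ω) ω) atTop (𝓝 0)) :
    ContinuousOn (fun s => I s ω) (Icc 0 S) := by
  have hu : TendstoUniformlyOn (fun k s => g k s ω) (fun s => I s ω) atTop (Icc 0 S) := by
    rw [EMetric.tendstoUniformlyOn_iff]
    intro ε hε
    filter_upwards [h.eventually (gt_mem_nhds hε)] with k hk s hs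
    rw [edist_comm, edist_eq_enorm_sub]
    exact (le_supNorm hs.2 (fun s ω => g k s ω - I s ω) ω).trans_lt hk
  exact hu.continuousOn (Eventually.of_forall hc).frequently

theorem tendsto_supNorm_limsup (hω : ∀ᶠ k in atTop,
      supNorm S (fun s ω => g (k + 1) s ω - g k s ω) ω ≤ ENNReal.ofReal ((1 / 2) ^ k)) :
    Tendsto (fun k => supNorm S
      (fun s ω => g k s ω - limsup (fun j => g j s ω) atTop) ω) atTop (𝓝 0) := by
  obtain ⟨N, hN⟩ := eventually_atTop.1 hω
  have hd : ∀ s ≤ S, ∀ k, dist (g (k + N) s ω) (g (k + 1 + N) s ω) ≤ (1 / 2) ^ N * (1 / 2) ^ k := by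
    intro s hs k
    have h1 := (le_supNorm hs (fun s ω => g (k + N + 1) s ω - g (k + N) s ω) ω).trans
      (hN (k + N) (Nat.le_add_left _ _))
    rw [Real.enorm_eq_ofReal_abs, ENNReal.ofReal_le_ofReal_iff (by positivity)] at h1
    rw [dist_comm, Real.dist_eq, ← pow_add, add_comm N k, add_right_comm k 1 N]
    exact h1
  have hbound : ∀ s ≤ S, ∀ k ≥ N, |g k s ω - limsup (fun j => g j s ω) atTop| ≤
      2 * (1 / 2) ^ k := by
    intro s hs k hk
    obtain ⟨a, ha⟩ := cauchySeq_tendsto_of_complete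
      (cauchySeq_of_le_geometric (1 / 2) ((1 / 2) ^ N) (by norm_num) (hd s hs))
    have ha' : Tendsto (fun j => g j s ω) atTop (𝓝 a) :=
      (tendsto_add_atTop_iff_nat (f := fun j => g j s ω) N).1 ha
    have h2 := dist_le_of_le_geometric_of_tendsto (1 / 2) ((1 / 2) ^ N) (by norm_num) (hd s hs) ha
      (k - N)
    rw [Nat.sub_add_cancel hk, Real.dist_eq, ← pow_add, Nat.add_sub_cancel' hk] at h2
    rw [ha'.limsup_eq]
    refine h2.trans (le_of_eq ?_)
    ring
  have h0 : Tendsto (fun k : ℕ => ENNReal.ofReal (2 * (1 / 2) ^ k)) atTop (𝓝 0) := by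
    have := (tendsto_pow_atTop_nhds_zero_of_lt_one (r := (1 / 2 : ℝ)) (by norm_num)
      (by norm_num)).const_mul 2
    rw [mul_zero] at this
    simpa using ENNReal.tendsto_ofReal this
  refine tendsto_of_tendsto_of_tendsto_of_le_of_le' tendsto_const_nhds h0
    (Eventually.of_forall fun _ => zero_le) ?_
  filter_upwards [eventually_ge_atTop N] with k hk
  refine supNorm_le fun s hs => ?_
  rw [Real.enorm_eq_ofReal_abs]
  exact ENNReal.ofReal_le_ofReal (hbound s hs k hk)

/-- The limit is taken to be the pointwise upper limit, defined for every `ω`. It is then measurable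
for `F s` itself, although convergence holds only almost surely. -/
theorem exists_contAdapted_limit (hg : ∀ k, ContAdapted F P S (g k))
    (h : ∀ᵐ ω ∂P, ∀ᶠ k in atTop,
      supNorm S (fun s ω => g (k + 1) s ω - g k s ω) ω ≤ ENNReal.ofReal ((1 / 2) ^ k)) :
    ∃ I, ContAdapted F P S I ∧
      ∀ᵐ ω ∂P, Tendsto (fun k => supNorm S (fun s ω => g k s ω - I s ω) ω) atTop (𝓝 0) := by
  obtain ⟨J, hJ⟩ : ∃ J : ℝ≥0 → Ω → ℝ, ∀ s ω, J s ω = limsup (fun j => g j s ω) atTop :=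
    ⟨_, fun _ _ => rfl⟩
  have hlim : ∀ᵐ ω ∂P, Tendsto (fun k => supNorm S (fun s ω => g k s ω - J s ω) ω) atTop (𝓝 0) := by
    filter_upwards [h] with ω hω
    simpa only [hJ] using tendsto_supNorm_limsup hω
  have hm : ∀ s ≤ S, Measurable[F s] (J s) := by
    intro s hs
    have : J s = fun ω => limsup (fun j => g j s ω) atTop := funext (hJ s)
    rw [this]
    exact Measurable.limsup fun k => (hg k).adapted s hs
  refine ⟨J, ⟨hm, ?_⟩, hlim⟩
  filter_upwards [hlim, ae_all_iff.2 fun k => (hg k).cont] with ω h1 h2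
  exact continuousOn_of_tendsto_supNorm h2 h1

end limits

/-! ### The Itô integral of a left-continuous process -/

theorem SimpleIntegrand.contAdapted_integral (hW : IsFBrownian F P W) (h : SimpleIntegrand F)
    (S : ℝ≥0) : ContAdapted F P S (h.integral W) where
  adapted s _ := h.measurable_integral hW.adapted s
  cont := (h.ae_continuous_integral hW).mono fun _ hc => hc.continuousOn

/-- On `A` the two limits `H` and `H'` agree, so if each approximation has squared error below `δ`,
the difference `h - h'` has square integral at most `2 (δ + δ)`. The maximal inequality applies to
it. The set `A` need not be measurable. -/
theorem measure_supNorm_integral_sub_ge_le [IsProbabilityMeasure P] (hW : IsFBrownian F P W)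
    (h h' : SimpleIntegrand F) {S : ℝ≥0} {H H' : ℝ≥0 → Ω → ℝ} (hH : ∀ᵐ ω ∂P, PathMeas S H ω)
    {A : Set Ω} (hA : ∀ ω ∈ A, ∀ u ∈ Ioc 0 S, H u ω = H' u ω) {ε : ℝ≥0∞} (hε : ε ≠ 0) (δ : ℝ≥0) :
    P ({ω | ε ≤ supNorm S (fun s ω => h.integral W s ω - h'.integral W s ω) ω} ∩ A) ≤
      4 * (4 * δ : ℝ≥0) / ε ^ 2 + P {ω | δ ≤ sqInt S (fun u ω => h.val u ω - H u ω) ω} +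
        P {ω | δ ≤ sqInt S (fun u ω => h'.val u ω - H' u ω) ω} := by
  obtain ⟨g, hgv, hgi⟩ := h.exists_sub h'
  have h1 := g.measure_supNorm_ge_le hW S hε (δ := 4 * δ)
  refine le_trans (measure_mono_ae ?_) ((measure_union_le (_ ∪ _) _).trans
    (add_le_add_left ((measure_union_le _ _).trans (add_le_add_left h1 _)) _))
  filter_upwards [hH] with ω hm hω
  by_cases c1 : δ ≤ sqInt S (fun u ω => h.val u ω - H u ω) ω
  · exact Or.inl (Or.inr c1)
  by_cases c2 : δ ≤ sqInt S (fun u ω => h'.val u ω - H' u ω) ω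
  · exact Or.inr c2
  refine Or.inl (Or.inl ⟨?_, ?_⟩)
  · have : supNorm S (g.integral W) ω =
        supNorm S (fun s ω => h.integral W s ω - h'.integral W s ω) ω :=
      iSup_congr fun s => iSup_congr fun _ => by rw [hgi]
    rw [this]
    exact hω.1
  · have e1 : ∫⁻ u in Icc (0 : ℝ) S, ‖g.val u.toNNReal ω‖ₑ ^ 2 =
        sqInt S (fun u ω => h.val u ω - h'.val u ω) ω := by
      simp only [sqInt, hgv]
    have e2 : sqInt S (fun u ω => H u ω - h'.val u ω) ω =
        sqInt S (fun u ω => h'.val u ω - H' u ω) ω := by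
      rw [sqInt_congr (H' := fun u ω => H' u ω - h'.val u ω) fun u hu => by rw [hA ω hω.2 u hu]]
      simp only [sqInt, enorm_sub_rev]
    rw [e1]
    refine (sqInt_sub_le ((h.measurable_val_path ω).aemeasurable.sub hm)).trans ?_
    rw [e2]
    push_cast
    rw [show (4 : ℝ≥0∞) * δ = 2 * (δ + δ) by ring]
    gcongr
    · exact (not_le.1 c1).le
    · exact (not_le.1 c2).le

namespace IsItoIntegral

variable {S : ℝ≥0} {H H' I I' : ℝ≥0 → Ω → ℝ}

/-- Locality: two Itô integrals coincide where their integrands do. -/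
theorem ae_eq_of_eq [IsProbabilityMeasure P] (hW : IsFBrownian F P W)
    (hI : IsItoIntegral F P W S H I) (hI' : IsItoIntegral F P W S H' I')
    (hH : ∀ᵐ ω ∂P, PathMeas S H ω) :
    ∀ᵐ ω ∂P, (∀ u ∈ Ioc 0 S, H u ω = H' u ω) → ∀ s ≤ S, I s ω = I' s ω := by
  obtain ⟨h, ha, hb⟩ := isItoIntegral_iff.1 hI
  obtain ⟨h', ha', hb'⟩ := isItoIntegral_iff.1 hI'
  set A : Set Ω := {ω | ∀ u ∈ Ioc 0 S, H u ω = H' u ω}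
  -- One `ε` is spent on each approximation and one on the difference of the elementary integrals.
  -- The limit `k → ∞` comes first and leaves `16 δ / ε²`; then `δ` tends to `0`.
  have key : ∀ ε : ℝ≥0, 0 < ε →
      P ({ω | 3 * ε ≤ supNorm S (fun s ω => I s ω - I' s ω) ω} ∩ A) = 0 := by
    intro ε hε
    have hε' : (ε : ℝ≥0∞) ≠ 0 := by simpa using hε.ne'
    have hε'' : (0 : ℝ≥0∞) < ε := by simpa using hε
    refine eq_zero_of_forall_le_mul (c := 16 / ε ^ 2)
      (ENNReal.div_ne_top (by simp) (pow_ne_zero 2 hε')) fun δ hδ => ?_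
    have hδ' : (0 : ℝ≥0∞) < δ := by simpa using hδ
    have hlim := (((hb _ hε'').add (hb' _ hε'')).add
      (((tendsto_const_nhds (x := 16 / (ε : ℝ≥0∞) ^ 2 * δ)).add (ha _ hδ')).add (ha' _ hδ')))
    simp only [add_zero, zero_add] at hlim
    refine ge_of_tendsto hlim (Eventually.of_forall fun k => ?_)
    have h1 := measure_supNorm_integral_sub_ge_le hW (h k) (h' k) hH (A := A) (H' := H')
      (fun ω hω => hω) hε' δ
    rw [show (4 : ℝ≥0∞) * (4 * δ : ℝ≥0) / ε ^ 2 = 16 / ε ^ 2 * δ by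
      simp only [div_eq_mul_inv]
      push_cast
      ring] at h1
    refine le_trans (measure_mono fun ω hω => ?_) ((measure_union_le _ _).trans
      (add_le_add (measure_union_le _ _) h1))
    by_contra hcon
    simp only [mem_union, not_or] at hcon
    obtain ⟨⟨c1, c2⟩, c3⟩ := hcon
    have d1 : supNorm S (fun s ω => (h k).integral W s ω - I s ω) ω < ε := not_le.1 fun hc => c1 hc
    have d2 : supNorm S (fun s ω => (h' k).integral W s ω - I' s ω) ω < ε :=
      not_le.1 fun hc => c2 hc
    have d3 : supNorm S (fun s ω => (h k).integral W s ω - (h' k).integral W s ω) ω < ε :=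
      not_le.1 fun hc => c3 ⟨hc, hω.2⟩
    have d4 : supNorm S (fun s ω => I s ω - I' s ω) ω ≤
        supNorm S (fun s ω => (h k).integral W s ω - I s ω) ω +
        supNorm S (fun s ω => (h' k).integral W s ω - I' s ω) ω +
        supNorm S (fun s ω => (h k).integral W s ω - (h' k).integral W s ω) ω := by
      refine supNorm_le fun s hs => ?_
      have e : I s ω - I' s ω = -((h k).integral W s ω - I s ω) +
        ((h' k).integral W s ω - I' s ω) + ((h k).integral W s ω - (h' k).integral W s ω) := by ring
      rw [e]
      refine (enorm_add_le _ _).trans (add_le_add ((enorm_add_le _ _).trans (add_le_add ?_ ?_)) ?_)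
      · rw [enorm_neg]
        exact le_supNorm hs (fun s ω => (h k).integral W s ω - I s ω) ω
      · exact le_supNorm hs (fun s ω => (h' k).integral W s ω - I' s ω) ω
      · exact le_supNorm hs (fun s ω => (h k).integral W s ω - (h' k).integral W s ω) ω
    have d5 := (le_trans hω.1 d4).trans_lt (ENNReal.add_lt_add (ENNReal.add_lt_add d1 d2) d3)
    rw [show (3 : ℝ≥0∞) * ε = ε + ε + ε by ring] at d5
    exact lt_irrefl _ d5
  have key' : ∀ᵐ ω ∂P, ∀ n : ℕ,
      ω ∉ {ω | 3 * ((1 / (n + 1) : ℝ≥0) : ℝ≥0∞) ≤ supNorm S (fun s ω => I s ω - I' s ω) ω} ∩ A :=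
    ae_all_iff.2 fun n => measure_eq_zero_iff_ae_notMem.1 (key _ (by positivity))
  filter_upwards [key'] with ω hω hA s hs
  have h0 : supNorm S (fun s ω => I s ω - I' s ω) ω = 0 := by
    refine eq_zero_of_forall_le_mul (c := 3) (by simp) fun δ hδ => ?_
    obtain ⟨n, hn⟩ := exists_nat_one_div_lt hδ
    have h1 : supNorm S (fun s ω => I s ω - I' s ω) ω < 3 * ((1 / (n + 1) : ℝ≥0) : ℝ≥0∞) :=
      not_le.1 fun hc => hω n ⟨hc, hA⟩
    refine h1.le.trans ?_
    gcongr
  have := le_supNorm hs (fun s ω => I s ω - I' s ω) ω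
  rw [h0, nonpos_iff_eq_zero, enorm_eq_zero, sub_eq_zero] at this
  exact this

theorem mono (hI : IsItoIntegral F P W S H I) {S' : ℝ≥0} (hS : S' ≤ S) :
    IsItoIntegral F P W S' H I := by
  obtain ⟨h, ha, hb⟩ := isItoIntegral_iff.1 hI
  refine isItoIntegral_iff.2 ⟨h, ha.of_le ha (C := 1) (by simp) (ae_of_all _ fun ω k => ?_),
    hb.of_le hb (C := 1) (by simp) (ae_of_all _ fun ω k => ?_)⟩
  · rw [one_mul]
    exact (sqInt_mono hS _ ω).trans le_self_add
  · rw [one_mul]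
    exact (supNorm_mono hS _ ω).trans le_self_add

theorem congr (hI : IsItoIntegral F P W S H I)
    (hH : ∀ᵐ ω ∂P, ∀ u ∈ Ioc 0 S, H u ω = H' u ω) (hII : ∀ᵐ ω ∂P, ∀ s ≤ S, I s ω = I' s ω) :
    IsItoIntegral F P W S H' I' := by
  obtain ⟨h, ha, hb⟩ := isItoIntegral_iff.1 hI
  refine isItoIntegral_iff.2 ⟨h, ha.of_le ha (C := 1) (by simp) ?_,
    hb.of_le hb (C := 1) (by simp) ?_⟩
  · filter_upwards [hH] with ω hω k
    rw [one_mul, sqInt_congr (H' := fun u ω => (h k).val u ω - H u ω) fun u hu => by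
      rw [hω u hu]]
    exact le_self_add
  · filter_upwards [hII] with ω hω k
    rw [one_mul]
    refine le_trans (supNorm_le fun s hs => ?_) le_self_add
    rw [← hω s hs]
    exact le_supNorm hs (fun s ω => (h k).integral W s ω - I s ω) ω

theorem sub (hI : IsItoIntegral F P W S H I) (hI' : IsItoIntegral F P W S H' I')
    (hH : ∀ᵐ ω ∂P, PathMeas S H ω) :
    IsItoIntegral F P W S (fun u ω => H u ω - H' u ω) (fun s ω => I s ω - I' s ω) := by
  obtain ⟨h, ha, hb⟩ := isItoIntegral_iff.1 hI
  obtain ⟨h', ha', hb'⟩ := isItoIntegral_iff.1 hI'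
  choose g hgv hgi using fun k => (h k).exists_sub (h' k)
  refine isItoIntegral_iff.2 ⟨g, ha.of_le ha' (C := 2) (by simp) ?_,
    hb.of_le hb' (C := 1) (by simp) (ae_of_all _ fun ω k => ?_)⟩
  · filter_upwards [hH] with ω hm k
    unfold sqInt
    have hm' : AEMeasurable (fun u : ℝ => (h k).val u.toNNReal ω - H u.toNNReal ω)
        (volume.restrict (Icc (0 : ℝ) S)) := ((h k).measurable_val_path ω).aemeasurable.sub hm
    rw [← lintegral_add_left' (hm'.enorm.pow_const 2), ← lintegral_const_mul' _ _ (by simp)]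
    refine lintegral_mono fun u => ?_
    dsimp only
    rw [hgv]
    have := enorm_add_sq_le ((h k).val u.toNNReal ω - H u.toNNReal ω)
      (-((h' k).val u.toNNReal ω - H' u.toNNReal ω))
    rw [enorm_neg] at this
    refine le_trans (le_of_eq ?_) this
    congr 2
    ring
  · rw [one_mul]
    refine supNorm_le fun s hs => ?_
    rw [hgi, show (h k).integral W s ω - (h' k).integral W s ω - (I s ω - I' s ω) =
      ((h k).integral W s ω - I s ω) + -((h' k).integral W s ω - I' s ω) by ring]
    refine (enorm_add_le _ _).trans (add_le_add ?_ ?_)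
    · exact le_supNorm hs (fun s ω => (h k).integral W s ω - I s ω) ω
    · rw [enorm_neg]
      exact le_supNorm hs (fun s ω => (h' k).integral W s ω - I' s ω) ω

theorem after (hI : IsItoIntegral F P W S H I) {u : ℝ≥0} {c : Ω → ℝ} (hc : Measurable[F u] c)
    (hb : ∃ C, ∀ ω, |c ω| ≤ C) :
    IsItoIntegral F P W S (fun s ω => if u < s then c ω * H s ω else 0)
      (fun s ω => c ω * (I s ω - I (min s u) ω)) := by
  obtain ⟨h, ha, hb'⟩ := isItoIntegral_iff.1 hI
  obtain ⟨C, hC⟩ := hb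
  have hC' : ∀ ω, ‖c ω‖ₑ ≤ ENNReal.ofReal C := fun ω => by
    rw [Real.enorm_eq_ofReal_abs]
    exact ENNReal.ofReal_le_ofReal (hC ω)
  refine isItoIntegral_iff.2 ⟨fun k => (h k).after u c hc ⟨C, hC⟩,
    ha.of_le ha (C := ENNReal.ofReal C ^ 2) (by simp) (ae_of_all _ fun ω k => ?_),
    hb'.of_le hb' (C := ENNReal.ofReal C) (by simp) (ae_of_all _ fun ω k => ?_)⟩
  · refine le_trans ?_ (mul_le_mul_right le_self_add _)
    unfold sqInt
    rw [← lintegral_const_mul' _ _ (by simp)]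
    refine lintegral_mono fun r => ?_
    dsimp only
    rw [(h k).after_val]
    split_ifs with hr
    · rw [← mul_sub, enorm_mul, mul_pow]
      gcongr
      exact hC' ω
    · simp
  · refine supNorm_le fun s hs => ?_
    rw [(h k).after_integral, ← mul_sub, enorm_mul]
    refine mul_le_mul' (hC' ω) ?_
    rw [show (h k).integral W s ω - (h k).integral W (min s u) ω - (I s ω - I (min s u) ω) =
      ((h k).integral W s ω - I s ω) +
        -((h k).integral W (min s u) ω - I (min s u) ω) by ring]
    refine (enorm_add_le _ _).trans (add_le_add ?_ ?_)
    · exact le_supNorm hs (fun s ω => (h k).integral W s ω - I s ω) ω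
    · rw [enorm_neg]
      exact le_supNorm ((min_le_left _ _).trans hs)
        (fun s ω => (h k).integral W s ω - I s ω) ω

theorem ae_continuousOn (hW : IsFBrownian F P W) (hI : IsItoIntegral F P W S H I) :
    ∀ᵐ ω ∂P, ContinuousOn (fun s => I s ω) (Icc 0 S) := by
  obtain ⟨h, -, hb⟩ := isItoIntegral_iff.1 hI
  obtain ⟨φ, -, hφ⟩ := hb.exists_subseq
  filter_upwards [hφ, ae_all_iff.2 fun k => (h (φ k)).ae_continuous_integral hW] with ω h1 h2
  exact continuousOn_of_tendsto_supNorm (fun k => (h2 k).continuousOn) h1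

theorem ae_eq_zero (hI : IsItoIntegral F P W S H I) :
    ∀ᵐ ω ∂P, I 0 ω = 0 := by
  obtain ⟨h, -, hb⟩ := isItoIntegral_iff.1 hI
  obtain ⟨φ, -, hφ⟩ := hb.exists_subseq
  filter_upwards [hφ] with ω h1
  refine tendsto_nhds_unique (tendsto_of_tendsto_supNorm h1 zero_le) ?_
  simp [SimpleIntegrand.integral]

end IsItoIntegral

theorem SimpleIntegrand.isItoIntegral (h : SimpleIntegrand F) (S : ℝ≥0) :
    IsItoIntegral F P W S h.val (h.integral W) := by
  refine isItoIntegral_iff.2 ⟨fun _ => h, fun ε hε => ?_, fun ε hε => ?_⟩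
  · simp [sqInt, not_le.2 hε]
  · simp [supNorm, not_le.2 hε]

/-! ### Existence of Itô integrals and moment estimates -/

theorem ofReal_half_pow_pos (n : ℕ) : 0 < ENNReal.ofReal ((1 / 2) ^ n) :=
  ENNReal.ofReal_pos.2 (by positivity)

theorem tsum_ofReal_half_pow_ne_top : ∑' n : ℕ, ENNReal.ofReal ((1 / 2) ^ n) ≠ ∞ := by
  have h : ∀ n : ℕ, ENNReal.ofReal ((1 / 2) ^ n) = ENNReal.ofReal (1 / 2) ^ n := fun n =>
    ENNReal.ofReal_pow (by norm_num) n
  simp_rw [h]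
  rw [ENNReal.tsum_geometric]
  refine ENNReal.inv_ne_top.2 (tsub_pos_of_lt ?_).ne'
  rw [ENNReal.ofReal_lt_one]
  norm_num

/-- The elementary integrals of the discretisations are Cauchy in probability for the uniform norm,
by the maximal inequality. A fast subsequence converges uniformly almost surely by Borel–Cantelli.
-/
theorem Caglad.exists_isItoIntegral [IsProbabilityMeasure P] (hW : IsFBrownian F P W) {S : ℝ≥0}
    {H : ℝ≥0 → Ω → ℝ} (hH : Caglad F P S H) : ∃ (I : ℝ≥0 → Ω → ℝ) (φ : ℕ → ℕ),
      ContAdapted F P S I ∧ StrictMono φ ∧ IsItoIntegral F P W S H I ∧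
      ∀ᵐ ω ∂P, Tendsto (fun k => supNorm S
        (fun s ω => (hH.disc (φ k) (φ k)).integral W s ω - I s ω) ω) atTop (𝓝 0) := by
  have h1 : TendstoZeroInProb P
      (fun k : ℕ => sqInt S (fun u ω => (hH.disc k k).val u ω - H u ω)) := by
    refine TendstoZeroInProb.of_ae
      (fun k => (((hH.disc k k).caglad S).sub hH).aemeasurable_sqInt) ?_
    filter_upwards [hH.ae_tendsto_sqInt_disc hH] with ω hω
    simpa [sqInt] using hω
  have h2 : ∀ n : ℕ, ∃ N : ℕ, ∀ k ≥ N, ∀ m ≥ N, P {ω | ENNReal.ofReal ((1 / 2) ^ n) ≤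
      supNorm S (fun s ω => (hH.disc k k).integral W s ω - (hH.disc m m).integral W s ω) ω} ≤
      ENNReal.ofReal ((1 / 2) ^ n) := by
    intro n
    set η := ENNReal.ofReal ((1 / 2) ^ n) with hη
    have hη0 : η ≠ 0 := (ofReal_half_pow_pos n).ne'
    -- The budget `η` is split as `η / 2` for the maximal inequality and `η / 4` for each
    -- discretisation error.
    obtain ⟨δ, hδ, hδ'⟩ := ENNReal.exists_nnreal_pos_mul_lt (a := 16 / η ^ 2) (b := η / 2)
      (ENNReal.div_ne_top (by simp) (pow_ne_zero 2 hη0)) (ENNReal.half_pos hη0).ne'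
    have hη4 : 0 < η / 2 / 2 := ENNReal.half_pos (ENNReal.half_pos hη0).ne'
    obtain ⟨N, hN⟩ := eventually_atTop.1
      (ENNReal.tendsto_nhds_zero.1 (h1 δ (by simpa using hδ)) _ hη4)
    refine ⟨N, fun k hk m hm => ?_⟩
    have h3 := measure_supNorm_integral_sub_ge_le hW (hH.disc k k) (hH.disc m m) hH.ae_pathMeas
      (A := univ) (H' := H) (fun ω _ u _ => rfl) hη0 δ
    rw [inter_univ] at h3
    refine h3.trans ?_
    calc _ ≤ η / 2 + η / 2 / 2 + η / 2 / 2 := by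
          refine add_le_add (add_le_add (le_trans (le_of_eq ?_) hδ'.le) (hN k hk)) (hN m hm)
          simp only [div_eq_mul_inv]
          push_cast
          ring
      _ = η := by rw [add_assoc, ENNReal.add_halves, ENNReal.add_halves]
  choose N hN using h2
  obtain ⟨φ, hφ, hφN⟩ := extraction_forall_of_eventually' (P := fun n k => N n ≤ k)
    fun n => ⟨N n, fun k hk => hk⟩
  set g : ℕ → SimpleIntegrand F := fun n => hH.disc (φ n) (φ n) with hg
  have h3 : ∀ᵐ ω ∂P, ∀ᶠ k in atTop, supNorm S
      (fun s ω => (g (k + 1)).integral W s ω - (g k).integral W s ω) ω ≤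
      ENNReal.ofReal ((1 / 2) ^ k) := by
    have hs : ∑' n, P {ω | ENNReal.ofReal ((1 / 2) ^ n) ≤ supNorm S
        (fun s ω => (g (n + 1)).integral W s ω - (g n).integral W s ω) ω} ≠ ∞ :=
      ne_top_of_le_ne_top tsum_ofReal_half_pow_ne_top (ENNReal.tsum_le_tsum fun n =>
        hN n _ ((hφN n).trans (hφ.monotone (Nat.le_succ n))) _ (hφN n))
    filter_upwards [ae_eventually_notMem hs] with ω hω
    filter_upwards [hω] with n hn
    exact (not_le.1 fun hc => hn hc).le
  obtain ⟨I, hI, hI'⟩ := exists_contAdapted_limit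
    (fun k => (g k).contAdapted_integral hW S) h3
  refine ⟨I, φ, hI, hφ, isItoIntegral_iff.2 ⟨g, h1.comp_strictMono hφ,
    TendstoZeroInProb.of_ae (fun k => ?_) hI'⟩, hI'⟩
  exact (((g k).contAdapted_integral hW S).sub hI).caglad.aemeasurable_supNorm

theorem supNorm_sq_le {S : ℝ≥0} {X : ℝ≥0 → Ω → ℝ} {ω : Ω} {C : ℝ≥0∞}
    (h : ∀ s ≤ S, ‖X s ω‖ₑ ^ 2 ≤ C) : supNorm S X ω ^ 2 ≤ C := by
  have h1 : supNorm S X ω ≤ C ^ (2⁻¹ : ℝ) := supNorm_le fun s hs => by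
    rw [ENNReal.le_rpow_inv_iff (by norm_num), ENNReal.rpow_ofNat]
    exact h s hs
  rwa [ENNReal.le_rpow_inv_iff (by norm_num), ENNReal.rpow_ofNat] at h1

theorem supNorm_sq {S : ℝ≥0} (X : ℝ≥0 → Ω → ℝ) (ω : Ω) :
    supNorm S X ω ^ 2 = ⨆ s ∈ Icc (0 : ℝ≥0) S, ‖X s ω‖ₑ ^ 2 :=
  le_antisymm (supNorm_sq_le fun s hs => le_iSup₂_of_le s ⟨zero_le, hs⟩ le_rfl)
    (iSup₂_le fun _ hs => pow_le_pow_left₀ zero_le (le_supNorm hs.2 X ω) 2)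

namespace IsItoIntegral

variable {S : ℝ≥0} {H I : ℝ≥0 → Ω → ℝ}

/-- Doob's inequality holds for the discretisations; Fatou passes to the limit on the left and
dominated convergence, which uses the moment assumption, on the right. -/
theorem lintegral_supNorm_sq_le_of_moment [IsProbabilityMeasure P] (hW : IsFBrownian F P W)
    (hH : Caglad F P S H) (hI : IsItoIntegral F P W S H I)
    (h2 : ∫⁻ ω, supNorm S H ω ^ 2 ∂P ≠ ∞) :
    ∫⁻ ω, supNorm S I ω ^ 2 ∂P ≤ 4 * ∫⁻ ω, sqInt S H ω ∂P := by
  obtain ⟨J, φ, -, hφ, hJ, hlim⟩ := hH.exists_isItoIntegral hW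
  have hIJ := hI.ae_eq_of_eq hW hJ hH.ae_pathMeas
  have h0 : ∫⁻ ω, supNorm S (fun (_ : ℝ≥0) (_ : Ω) => (0 : ℝ)) ω ^ 2 ∂P ≠ ∞ := by simp [supNorm]
  have ht := (hH.tendsto_lintegral_sqInt_disc Caglad.zero h2 h0).comp hφ.tendsto_atTop
  simp only [sub_zero] at ht
  refine lintegral_le_of_le_liminf
    (f := fun k ω => supNorm S ((hH.disc (φ k) (φ k)).integral W) ω ^ 2)
    (fun k => ((hH.disc (φ k) (φ k)).aemeasurable_supNorm_integral hW S).pow_const 2) ?_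
    (fun k => ?_) (ENNReal.Tendsto.const_mul ht (Or.inr (by simp)))
  · filter_upwards [hIJ, hlim] with ω h3 h4
    refine supNorm_sq_le fun s hs => ?_
    rw [h3 (fun u _ => rfl) s hs]
    have h5 := ((ENNReal.continuous_pow 2).tendsto _).comp (tendsto_of_tendsto_supNorm h4 hs).enorm
    rw [← h5.liminf_eq]
    exact liminf_le_liminf (Eventually.of_forall fun k =>
      pow_le_pow_left₀ zero_le (le_supNorm hs _ ω) 2)
  · refine ((hH.disc (φ k) (φ k)).doob hW S).trans (le_of_eq ?_)
    simp only [← SimpleIntegrand.lintegral_val_sq]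
    rfl

/-- Doob's inequality for Itô integrals. -/
theorem lintegral_supNorm_sq_le [IsProbabilityMeasure P] (hW : IsFBrownian F P W)
    (hH : Caglad F P S H) (hI : IsItoIntegral F P W S H I) :
    ∫⁻ ω, supNorm S I ω ^ 2 ∂P ≤ 4 * ∫⁻ ω, sqInt S H ω ∂P := by
  -- The moment assumption is removed by clamping `H` at level `N`. By locality the clamped integral
  -- equals `I` once `N` exceeds the bound of the path, and clamping only decreases the right-hand
  -- side.
  have hc : ∀ N : ℕ, Caglad F P S (fun u ω => clamp N (H u ω)) := fun N =>
    hH.comp (continuous_clamp N)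
  choose J φ hJc _ hJ _ using fun N => (hc N).exists_isItoIntegral hW
  have hIJ := ae_all_iff.2 fun N => hI.ae_eq_of_eq hW (hJ N) hH.ae_pathMeas
  refine lintegral_le_of_le_liminf (f := fun N ω => supNorm S (J N) ω ^ 2)
    (fun N => (hJc N).caglad.aemeasurable_supNorm.pow_const 2) ?_
    (fun N => ?_) tendsto_const_nhds
  · filter_upwards [hIJ, hH.bdd] with ω h1 ⟨C, hC⟩
    have h2 : ∀ᶠ N : ℕ in atTop, supNorm S (J N) ω ^ 2 = supNorm S I ω ^ 2 := by
      filter_upwards [tendsto_natCast_atTop_atTop.eventually_ge_atTop C] with N hN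
      congr 1
      refine iSup_congr fun s => iSup_congr fun hs => ?_
      rw [h1 N (fun u hu => (clamp_eq ((hC u hu.2).trans hN)).symm) s hs.2]
    exact ((tendsto_const_nhds.congr' (h2.mono fun _ h => h.symm)).liminf_eq).ge
  · refine ((hJ N).lintegral_supNorm_sq_le_of_moment hW (hc N) ?_).trans ?_
    · refine ne_top_of_le_ne_top (b := ENNReal.ofReal N ^ 2) (by simp) ?_
      calc _ ≤ ∫⁻ _, ENNReal.ofReal N ^ 2 ∂P := lintegral_mono fun ω =>
            pow_le_pow_left₀ zero_le (supNorm_le fun s _ => by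
              rw [Real.enorm_eq_ofReal_abs]
              exact ENNReal.ofReal_le_ofReal (abs_clamp_le (Nat.cast_nonneg N) _)) 2
        _ = _ := by simp
    · gcongr with ω
      refine lintegral_mono fun u => pow_le_pow_left₀ zero_le ?_ 2
      dsimp only
      rw [Real.enorm_eq_ofReal_abs, Real.enorm_eq_ofReal_abs]
      exact ENNReal.ofReal_le_ofReal (abs_clamp_le_abs (Nat.cast_nonneg N) _)

theorem aestronglyMeasurable (hI : IsItoIntegral F P W S H I) (hW : IsFBrownian F P W) {s : ℝ≥0}
    (hs : s ≤ S) : AEStronglyMeasurable (I s) P := by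
  obtain ⟨h, -, hb⟩ := isItoIntegral_iff.1 hI
  obtain ⟨φ, -, hφ⟩ := hb.exists_subseq
  refine aestronglyMeasurable_of_tendsto_ae atTop (f := fun k => (h (φ k)).integral W s)
    (fun k => (((h (φ k)).measurable_integral hW.adapted s).mono
      (F.le s) le_rfl).aestronglyMeasurable) ?_
  filter_upwards [hφ] with ω hω using tendsto_of_tendsto_supNorm hω hs

theorem memLp_two [IsProbabilityMeasure P] (hW : IsFBrownian F P W)
    (hH : Caglad F P S H) (hI : IsItoIntegral F P W S H I)
    (h2 : ∫⁻ ω, sqInt S H ω ∂P ≠ ∞) {s : ℝ≥0} (hs : s ≤ S) : MemLp (I s) 2 P := by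
  refine ⟨hI.aestronglyMeasurable hW hs, ?_⟩
  rw [eLpNorm_lt_top_iff_lintegral_rpow_enorm_lt_top (by simp) (by simp)]
  refine lt_of_le_of_lt ?_ (lt_top_iff_ne_top.2 (ENNReal.mul_ne_top (a := 4) (by simp) h2))
  refine le_trans (lintegral_mono fun ω => ?_) (hI.lintegral_supNorm_sq_le hW hH)
  simp only [ENNReal.toReal_ofNat, ENNReal.rpow_ofNat]
  exact pow_le_pow_left₀ zero_le (le_supNorm hs I ω) 2

theorem _root_.ReflSDE.lintegral_sqInt_ne_top {S : ℝ≥0} {H : ℝ≥0 → Ω → ℝ}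
    (h2 : ∫⁻ ω, supNorm S H ω ^ 2 ∂P ≠ ∞) : ∫⁻ ω, sqInt S H ω ∂P ≠ ∞ := by
  refine ne_top_of_le_ne_top (ENNReal.mul_ne_top (a := S) (by simp) h2) ?_
  rw [← lintegral_const_mul' _ _ (by simp)]
  exact lintegral_mono fun ω => sqInt_le fun u hu => le_supNorm hu.2 H ω

/-- Elementary integrals are centred, and under the moment assumption they approximate `I s` in
`L²`. -/
theorem integral_eq_zero [IsProbabilityMeasure P] (hW : IsFBrownian F P W)
    (hH : Caglad F P S H) (hI : IsItoIntegral F P W S H I)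
    (h2 : ∫⁻ ω, supNorm S H ω ^ 2 ∂P ≠ ∞) {s : ℝ≥0} (hs : s ≤ S) : ∫ ω, I s ω ∂P = 0 := by
  have hint : Integrable (I s) P :=
    (hI.memLp_two hW hH (lintegral_sqInt_ne_top h2) hs).integrable (by norm_num)
  have hb : ∀ k : ℕ, ‖∫ ω, I s ω ∂P‖ₑ ^ 2 ≤
      4 * ∫⁻ ω, sqInt S (fun u ω => (hH.disc k k).val u ω - H u ω) ω ∂P := by
    intro k
    have h3 : ∫ ω, I s ω ∂P = -∫ ω, ((hH.disc k k).integral W s ω - I s ω) ∂P := by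
      rw [integral_sub ((hH.disc k k).hasMoments_integral hW s).integrable hint,
        (hH.disc k k).integral_integral_eq_zero hW]
      simp
    have h4 := (((hH.disc k k).isItoIntegral (P := P) S).sub hI
      ((hH.disc k k).caglad (P := P) S).ae_pathMeas).lintegral_supNorm_sq_le hW
      (((hH.disc k k).caglad S).sub hH)
    rw [h3, enorm_neg]
    refine le_trans (pow_le_pow_left₀ zero_le (enorm_integral_le_lintegral_enorm _) 2) ?_
    refine (sq_lintegral_le P ?_).trans ?_
    · exact ((((hH.disc k k).hasMoments_integral hW s).integrable.sub hint).aestronglyMeasurable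
        |>.enorm)
    · rw [measure_univ, one_mul]
      refine le_trans (lintegral_mono fun ω => ?_) h4
      exact pow_le_pow_left₀ zero_le
        (le_supNorm hs (fun s ω => (hH.disc k k).integral W s ω - I s ω) ω) 2
  have hlim := ENNReal.Tendsto.const_mul (a := 4)
    (hH.tendsto_lintegral_sqInt_disc hH h2 h2) (Or.inr (by simp))
  simp only [sub_self, sqInt, enorm_zero, ne_eq, OfNat.ofNat_ne_zero, not_false_eq_true, zero_pow,
    lintegral_zero, mul_zero] at hlim
  have h5 := ge_of_tendsto hlim (Eventually.of_forall hb)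
  simpa using h5

/-- The bound for elementary integrals passes to the limit by Fatou, because discretisation does not
increase the bound on the integrand. -/
theorem lintegral_incr_pow_four_le [IsProbabilityMeasure P] (hW : IsFBrownian F P W)
    (hH : Caglad F P S H) (hI : IsItoIntegral F P W S H I) {C : ℝ}
    (hC : ∀ s ≤ S, ∀ ω, |H s ω| ≤ C) {u v : ℝ≥0} (huv : u ≤ v) (hv : v ≤ S) :
    ∫⁻ ω, ‖I v ω - I u ω‖ₑ ^ 4 ∂P ≤
      ENNReal.ofReal ((4 + 3 * gaussMom4) * C ^ 4 * ((v : ℝ) - u) ^ 2) := by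
  obtain ⟨J, φ, -, hφ, hJ, hlim⟩ := hH.exists_isItoIntegral hW
  have hIJ := hI.ae_eq_of_eq hW hJ hH.ae_pathMeas
  have hmom : ∀ k, HasMoments P fun ω => (hH.disc (φ k) (φ k)).integral W v ω -
      (hH.disc (φ k) (φ k)).integral W u ω := fun k =>
    ((hH.disc (φ k) (φ k)).hasMoments_integral hW v).sub
      ((hH.disc (φ k) (φ k)).hasMoments_integral hW u)
  refine lintegral_le_of_le_liminf
    (f := fun k ω => ‖(hH.disc (φ k) (φ k)).integral W v ω -
      (hH.disc (φ k) (φ k)).integral W u ω‖ₑ ^ 4)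
    (fun k => (hmom k).integrable.aestronglyMeasurable.enorm.pow_const 4) ?_
    (fun k => ?_) tendsto_const_nhds
  · filter_upwards [hIJ, hlim] with ω h3 h4
    rw [h3 (fun u _ => rfl) v hv, h3 (fun u _ => rfl) u (huv.trans hv)]
    have h5 := ((ENNReal.continuous_pow 4).tendsto _).comp
      ((tendsto_of_tendsto_supNorm h4 hv).sub
        (tendsto_of_tendsto_supNorm h4 (huv.trans hv))).enorm
    exact h5.liminf_eq.ge
  · set h := hH.disc (φ k) (φ k) with hh
    have e : ∀ ω, h.integral W v ω - h.integral W u ω =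
        (h.after u (fun _ => 1) measurable_const ⟨1, by simp⟩).integral W v ω := by
      intro ω
      rw [h.after_integral, min_eq_right huv, one_mul]
    have hcoef : ∀ i ω, |(h.after u (fun _ => 1) measurable_const ⟨1, by simp⟩).coef i ω| ≤ C := by
      intro i ω
      simp only [SimpleIntegrand.after, one_mul, hh, Caglad.disc]
      exact (abs_clamp_le_abs (by positivity) _).trans (hC _ (min_le_right _ _) ω)
    have h4 := (h.after u (fun _ => 1) measurable_const ⟨1, by simp⟩).integral_integral_pow_four_le
      hW v hcoef
    have hm := ((h.after u (fun _ => 1) measurable_const ⟨1, by simp⟩).hasMoments_integral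
      (P := P) hW v).pow 4
    calc ∫⁻ ω, ‖h.integral W v ω - h.integral W u ω‖ₑ ^ 4 ∂P
        = ∫⁻ ω, ENNReal.ofReal
          ((h.after u (fun _ => 1) measurable_const ⟨1, by simp⟩).integral W v ω ^ 4) ∂P := by
          refine lintegral_congr fun ω => ?_
          rw [e, Real.enorm_eq_ofReal_abs, ← ENNReal.ofReal_pow (abs_nonneg _),
            Even.pow_abs ⟨2, rfl⟩]
      _ = ENNReal.ofReal (∫ ω,
          (h.after u (fun _ => 1) measurable_const ⟨1, by simp⟩).integral W v ω ^ 4 ∂P) :=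
          (ofReal_integral_eq_lintegral_ofReal hm.integrable
            (ae_of_all _ fun ω => Even.pow_nonneg ⟨2, rfl⟩ _)).symm
      _ ≤ _ := by
          refine ENNReal.ofReal_le_ofReal (h4.trans ?_)
          -- The integrand restarted at `u` has its first partition point at or after `u`, so the
          -- elapsed time in the fourth moment bound is at most `v - u`.
          have h5 : u ≤ min ((h.after u (fun _ => 1) measurable_const ⟨1, by simp⟩).time 0) v :=
            le_min (le_max_right _ _) huv
          have h5' : (u : ℝ) ≤ (min ((h.after u (fun _ => 1) measurable_const
            ⟨1, by simp⟩).time 0) v : ℝ≥0) := h5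
          have h6 : ((min ((h.after u (fun _ => 1) measurable_const
            ⟨1, by simp⟩).time 0) v : ℝ≥0) : ℝ) ≤ v := by exact_mod_cast min_le_right _ _
          have := gaussMom4_nonneg
          gcongr

end IsItoIntegral

/-! ### Drift integrals -/

theorem integral_indicator_Ioc_toNNReal (a b s : ℝ≥0) (hab : a ≤ b) (c : ℝ) :
    IntervalIntegrable (fun u : ℝ => (Ioc a b).indicator (fun _ => c) u.toNNReal) volume 0 s ∧
    ∫ u in (0 : ℝ)..s, (Ioc a b).indicator (fun _ => c) u.toNNReal =
      c * ((min b s : ℝ≥0) - (min a s : ℝ≥0)) := by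
  have h0 : (0 : ℝ) ≤ s := s.2
  have e : ∀ u ∈ Ioc (0 : ℝ) s, (Ioc a b).indicator (fun _ => c) u.toNNReal =
      (Ioc ((min a s : ℝ≥0) : ℝ) (min b s : ℝ≥0)).indicator (fun _ => c) u := by
    intro u hu
    have h1 : u.toNNReal ∈ Ioc a b ↔ u ∈ Ioc ((min a s : ℝ≥0) : ℝ) (min b s : ℝ≥0) := by
      rw [mem_Ioc, mem_Ioc, Real.lt_toNNReal_iff_coe_lt, Real.toNNReal_le_iff_le_coe]
      push_cast
      rw [min_lt_iff, le_min_iff]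
      constructor
      · rintro ⟨h1, h2⟩
        exact ⟨Or.inl h1, h2, hu.2⟩
      · rintro ⟨h1, h2, -⟩
        exact ⟨h1.resolve_right (not_lt.2 hu.2), h2⟩
    by_cases h : u.toNNReal ∈ Ioc a b
    · rw [Set.indicator_of_mem h, Set.indicator_of_mem (h1.1 h)]
    · rw [Set.indicator_of_notMem h, Set.indicator_of_notMem (fun h' => h (h1.2 h'))]
  constructor
  · rw [intervalIntegrable_iff_integrableOn_Ioc_of_le h0]
    refine IntegrableOn.congr_fun ?_ (fun u hu => (e u hu).symm) measurableSet_Ioc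
    exact (integrableOn_const (by simp)).indicator measurableSet_Ioc
  · rw [intervalIntegral.integral_of_le h0, setIntegral_congr_fun measurableSet_Ioc e,
      setIntegral_indicator measurableSet_Ioc, setIntegral_const, Ioc_inter_Ioc]
    have h1 : min a s ≤ min b s := min_le_min_right _ hab
    have h2 : max (0 : ℝ) (min a s : ℝ≥0) = (min a s : ℝ≥0) := max_eq_right (min a s).2
    have h3 : min (s : ℝ) (min b s : ℝ≥0) = (min b s : ℝ≥0) :=
      min_eq_right (by exact_mod_cast min_le_right b s)
    rw [h2, h3, Measure.real, Real.volume_Ioc, ENNReal.toReal_ofReal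
      (sub_nonneg.2 (by exact_mod_cast h1)), smul_eq_mul, mul_comm]

/-- The time integral is the elementary integral with integrator `s ↦ s`. Its adaptedness therefore
follows from the same lemma as for `W`. -/
theorem SimpleIntegrand.integral_val (h : SimpleIntegrand F) (s : ℝ≥0) (ω : Ω) :
    IntervalIntegrable (fun u : ℝ => h.val u.toNNReal ω) volume 0 s ∧
    ∫ u in (0 : ℝ)..s, h.val u.toNNReal ω = h.integral (fun s _ => (s : ℝ)) s ω := by
  have h1 := fun i => integral_indicator_Ioc_toNNReal (h.time i) (h.time (i + 1)) s
    (h.mono (Nat.le_succ i)) (h.coef i ω)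
  unfold SimpleIntegrand.val SimpleIntegrand.integral
  constructor
  · have h2 := IntervalIntegrable.sum (Finset.range h.n) fun i _ => (h1 i).1
    rwa [Finset.sum_fn] at h2
  · rw [intervalIntegral.integral_finsetSum fun i _ => (h1 i).1]
    exact Finset.sum_congr rfl fun i _ => (h1 i).2

theorem PathMeas.mono {S S' : ℝ≥0} {H : ℝ≥0 → Ω → ℝ} {ω : Ω} (h : PathMeas S H ω) (hS : S' ≤ S) :
    PathMeas S' H ω :=
  AEMeasurable.mono_measure h (Measure.restrict_mono (Icc_subset_Icc_right (by exact_mod_cast hS))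
    le_rfl)

theorem PathMeas.sq_integral_le {S : ℝ≥0} {H : ℝ≥0 → Ω → ℝ} {ω : Ω} (h : PathMeas S H ω) :
    ‖∫ u in (0 : ℝ)..S, H u.toNNReal ω‖ₑ ^ 2 ≤ S * sqInt S H ω := by
  rw [intervalIntegral.integral_of_le S.coe_nonneg]
  have h1 := sq_lintegral_le _ h.enorm
  rw [Measure.restrict_apply_univ, Real.volume_Icc, sub_zero, ENNReal.ofReal_coe_nnreal] at h1
  refine le_trans (pow_le_pow_left₀ zero_le ?_ 2) h1
  rw [← restrict_Ioc_eq_restrict_Icc]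
  exact enorm_integral_le_lintegral_enorm _

theorem PathMeas.integrableOn {S : ℝ≥0} {H : ℝ≥0 → Ω → ℝ} {ω : Ω} (h : PathMeas S H ω) {C : ℝ}
    (hC : ∀ s ≤ S, |H s ω| ≤ C) :
    IntegrableOn (fun u : ℝ => H u.toNNReal ω) (Icc (0 : ℝ) S) := by
  refine ⟨h.aestronglyMeasurable, HasFiniteIntegral.of_bounded (C := C) ?_⟩
  filter_upwards [ae_restrict_Icc_Ioc (S := S) (p := fun u => |H u ω| ≤ C)
    fun u hu => hC u hu.2] with u hu using hu

theorem PathMeas.intervalIntegrable {S s : ℝ≥0} {H : ℝ≥0 → Ω → ℝ} {ω : Ω} (h : PathMeas S H ω)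
    {C : ℝ} (hC : ∀ s ≤ S, |H s ω| ≤ C) (hs : s ≤ S) :
    IntervalIntegrable (fun u : ℝ => H u.toNNReal ω) volume 0 s := by
  rw [intervalIntegrable_iff_integrableOn_Icc_of_le s.coe_nonneg]
  exact (h.integrableOn hC).mono_set (Icc_subset_Icc_right (by exact_mod_cast hs))

theorem PathMeas.continuousOn_integral {S : ℝ≥0} {H : ℝ≥0 → Ω → ℝ} {ω : Ω} (h : PathMeas S H ω)
    {C : ℝ} (hC : ∀ s ≤ S, |H s ω| ≤ C) :
    ContinuousOn (fun s : ℝ≥0 => ∫ u in (0 : ℝ)..s, H u.toNNReal ω) (Icc 0 S) := by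
  have h1 := intervalIntegral.continuousOn_primitive_interval (μ := volume) (a := 0) (b := (S : ℝ))
    (f := fun u : ℝ => H u.toNNReal ω) (by rw [uIcc_of_le S.coe_nonneg]; exact h.integrableOn hC)
  rw [uIcc_of_le S.coe_nonneg] at h1
  exact h1.comp NNReal.continuous_coe.continuousOn fun s hs =>
    ⟨s.2, by exact_mod_cast hs.2⟩

/-- The pathwise integral makes sense only off a null set; the upper limit of the elementary
integrals of the discretisations gives a version measurable for every `F s`. -/
theorem Caglad.exists_drift [IsProbabilityMeasure P] {S : ℝ≥0} {H : ℝ≥0 → Ω → ℝ}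
    (hH : Caglad F P S H) : ∃ B : ℝ≥0 → Ω → ℝ, ContAdapted F P S B ∧
      ∀ᵐ ω ∂P, ∀ s ≤ S, B s ω = ∫ u in (0 : ℝ)..s, H u.toNNReal ω := by
  obtain ⟨B, hB⟩ : ∃ B : ℝ≥0 → Ω → ℝ, ∀ s ω, B s ω =
      limsup (fun k : ℕ => (hH.disc k k).integral (fun s _ => (s : ℝ)) s ω) atTop :=
    ⟨_, fun _ _ => rfl⟩
  have hlim : ∀ᵐ ω ∂P, ∀ s ≤ S, B s ω = ∫ u in (0 : ℝ)..s, H u.toNNReal ω := by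
    filter_upwards [hH.ae_tendsto_sqInt_disc hH, hH.ae_pathMeas, hH.bdd] with ω hω hm ⟨C, hC⟩ s hs
    rw [hB]
    refine Tendsto.limsup_eq ?_
    simp only [sub_self, sqInt, enorm_zero, ne_eq, OfNat.ofNat_ne_zero, not_false_eq_true,
      zero_pow, lintegral_zero] at hω
    have h1 : ∀ k : ℕ, ‖(hH.disc k k).integral (fun s _ => (s : ℝ)) s ω -
        ∫ u in (0 : ℝ)..s, H u.toNNReal ω‖ₑ ^ 2 ≤
        S * sqInt S (fun u ω => (hH.disc k k).val u ω - H u ω) ω := by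
      intro k
      rw [← ((hH.disc k k).integral_val s ω).2, ← intervalIntegral.integral_sub
        ((hH.disc k k).integral_val s ω).1 (hm.intervalIntegrable hC hs)]
      have h2 : PathMeas s (fun u ω => (hH.disc k k).val u ω - H u ω) ω :=
        PathMeas.mono (AEMeasurable.sub ((hH.disc k k).measurable_val_path ω).aemeasurable hm) hs
      refine h2.sq_integral_le.trans ?_
      gcongr
      exact sqInt_mono hs _ ω
    have h2 := ENNReal.Tendsto.const_mul (a := S) hω (Or.inr (by simp))
    rw [mul_zero] at h2
    have h3 := tendsto_of_tendsto_of_tendsto_of_le_of_le tendsto_const_nhds h2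
      (fun _ => zero_le) h1
    have h4 := (ENNReal.continuous_rpow_const (y := 1 / 2)).tendsto _ |>.comp h3
    simp only [Function.comp_def, ← ENNReal.rpow_natCast, ← ENNReal.rpow_mul] at h4
    rw [tendsto_iff_edist_tendsto_0]
    simpa [edist_eq_enorm_sub] using h4
  refine ⟨B, ⟨fun s hs => ?_, ?_⟩, hlim⟩
  · have h1 : B s = fun ω =>
        limsup (fun k : ℕ => (hH.disc k k).integral (fun s _ => (s : ℝ)) s ω) atTop :=
      funext fun ω => hB s ω
    rw [h1]
    exact Measurable.limsup fun k =>
      (hH.disc k k).measurable_integral (V := fun s _ => (s : ℝ)) (fun s => measurable_const) s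
  · filter_upwards [hlim, hH.ae_pathMeas, hH.bdd] with ω hω hm ⟨C, hC⟩
    exact (hm.continuousOn_integral hC).congr fun s hs => hω s hs.2

/-! ### The Skorokhod map -/

/-- `k s` is the running maximum of `(z - g)⁺` on `[0, s]`, for all `s ∈ [0, S]`. -/
def IsReflector (S : ℝ≥0) (g z k : ℝ≥0 → ℝ) : Prop :=
  ∀ s ≤ S, IsLUB ((fun u => max (z u - g u) 0) '' Icc 0 s) (k s)

namespace IsReflector

variable {S : ℝ≥0} {g z k z' k' : ℝ≥0 → ℝ}

theorem le (h : IsReflector S g z k) {u s : ℝ≥0} (hus : u ≤ s) (hs : s ≤ S) :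
    max (z u - g u) 0 ≤ k s := (h s hs).1 ⟨u, ⟨zero_le, hus⟩, rfl⟩

theorem le_of_forall (h : IsReflector S g z k) {s : ℝ≥0} (hs : s ≤ S) {M : ℝ}
    (hM : ∀ u ≤ s, max (z u - g u) 0 ≤ M) : k s ≤ M := by
  refine (h s hs).2 ?_
  rintro _ ⟨u, hu, rfl⟩
  exact hM u hu.2

theorem nonneg (h : IsReflector S g z k) {s : ℝ≥0} (hs : s ≤ S) : 0 ≤ k s :=
  (le_max_right _ _).trans (h.le le_rfl hs)

theorem sub_le (h : IsReflector S g z k) {s : ℝ≥0} (hs : s ≤ S) : z s - k s ≤ g s := by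
  linarith [(le_max_left _ _).trans (h.le le_rfl hs)]

theorem monotoneOn (h : IsReflector S g z k) : MonotoneOn k (Icc 0 S) := fun _ hs _ hr hsr =>
  h.le_of_forall hs.2 fun _ hu => h.le (hu.trans hsr) hr.2

theorem apply_zero (h : IsReflector S g z k) : k 0 = max (z 0 - g 0) 0 := by
  refine le_antisymm (h.le_of_forall zero_le fun u hu => ?_) (h.le le_rfl zero_le)
  rw [le_zero_iff.1 hu]

/-- A supremum is 1-Lipschitz in the uniform norm, and so is `max · 0`. Hence `z ↦ z - k` is
2-Lipschitz, which is all that the Picard and Gronwall arguments need to know about reflection. -/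
theorem abs_sub_le (h : IsReflector S g z k) (h' : IsReflector S g z' k') {s : ℝ≥0} (hs : s ≤ S)
    {M : ℝ} (hM : ∀ u ≤ s, |z u - z' u| ≤ M) : |k s - k' s| ≤ M := by
  have key : ∀ {z z' k k' : ℝ≥0 → ℝ}, IsReflector S g z k → IsReflector S g z' k' →
      (∀ u ≤ s, |z u - z' u| ≤ M) → k s - k' s ≤ M := by
    intro z z' k k' h h' hM
    rw [sub_le_iff_le_add]
    refine h.le_of_forall hs fun u hu => ?_
    have h1 := h'.le hu hs
    have h2 := (abs_le.1 (hM u hu)).2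
    refine max_le ?_ (add_nonneg ((abs_nonneg _).trans (hM u hu)) (h'.nonneg hs))
    linarith [(le_max_left _ _).trans h1]
  refine abs_le.2 ⟨?_, key h h' hM⟩
  have := key h' h fun u hu => by rw [abs_sub_comm]; exact hM u hu
  linarith

theorem congr (h : IsReflector S g z k) (hz : ∀ s ≤ S, z s = z' s) : IsReflector S g z' k := by
  intro s hs
  have : (fun u => max (z' u - g u) 0) '' Icc 0 s = (fun u => max (z u - g u) 0) '' Icc 0 s :=
    image_congr fun u hu => by rw [hz u (hu.2.trans hs)]
  rw [this]
  exact h s hs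

theorem unique (h : IsReflector S g z k) (h' : IsReflector S g z k') {s : ℝ≥0} (hs : s ≤ S) :
    k s = k' s := (h s hs).unique (h' s hs)

/-- A moving boundary that does not decrease cannot create new pushing: for `w ≥ u`, `z w - g w ≤ (z
w - z u) + (z u - g u)`. So increments of `k` are controlled by those of `z` alone, and `k` is
continuous at the jumps of `g` too. -/
theorem le_add (h : IsReflector S g z k) (hg : MonotoneOn g (Icc 0 S)) {u v : ℝ≥0} (huv : u ≤ v)
    (hv : v ≤ S) {ε : ℝ} (hε : 0 ≤ ε) (hz : ∀ w, u ≤ w → w ≤ v → z w - z u ≤ ε) :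
    k v ≤ k u + ε := by
  refine h.le_of_forall hv fun w hw => ?_
  rcases le_total w u with hwu | hwu
  · linarith [h.le hwu (huv.trans hv)]
  · have h1 := h.le le_rfl (huv.trans hv)
    have h2 := hg ⟨zero_le, huv.trans hv⟩ ⟨zero_le, hw.trans hv⟩ hwu
    refine max_le ?_ (add_nonneg (h.nonneg (huv.trans hv)) hε)
    linarith [(le_max_left _ _).trans h1, hz w hwu hw]

theorem continuousOn (h : IsReflector S g z k) (hg : MonotoneOn g (Icc 0 S))
    (hz : ContinuousOn z (Icc 0 S)) : ContinuousOn k (Icc 0 S) := by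
  have hu := isCompact_Icc.uniformContinuousOn_of_continuous hz
  rw [Metric.uniformContinuousOn_iff] at hu
  refine UniformContinuousOn.continuousOn (Metric.uniformContinuousOn_iff.2 fun ε hε => ?_)
  obtain ⟨δ, hδ, hd⟩ := hu (ε / 2) (by positivity)
  have key : ∀ u v : ℝ≥0, u ≤ v → v ≤ S → dist u v < δ → |k u - k v| < ε := by
    intro u v huv hv hdist
    have h1 := h.monotoneOn ⟨zero_le, huv.trans hv⟩ ⟨zero_le, hv⟩ huv
    have h2 := h.le_add hg huv hv (half_pos hε).le fun w h1 h2 => by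
      have h3 : dist w u < δ := by
        refine lt_of_le_of_lt ?_ hdist
        rw [NNReal.dist_eq, NNReal.dist_eq, abs_sub_comm (u : ℝ)]
        have h1' : (u : ℝ) ≤ w := h1
        have h2' : (w : ℝ) ≤ v := h2
        rw [abs_of_nonneg (by linarith), abs_of_nonneg (by linarith)]
        linarith
      have h4 := hd w ⟨zero_le, h2.trans hv⟩ u ⟨zero_le, huv.trans hv⟩ h3
      rw [Real.dist_eq] at h4
      exact (le_abs_self _).trans h4.le
    rw [abs_sub_comm, abs_of_nonneg (sub_nonneg.2 h1)]
    linarith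
  refine ⟨δ, hδ, fun u hu v hv hdist => ?_⟩
  rw [Real.dist_eq]
  rcases le_total u v with huv | huv
  · exact key u v huv hv.2 hdist
  · rw [abs_sub_comm]
    exact key v u huv hu.2 (by rwa [dist_comm])

theorem exists_of_continuousOn (hg : MonotoneOn g (Icc 0 S)) (hz : ContinuousOn z (Icc 0 S)) :
    ∃ k, IsReflector S g z k := by
  obtain ⟨C, hC⟩ := exists_abs_le_of_continuousOn hz
  refine ⟨fun s => sSup ((fun u => max (z u - g u) 0) '' Icc 0 s), fun s hs => isLUB_csSup
    ⟨_, 0, ⟨le_rfl, zero_le⟩, rfl⟩ ⟨max (C - g 0) 0, ?_⟩⟩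
  rintro _ ⟨u, hu, rfl⟩
  refine max_le_max_right _ ?_
  have := hg ⟨le_rfl, zero_le⟩ ⟨zero_le, hu.2.trans hs⟩ zero_le
  linarith [(abs_le.1 (hC u (hu.2.trans hs))).2]

/-- The extension of the running maximum to a Stieltjes function. -/
theorem exists_stieltjes {k : ℝ≥0 → ℝ} (hm : MonotoneOn k (Icc 0 S))
    (hc : ContinuousOn k (Icc 0 S)) :
    ∃ G : StieltjesFunction ℝ≥0, ∀ s, G s = k (min s S) := by
  refine ⟨⟨fun s => k (min s S), fun s r h => ?_, fun s => ?_⟩, fun s => rfl⟩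
  · exact hm ⟨zero_le, min_le_right _ _⟩ ⟨zero_le, min_le_right _ _⟩ (min_le_min_right _ h)
  · have : Continuous fun s => k (min s S) := hc.comp_continuous (by fun_prop)
      fun s => ⟨zero_le, min_le_right _ _⟩
    exact this.continuousWithinAt

/-- Away from the boundary the running maximum is locally constant. To the left of `s` the boundary
is controlled by left-continuity, to the right by monotonicity. -/
theorem exists_const_nhds (h : IsReflector S g z k) (hg : MonotoneOn g (Icc 0 S))
    (hgl : ∀ u ≤ S, ContinuousWithinAt g (Iic u) u) (hz : ContinuousOn z (Icc 0 S)) {s : ℝ≥0}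
    (hs : s ∈ Ioc 0 S) (hlt : z s - k s < g s) :
    ∃ a < s, ∃ b > s, k a = k (min b S) := by
  have hk := h.continuousOn hg hz
  -- With the gap equal to `4 ε`, near `s` one has `z w - g w < (z s + ε) - (g s - ε) = k s - 2 ε <
  -- k a'`.
  set ε := (g s - z s + k s) / 4 with hε
  have hε0 : 0 < ε := by rw [hε]; linarith
  have hsS : s ∈ Icc 0 S := ⟨zero_le, hs.2⟩
  have e1 : ∀ᶠ a in 𝓝[Iic s] s, g s - ε < g a := (hgl s hs.2).eventually_const_lt (by linarith)
  have e2 : ∀ᶠ a in 𝓝[Iic s] s, k s - ε < k a :=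
    ((hk s hsS).mono fun _ hu => ⟨zero_le, le_trans hu hs.2⟩).eventually_const_lt (by linarith)
  have e3 : ∀ᶠ w in 𝓝[Icc 0 S] s, z w < z s + ε := (hz s hsS).eventually_lt_const (by linarith)
  rw [eventually_nhdsWithin_iff] at e1 e2 e3
  obtain ⟨a, b, ⟨has, hsb⟩, hab⟩ := (mem_nhds_iff_exists_Ioo_subset' ⟨0, hs.1⟩
    (exists_gt s)).1 (e1.and (e2.and e3))
  obtain ⟨a', ha1, ha2⟩ := exists_between has
  obtain ⟨b', hb1, hb2⟩ := exists_between hsb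
  refine ⟨a', ha2, b', hb1, le_antisymm (h.monotoneOn ⟨zero_le, ha2.le.trans hs.2⟩
    ⟨zero_le, min_le_right _ _⟩ (le_min (ha2.trans hb1).le (ha2.le.trans hs.2))) ?_⟩
  refine h.le_of_forall (min_le_right _ _) fun w hw => ?_
  have haS := ha2.le.trans hs.2
  rcases le_total w a' with hwa | hwa
  · exact h.le hwa haS
  · have h1 := (hab ⟨ha1, ha2.trans (hb1.trans hb2)⟩).1 ha2.le
    have h2 := (hab ⟨ha1, ha2.trans (hb1.trans hb2)⟩).2.1 ha2.le
    have hwS := hw.trans (min_le_right _ _)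
    have h3 := (hab ⟨ha1.trans_le hwa, (hw.trans (min_le_left _ _)).trans_lt hb2⟩).2.2
      ⟨zero_le, hwS⟩
    have h4 := hg ⟨zero_le, haS⟩ ⟨zero_le, hwS⟩ hwa
    refine max_le ?_ (h.nonneg haS)
    linarith

/-- Every point of `(0, S]` off the boundary has a neighbourhood that is null for `dk`, and a
locally null set is null. -/
theorem minimal (h : IsReflector S g z k) (hg : MonotoneOn g (Icc 0 S))
    (hgl : ∀ u ≤ S, ContinuousWithinAt g (Iic u) u) (hz : ContinuousOn z (Icc 0 S)) :
    ∃ G : StieltjesFunction ℝ≥0, (∀ s ∈ Icc 0 S, G s = k s) ∧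
      ∫⁻ s in Ioc 0 S, {s | z s - k s < g s}.indicator 1 s ∂G.measure = 0 := by
  obtain ⟨G, hG⟩ := exists_stieltjes h.monotoneOn (h.continuousOn hg hz)
  refine ⟨G, fun s hs => by rw [hG, min_eq_left hs.2], le_zero_iff.1
    ((lintegral_indicator_one_le _).trans ?_)⟩
  rw [Measure.restrict_apply' measurableSet_Ioc]
  refine (measure_null_of_locally_null _ fun s hs => ?_).le
  obtain ⟨a, ha, b, hb, hab⟩ := h.exists_const_nhds hg hgl hz hs.2 hs.1
  refine ⟨Ioc a b, mem_nhdsWithin_of_mem_nhds (Ioc_mem_nhds ha hb), ?_⟩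
  rw [G.measure_Ioc, hG, hG, ← hab, min_eq_left (ha.le.trans hs.2.2), sub_self, ENNReal.ofReal_zero]

/-- Any admissible `k` dominates the running maximum. If it exceeded an upper bound `M` at `s`, let
`r` be the last time before `s` with `k ≤ M`; on `(r, s]` the path is strictly below the boundary,
so `dk` vanishes there and `k s = k r ≤ M`. -/
theorem of_minimal {k : ℝ≥0 → ℝ} (hm : MonotoneOn k (Icc 0 S)) (hc : ContinuousOn k (Icc 0 S))
    (h0 : k 0 = max (z 0 - g 0) 0) (hle : ∀ s ≤ S, z s - k s ≤ g s) (G : StieltjesFunction ℝ≥0)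
    (hG : ∀ s ∈ Icc 0 S, G s = k s)
    (hmin : ∫⁻ s in Ioc 0 S, {s | z s - k s < g s}.indicator 1 s ∂G.measure = 0) :
    IsReflector S g z k := by
  have hub : ∀ s ≤ S, max (z s - g s) 0 ≤ k s := fun s hs => by
    have h1 := hm ⟨le_rfl, zero_le⟩ ⟨zero_le, hs⟩ zero_le
    refine max_le (by linarith [hle s hs]) (le_trans ?_ h1)
    rw [h0]
    exact le_max_right _ _
  refine fun s hs => ⟨?_, fun M hM => ?_⟩
  · rintro _ ⟨u, hu, rfl⟩
    exact (hub u (hu.2.trans hs)).trans (hm ⟨zero_le, hu.2.trans hs⟩ ⟨zero_le, hs⟩ hu.2)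
  by_contra! hlt
  set A := Icc 0 s ∩ k ⁻¹' Iic M with hA
  have hAc : IsClosed A := (hc.mono (Icc_subset_Icc_right hs)).preimage_isClosed_of_isClosed
    isClosed_Icc isClosed_Iic
  have hA0 : (0 : ℝ≥0) ∈ A := ⟨⟨le_rfl, zero_le⟩, by
    rw [mem_preimage, h0]
    exact hM ⟨0, ⟨le_rfl, zero_le⟩, rfl⟩⟩
  have hAb : BddAbove A := ⟨s, fun u hu => hu.1.2⟩
  have hr := hAc.csSup_mem ⟨0, hA0⟩ hAb
  set r := sSup A
  have hrM : k r ≤ M := hr.2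
  have h1 : ∀ u ∈ Ioc r s, z u - k u < g u := by
    intro u hu
    have h2 : M < k u := by
      by_contra! h3
      exact absurd (le_csSup hAb ⟨⟨zero_le, hu.2⟩, h3⟩) (not_le.2 hu.1)
    have h3 := (le_max_left _ _).trans (hM ⟨u, ⟨zero_le, hu.2⟩, rfl⟩)
    linarith
  have h2 : G.measure (Ioc r s) = 0 := by
    refine le_zero_iff.1 (le_trans ?_ hmin.le)
    rw [← inter_eq_left.2 (Ioc_subset_Ioc (zero_le (a := r)) hs),
      ← Measure.restrict_apply' measurableSet_Ioc, ← lintegral_indicator_one measurableSet_Ioc]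
    exact lintegral_mono fun u => indicator_le_indicator_of_subset (fun u hu => h1 u hu)
      (fun _ => zero_le) u
  rw [G.measure_Ioc, hG s ⟨zero_le, hs⟩, hG r ⟨zero_le, hr.1.2.trans hs⟩,
    ENNReal.ofReal_eq_zero] at h2
  linarith

end IsReflector

/-- A countable supremum over dyadic multiples of `s` gives an everywhere defined adapted version;
`ENNReal.ofReal` takes the positive part. -/
theorem ContAdapted.exists_reflector {S : ℝ≥0} {Z : ℝ≥0 → Ω → ℝ} (hZ : ContAdapted F P S Z)
    {g : ℝ≥0 → ℝ} (hg : MonotoneOn g (Icc 0 S))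
    (hgl : ∀ u ≤ S, ContinuousWithinAt g (Iic u) u) :
    ∃ K : ℝ≥0 → Ω → ℝ, ContAdapted F P S K ∧
      ∀ᵐ ω ∂P, IsReflector S g (fun s => Z s ω) (fun s => K s ω) := by
  set K : ℝ≥0 → Ω → ℝ := fun s ω =>
    (⨆ p, ENNReal.ofReal (Z (dyadic p * s) ω - g (dyadic p * s))).toReal with hK
  have hlim : ∀ᵐ ω ∂P, IsReflector S g (fun s => Z s ω) (fun s => K s ω) := by
    filter_upwards [hZ.cont] with ω hω
    obtain ⟨k, hk⟩ := IsReflector.exists_of_continuousOn hg hω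
    intro s hs
    have h1 : K s ω = k s := by
      simp only [hK]
      rw [← iSup_Icc_eq_dyadic (g := fun u => ENNReal.ofReal (Z u ω - g u)) fun u hu =>
        ENNReal.continuous_ofReal.continuousAt.comp_continuousWithinAt
          ((continuousWithinAt_Iic_of_continuousOn hω u (hu.trans hs)).sub (hgl u (hu.trans hs)))]
      have hle : ⨆ u ∈ Icc 0 s, ENNReal.ofReal (Z u ω - g u) ≤ ENNReal.ofReal (k s) :=
        iSup₂_le fun u hu => ENNReal.ofReal_le_ofReal
          ((le_max_left _ _).trans (hk.le hu.2 hs))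
      refine le_antisymm (ENNReal.toReal_le_of_le_ofReal (hk.nonneg hs) hle)
        (hk.le_of_forall hs fun u hu => max_le ?_ ENNReal.toReal_nonneg)
      rw [← ENNReal.ofReal_le_iff_le_toReal (ne_top_of_le_ne_top ENNReal.ofReal_ne_top hle)]
      exact le_iSup₂_of_le u ⟨zero_le, hu⟩ le_rfl
    beta_reduce
    rw [h1]
    exact hk s hs
  refine ⟨K, ⟨fun s hs => ?_, ?_⟩, hlim⟩
  · refine Measurable.ennreal_toReal (Measurable.iSup fun p => ENNReal.measurable_ofReal.comp ?_)
    exact ((hZ.adapted _ ((dyadic_mul_le p s).trans hs)).mono (F.mono (dyadic_mul_le p s))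
      le_rfl).sub measurable_const
  · filter_upwards [hlim, hZ.cont] with ω h1 h2 using h1.continuousOn hg h2

/-! ### A stopped Gronwall estimate -/

theorem lintegral_exp_le {C : ℝ≥0} (s : ℝ≥0) :
    C * ∫⁻ u in Icc (0 : ℝ) s, ENNReal.ofReal (Real.exp (8 * C * u)) ≤
      ENNReal.ofReal (Real.exp (8 * C * s)) / 8 := by
  have h1 : ∫⁻ u in Icc (0 : ℝ) s, ENNReal.ofReal (Real.exp (8 * C * u)) =
      ENNReal.ofReal (∫ u in (0 : ℝ)..s, Real.exp (8 * C * u)) := by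
    rw [intervalIntegral.integral_of_le s.coe_nonneg, ← restrict_Ioc_eq_restrict_Icc,
      ofReal_integral_eq_lintegral_ofReal]
    · exact (Continuous.integrableOn_Icc (by fun_prop)).mono_set Ioc_subset_Icc_self
    · exact ae_of_all _ fun u => (Real.exp_pos _).le
  have h2 : (C : ℝ) * ∫ u in (0 : ℝ)..s, Real.exp (8 * C * u) ≤ Real.exp (8 * C * s) / 8 := by
    have h3 : ∀ u ∈ uIcc (0 : ℝ) s, HasDerivAt (fun u => Real.exp (8 * C * u) / 8)
        (C * Real.exp (8 * C * u)) u := by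
      intro u _
      have h4 := ((((hasDerivAt_id u).const_mul (8 * (C : ℝ))).exp).div_const 8)
      refine h4.congr_deriv ?_
      simp only [id]
      ring
    rw [← intervalIntegral.integral_const_mul, intervalIntegral.integral_eq_sub_of_hasDerivAt h3
      (Continuous.intervalIntegrable (by fun_prop) _ _)]
    have := Real.exp_pos (8 * C * 0)
    linarith
  rw [h1, ← ENNReal.ofReal_coe_nnreal, ← ENNReal.ofReal_mul C.coe_nonneg]
  refine (ENNReal.ofReal_le_ofReal h2).trans (le_of_eq ?_)
  rw [ENNReal.ofReal_div_of_pos (by norm_num)]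
  simp

/-- In the weight `exp (8 C s)` the operator `φ ↦ C ∫ φ` contracts by `1 / 8`. Gronwall needs less
than this; the Picard iteration uses it to beat the squares of the thresholds `(1 / 2) ^ n`. -/
theorem gronwall_step {S : ℝ≥0} {φ : ℝ≥0 → ℝ≥0∞} {C : ℝ≥0} {K : ℝ≥0∞}
    (hK : ∀ s ≤ S, φ s ≤ K * ENNReal.ofReal (Real.exp (8 * C * s))) {s : ℝ≥0} (hs : s ≤ S) :
    C * ∫⁻ u in Icc (0 : ℝ) s, φ u.toNNReal ≤ K / 8 * ENNReal.ofReal (Real.exp (8 * C * s)) := by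
  have h1 : ∫⁻ u in Icc (0 : ℝ) s, φ u.toNNReal ≤
      ∫⁻ u in Icc (0 : ℝ) s, K * ENNReal.ofReal (Real.exp (8 * C * u)) := by
    refine setLIntegral_mono' measurableSet_Icc fun u hu => ?_
    have h2 := hK u.toNNReal ((Real.toNNReal_le_iff_le_coe.2 hu.2).trans hs)
    rwa [Real.coe_toNNReal _ hu.1] at h2
  rw [lintegral_const_mul _ (by fun_prop)] at h1
  calc _ ≤ C * (K * ∫⁻ u in Icc (0 : ℝ) s, ENNReal.ofReal (Real.exp (8 * C * u))) := by gcongr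
    _ = K * (C * ∫⁻ u in Icc (0 : ℝ) s, ENNReal.ofReal (Real.exp (8 * C * u))) := by ring
    _ ≤ K * (ENNReal.ofReal (Real.exp (8 * C * s)) / 8) := by
        gcongr
        exact lintegral_exp_le s
    _ = _ := by simp only [div_eq_mul_inv]; ring

/-- Iterating the contraction from the a priori bound `M` gives `2 α + M 2⁻ⁿ` in the exponential
weight. No measurability of `φ` is needed, but the finiteness of `M` is essential. -/
theorem gronwall {S : ℝ≥0} {φ : ℝ≥0 → ℝ≥0∞} {C : ℝ≥0} {α M : ℝ≥0∞} (hMt : M ≠ ∞)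
    (hM : ∀ s ≤ S, φ s ≤ M) (h : ∀ s ≤ S, φ s ≤ α + C * ∫⁻ u in Icc (0 : ℝ) s, φ u.toNNReal) :
    φ S ≤ 2 * α * ENNReal.ofReal (Real.exp (8 * C * S)) := by
  have hexp : ∀ s : ℝ≥0, 1 ≤ ENNReal.ofReal (Real.exp (8 * C * s)) := fun s => by
    rw [ENNReal.one_le_ofReal]
    exact Real.one_le_exp (by positivity)
  have key : ∀ n : ℕ, ∀ s ≤ S,
      φ s ≤ (2 * α + M * (2⁻¹) ^ n) * ENNReal.ofReal (Real.exp (8 * C * s)) := by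
    intro n
    induction n with
    | zero =>
      intro s hs
      rw [pow_zero, mul_one]
      calc φ s ≤ M * 1 := by rw [mul_one]; exact hM s hs
        _ ≤ _ := mul_le_mul' le_add_self (hexp s)
    | succ n ih =>
      intro s hs
      calc φ s ≤ α * 1 + (2 * α + M * (2⁻¹) ^ n) / 8 * ENNReal.ofReal (Real.exp (8 * C * s)) := by
            rw [mul_one]
            exact (h s hs).trans (add_le_add_right (gronwall_step ih hs) α)
        _ ≤ α * ENNReal.ofReal (Real.exp (8 * C * s)) +
            (2 * α + M * (2⁻¹) ^ n) / 2 * ENNReal.ofReal (Real.exp (8 * C * s)) := by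
            gcongr
            · exact hexp s
            · norm_num
        _ = _ := by
            rw [← add_mul, ENNReal.add_div, ← add_assoc, mul_comm 2 α, mul_div_assoc,
              ENNReal.div_self (by simp) (by simp), pow_succ, mul_div_assoc, div_eq_mul_inv _ 2]
            ring
  have h1 := ENNReal.Tendsto.const_mul (a := M)
    (ENNReal.tendsto_pow_atTop_nhds_zero_of_lt_one (r := 2⁻¹) (by simp)) (Or.inr hMt)
  have h2 := ENNReal.Tendsto.mul_const (b := ENNReal.ofReal (Real.exp (8 * C * S)))
    ((tendsto_const_nhds (x := 2 * α)).add h1) (Or.inr ENNReal.ofReal_ne_top)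
  rw [mul_zero, add_zero] at h2
  exact ge_of_tendsto h2 (Eventually.of_forall fun n => key n S le_rfl)

theorem Caglad.lintegral_sqInt_eq [SFinite P] {S : ℝ≥0} {H : ℝ≥0 → Ω → ℝ} (hH : Caglad F P S H) :
    ∫⁻ ω, sqInt S H ω ∂P = ∫⁻ u in Icc (0 : ℝ) S, ∫⁻ ω, ‖H u.toNNReal ω‖ₑ ^ 2 ∂P := by
  obtain ⟨G, hG, h⟩ := hH.exists_measurable
  have hm : Measurable fun p : Ω × ℝ => ‖G (p.2.toNNReal, p.1)‖ₑ ^ 2 :=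
    (hG.comp ((measurable_real_toNNReal.comp measurable_snd).prodMk
      measurable_fst)).enorm.pow_const 2
  calc ∫⁻ ω, sqInt S H ω ∂P = ∫⁻ ω, (∫⁻ u in Icc (0 : ℝ) S, ‖G (u.toNNReal, ω)‖ₑ ^ 2) ∂P := by
        refine lintegral_congr_ae ?_
        filter_upwards [h] with ω hω using sqInt_congr (H' := fun u ω => G (u, ω)) hω
    _ = ∫⁻ u in Icc (0 : ℝ) S, ∫⁻ ω, ‖G (u.toNNReal, ω)‖ₑ ^ 2 ∂P :=
        lintegral_lintegral_swap hm.aemeasurable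
    _ = _ := by
        refine lintegral_congr_ae ?_
        filter_upwards [ae_restrict_Icc_Ioc (S := S)
          (p := fun u => ∫⁻ ω, ‖G (u, ω)‖ₑ ^ 2 ∂P = ∫⁻ ω, ‖H u ω‖ₑ ^ 2 ∂P) fun u hu => by
            refine lintegral_congr_ae ?_
            filter_upwards [h] with ω hω
            rw [hω u hu]] with u hu using hu

/-- Doob-type bound for the supremum of a semimartingale. -/
theorem lintegral_supNorm_drift_add_le [IsProbabilityMeasure P] (hW : IsFBrownian F P W) {S : ℝ≥0}
    {β H B I : ℝ≥0 → Ω → ℝ} (hβ : Caglad F P S β) (hH : Caglad F P S H)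
    (hB : ∀ᵐ ω ∂P, ∀ s ≤ S, B s ω = ∫ u in (0 : ℝ)..s, β u.toNNReal ω)
    (hI : IsItoIntegral F P W S H I) :
    ∫⁻ ω, (supNorm S B ω + supNorm S I ω) ^ 2 ∂P ≤
      2 * (S * ∫⁻ ω, sqInt S β ω ∂P + 4 * ∫⁻ ω, sqInt S H ω ∂P) := by
  have h1 : ∀ᵐ ω ∂P, supNorm S B ω ^ 2 ≤ S * sqInt S β ω := by
    filter_upwards [hB, hβ.ae_pathMeas] with ω h1 hm
    have h2 : supNorm S B ω ≤ (S * sqInt S β ω) ^ (1 / 2 : ℝ) := by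
      refine supNorm_le fun s hs => ?_
      have h3 := (hm.mono hs).sq_integral_le.trans
        (mul_le_mul' (ENNReal.coe_le_coe.2 hs) (sqInt_mono hs β ω))
      rw [← h1 s hs] at h3
      have h4 := ENNReal.rpow_le_rpow h3 (show (0 : ℝ) ≤ 1 / 2 by norm_num)
      rwa [← ENNReal.rpow_natCast, ← ENNReal.rpow_mul, Nat.cast_ofNat, mul_one_div_cancel
        (by norm_num), ENNReal.rpow_one] at h4
    refine (pow_le_pow_left₀ zero_le h2 2).trans (le_of_eq ?_)
    rw [← ENNReal.rpow_natCast, ← ENNReal.rpow_mul, Nat.cast_ofNat, one_div_mul_cancel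
        (by norm_num), ENNReal.rpow_one]
  calc ∫⁻ ω, (supNorm S B ω + supNorm S I ω) ^ 2 ∂P
      ≤ ∫⁻ ω, 2 * (S * sqInt S β ω + supNorm S I ω ^ 2) ∂P := by
        refine lintegral_mono_ae ?_
        filter_upwards [h1] with ω hω
        refine (ennreal_add_sq_le _ _).trans ?_
        gcongr
    _ = 2 * (S * ∫⁻ ω, sqInt S β ω ∂P + ∫⁻ ω, supNorm S I ω ^ 2 ∂P) := by
        rw [lintegral_const_mul' _ _ (by simp),
          lintegral_add_left' (hβ.aemeasurable_sqInt.const_mul _), lintegral_const_mul' _ _ (by simp)]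
    _ ≤ _ := by
        gcongr
        exact hI.lintegral_supNorm_sq_le hW hH

theorem sqInt_le_of_abs_le {S : ℝ≥0} {β D : ℝ≥0 → Ω → ℝ} {ω : Ω} {L a : ℝ≥0}
    (h : ∀ u ≤ S, |β u ω| ≤ L * (a + |D u ω|)) :
    sqInt S β ω ≤ 2 * L ^ 2 * (S * a ^ 2 + sqInt S D ω) := by
  have h1 : sqInt S β ω ≤ ∫⁻ u in Icc (0 : ℝ) S,
      2 * L ^ 2 * ((a : ℝ≥0∞) ^ 2 + ‖D u.toNNReal ω‖ₑ ^ 2) := by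
    refine lintegral_mono_ae ?_
    filter_upwards [ae_restrict_Icc_Ioc (S := S) (p := fun u => |β u ω| ≤ L * (a + |D u ω|))
      fun u hu => h u hu.2] with u hu
    have h2 : ‖β u.toNNReal ω‖ₑ ≤ L * (a + ‖D u.toNNReal ω‖ₑ) := by
      rw [Real.enorm_eq_ofReal_abs, Real.enorm_eq_ofReal_abs]
      refine (ENNReal.ofReal_le_ofReal hu).trans (le_of_eq ?_)
      rw [ENNReal.ofReal_mul L.coe_nonneg, ENNReal.ofReal_add a.coe_nonneg (abs_nonneg _),
        ENNReal.ofReal_coe_nnreal, ENNReal.ofReal_coe_nnreal]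
    calc _ ≤ (L * (a + ‖D u.toNNReal ω‖ₑ) : ℝ≥0∞) ^ 2 := pow_le_pow_left₀ zero_le h2 2
      _ = L ^ 2 * (a + ‖D u.toNNReal ω‖ₑ : ℝ≥0∞) ^ 2 := by ring
      _ ≤ L ^ 2 * (2 * ((a : ℝ≥0∞) ^ 2 + ‖D u.toNNReal ω‖ₑ ^ 2)) := by
          gcongr
          exact ennreal_add_sq_le _ _
      _ = _ := by ring
  refine h1.trans (le_of_eq ?_)
  rw [lintegral_const_mul' _ _ (ENNReal.mul_ne_top (by simp) (by simp)),
    lintegral_add_left' aemeasurable_const, lintegral_const, Measure.restrict_apply_univ,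
    Real.volume_Icc, sub_zero, ENNReal.ofReal_coe_nnreal, mul_comm ((a : ℝ≥0∞) ^ 2)]
  rfl

/-- The process `J` marks the time before an exit. While `J = 1`, `B` and `I` coincide with the
integrals of `β J` and `H J`, whose coefficients are controlled by `D J` at all times; so Gronwall
closes for `D J`, under integrability of `D J` only. -/
theorem stopped_gronwall [IsProbabilityMeasure P] (hW : IsFBrownian F P W) {S : ℝ≥0}
    {D β H B I J : ℝ≥0 → Ω → ℝ} {c a L : ℝ≥0} (hD : Caglad F P S D) (hβ : Caglad F P S β)
    (hH : Caglad F P S H) (hB : ∀ᵐ ω ∂P, ∀ s ≤ S, B s ω = ∫ u in (0 : ℝ)..s, β u.toNNReal ω)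
    (hI : IsItoIntegral F P W S H I) (hJ : Caglad F P S J)
    (hJ01 : ∀ᵐ ω ∂P, ∀ s ≤ S, J s ω = 0 ∨ J s ω = 1)
    (hJanti : ∀ᵐ ω ∂P, ∀ u s, u ≤ s → s ≤ S → J s ω = 1 → J u ω = 1)
    (hle : ∀ᵐ ω ∂P, ∀ s ≤ S,
      ‖D s ω‖ₑ ≤ c + 2 * supNorm s (fun u ω => B u ω + I u ω) ω)
    (hβD : ∀ᵐ ω ∂P, ∀ s ≤ S, J s ω = 1 → |β s ω| ≤ L * (a + |D s ω|))
    (hHD : ∀ᵐ ω ∂P, ∀ s ≤ S, J s ω = 1 → |H s ω| ≤ L * (a + |D s ω|))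
    (hfin : ∫⁻ ω, supNorm S (fun s ω => D s ω * J s ω) ω ^ 2 ∂P ≠ ∞) :
    ∫⁻ ω, supNorm S (fun s ω => D s ω * J s ω) ω ^ 2 ∂P ≤
      2 * (2 * c ^ 2 + (32 * (S + 4) * L ^ 2 : ℝ≥0) * (S * a ^ 2)) *
        ENNReal.ofReal (Real.exp (8 * (32 * (S + 4) * L ^ 2 : ℝ≥0) * S)) := by
  set E : ℝ≥0 → Ω → ℝ := fun s ω => D s ω * J s ω with hE
  -- The factor `8` comes from `(c + 2 (b + i))² ≤ 2 c² + 8 (b + i)²`, a factor `2` together with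
  -- `S` and `4` from the semimartingale bound, and `2 L²` from the growth of the coefficients.
  set K : ℝ≥0 := 32 * (S + 4) * L ^ 2 with hK
  have hEc : Caglad F P S E := hD.mul hJ
  have hβJ := hβ.mul hJ
  have hHJ := hH.mul hJ
  obtain ⟨B', -, hB'⟩ := hβJ.exists_drift
  obtain ⟨I', -, -, -, hI', -⟩ := hHJ.exists_isItoIntegral hW
  have hbd : ∀ {γ : ℝ≥0 → Ω → ℝ}, (∀ᵐ ω ∂P, ∀ s ≤ S, J s ω = 1 → |γ s ω| ≤ L * (a + |D s ω|)) →
      ∀ᵐ ω ∂P, ∀ s ≤ S, |γ s ω * J s ω| ≤ L * (a + |E s ω|) := by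
    intro γ hγ
    filter_upwards [hγ, hJ01] with ω h1 h2 s hs
    rcases h2 s hs with h0 | h0
    · rw [h0, mul_zero, abs_zero]
      positivity
    · simp only [hE, h0, mul_one]
      exact h1 s hs h0
  refine gronwall (φ := fun s => ∫⁻ ω, supNorm s E ω ^ 2 ∂P) hfin
    (fun s hs => lintegral_mono fun ω => pow_le_pow_left₀ zero_le (supNorm_mono hs E ω) 2)
    fun s hs => ?_
  have hpt : ∀ᵐ ω ∂P, supNorm s E ω ≤ c + 2 * (supNorm s B' ω + supNorm s I' ω) := by
    -- Locality is applied on the countably many intervals `[0, dyadic p * s]`, so that a single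
    -- null set serves for the random time at which `J` drops to `0`.
    have hloc : ∀ᵐ ω ∂P, ∀ p : ℕ × ℕ, (∀ u ∈ Ioc 0 (dyadic p * s), H u ω = H u ω * J u ω) →
        ∀ r ≤ dyadic p * s, I r ω = I' r ω := by
      refine ae_all_iff.2 fun p => ?_
      have h1 := (dyadic_mul_le p s).trans hs
      exact (hI.mono h1).ae_eq_of_eq hW (hI'.mono h1) (hH.mono h1).ae_pathMeas
    filter_upwards [hloc, hEc.left_cont, hJ01, hJanti, hB, hB', hle] with ω h1 h2 h3 h4 h5 h6 h7
    rw [supNorm_eq_dyadicSup fun u hu => h2 u (hu.trans hs)]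
    refine iSup_le fun p => ?_
    have hps := (dyadic_mul_le p s).trans hs
    rcases h3 _ hps with h0 | h0
    · simp [hE, h0]
    · simp only [hE, h0, mul_one]
      refine (h7 _ hps).trans ?_
      gcongr
      refine supNorm_le fun u hu => ?_
      have hJu : ∀ r ≤ dyadic p * s, J r ω = 1 := fun r hr => h4 r _ hr hps h0
      have hI1 := h1 p (fun r hr => by rw [hJu r hr.2, mul_one]) u hu
      have hB1 : B u ω = B' u ω := by
        rw [h5 u (hu.trans hps), h6 u (hu.trans hps)]
        refine intervalIntegral.integral_congr fun r hr => ?_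
        rw [uIcc_of_le u.coe_nonneg] at hr
        rw [hJu _ ((Real.toNNReal_le_iff_le_coe.2 hr.2).trans hu), mul_one]
      rw [hI1, hB1]
      exact (enorm_add_le _ _).trans (add_le_add (le_supNorm (hu.trans (dyadic_mul_le p s)) _ _)
        (le_supNorm (hu.trans (dyadic_mul_le p s)) _ _))
  have hEs := hEc.mono hs
  have hsq : ∀ {γ : ℝ≥0 → Ω → ℝ}, (∀ᵐ ω ∂P, ∀ s ≤ S, J s ω = 1 → |γ s ω| ≤ L * (a + |D s ω|)) →
      ∫⁻ ω, sqInt s (fun s ω => γ s ω * J s ω) ω ∂P ≤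
        2 * L ^ 2 * (S * a ^ 2 + ∫⁻ ω, sqInt s E ω ∂P) := by
    intro γ hγ
    calc _ ≤ ∫⁻ ω, 2 * L ^ 2 * (S * a ^ 2 + sqInt s E ω) ∂P := by
          refine lintegral_mono_ae ?_
          filter_upwards [hbd hγ] with ω h1
          refine (sqInt_le_of_abs_le fun u hu => h1 u (hu.trans hs)).trans ?_
          gcongr
      _ = _ := by
          rw [lintegral_const_mul' _ _ (ENNReal.mul_ne_top (by simp) (by simp)),
            lintegral_add_left' aemeasurable_const, lintegral_const, measure_univ, mul_one]
  have hφ : ∫⁻ ω, sqInt s E ω ∂P ≤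
      ∫⁻ u in Icc (0 : ℝ) s, ∫⁻ ω, supNorm u.toNNReal E ω ^ 2 ∂P := by
    rw [hEs.lintegral_sqInt_eq]
    exact lintegral_mono fun u => lintegral_mono fun ω =>
      pow_le_pow_left₀ zero_le (le_supNorm le_rfl E ω) 2
  have hBI := lintegral_supNorm_drift_add_le hW (hβJ.mono hs) (hHJ.mono hs)
    (hB'.mono fun ω h u hu => h u (hu.trans hs)) (hI'.mono hs)
  calc ∫⁻ ω, supNorm s E ω ^ 2 ∂P
      ≤ ∫⁻ ω, (2 * c ^ 2 + 8 * (supNorm s B' ω + supNorm s I' ω) ^ 2 : ℝ≥0∞) ∂P := by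
        refine lintegral_mono_ae ?_
        filter_upwards [hpt] with ω hω
        refine (pow_le_pow_left₀ zero_le hω 2).trans ((ennreal_add_sq_le _ _).trans (le_of_eq ?_))
        ring
    _ = 2 * c ^ 2 + 8 * ∫⁻ ω, (supNorm s B' ω + supNorm s I' ω) ^ 2 ∂P := by
        rw [lintegral_add_left' aemeasurable_const, lintegral_const, measure_univ, mul_one,
          lintegral_const_mul' _ _ (by simp)]
    _ ≤ 2 * c ^ 2 + 8 * (2 * (S * (2 * L ^ 2 * (S * a ^ 2 + ∫⁻ ω, sqInt s E ω ∂P)) +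
          4 * (2 * L ^ 2 * (S * a ^ 2 + ∫⁻ ω, sqInt s E ω ∂P)))) := by
        gcongr
        refine hBI.trans ?_
        gcongr
        · exact hsq hβD
        · exact hsq hHD
    _ = 2 * c ^ 2 + K * (S * a ^ 2) + K * ∫⁻ ω, sqInt s E ω ∂P := by
        rw [hK]
        push_cast
        ring
    _ ≤ _ := by gcongr

/-! ### Reflected processes with given coefficients -/

/-- `X = Z - K` where `Z = x + ∫ β ds + I`, `I = ∫ H dW`, and `K` is the running maximum of
`(Z - g)⁺`. -/
structure ReflStep (F : Filtration ℝ≥0 mΩ) (P : Measure Ω) (W : ℝ≥0 → Ω → ℝ) (S : ℝ≥0)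
    (g : ℝ≥0 → ℝ) (x : ℝ) (β H X I K : ℝ≥0 → Ω → ℝ) : Prop where
  ito : IsItoIntegral F P W S H I
  refl : ∀ᵐ ω ∂P, IsReflector S g
    (fun s => x + (∫ u in (0 : ℝ)..s, β u.toNNReal ω) + I s ω) (fun s => K s ω)
  eq : ∀ᵐ ω ∂P, ∀ s ≤ S, X s ω = x + (∫ u in (0 : ℝ)..s, β u.toNNReal ω) + I s ω - K s ω

theorem IsReflector.enorm_sub_le {S : ℝ≥0} {g z k z' k' : ℝ≥0 → ℝ} (h : IsReflector S g z k)
    (h' : IsReflector S g z' k') {s : ℝ≥0} (hs : s ≤ S) :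
    ‖(z s - k s) - (z' s - k' s)‖ₑ ≤ 2 * ⨆ u ∈ Icc 0 s, ‖z u - z' u‖ₑ := by
  set M := ⨆ u ∈ Icc 0 s, ‖z u - z' u‖ₑ with hM
  rcases eq_or_ne M ∞ with h0 | h0
  · rw [h0]
    simp
  have h1 : ∀ u ≤ s, |z u - z' u| ≤ M.toReal := by
    intro u hu
    rw [← ENNReal.ofReal_le_iff_le_toReal h0, ← Real.enorm_eq_ofReal_abs, hM]
    exact le_iSup₂_of_le u ⟨zero_le, hu⟩ le_rfl
  have h2 := h.abs_sub_le h' hs h1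
  have h3 : |(z s - k s) - (z' s - k' s)| ≤ 2 * M.toReal := by
    rw [show (z s - k s) - (z' s - k' s) = (z s - z' s) - (k s - k' s) by ring]
    exact (abs_sub _ _).trans (by linarith [h1 s le_rfl])
  rw [Real.enorm_eq_ofReal_abs]
  refine (ENNReal.ofReal_le_ofReal h3).trans (le_of_eq ?_)
  rw [ENNReal.ofReal_mul zero_le_two, ENNReal.ofReal_toReal h0, ENNReal.ofReal_ofNat]

theorem isReflector_const {S : ℝ≥0} {g : ℝ≥0 → ℝ} (hg : MonotoneOn g (Icc 0 S)) (x : ℝ) :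
    IsReflector S g (fun _ => x) (fun _ => max (x - g 0) 0) := by
  refine fun s hs => ⟨?_, fun M hM => hM ⟨0, ⟨le_rfl, zero_le⟩, rfl⟩⟩
  rintro _ ⟨u, hu, rfl⟩
  have := hg ⟨le_rfl, zero_le⟩ ⟨zero_le, hu.2.trans hs⟩ zero_le
  exact max_le_max_right _ (by linarith)

theorem isItoIntegral_zero (S : ℝ≥0) :
    IsItoIntegral F P W S (fun (_ : ℝ≥0) (_ : Ω) => (0 : ℝ)) (fun _ _ => 0) := by
  have h := (SimpleIntegrand.mk (F := F) 0 (fun _ => 0) monotone_const (fun _ _ => 0)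
    (fun _ => measurable_const) fun _ => ⟨0, by simp⟩).isItoIntegral (P := P) (W := W) S
  exact h.congr (ae_of_all _ fun ω u _ => by simp [SimpleIntegrand.val])
    (ae_of_all _ fun ω s _ => by simp [SimpleIntegrand.integral])

/-- The reflected process without coefficients, constant after its initial jump. Comparing with it
turns the difference estimates into moment bounds. -/
theorem ReflStep.const {S : ℝ≥0} {g : ℝ≥0 → ℝ} (hg : MonotoneOn g (Icc 0 S)) (x : ℝ) :
    ReflStep F P W S g x (fun _ _ => 0) (fun _ _ => 0) (fun _ _ => min x (g 0)) (fun _ _ => 0)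
      (fun _ _ => max (x - g 0) 0) where
  ito := isItoIntegral_zero S
  refl := ae_of_all _ fun ω => by simpa using isReflector_const hg x
  eq := ae_of_all _ fun ω s _ => by
    rcases le_total x (g 0) with h | h
    · simp [h]
    · simp [h]

/-- The processes `X`, `Y` agree on `[0, S]` as soon as they agree at fixed times. -/
theorem ae_eq_of_forall_ae_eq {S : ℝ≥0} {X Y : ℝ≥0 → Ω → ℝ} (hX : Caglad F P S X)
    (hY : Caglad F P S Y) (h : ∀ s ≤ S, X s =ᵐ[P] Y s) : ∀ᵐ ω ∂P, ∀ s ≤ S, X s ω = Y s ω := by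
  have h1 : ∀ᵐ ω ∂P, ∀ p, X (dyadic p * S) ω = Y (dyadic p * S) ω :=
    ae_all_iff.2 fun p => h _ (dyadic_mul_le p S)
  filter_upwards [h1, (hX.sub hY).left_cont] with ω h1 h2 s hs
  have h3 : supNorm S (fun s ω => X s ω - Y s ω) ω = 0 := by
    rw [supNorm_eq_dyadicSup h2]
    simp [dyadicSup, h1]
  have h4 := le_supNorm hs (fun s ω => X s ω - Y s ω) ω
  rw [h3] at h4
  simpa [sub_eq_zero] using h4

theorem ae_eq_zero_of_lintegral_supNorm {S : ℝ≥0} {X : ℝ≥0 → Ω → ℝ} (hX : Caglad F P S X)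
    (h : ∫⁻ ω, supNorm S X ω ^ 2 ∂P = 0) :
    ∀ᵐ ω ∂P, ∀ s ≤ S, X s ω = 0 := by
  rw [lintegral_eq_zero_iff' (hX.aemeasurable_supNorm.pow_const 2)] at h
  filter_upwards [h] with ω hω s hs
  have h1 := le_supNorm hs X ω
  have h2 : supNorm S X ω = 0 := by simpa using hω
  rw [h2] at h1
  simpa using h1

namespace ReflStep

variable {S : ℝ≥0} {g : ℝ≥0 → ℝ} {x : ℝ} {β H X I K β' H' X' I' K' : ℝ≥0 → Ω → ℝ}

theorem enorm_sub_le (h : ReflStep F P W S g x β H X I K)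
    (h' : ReflStep F P W S g x β' H' X' I' K') (hβ : Caglad F P S β) (hβ' : Caglad F P S β')
    {B : ℝ≥0 → Ω → ℝ} (hB : ∀ᵐ ω ∂P, ∀ s ≤ S,
      B s ω = ∫ u in (0 : ℝ)..s, (β u.toNNReal ω - β' u.toNNReal ω)) :
    ∀ᵐ ω ∂P, ∀ s ≤ S, ‖X s ω - X' s ω‖ₑ ≤
      2 * supNorm s (fun u ω => B u ω + (I u ω - I' u ω)) ω := by
  filter_upwards [h.refl, h'.refl, h.eq, h'.eq, hB, hβ.ae_pathMeas, hβ'.ae_pathMeas, hβ.bdd,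
    hβ'.bdd] with ω h1 h2 h3 h4 h5 m1 m2 ⟨C, hC⟩ ⟨C', hC'⟩ s hs
  rw [h3 s hs, h4 s hs]
  refine (h1.enorm_sub_le h2 hs).trans (le_of_eq ?_)
  unfold supNorm
  congr 1
  refine iSup_congr fun u => iSup_congr fun hu => ?_
  beta_reduce
  rw [h5 u (hu.2.trans hs), intervalIntegral.integral_sub
    (m1.intervalIntegrable hC (hu.2.trans hs)) (m2.intervalIntegrable hC' (hu.2.trans hs))]
  congr 1
  ring

theorem mono (h : ReflStep F P W S g x β H X I K) {s : ℝ≥0} (hs : s ≤ S) :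
    ReflStep F P W s g x β H X I K where
  ito := h.ito.mono hs
  refl := h.refl.mono fun _ h u hu => h u (hu.trans hs)
  eq := h.eq.mono fun _ h u hu => h u (hu.trans hs)

theorem lintegral_sub_le [IsProbabilityMeasure P] (hW : IsFBrownian F P W)
    (h : ReflStep F P W S g x β H X I K) (h' : ReflStep F P W S g x β' H' X' I' K')
    (hβ : Caglad F P S β) (hβ' : Caglad F P S β') (hH : Caglad F P S H) (hH' : Caglad F P S H') :
    ∫⁻ ω, supNorm S (fun s ω => X s ω - X' s ω) ω ^ 2 ∂P ≤
      8 * (S * ∫⁻ ω, sqInt S (fun s ω => β s ω - β' s ω) ω ∂P +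
        4 * ∫⁻ ω, sqInt S (fun s ω => H s ω - H' s ω) ω ∂P) := by
  obtain ⟨B, -, hB⟩ := (hβ.sub hβ').exists_drift
  have h1 := lintegral_supNorm_drift_add_le hW (hβ.sub hβ') (hH.sub hH') hB
    (h.ito.sub h'.ito hH.ae_pathMeas)
  calc _ ≤ ∫⁻ ω, 4 * (supNorm S B ω + supNorm S (fun s ω => I s ω - I' s ω) ω) ^ 2 ∂P := by
        refine lintegral_mono_ae ?_
        filter_upwards [h.enorm_sub_le h' hβ hβ' hB] with ω hω
        have h2 : supNorm S (fun s ω => X s ω - X' s ω) ω ≤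
            2 * (supNorm S B ω + supNorm S (fun s ω => I s ω - I' s ω) ω) := by
          refine supNorm_le fun s hs => (hω s hs).trans ?_
          gcongr
          exact supNorm_le fun u hu => (enorm_add_le _ _).trans
            (add_le_add (le_supNorm (hu.trans hs) _ _)
              (le_supNorm (hu.trans hs) (fun s ω => I s ω - I' s ω) _))
        refine (pow_le_pow_left₀ zero_le h2 2).trans (le_of_eq ?_)
        ring
    _ = 4 * ∫⁻ ω, (supNorm S B ω + supNorm S (fun s ω => I s ω - I' s ω) ω) ^ 2 ∂P :=
        lintegral_const_mul' _ _ (by simp)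
    _ ≤ 4 * _ := mul_le_mul_right h1 _
    _ = _ := by ring

/-- Two reflected processes coincide as long as `J = 1`, if their coefficients are Lipschitz there. -/
theorem ae_eq_of_lipschitz [IsProbabilityMeasure P] (hW : IsFBrownian F P W)
    (h : ReflStep F P W S g x β H X I K) (h' : ReflStep F P W S g x β' H' X' I' K')
    (hβ : Caglad F P S β) (hβ' : Caglad F P S β') (hH : Caglad F P S H) (hH' : Caglad F P S H')
    (hX : Caglad F P S X) (hX' : Caglad F P S X') {J : ℝ≥0 → Ω → ℝ} (hJ : Caglad F P S J)
    (hJ01 : ∀ᵐ ω ∂P, ∀ s ≤ S, J s ω = 0 ∨ J s ω = 1)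
    (hJanti : ∀ᵐ ω ∂P, ∀ u s, u ≤ s → s ≤ S → J s ω = 1 → J u ω = 1) {L : ℝ≥0}
    (hβL : ∀ᵐ ω ∂P, ∀ s ≤ S, J s ω = 1 → |β s ω - β' s ω| ≤ L * |X s ω - X' s ω|)
    (hHL : ∀ᵐ ω ∂P, ∀ s ≤ S, J s ω = 1 → |H s ω - H' s ω| ≤ L * |X s ω - X' s ω|)
    (hfin : ∫⁻ ω, supNorm S (fun s ω => (X s ω - X' s ω) * J s ω) ω ^ 2 ∂P ≠ ∞) :
    ∀ᵐ ω ∂P, ∀ s ≤ S, J s ω = 1 → X s ω = X' s ω := by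
  obtain ⟨B, -, hB⟩ := (hβ.sub hβ').exists_drift
  have h1 := stopped_gronwall hW (c := 0) (a := 0) (L := L) (hX.sub hX') (hβ.sub hβ')
    (hH.sub hH') hB (h.ito.sub h'.ito hH.ae_pathMeas) hJ hJ01 hJanti
    (by simpa using h.enorm_sub_le h' hβ hβ' hB) (by simpa using hβL) (by simpa using hHL) hfin
  simp only [ENNReal.coe_zero, ne_eq, OfNat.ofNat_ne_zero, not_false_eq_true, zero_pow, mul_zero,
    add_zero, zero_mul, nonpos_iff_eq_zero] at h1
  filter_upwards [ae_eq_zero_of_lintegral_supNorm (X := fun s ω => (X s ω - X' s ω) * J s ω)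
    ((hX.sub hX').mul hJ) h1] with ω hω s hs hJs
  have := hω s hs
  rw [hJs, mul_one] at this
  linarith

/-- Second moments of a reflected process whose coefficients have linear growth. -/
theorem lintegral_supNorm_sq_le [IsProbabilityMeasure P] (hW : IsFBrownian F P W)
    (hg : MonotoneOn g (Icc 0 S)) (h : ReflStep F P W S g x β H X I K) (hβ : Caglad F P S β)
    (hH : Caglad F P S H) (hX : Caglad F P S X) {L : ℝ≥0}
    (hβL : ∀ᵐ ω ∂P, ∀ s ≤ S, |β s ω| ≤ L * (1 + |X s ω|))
    (hHL : ∀ᵐ ω ∂P, ∀ s ≤ S, |H s ω| ≤ L * (1 + |X s ω|))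
    (hfin : ∫⁻ ω, supNorm S X ω ^ 2 ∂P ≠ ∞) :
    ∫⁻ ω, supNorm S X ω ^ 2 ∂P ≤
      2 * (2 * ‖min x (g 0)‖₊ ^ 2 + (32 * (S + 4) * L ^ 2 : ℝ≥0) * S) *
        ENNReal.ofReal (Real.exp (8 * (32 * (S + 4) * L ^ 2 : ℝ≥0) * S)) := by
  obtain ⟨B, -, hB⟩ := hβ.exists_drift
  have h0 := h.enorm_sub_le (ReflStep.const hg x) hβ Caglad.zero (B := B) (by simpa using hB)
  have h1 := stopped_gronwall hW (c := ‖min x (g 0)‖₊) (a := 1) (L := L) (J := fun _ _ => 1) hX hβ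
    hH hB h.ito (ContAdapted.const S 1).caglad (ae_of_all _ fun _ _ _ => Or.inr rfl)
    (ae_of_all _ fun _ _ _ _ _ _ => rfl) (by
      filter_upwards [h0] with ω hω s hs
      calc ‖X s ω‖ₑ = ‖min x (g 0) + (X s ω - min x (g 0))‖ₑ := by congr 1; ring
        _ ≤ ‖min x (g 0)‖ₑ + ‖X s ω - min x (g 0)‖ₑ := enorm_add_le _ _
        _ ≤ _ := by
          refine add_le_add (le_of_eq rfl) ?_
          simpa using hω s hs)
    (by simpa using hβL) (by simpa using hHL) (by simpa using hfin)
  simpa using h1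

end ReflStep

/-! ### Indicators of the time before a process leaves a ball -/

/-- The indicator of the event that `|A| ≤ n` on `[0, s]`. -/
noncomputable def levelInd (A : ℝ≥0 → Ω → ℝ) (n : ℝ≥0∞) (s : ℝ≥0) (ω : Ω) : ℝ :=
  if dyadicSup A s ω ≤ n then 1 else 0

theorem levelInd_eq_zero_or_one (A : ℝ≥0 → Ω → ℝ) (n : ℝ≥0∞) (s : ℝ≥0) (ω : Ω) :
    levelInd A n s ω = 0 ∨ levelInd A n s ω = 1 := by
  unfold levelInd
  split_ifs <;> simp

theorem Caglad.levelInd_eq_one_iff {S : ℝ≥0} {A : ℝ≥0 → Ω → ℝ} (hA : Caglad F P S A) (n : ℝ≥0∞) :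
    ∀ᵐ ω ∂P, ∀ s ≤ S, levelInd A n s ω = 1 ↔ supNorm s A ω ≤ n := by
  filter_upwards [hA.left_cont] with ω hω s hs
  rw [supNorm_eq_dyadicSup fun u hu => hω u (hu.trans hs), levelInd]
  split_ifs with h <;> simp [h]

theorem Caglad.levelInd_anti {S : ℝ≥0} {A : ℝ≥0 → Ω → ℝ} (hA : Caglad F P S A) (n : ℝ≥0∞) :
    ∀ᵐ ω ∂P, ∀ u s, u ≤ s → s ≤ S → levelInd A n s ω = 1 → levelInd A n u ω = 1 := by
  filter_upwards [hA.levelInd_eq_one_iff n] with ω hω u s hus hs h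
  rw [hω _ (hus.trans hs)]
  rw [hω _ hs] at h
  exact (supNorm_mono hus A ω).trans h

/-- If the running supremum at `s` exceeds `n`, then by left-continuity of `A` it already does
slightly before `s`. The non-strict inequality in the definition is what makes the indicator
left-continuous. -/
theorem Caglad.levelInd {S : ℝ≥0} {A : ℝ≥0 → Ω → ℝ} (hA : Caglad F P S A) (n : ℝ≥0∞) :
    Caglad F P S (levelInd A n) where
  adapted s hs := Measurable.ite
    ((measurable_dyadicSup fun u hu => hA.adapted u (hu.trans hs)) measurableSet_Iic)
    measurable_const measurable_const
  left_cont := by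
    filter_upwards [hA.levelInd_eq_one_iff n, hA.levelInd_anti n, hA.left_cont]
      with ω h1 h2 h3 s hs
    rcases levelInd_eq_zero_or_one A n s ω with h0 | h0
    · have h4 : n < supNorm s A ω := by
        by_contra! h4
        rw [(h1 s hs).2 h4] at h0
        exact one_ne_zero h0
      obtain ⟨r, hr'⟩ := lt_iSup_iff.1 h4
      obtain ⟨hrs, hr⟩ := lt_iSup_iff.1 hr'
      have h5 : ∀ᶠ u in 𝓝[Iic s] s, n < supNorm u A ω := by
        rcases eq_or_lt_of_le hrs.2 with rfl | hlt
        · filter_upwards [Tendsto.eventually_const_lt hr (h3 r hs).enorm] with u hu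
          exact hu.trans_le (le_supNorm le_rfl A ω)
        · filter_upwards [mem_nhdsWithin_of_mem_nhds (lt_mem_nhds hlt)] with u hu
          exact hr.trans_le (le_supNorm (le_of_lt hu) A ω)
      refine (continuousWithinAt_const (b := (0 : ℝ))).congr_of_eventuallyEq ?_ h0
      filter_upwards [h5, self_mem_nhdsWithin] with u hu hus
      refine (levelInd_eq_zero_or_one A n u ω).resolve_right fun h6 => ?_
      exact absurd ((h1 u (le_trans hus hs)).1 h6) (not_le.2 hu)
    · exact (continuousWithinAt_const (b := (1 : ℝ))).congr (fun u hu => h2 u s hu hs h0) h0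
  bdd := ae_of_all _ fun ω => ⟨1, fun s _ => by
    rcases levelInd_eq_zero_or_one A n s ω with h0 | h0 <;> simp [h0]⟩

/-! ### Existence for bounded Lipschitz coefficients -/

theorem ReflStep.exists_of_caglad [IsProbabilityMeasure P] (hW : IsFBrownian F P W) {S : ℝ≥0}
    {g : ℝ≥0 → ℝ} (hg : MonotoneOn g (Icc 0 S)) (hgl : ∀ u ≤ S, ContinuousWithinAt g (Iic u) u)
    (x : ℝ) {β H : ℝ≥0 → Ω → ℝ} (hβ : Caglad F P S β) (hH : Caglad F P S H) :
    ∃ X I K : ℝ≥0 → Ω → ℝ, ContAdapted F P S X ∧ ContAdapted F P S K ∧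
      ReflStep F P W S g x β H X I K := by
  obtain ⟨B, hBc, hB⟩ := hβ.exists_drift
  obtain ⟨I, -, hIc, -, hI, -⟩ := hH.exists_isItoIntegral hW
  have hZ := ((ContAdapted.const S x).add hBc).add hIc
  obtain ⟨K, hKc, hK⟩ := hZ.exists_reflector hg hgl
  refine ⟨_, I, K, hZ.sub hKc, hKc, hI, ?_, ?_⟩
  · filter_upwards [hK, hB] with ω h1 h2
    exact h1.congr fun s hs => by rw [h2 s hs]
  · filter_upwards [hB] with ω h2 s hs
    rw [h2 s hs]

theorem lintegral_sqInt_le_of_lipschitz [IsProbabilityMeasure P] {S : ℝ≥0}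
    {Y Y' : ℝ≥0 → Ω → ℝ} (hY : Caglad F P S Y) (hY' : Caglad F P S Y') {μ : ℝ → ℝ} {L : ℝ≥0}
    (hμ : ∀ y z, |μ y - μ z| ≤ L * |y - z|) :
    ∫⁻ ω, sqInt S (fun s ω => μ (Y s ω) - μ (Y' s ω)) ω ∂P ≤
      2 * L ^ 2 * ∫⁻ u in Icc (0 : ℝ) S,
        ∫⁻ ω, supNorm u.toNNReal (fun s ω => Y s ω - Y' s ω) ω ^ 2 ∂P := by
  calc _ ≤ ∫⁻ ω, 2 * L ^ 2 * sqInt S (fun s ω => Y s ω - Y' s ω) ω ∂P :=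
        lintegral_mono fun ω => by
          simpa using sqInt_le_of_abs_le (β := fun s ω => μ (Y s ω) - μ (Y' s ω))
            (D := fun s ω => Y s ω - Y' s ω) (a := 0) (S := S) (ω := ω) (L := L)
            (fun u _ => by simpa using hμ (Y u ω) (Y' u ω))
    _ = 2 * L ^ 2 * ∫⁻ ω, sqInt S (fun s ω => Y s ω - Y' s ω) ω ∂P :=
        lintegral_const_mul' _ _ (ENNReal.mul_ne_top (by simp) (by simp))
    _ ≤ _ := by
        rw [(hY.sub hY').lintegral_sqInt_eq]
        gcongr with u ω
        exact le_supNorm le_rfl (fun s ω => Y s ω - Y' s ω) ω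

/-- The estimate for one Picard step, stated on every `[0, s]` so that `gronwall_step` can be
iterated. -/
theorem ReflStep.lintegral_sub_le_of_lipschitz [IsProbabilityMeasure P] (hW : IsFBrownian F P W)
    {S : ℝ≥0} {g : ℝ≥0 → ℝ} {x : ℝ} {Y Y' X X' I I' K K' : ℝ≥0 → Ω → ℝ} {μ σ : ℝ → ℝ} {L : ℝ≥0}
    (hμ : ∀ y z, |μ y - μ z| ≤ L * |y - z|) (hσ : ∀ y z, |σ y - σ z| ≤ L * |y - z|)
    (hμc : Continuous μ) (hσc : Continuous σ)
    (hY : ContAdapted F P S Y) (hY' : ContAdapted F P S Y')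
    (h : ReflStep F P W S g x (fun s ω => μ (Y s ω)) (fun s ω => σ (Y s ω)) X I K)
    (h' : ReflStep F P W S g x (fun s ω => μ (Y' s ω)) (fun s ω => σ (Y' s ω)) X' I' K') :
    ∀ s ≤ S, ∫⁻ ω, supNorm s (fun s ω => X s ω - X' s ω) ω ^ 2 ∂P ≤
      (16 * (S + 4) * L ^ 2 : ℝ≥0) * ∫⁻ u in Icc (0 : ℝ) s,
        ∫⁻ ω, supNorm u.toNNReal (fun s ω => Y s ω - Y' s ω) ω ^ 2 ∂P := by
  intro s hs
  refine ((h.mono hs).lintegral_sub_le hW (h'.mono hs) ((hY.mono hs).comp hμc).caglad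
    ((hY'.mono hs).comp hμc).caglad ((hY.mono hs).comp hσc).caglad
    ((hY'.mono hs).comp hσc).caglad).trans ?_
  have h1 := lintegral_sqInt_le_of_lipschitz (hY.mono hs).caglad (hY'.mono hs).caglad hμ
  have h2 := lintegral_sqInt_le_of_lipschitz (hY.mono hs).caglad (hY'.mono hs).caglad hσ
  set A := ∫⁻ u in Icc (0 : ℝ) s,
        ∫⁻ ω, supNorm u.toNNReal (fun s ω => Y s ω - Y' s ω) ω ^ 2 ∂P
  calc _ ≤ 8 * (S * (2 * L ^ 2 * A) + 4 * (2 * L ^ 2 * A)) := by gcongr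
    _ = _ := by push_cast; ring

theorem lintegral_sqInt_ne_top_of_bdd [IsProbabilityMeasure P] {S : ℝ≥0} {H : ℝ≥0 → Ω → ℝ} {C : ℝ}
    (h : ∀ s ω, |H s ω| ≤ C) : ∫⁻ ω, sqInt S H ω ∂P ≠ ∞ := by
  refine ne_top_of_le_ne_top (b := S * ENNReal.ofReal C ^ 2)
    (ENNReal.mul_ne_top (by simp) (by simp)) ?_
  calc ∫⁻ ω, sqInt S H ω ∂P ≤ ∫⁻ _, S * ENNReal.ofReal C ^ 2 ∂P :=
        lintegral_mono fun ω => sqInt_le fun u _ => by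
          rw [Real.enorm_eq_ofReal_abs]
          exact ENNReal.ofReal_le_ofReal (h u ω)
    _ = _ := by simp

theorem ReflStep.lintegral_supNorm_ne_top_of_bdd [IsProbabilityMeasure P]
    (hW : IsFBrownian F P W) {S : ℝ≥0} {g : ℝ≥0 → ℝ} (hg : MonotoneOn g (Icc 0 S)) {x : ℝ}
    {β H X I K : ℝ≥0 → Ω → ℝ} {C : ℝ} (h : ReflStep F P W S g x β H X I K)
    (hβ : Caglad F P S β) (hH : Caglad F P S H) (hβC : ∀ s ω, |β s ω| ≤ C)
    (hHC : ∀ s ω, |H s ω| ≤ C) :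
    ∫⁻ ω, supNorm S (fun s ω => X s ω - min x (g 0)) ω ^ 2 ∂P ≠ ∞ := by
  refine ne_top_of_le_ne_top ?_ (h.lintegral_sub_le hW (ReflStep.const hg x) hβ Caglad.zero hH
    Caglad.zero)
  simp only [sub_zero]
  exact ENNReal.mul_ne_top (by simp) (ENNReal.add_ne_top.2
    ⟨ENNReal.mul_ne_top (by simp) (lintegral_sqInt_ne_top_of_bdd hβC),
      ENNReal.mul_ne_top (by simp) (lintegral_sqInt_ne_top_of_bdd hHC)⟩)

/-- Picard iteration: the squared distances of successive iterates decay like `(1 / 8) ^ n`, so the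
iterates converge uniformly almost surely. Boundedness of the coefficients makes the first distance
finite and provides domination in the limit. -/
theorem exists_reflStep_of_bdd_lipschitz [IsProbabilityMeasure P] (hW : IsFBrownian F P W)
    {S : ℝ≥0} {g : ℝ≥0 → ℝ} (hg : MonotoneOn g (Icc 0 S))
    (hgl : ∀ u ≤ S, ContinuousWithinAt g (Iic u) u) (x : ℝ) {μ σ : ℝ → ℝ} {L : ℝ≥0} {C : ℝ}
    (hμ : ∀ y z, |μ y - μ z| ≤ L * |y - z|) (hσ : ∀ y z, |σ y - σ z| ≤ L * |y - z|)
    (hμc : Continuous μ) (hσc : Continuous σ) (hμC : ∀ y, |μ y| ≤ C) (hσC : ∀ y, |σ y| ≤ C) :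
    ∃ X I K : ℝ≥0 → Ω → ℝ, ContAdapted F P S X ∧ ContAdapted F P S K ∧
      ReflStep F P W S g x (fun s ω => μ (X s ω)) (fun s ω => σ (X s ω)) X I K := by
  have hstep : ∀ Y : {Y : ℝ≥0 → Ω → ℝ // ContAdapted F P S Y},
      ∃ X : {Y : ℝ≥0 → Ω → ℝ // ContAdapted F P S Y}, ∃ I K,
        ReflStep F P W S g x (fun s ω => μ (Y.1 s ω)) (fun s ω => σ (Y.1 s ω)) X.1 I K := by
    intro Y
    obtain ⟨X, I, K, hX, -, h⟩ := ReflStep.exists_of_caglad hW hg hgl x (Y.2.comp hμc).caglad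
      (Y.2.comp hσc).caglad
    exact ⟨⟨X, hX⟩, I, K, h⟩
  choose Φ I K hΦ using hstep
  set X0 : {Y : ℝ≥0 → Ω → ℝ // ContAdapted F P S Y} :=
    ⟨fun _ _ => min x (g 0), ContAdapted.const S _⟩ with hX0
  set X : ℕ → {Y : ℝ≥0 → Ω → ℝ // ContAdapted F P S Y} := fun n => Φ^[n] X0 with hX
  have hXs : ∀ n, X (n + 1) = Φ (X n) := fun n => Function.iterate_succ_apply' Φ n X0
  set A : ℝ≥0 := 16 * (S + 4) * L ^ 2 with hA
  set φ : ℕ → ℝ≥0 → ℝ≥0∞ := fun n s =>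
    ∫⁻ ω, supNorm s (fun s ω => (X (n + 1)).1 s ω - (X n).1 s ω) ω ^ 2 ∂P with hφ
  have hM : φ 0 S ≠ ∞ :=
    (hΦ X0).lintegral_supNorm_ne_top_of_bdd hW hg (X0.2.comp hμc).caglad (X0.2.comp hσc).caglad
      (fun _ _ => hμC _) (fun _ _ => hσC _)
  have hφn : ∀ n, ∀ s ≤ S, φ n s ≤
      φ 0 S * ENNReal.ofReal ((1 / 8) ^ n) * ENNReal.ofReal (Real.exp (8 * A * s)) := by
    intro n
    induction n with
    | zero =>
      intro s hs
      have h1 : 1 ≤ ENNReal.ofReal (Real.exp (8 * A * s)) := by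
        rw [ENNReal.one_le_ofReal]
        exact Real.one_le_exp (by positivity)
      rw [pow_zero, ENNReal.ofReal_one, mul_one]
      calc φ 0 s ≤ φ 0 S * 1 := by
            rw [mul_one]
            exact lintegral_mono fun ω => pow_le_pow_left₀ zero_le (supNorm_mono hs _ ω) 2
        _ ≤ _ := by gcongr
    | succ n ih =>
      intro s hs
      have h1 : φ (n + 1) s ≤ A * ∫⁻ u in Icc (0 : ℝ) s, φ n u.toNNReal := by
        have h2 := (hΦ (X (n + 1))).lintegral_sub_le_of_lipschitz hW hμ hσ hμc hσc (X (n + 1)).2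
          (X n).2 (hΦ (X n)) s hs
        rwa [← hXs, ← hXs] at h2
      refine (h1.trans (gronwall_step ih hs)).trans (le_of_eq ?_)
      rw [pow_succ, ENNReal.ofReal_mul (by positivity), ENNReal.ofReal_div_of_pos (by norm_num)]
      simp only [ENNReal.ofReal_one, div_eq_mul_inv, one_mul, ENNReal.ofReal_ofNat]
      ring
  have hsum : ∑' n, P {ω | ENNReal.ofReal ((1 / 2) ^ n) ≤
      supNorm S (fun s ω => (X (n + 1)).1 s ω - (X n).1 s ω) ω} ≠ ∞ := by
    have h1 : ∀ n, P {ω | ENNReal.ofReal ((1 / 2) ^ n) ≤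
        supNorm S (fun s ω => (X (n + 1)).1 s ω - (X n).1 s ω) ω} ≤
        φ 0 S * ENNReal.ofReal (Real.exp (8 * A * S)) * ENNReal.ofReal ((1 / 2) ^ n) := by
      intro n
      have hp := (ofReal_half_pow_pos n).ne'
      have h2 := meas_ge_le_lintegral_div (μ := P) (((((X (n + 1)).2.sub (X n).2).caglad
        ).aemeasurable_supNorm).pow_const 2) (pow_ne_zero 2 hp) (by simp)
      refine (measure_mono fun ω (hω : ENNReal.ofReal ((1 / 2) ^ n) ≤ supNorm S
        (fun s ω => (X (n + 1)).1 s ω - (X n).1 s ω) ω) => pow_le_pow_left₀ zero_le hω 2).trans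
        (h2.trans ?_)
      refine ENNReal.div_le_of_le_mul ((hφn n S le_rfl).trans (le_of_eq ?_))
      rw [← ENNReal.ofReal_pow (by positivity), mul_assoc _ (ENNReal.ofReal ((1 / 2) ^ n)),
        ← ENNReal.ofReal_mul (by positivity), mul_right_comm]
      congr 2
      -- Chebyshev at threshold `2⁻ⁿ` costs a factor `4 ^ n`; since `8⁻ⁿ = 2⁻ⁿ · 4⁻ⁿ`, a summable
      -- `2⁻ⁿ` is left.
      rw [← pow_mul, ← pow_add, show n + n * 2 = 3 * n by ring, pow_mul]
      norm_num
    refine ne_top_of_le_ne_top ?_ (ENNReal.tsum_le_tsum h1)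
    rw [ENNReal.tsum_mul_left]
    exact ENNReal.mul_ne_top (ENNReal.mul_ne_top hM (by simp)) tsum_ofReal_half_pow_ne_top
  obtain ⟨Y, hYc, hY⟩ := exists_contAdapted_limit (fun n => (X n).2) (by
    filter_upwards [ae_eventually_notMem hsum] with ω hω
    filter_upwards [hω] with n hn
    exact (not_le.1 hn).le)
  obtain ⟨X', I', K', hX', hK', h'⟩ := ReflStep.exists_of_caglad hW hg hgl x (hYc.comp hμc).caglad
    (hYc.comp hσc).caglad
  have hsq : ∀ {γ : ℝ → ℝ}, Continuous γ → (∀ y, |γ y| ≤ C) → Tendsto (fun n => ∫⁻ ω,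
      sqInt S (fun s ω => γ ((X n).1 s ω) - γ (Y s ω)) ω ∂P) atTop (𝓝 0) := by
    intro γ hγ hγC
    have hb : ∀ (n : ℕ) u ω, ‖γ ((X n).1 u ω) - γ (Y u ω)‖ₑ ≤ ENNReal.ofReal (2 * C) := by
      intro n u ω
      rw [Real.enorm_eq_ofReal_abs]
      exact ENNReal.ofReal_le_ofReal ((abs_sub _ _).trans
        (by linarith [hγC ((X n).1 u ω), hγC (Y u ω)]))
    have h1 : ∀ᵐ ω ∂P, Tendsto (fun n => sqInt S (fun s ω => γ ((X n).1 s ω) - γ (Y s ω)) ω)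
        atTop (𝓝 0) := by
      filter_upwards [hY, ae_all_iff.2 fun n => (((X n).2.comp hγ).sub (hYc.comp hγ)).caglad.ae_pathMeas]
        with ω hω hm
      rw [← lintegral_zero (μ := volume.restrict (Icc (0 : ℝ) S))]
      refine tendsto_lintegral_of_dominated_convergence' (fun _ => ENNReal.ofReal (2 * C) ^ 2)
        (fun n => (hm n).enorm.pow_const 2) (fun n => ae_of_all _ fun u =>
          pow_le_pow_left₀ zero_le (hb n _ ω) 2) ?_ ?_
      · rw [lintegral_const]
        exact ENNReal.mul_ne_top (ENNReal.pow_ne_top ENNReal.ofReal_ne_top) (by simp)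
      · filter_upwards [ae_restrict_Icc_Ioc (S := S) (p := fun u => u ≤ S) fun u hu => hu.2]
          with u hu
        have h2 := ((hγ.tendsto _).comp (tendsto_of_tendsto_supNorm hω hu)).sub
          (tendsto_const_nhds (x := γ (Y u.toNNReal ω)))
        simpa [Function.comp_def] using ((ENNReal.continuous_pow 2).tendsto _).comp h2.enorm
    rw [← lintegral_zero (μ := P)]
    refine tendsto_lintegral_of_dominated_convergence' (fun _ => S * ENNReal.ofReal (2 * C) ^ 2)
      (fun n => (((X n).2.comp hγ).sub (hYc.comp hγ)).caglad.aemeasurable_sqInt)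
      (fun n => ae_of_all _ fun ω => sqInt_le fun u _ => hb n u ω) ?_ h1
    rw [lintegral_const, measure_univ, mul_one]
    exact ENNReal.mul_ne_top (by simp) (ENNReal.pow_ne_top ENNReal.ofReal_ne_top)
  have hlim : Tendsto (fun n => ∫⁻ ω, supNorm S (fun s ω => (X (n + 1)).1 s ω - X' s ω) ω ^ 2 ∂P)
      atTop (𝓝 0) := by
    have h1 := ENNReal.Tendsto.const_mul (a := 8) ((ENNReal.Tendsto.const_mul (a := S)
      (hsq hμc hμC) (Or.inr (by simp))).add (ENNReal.Tendsto.const_mul (a := 4) (hsq hσc hσC)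
        (Or.inr (by simp)))) (Or.inr (by simp))
    simp only [mul_zero, add_zero] at h1
    refine tendsto_of_tendsto_of_tendsto_of_le_of_le tendsto_const_nhds h1 (fun _ => zero_le)
      fun n => ?_
    have h2 := (hΦ (X n)).lintegral_sub_le hW h' ((X n).2.comp hμc).caglad (hYc.comp hμc).caglad
      ((X n).2.comp hσc).caglad (hYc.comp hσc).caglad
    rwa [← hXs] at h2
  -- `X'` is the image of the limit `Y` under the Picard map. The iterates tend to `Y` almost surely
  -- and to `X'` in mean square, so `Y` is a fixed point.
  have hYX : ∀ᵐ ω ∂P, ∀ s ≤ S, Y s ω = X' s ω := by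
    refine ae_eq_of_forall_ae_eq hYc.caglad hX'.caglad fun s hs => ?_
    have hm : ∀ Z : {Y : ℝ≥0 → Ω → ℝ // ContAdapted F P S Y},
        AEMeasurable (fun ω => ‖Z.1 s ω - X' s ω‖ₑ ^ 2) P := fun Z =>
      ((((Z.2.sub hX').adapted s hs).mono (F.le s) le_rfl).enorm.pow_const 2).aemeasurable
    have h0 : ∫⁻ ω, ‖Y s ω - X' s ω‖ₑ ^ 2 ∂P ≤ 0 := by
      refine lintegral_le_of_le_liminf (f := fun n ω => ‖(X (n + 1)).1 s ω - X' s ω‖ₑ ^ 2)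
        (fun n => hm _) ?_ (fun n => lintegral_mono fun ω => pow_le_pow_left₀ zero_le
          (le_supNorm hs (fun s ω => (X (n + 1)).1 s ω - X' s ω) ω) 2) hlim
      filter_upwards [hY] with ω hω
      have h2 := ((tendsto_of_tendsto_supNorm hω hs).comp (tendsto_add_atTop_nat 1)).sub
        (tendsto_const_nhds (x := X' s ω))
      exact (((ENNReal.continuous_pow 2).tendsto _).comp h2.enorm).liminf_eq.ge
    rw [le_zero_iff, lintegral_eq_zero_iff' (hm ⟨Y, hYc⟩)] at h0
    filter_upwards [h0] with ω hω
    simpa [sub_eq_zero] using hω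
  refine ⟨Y, I', K', hYc, hK', h'.ito, h'.refl, ?_⟩
  filter_upwards [hYX, h'.eq] with ω h1 h2 s hs
  rw [h1 s hs]
  exact h2 s hs

/-! ### Locally Lipschitz coefficients of linear growth -/

/-- `μ` is Lipschitz on bounded sets, and has linear growth. -/
structure LocLipGrowth (C : ℝ≥0) (μ : ℝ → ℝ) : Prop where
  lip : ∀ R : ℝ, ∃ L : ℝ≥0, ∀ y z, |y| ≤ R → |z| ≤ R → |μ y - μ z| ≤ L * |y - z|
  growth : ∀ y, |μ y| ≤ C * (1 + |y|)

theorem LocLipGrowth.continuous {C : ℝ≥0} {μ : ℝ → ℝ} (h : LocLipGrowth C μ) : Continuous μ := by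
  refine continuous_iff_continuousAt.2 fun y => ?_
  obtain ⟨L, hL⟩ := h.lip (|y| + 1)
  have h1 : LipschitzOnWith L μ (Metric.ball y 1) := by
    refine LipschitzOnWith.of_dist_le_mul fun a ha b hb => ?_
    have key : ∀ a ∈ Metric.ball y 1, |a| ≤ |y| + 1 := fun a ha => by
      rw [Metric.mem_ball, Real.dist_eq] at ha
      have := abs_sub_abs_le_abs_sub a y
      linarith
    exact hL a b (key a ha) (key b hb)
  exact h1.continuousOn.continuousAt (Metric.ball_mem_nhds y one_pos)

theorem lintegral_supNorm_sq_ne_top_of_sub {S : ℝ≥0} {X Y : ℝ≥0 → Ω → ℝ}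
    (hX : Caglad F P S X) (hY : Caglad F P S Y)
    (h : ∫⁻ ω, supNorm S (fun s ω => X s ω - Y s ω) ω ^ 2 ∂P ≠ ∞)
    (hYf : ∫⁻ ω, supNorm S Y ω ^ 2 ∂P ≠ ∞) : ∫⁻ ω, supNorm S X ω ^ 2 ∂P ≠ ∞ := by
  refine ne_top_of_le_ne_top (ENNReal.mul_ne_top (a := 2) (by simp)
    (ENNReal.add_ne_top.2 ⟨h, hYf⟩)) ?_
  rw [← lintegral_add_left' ((hX.sub hY).aemeasurable_supNorm.pow_const 2),
    ← lintegral_const_mul' _ _ (by simp)]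
  refine lintegral_mono fun ω => le_trans (pow_le_pow_left₀ zero_le ?_ 2) (ennreal_add_sq_le _ _)
  refine supNorm_le fun s hs => ?_
  calc ‖X s ω‖ₑ = ‖(X s ω - Y s ω) + Y s ω‖ₑ := by rw [sub_add_cancel]
    _ ≤ _ := (enorm_add_le _ _).trans (add_le_add
      (le_supNorm hs (fun s ω => X s ω - Y s ω) ω) (le_supNorm hs Y ω))

theorem lintegral_supNorm_sq_sub_ne_top {S : ℝ≥0} {X Y : ℝ≥0 → Ω → ℝ}
    (hX : Caglad F P S X) (hXf : ∫⁻ ω, supNorm S X ω ^ 2 ∂P ≠ ∞)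
    (hYf : ∫⁻ ω, supNorm S Y ω ^ 2 ∂P ≠ ∞) :
    ∫⁻ ω, supNorm S (fun s ω => X s ω - Y s ω) ω ^ 2 ∂P ≠ ∞ := by
  refine ne_top_of_le_ne_top (ENNReal.mul_ne_top (a := 2) (by simp)
    (ENNReal.add_ne_top.2 ⟨hXf, hYf⟩)) ?_
  rw [← lintegral_add_left' (hX.aemeasurable_supNorm.pow_const 2),
    ← lintegral_const_mul' _ _ (by simp)]
  refine lintegral_mono fun ω => le_trans (pow_le_pow_left₀ zero_le ?_ 2) (ennreal_add_sq_le _ _)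
  refine supNorm_le fun s hs => ?_
  calc ‖X s ω - Y s ω‖ₑ ≤ ‖X s ω‖ₑ + ‖Y s ω‖ₑ := enorm_sub_le
    _ ≤ _ := add_le_add (le_supNorm hs X ω) (le_supNorm hs Y ω)

/-- Two solutions of the same reflected equation are indistinguishable. -/
theorem ReflStep.unique [IsProbabilityMeasure P] (hW : IsFBrownian F P W) {S : ℝ≥0}
    {g : ℝ≥0 → ℝ} {x : ℝ} {μ σ : ℝ → ℝ} {C : ℝ≥0} (hμ : LocLipGrowth C μ) (hσ : LocLipGrowth C σ)
    {X I K X' I' K' : ℝ≥0 → Ω → ℝ} (hX : ContAdapted F P S X) (hX' : ContAdapted F P S X')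
    (h : ReflStep F P W S g x (fun s ω => μ (X s ω)) (fun s ω => σ (X s ω)) X I K)
    (h' : ReflStep F P W S g x (fun s ω => μ (X' s ω)) (fun s ω => σ (X' s ω)) X' I' K') :
    ∀ᵐ ω ∂P, ∀ s ≤ S, X s ω = X' s ω := by
  -- Before `A` exceeds `n` both processes lie in `[-n, n]`, where the coefficients are Lipschitz
  -- and the difference is bounded. No moments of either solution are assumed.
  set A : ℝ≥0 → Ω → ℝ := fun s ω => |X s ω| + |X' s ω| with hA
  have hAc : Caglad F P S A := ((hX.comp continuous_abs).add (hX'.comp continuous_abs)).caglad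
  have key : ∀ n : ℕ, ∀ᵐ ω ∂P, ∀ s ≤ S, levelInd A n s ω = 1 → X s ω = X' s ω := by
    intro n
    have hb : ∀ᵐ ω ∂P, ∀ s ≤ S, levelInd A n s ω = 1 → |X s ω| ≤ n ∧ |X' s ω| ≤ n := by
      filter_upwards [hAc.levelInd_eq_one_iff n] with ω hω s hs h1
      have h2 := (le_supNorm le_rfl A ω).trans ((hω s hs).1 h1)
      rw [Real.enorm_eq_ofReal_abs, ← ENNReal.ofReal_natCast, ENNReal.ofReal_le_ofReal_iff
        (Nat.cast_nonneg n)] at h2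
      have h3 := (le_abs_self _).trans h2
      simp only [hA] at h3
      exact ⟨by linarith [abs_nonneg (X' s ω)], by linarith [abs_nonneg (X s ω)]⟩
    obtain ⟨L, hL⟩ := hμ.lip n
    obtain ⟨L', hL'⟩ := hσ.lip n
    have hLL : (L : ℝ) ≤ (max L L' : ℝ≥0) := by exact_mod_cast le_max_left L L'
    have hLL' : (L' : ℝ) ≤ (max L L' : ℝ≥0) := by exact_mod_cast le_max_right L L'
    refine h.ae_eq_of_lipschitz hW h' (hX.comp hμ.continuous).caglad
      (hX'.comp hμ.continuous).caglad (hX.comp hσ.continuous).caglad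
      (hX'.comp hσ.continuous).caglad hX.caglad hX'.caglad (hAc.levelInd n)
      (ae_of_all _ fun ω s _ => levelInd_eq_zero_or_one A n s ω) (hAc.levelInd_anti n)
      (L := max L L') ?_ ?_ ?_
    · filter_upwards [hb] with ω hω s hs h1
      exact (hL _ _ (hω s hs h1).1 (hω s hs h1).2).trans (by gcongr)
    · filter_upwards [hb] with ω hω s hs h1
      exact (hL' _ _ (hω s hs h1).1 (hω s hs h1).2).trans (by gcongr)
    · refine ne_top_of_le_ne_top (b := ∫⁻ _, ENNReal.ofReal (2 * n) ^ 2 ∂P) (by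
        rw [lintegral_const, measure_univ, mul_one]
        exact ENNReal.pow_ne_top ENNReal.ofReal_ne_top) (lintegral_mono_ae ?_)
      filter_upwards [hb] with ω hω
      refine pow_le_pow_left₀ zero_le (supNorm_le fun s hs => ?_) 2
      rcases levelInd_eq_zero_or_one A n s ω with h0 | h0
      · simp [h0]
      · rw [h0, mul_one, Real.enorm_eq_ofReal_abs]
        refine ENNReal.ofReal_le_ofReal ((abs_sub _ _).trans ?_)
        linarith [(hω s hs h0).1, (hω s hs h0).2]
  filter_upwards [ae_all_iff.2 key, hAc.ae_supNorm_lt_top, ae_all_iff.2 fun n : ℕ =>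
    hAc.levelInd_eq_one_iff n] with ω h1 h2 h3 s hs
  obtain ⟨n, hn⟩ := ENNReal.exists_nat_gt h2.ne
  exact h1 n s hs ((h3 n s hs).2 ((supNorm_mono hs A ω).trans hn.le))

theorem abs_comp_clamp_le {C : ℝ≥0} {μ : ℝ → ℝ} (h : LocLipGrowth C μ) {R : ℝ} (hR : 0 ≤ R)
    (y : ℝ) : |μ (clamp R y)| ≤ C * (1 + R) :=
  (h.growth _).trans (mul_le_mul_of_nonneg_left (by linarith [abs_clamp_le hR y]) C.coe_nonneg)

theorem abs_comp_clamp_le' {C : ℝ≥0} {μ : ℝ → ℝ} (h : LocLipGrowth C μ) {R : ℝ} (hR : 0 ≤ R)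
    (y : ℝ) : |μ (clamp R y)| ≤ C * (1 + |y|) :=
  (h.growth _).trans (mul_le_mul_of_nonneg_left (by linarith [abs_clamp_le_abs hR y]) C.coe_nonneg)

/-- Clamping the argument makes the coefficients bounded and globally Lipschitz, while the growth
constant stays `C`. The second moment bound `M` is therefore independent of the level `R`. -/
theorem exists_reflStep_truncated [IsProbabilityMeasure P] (hW : IsFBrownian F P W)
    {S : ℝ≥0} {g : ℝ≥0 → ℝ} (hg : MonotoneOn g (Icc 0 S))
    (hgl : ∀ u ≤ S, ContinuousWithinAt g (Iic u) u) (x : ℝ) {μ σ : ℝ → ℝ} {C : ℝ≥0}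
    (hμ : LocLipGrowth C μ) (hσ : LocLipGrowth C σ) : ∃ M : ℝ≥0∞, M ≠ ∞ ∧ ∀ R : ℝ, 0 ≤ R →
    ∃ X I K : ℝ≥0 → Ω → ℝ, ContAdapted F P S X ∧ ∫⁻ ω, supNorm S X ω ^ 2 ∂P ≤ M ∧
      ReflStep F P W S g x (fun s ω => μ (clamp R (X s ω))) (fun s ω => σ (clamp R (X s ω)))
        X I K := by
  refine ⟨2 * (2 * ‖min x (g 0)‖₊ ^ 2 + (32 * (S + 4) * C ^ 2 : ℝ≥0) * S) *
        ENNReal.ofReal (Real.exp (8 * (32 * (S + 4) * C ^ 2 : ℝ≥0) * S)),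
    ENNReal.mul_ne_top (ENNReal.mul_ne_top (by simp) (ENNReal.add_ne_top.2
      ⟨ENNReal.mul_ne_top (by simp) (by simp), ENNReal.mul_ne_top ENNReal.coe_ne_top (by simp)⟩))
      ENNReal.ofReal_ne_top, fun R hR => ?_⟩
  obtain ⟨L, hL⟩ := hμ.lip R
  obtain ⟨L', hL'⟩ := hσ.lip R
  have hlip : ∀ {γ : ℝ → ℝ} {l : ℝ≥0}, (∀ y z, |y| ≤ R → |z| ≤ R → |γ y - γ z| ≤ l * |y - z|) →
      l ≤ max L L' → ∀ y z, |γ (clamp R y) - γ (clamp R z)| ≤ (max L L' : ℝ≥0) * |y - z| := by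
    intro γ l hγ hl y z
    have hl' : (l : ℝ) ≤ (max L L' : ℝ≥0) := by exact_mod_cast hl
    exact (hγ _ _ (abs_clamp_le hR y) (abs_clamp_le hR z)).trans
      (mul_le_mul hl' (abs_clamp_sub_clamp_le R y z) (abs_nonneg _) (NNReal.coe_nonneg _))
  have hμc := hμ.continuous.comp (continuous_clamp R)
  have hσc := hσ.continuous.comp (continuous_clamp R)
  obtain ⟨X, I, K, hX, -, h⟩ := exists_reflStep_of_bdd_lipschitz hW hg hgl x (hlip hL (le_max_left _ _))
    (hlip hL' (le_max_right _ _)) hμc hσc (abs_comp_clamp_le hμ hR) (abs_comp_clamp_le hσ hR)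
  refine ⟨X, I, K, hX, h.lintegral_supNorm_sq_le hW hg (hX.comp hμc).caglad (hX.comp hσc).caglad
    hX.caglad (ae_of_all _ fun ω s _ => abs_comp_clamp_le' hμ hR _)
    (ae_of_all _ fun ω s _ => abs_comp_clamp_le' hσ hR _) ?_, h⟩
  refine lintegral_supNorm_sq_ne_top_of_sub hX.caglad (ContAdapted.const S (min x (g 0))).caglad
    (h.lintegral_supNorm_ne_top_of_bdd hW hg (hX.comp hμc).caglad (hX.comp hσc).caglad
      (fun _ _ => abs_comp_clamp_le hμ hR _) (fun _ _ => abs_comp_clamp_le hσ hR _)) ?_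
  refine ne_top_of_le_ne_top (b := ∫⁻ _, ‖min x (g 0)‖ₑ ^ 2 ∂P) (by
    rw [lintegral_const, measure_univ, mul_one]
    exact ENNReal.pow_ne_top enorm_ne_top) (lintegral_mono fun ω =>
      pow_le_pow_left₀ zero_le (supNorm_le fun s _ => le_rfl) 2)

/-- Existence for the reflected equation on the whole line. -/
theorem exists_reflStep [IsProbabilityMeasure P] (hW : IsFBrownian F P W)
    {S : ℝ≥0} {g : ℝ≥0 → ℝ} (hg : MonotoneOn g (Icc 0 S))
    (hgl : ∀ u ≤ S, ContinuousWithinAt g (Iic u) u) (x : ℝ) {μ σ : ℝ → ℝ} {C : ℝ≥0}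
    (hμ : LocLipGrowth C μ) (hσ : LocLipGrowth C σ) :
    ∃ X I K : ℝ≥0 → Ω → ℝ, ContAdapted F P S X ∧ ContAdapted F P S K ∧
      ∫⁻ ω, supNorm S X ω ^ 2 ∂P ≠ ∞ ∧
      ReflStep F P W S g x (fun s ω => μ (X s ω)) (fun s ω => σ (X s ω)) X I K := by
  obtain ⟨M, hM, hR⟩ := exists_reflStep_truncated hW hg hgl x hμ hσ
  -- With levels `2 ^ j`, the uniform bound `M` makes the probabilities of reaching the level
  -- summable in `j`.
  choose Xn In Kn hXc hXM hn using fun j : ℕ => hR ((2 : ℝ) ^ j) (by positivity)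
  have hγc : ∀ {γ : ℝ → ℝ}, LocLipGrowth C γ → ∀ j : ℕ, Continuous fun y => γ (clamp (2 ^ j) y) :=
    fun h j => h.continuous.comp (continuous_clamp _)
  have hsup : ∀ {s : ℝ≥0} {X : ℝ≥0 → Ω → ℝ} {ω : Ω} {j : ℕ},
      supNorm s X ω ≤ ENNReal.ofReal (2 ^ j) → ∀ u ≤ s, |X u ω| ≤ 2 ^ j := by
    intro s X ω j h u hu
    have h2 := (le_supNorm hu X ω).trans h
    rwa [Real.enorm_eq_ofReal_abs, ENNReal.ofReal_le_ofReal_iff (by positivity)] at h2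
  have hcons : ∀ j, ∀ᵐ ω ∂P, supNorm S (Xn j) ω ≤ ENNReal.ofReal (2 ^ j) →
      ∀ s ≤ S, Xn j s ω = Xn (j + 1) s ω := by
    intro j
    set J := levelInd (Xn j) (ENNReal.ofReal (2 ^ j)) with hJ
    have hb : ∀ᵐ ω ∂P, ∀ s ≤ S, J s ω = 1 → |Xn j s ω| ≤ 2 ^ j := by
      filter_upwards [(hXc j).caglad.levelInd_eq_one_iff (ENNReal.ofReal (2 ^ j))] with ω hω s hs h1
      exact hsup ((hω s hs).1 h1) s le_rfl
    -- Only `Xn j` needs to be bounded: at its values the two truncations coincide, and the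
    -- coefficients clamped at `2 ^ (j + 1)` are globally Lipschitz.
    have hlip : ∀ {γ : ℝ → ℝ} {l : ℝ≥0}, (∀ y z, |y| ≤ 2 ^ (j + 1) → |z| ≤ 2 ^ (j + 1) →
        |γ y - γ z| ≤ l * |y - z|) → ∀ l' : ℝ≥0, l ≤ l' → ∀ᵐ ω ∂P, ∀ s ≤ S, J s ω = 1 →
        |γ (clamp (2 ^ j) (Xn j s ω)) - γ (clamp (2 ^ (j + 1)) (Xn (j + 1) s ω))| ≤
          l' * |Xn j s ω - Xn (j + 1) s ω| := by
      intro γ l hγ l' hl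
      have hl' : (l : ℝ) ≤ l' := by exact_mod_cast hl
      filter_upwards [hb] with ω hω s hs h1
      have h2 := hω s hs h1
      have h3 : |Xn j s ω| ≤ 2 ^ (j + 1) := h2.trans (pow_le_pow_right₀ one_le_two (Nat.le_succ j))
      rw [clamp_eq h2, ← clamp_eq h3]
      refine (hγ _ _ (abs_clamp_le (by positivity) _) (abs_clamp_le (by positivity) _)).trans
        (mul_le_mul hl' ?_ (abs_nonneg _) (NNReal.coe_nonneg _))
      rw [clamp_eq h3]
      nth_rewrite 1 [← clamp_eq h3]
      exact abs_clamp_sub_clamp_le _ _ _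
    obtain ⟨L, hL⟩ := hμ.lip (2 ^ (j + 1))
    obtain ⟨L', hL'⟩ := hσ.lip (2 ^ (j + 1))
    have h1 := (hn j).ae_eq_of_lipschitz hW (hn (j + 1)) ((hXc j).comp (hγc hμ j)).caglad
      ((hXc (j + 1)).comp (hγc hμ (j + 1))).caglad ((hXc j).comp (hγc hσ j)).caglad
      ((hXc (j + 1)).comp (hγc hσ (j + 1))).caglad (hXc j).caglad (hXc (j + 1)).caglad
      ((hXc j).caglad.levelInd (ENNReal.ofReal (2 ^ j)))
      (ae_of_all _ fun ω s _ => levelInd_eq_zero_or_one _ _ s ω) ((hXc j).caglad.levelInd_anti _)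
      (L := max L L') (hlip hL _ (le_max_left _ _)) (hlip hL' _ (le_max_right _ _)) ?_
    · filter_upwards [h1, (hXc j).caglad.levelInd_eq_one_iff (ENNReal.ofReal (2 ^ j))]
        with ω h1 h2 h3 s hs
      exact h1 s hs ((h2 s hs).2 ((supNorm_mono hs _ ω).trans h3))
    · refine ne_top_of_le_ne_top (lintegral_supNorm_sq_sub_ne_top (hXc j).caglad
        (ne_top_of_le_ne_top hM (hXM j)) (ne_top_of_le_ne_top hM (hXM (j + 1))))
        (lintegral_mono fun ω => pow_le_pow_left₀ zero_le (supNorm_le fun s hs => ?_) 2)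
      rcases levelInd_eq_zero_or_one (Xn j) (ENNReal.ofReal (2 ^ j)) s ω with h0 | h0
      · rw [h0, mul_zero, enorm_zero]
        exact zero_le
      · rw [h0, mul_one]
        exact le_supNorm hs (fun s ω => Xn j s ω - Xn (j + 1) s ω) ω
  have hsum : ∑' j, P {ω | ENNReal.ofReal (2 ^ j) ≤ supNorm S (Xn j) ω} ≠ ∞ := by
    have h1 : ∀ j : ℕ, P {ω | ENNReal.ofReal (2 ^ j) ≤ supNorm S (Xn j) ω} ≤
        M * ENNReal.ofReal ((1 / 2) ^ j) := by
      intro j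
      have hp : ENNReal.ofReal (2 ^ j) ≠ 0 := (ENNReal.ofReal_pos.2 (by positivity)).ne'
      have h2 := meas_ge_le_lintegral_div (μ := P) ((hXc j).caglad.aemeasurable_supNorm.pow_const 2)
        (pow_ne_zero 2 hp) (by simp)
      refine (measure_mono fun ω (hω : ENNReal.ofReal (2 ^ j) ≤ supNorm S (Xn j) ω) =>
        pow_le_pow_left₀ zero_le hω 2).trans (h2.trans ?_)
      refine ENNReal.div_le_of_le_mul ((hXM j).trans ?_)
      rw [mul_assoc, ← ENNReal.ofReal_pow (by positivity), ← ENNReal.ofReal_mul (by positivity)]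
      refine le_mul_of_one_le_right zero_le ?_
      rw [ENNReal.one_le_ofReal, sq, ← mul_assoc, ← mul_pow]
      norm_num
      exact one_le_pow₀ one_le_two
    refine ne_top_of_le_ne_top ?_ (ENNReal.tsum_le_tsum h1)
    rw [ENNReal.tsum_mul_left]
    exact ENNReal.mul_ne_top hM tsum_ofReal_half_pow_ne_top
  -- Almost surely only finitely many `Xn j` reach their level; from then on consecutive ones
  -- coincide on all of `[0, S]`, and the sequence is eventually constant.
  have hev : ∀ᵐ ω ∂P, ∃ N, ∀ j ≥ N, supNorm S (Xn j) ω ≤ ENNReal.ofReal (2 ^ j) ∧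
      ∀ s ≤ S, Xn j s ω = Xn (j + 1) s ω := by
    filter_upwards [ae_eventually_notMem hsum, ae_all_iff.2 hcons] with ω h1 h2
    obtain ⟨N, hN⟩ := eventually_atTop.1 h1
    exact ⟨N, fun j hj => ⟨(not_le.1 (hN j hj)).le, h2 j (not_le.1 (hN j hj)).le⟩⟩
  obtain ⟨X, hX, hXlim⟩ := exists_contAdapted_limit (fun n => hXc n) (by
    filter_upwards [hev] with ω ⟨N, hN⟩
    filter_upwards [eventually_ge_atTop N] with j hj
    refine (supNorm_le (C := 0) fun s hs => ?_).trans zero_le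
    rw [(hN j hj).2 s hs]
    simp)
  have hXeq : ∀ᵐ ω ∂P, ∃ N, ∀ j ≥ N, supNorm S (Xn j) ω ≤ ENNReal.ofReal (2 ^ j) ∧
      ∀ s ≤ S, X s ω = Xn j s ω := by
    filter_upwards [hev, hXlim] with ω ⟨N, hN⟩ hlim
    have h1 : ∀ j ≥ N, ∀ s ≤ S, Xn j s ω = Xn N s ω := by
      intro j hj
      induction j, hj using Nat.le_induction with
      | base => exact fun _ _ => rfl
      | succ j hj ih => exact fun s hs => ((hN j hj).2 s hs).symm.trans (ih s hs)
    refine ⟨N, fun j hj => ⟨(hN j hj).1, fun s hs => ?_⟩⟩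
    rw [h1 j hj s hs]
    refine tendsto_nhds_unique (tendsto_of_tendsto_supNorm hlim hs) ?_
    refine tendsto_const_nhds.congr' ?_
    filter_upwards [eventually_ge_atTop N] with k hk using (h1 k hk s hs).symm
  have hXf : ∫⁻ ω, supNorm S X ω ^ 2 ∂P ≠ ∞ := by
    refine ne_top_of_le_ne_top hM (lintegral_le_of_le_liminf (f := fun j ω => supNorm S (Xn j) ω ^ 2)
      (fun j => (hXc j).caglad.aemeasurable_supNorm.pow_const 2) ?_ hXM tendsto_const_nhds)
    filter_upwards [hXeq] with ω ⟨N, hN⟩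
    refine (tendsto_const_nhds.congr' ?_ : Tendsto _ _ _).liminf_eq.ge
    filter_upwards [eventually_ge_atTop N] with j hj
    congr 1
    exact iSup_congr fun s => iSup_congr fun hs => by rw [(hN j hj).2 s hs.2]
  -- The integral and the reflector are built afresh from the coefficients along `X`. By locality
  -- they agree pathwise with those of `Xn N` for large `N`, so `X` satisfies the equation.
  obtain ⟨X', I, K, hX', hK, h⟩ := ReflStep.exists_of_caglad hW hg hgl x
    (hX.comp hμ.continuous).caglad (hX.comp hσ.continuous).caglad
  refine ⟨X, I, K, hX, hK, hXf, h.ito, h.refl, ?_⟩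
  have hloc : ∀ᵐ ω ∂P, ∀ j, (∀ u ∈ Ioc 0 S, σ (X u ω) = σ (clamp (2 ^ j) (Xn j u ω))) →
      ∀ s ≤ S, I s ω = In j s ω := ae_all_iff.2 fun j =>
    h.ito.ae_eq_of_eq hW (hn j).ito (hX.comp hσ.continuous).caglad.ae_pathMeas
  filter_upwards [hXeq, hloc, h.refl, ae_all_iff.2 fun j => (hn j).refl,
    ae_all_iff.2 fun j => (hn j).eq] with ω ⟨N, hN⟩ h1 h2 h3 h4
  obtain ⟨hN1, hN2⟩ := hN N le_rfl
  have h5 : ∀ u ≤ S, clamp (2 ^ N) (Xn N u ω) = X u ω := fun u hu => by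
    rw [clamp_eq (hsup hN1 u hu), hN2 u hu]
  have hI := h1 N fun u hu => by rw [h5 u hu.2]
  have hB : ∀ s ≤ S, ∫ u in (0 : ℝ)..s, μ (clamp (2 ^ N) (Xn N u.toNNReal ω)) =
      ∫ u in (0 : ℝ)..s, μ (X u.toNNReal ω) := by
    intro s hs
    refine intervalIntegral.integral_congr fun u hu => ?_
    rw [uIcc_of_le s.coe_nonneg] at hu
    rw [h5 _ ((Real.toNNReal_le_iff_le_coe.2 hu.2).trans hs)]
  have h6 : IsReflector S g (fun s => x + (∫ u in (0 : ℝ)..s, μ (X u.toNNReal ω)) + I s ω)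
      (fun s => Kn N s ω) := (h3 N).congr fun s hs => by rw [hB s hs, hI s hs]
  intro s hs
  rw [hN2 s hs, h4 N s hs, hB s hs, hI s hs, h2.unique h6 hs]

/-- At time `S` one has `K = x - X + B + I`, and every term on the right is square integrable. -/
theorem ReflStep.lintegral_reflector_sq_ne_top [IsProbabilityMeasure P] (hW : IsFBrownian F P W)
    {S : ℝ≥0} {g : ℝ≥0 → ℝ} {x : ℝ} {β H X I K : ℝ≥0 → Ω → ℝ} {C : ℝ≥0}
    (h : ReflStep F P W S g x β H X I K) (hβ : Caglad F P S β) (hH : Caglad F P S H)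
    (hX : Caglad F P S X) (hXf : ∫⁻ ω, supNorm S X ω ^ 2 ∂P ≠ ∞)
    (hβC : ∀ s ω, |β s ω| ≤ C * (1 + |X s ω|)) (hHC : ∀ s ω, |H s ω| ≤ C * (1 + |X s ω|)) :
    ∫⁻ ω, ‖K S ω‖ₑ ^ 2 ∂P ≠ ∞ := by
  obtain ⟨B, -, hB⟩ := hβ.exists_drift
  have h1 := lintegral_supNorm_drift_add_le hW hβ hH hB h.ito
  have hsq : ∀ {γ : ℝ≥0 → Ω → ℝ}, (∀ s ω, |γ s ω| ≤ C * (1 + |X s ω|)) →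
      ∫⁻ ω, sqInt S γ ω ∂P ≠ ∞ := by
    intro γ hγ
    have h2 : ∫⁻ ω, sqInt S γ ω ∂P ≤ ∫⁻ ω, 2 * C ^ 2 * (S + S * supNorm S X ω ^ 2) ∂P :=
      lintegral_mono fun ω => by
        have h3 := sqInt_le_of_abs_le (β := γ) (D := X) (a := 1) (S := S) (ω := ω) (L := C)
          (fun u _ => by simpa using hγ u ω)
        refine h3.trans ?_
        rw [ENNReal.coe_one, one_pow, mul_one]
        gcongr
        exact sqInt_le fun u hu => le_supNorm hu.2 X ω
    refine ne_top_of_le_ne_top ?_ h2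
    rw [lintegral_const_mul' _ _ (ENNReal.mul_ne_top (by simp) (by simp)),
      lintegral_add_left' aemeasurable_const, lintegral_const_mul' _ _ (by simp), lintegral_const,
      measure_univ, mul_one]
    exact ENNReal.mul_ne_top (ENNReal.mul_ne_top (by simp) (by simp))
      (ENNReal.add_ne_top.2 ⟨by simp, ENNReal.mul_ne_top (by simp) hXf⟩)
  have h2 : ∫⁻ ω, (supNorm S B ω + supNorm S I ω) ^ 2 ∂P ≠ ∞ :=
    ne_top_of_le_ne_top (ENNReal.mul_ne_top (by simp) (ENNReal.add_ne_top.2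
      ⟨ENNReal.mul_ne_top (by simp) (hsq hβC), ENNReal.mul_ne_top (by simp) (hsq hHC)⟩)) h1
  have h3 : ∫⁻ ω, ‖K S ω‖ₑ ^ 2 ∂P ≤ ∫⁻ ω, 2 * (2 * (‖x‖ₑ ^ 2 + supNorm S X ω ^ 2) +
      (supNorm S B ω + supNorm S I ω) ^ 2) ∂P := by
    refine lintegral_mono_ae ?_
    filter_upwards [h.eq, hB] with ω h3 h4
    have h5 : K S ω = x + (-X S ω) + (B S ω + I S ω) := by
      rw [h3 S le_rfl, h4 S le_rfl]
      ring
    rw [h5]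
    refine (enorm_add_sq_le _ _).trans ?_
    gcongr
    · refine (enorm_add_sq_le _ _).trans ?_
      rw [enorm_neg]
      gcongr
      exact le_supNorm le_rfl X ω
    · exact (enorm_add_le _ _).trans (add_le_add (le_supNorm le_rfl B ω) (le_supNorm le_rfl I ω))
  refine ne_top_of_le_ne_top ?_ h3
  have hm := (hX.aemeasurable_supNorm.pow_const 2)
  rw [lintegral_const_mul' _ _ (by simp), lintegral_add_left' ((hm.const_add _).const_mul _),
    lintegral_const_mul' _ _ (by simp), lintegral_add_left' aemeasurable_const, lintegral_const,
    measure_univ, mul_one]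
  exact ENNReal.mul_ne_top (by simp) (ENNReal.add_ne_top.2 ⟨ENNReal.mul_ne_top (by simp)
    (ENNReal.add_ne_top.2 ⟨ENNReal.pow_ne_top enorm_ne_top, hXf⟩), h2⟩)

/-! ### Coefficients at an end-point that is not attained -/

/-- The same conclusion as `stopped_gronwall` without an a priori moment: stop at level `n`, where
the bound does not depend on `n`, and apply Fatou. This serves the uncontrolled solutions, which are
only assumed continuous. -/
theorem lintegral_supNorm_sq_le_of_linear_growth [IsProbabilityMeasure P] (hW : IsFBrownian F P W)
    {S : ℝ≥0} {D β H B I : ℝ≥0 → Ω → ℝ} {c a L : ℝ≥0} (hD : Caglad F P S D) (hβ : Caglad F P S β)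
    (hH : Caglad F P S H) (hB : ∀ᵐ ω ∂P, ∀ s ≤ S, B s ω = ∫ u in (0 : ℝ)..s, β u.toNNReal ω)
    (hI : IsItoIntegral F P W S H I)
    (hle : ∀ᵐ ω ∂P, ∀ s ≤ S, ‖D s ω‖ₑ ≤ c + 2 * supNorm s (fun u ω => B u ω + I u ω) ω)
    (hβD : ∀ s ω, |β s ω| ≤ L * (a + |D s ω|)) (hHD : ∀ s ω, |H s ω| ≤ L * (a + |D s ω|)) :
    ∫⁻ ω, supNorm S D ω ^ 2 ∂P ≤
      2 * (2 * c ^ 2 + (32 * (S + 4) * L ^ 2 : ℝ≥0) * (S * a ^ 2)) *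
        ENNReal.ofReal (Real.exp (8 * (32 * (S + 4) * L ^ 2 : ℝ≥0) * S)) := by
  have hlev : ∀ n : ℕ, ∀ᵐ ω ∂P, ∀ s ≤ S, ‖D s ω * levelInd D n s ω‖ₑ ≤ n := by
    intro n
    filter_upwards [hD.levelInd_eq_one_iff n] with ω hω s hs
    rcases levelInd_eq_zero_or_one D n s ω with h0 | h0
    · rw [h0, mul_zero, enorm_zero]
      exact zero_le
    · rw [h0, mul_one]
      exact (le_supNorm le_rfl D ω).trans ((hω s hs).1 h0)
  refine lintegral_le_of_le_liminf
    (f := fun (n : ℕ) ω => supNorm S (fun s ω => D s ω * levelInd D n s ω) ω ^ 2)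
    (fun n => (hD.mul (hD.levelInd n)).aemeasurable_supNorm.pow_const 2) ?_
    (fun n => stopped_gronwall hW hD hβ hH hB hI (hD.levelInd n)
      (ae_of_all _ fun ω s _ => levelInd_eq_zero_or_one D n s ω) (hD.levelInd_anti n) hle
      (ae_of_all _ fun ω s _ _ => hβD s ω) (ae_of_all _ fun ω s _ _ => hHD s ω) ?_)
    tendsto_const_nhds
  · filter_upwards [hD.ae_supNorm_lt_top, ae_all_iff.2 fun n : ℕ => hD.levelInd_eq_one_iff n]
      with ω h1 h2
    obtain ⟨N, hN⟩ := ENNReal.exists_nat_gt h1.ne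
    refine (tendsto_const_nhds.congr' ?_ : Tendsto _ _ _).liminf_eq.ge
    filter_upwards [eventually_ge_atTop N] with n hn
    congr 1
    refine iSup_congr fun s => iSup_congr fun hs => ?_
    beta_reduce
    rw [(h2 n s hs.2).2 ((supNorm_mono hs.2 D ω).trans (hN.le.trans (by exact_mod_cast hn))),
      mul_one]
  · refine ne_top_of_le_ne_top (b := ∫⁻ _, (n : ℝ≥0∞) ^ 2 ∂P) (by simp) (lintegral_mono_ae ?_)
    filter_upwards [hlev n] with ω hω
    exact pow_le_pow_left₀ zero_le (supNorm_le hω) 2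

theorem isItoIntegral_const (S : ℝ≥0) (c : ℝ) :
    IsItoIntegral F P W S (fun (_ : ℝ≥0) (_ : Ω) => c) (fun s ω => c * (W s ω - W 0 ω)) := by
  have h := (SimpleIntegrand.mk (F := F) 1 (fun i => if i = 0 then 0 else S) (fun i j hij => by
      rcases Nat.eq_zero_or_pos i with rfl | hi
      · simp
      · simp only [if_neg hi.ne', if_neg (hi.trans_le hij).ne', le_refl])
    (fun _ _ => c) (fun _ => measurable_const) fun _ => ⟨|c|, fun _ => le_rfl⟩).isItoIntegral
    (P := P) (W := W) S
  refine h.congr (ae_of_all _ fun ω u hu => ?_) (ae_of_all _ fun ω s hs => ?_)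
  · simp [SimpleIntegrand.val, Set.indicator_of_mem hu]
  · simp [SimpleIntegrand.integral, min_eq_right hs]

theorem PathMeas.abs_integral_le {S : ℝ≥0} {H : ℝ≥0 → Ω → ℝ} {ω : Ω} {C : ℝ}
    (hC : ∀ s ≤ S, |H s ω| ≤ C) : |∫ u in (0 : ℝ)..S, H u.toNNReal ω| ≤ C * S := by
  have h := intervalIntegral.norm_integral_le_of_norm_le_const (a := 0) (b := (S : ℝ))
    (f := fun u : ℝ => H u.toNNReal ω) (C := C) fun u hu => by
      rw [uIoc_of_le S.coe_nonneg] at hu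
      exact hC _ (Real.toNNReal_le_iff_le_coe.2 hu.2)
  simpa using h

/-- First order expansion, at time `S` and near `0`, of a nonnegative solution of an uncontrolled
equation. -/
theorem exists_moment_constant [IsProbabilityMeasure P] (hW : IsFBrownian F P W) {μ σ : ℝ → ℝ}
    {C : ℝ≥0} (hμ : LocLipGrowth C μ) (hσ : LocLipGrowth C σ) {L : ℝ}
    (hμL : ∀ y, |μ y - μ 0| ≤ L * |y|) (hσL : ∀ y, |σ y - σ 0| ≤ L * |y|) :
    ∃ A : ℝ, 0 ≤ A ∧ ∀ (S : ℝ≥0) (y : ℝ), S ≤ 1 → 0 ≤ y → y ≤ S → ∀ Y I : ℝ≥0 → Ω → ℝ,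
      ContAdapted F P S Y → IsItoIntegral F P W S (fun u ω => σ (Y u ω)) I →
      (∀ᵐ ω ∂P, ∀ s ≤ S, 0 ≤ Y s ω ∧
        Y s ω = y + (∫ u in (0 : ℝ)..s, μ (Y u.toNNReal ω)) + I s ω) →
      ∃ N : Ω → ℝ, 0 ≤ N ∧ Integrable N P ∧ Integrable (fun ω => N ω ^ 2) P ∧
        ∫ ω, N ω ^ 2 ∂P ≤ A * S ∧
        0 ≤ y + μ 0 * S + L * S * ∫ ω, N ω ∂P ∧
        |σ 0| * (√S * gaussAbs) ≤ 2 * (y + C * (1 + ∫ ω, N ω ∂P) * S) +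
          (S + 4 * L ^ 2 * ∫ ω, N ω ^ 2 ∂P) / 2 := by
  -- The Gronwall constant at `S = 1`. With `0 ≤ y ≤ S ≤ 1` also `y² ≤ S`, so the whole second
  -- moment is of order `S`.
  set K : ℝ≥0 := 32 * (1 + 4) * C ^ 2 with hK
  refine ⟨2 * (2 + K) * Real.exp (8 * K), by positivity,
    fun S y hS hy0 hyS Y I hY hI hYeq => ?_⟩
  have hβ := (hY.comp hμ.continuous).caglad
  have hH := (hY.comp hσ.continuous).caglad
  obtain ⟨B, -, hB⟩ := hβ.exists_drift
  have hsup : ∫⁻ ω, supNorm S Y ω ^ 2 ∂P ≤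
      ENNReal.ofReal (2 * (2 + K) * Real.exp (8 * K) * S) := by
    set c : ℝ≥0 := ⟨y, hy0⟩ with hc
    have hcy : (c : ℝ) = y := rfl
    have h1 := lintegral_supNorm_sq_le_of_linear_growth hW (c := c) (a := 1) (L := C)
      hY.caglad hβ hH hB hI (by
        filter_upwards [hYeq, hB] with ω h1 h2 s hs
        rw [(h1 s hs).2, add_assoc, ← h2 s hs]
        refine (enorm_add_le _ _).trans (add_le_add (le_of_eq ?_) ?_)
        · rw [Real.enorm_eq_ofReal hy0]
          exact ENNReal.ofReal_eq_coe_nnreal hy0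
        · refine le_trans ?_ (le_mul_of_one_le_left zero_le one_le_two)
          exact le_supNorm le_rfl (fun u ω => B u ω + I u ω) ω)
      (fun s ω => by simpa using hμ.growth (Y s ω)) (fun s ω => by simpa using hσ.growth (Y s ω))
    refine h1.trans ?_
    have hS' : (S : ℝ) ≤ 1 := by exact_mod_cast hS
    have e : (2 * (2 * (c : ℝ≥0∞) ^ 2 + (32 * (S + 4) * C ^ 2 : ℝ≥0) *
        (S * (1 : ℝ≥0) ^ 2)) : ℝ≥0∞) =
        ENNReal.ofReal (2 * (2 * y ^ 2 + 32 * (S + 4) * C ^ 2 * S)) := by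
      rw [← ENNReal.ofReal_coe_nnreal (p := c), hcy]
      have h3 : ((32 * (S + 4) * C ^ 2 : ℝ≥0) : ℝ≥0∞) =
          ENNReal.ofReal (32 * (S + 4) * C ^ 2) := by
        rw [← ENNReal.ofReal_coe_nnreal]
        push_cast
        rfl
      rw [h3, ENNReal.ofReal_mul zero_le_two, ENNReal.ofReal_add (by positivity) (by positivity),
        ENNReal.ofReal_mul zero_le_two, ENNReal.ofReal_pow hy0,
        ENNReal.ofReal_mul (q := (S : ℝ)) (by positivity), ENNReal.ofReal_coe_nnreal]
      simp
    rw [e, ← ENNReal.ofReal_mul (by positivity)]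
    refine ENNReal.ofReal_le_ofReal ?_
    have h4 : 32 * ((S : ℝ) + 4) * C ^ 2 ≤ K := by
      rw [hK]
      push_cast
      gcongr
    have h5 : ((32 * (S + 4) * C ^ 2 : ℝ≥0) : ℝ) ≤ K := by exact_mod_cast h4
    have h6 : y ^ 2 ≤ S := by nlinarith
    calc 2 * (2 * y ^ 2 + 32 * ((S : ℝ) + 4) * C ^ 2 * S) *
          Real.exp (8 * (32 * (S + 4) * C ^ 2 : ℝ≥0) * S)
        ≤ 2 * (2 * S + K * S) * Real.exp (8 * K * 1) := by gcongr
      _ = _ := by ring_nf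
  have hSm : AEMeasurable (supNorm S Y) P := hY.caglad.aemeasurable_supNorm
  set N : Ω → ℝ := fun ω => (supNorm S Y ω).toReal with hN
  have hN0 : 0 ≤ N := fun ω => ENNReal.toReal_nonneg
  have hNm : AEStronglyMeasurable N P := hSm.ennreal_toReal.aestronglyMeasurable
  have hNY : ∀ᵐ ω ∂P, ∀ s ≤ S, |Y s ω| ≤ N ω := by
    filter_upwards [hY.caglad.ae_supNorm_lt_top] with ω hω s hs
    have := le_supNorm hs Y ω
    rw [Real.enorm_eq_ofReal_abs, ENNReal.ofReal_le_iff_le_toReal hω.ne] at this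
    exact this
  have hN2 : ∫⁻ ω, ENNReal.ofReal (N ω ^ 2) ∂P ≤
      ENNReal.ofReal (2 * (2 + K) * Real.exp (8 * K) * S) := by
    refine le_trans (lintegral_mono fun ω => ?_) hsup
    rw [ENNReal.ofReal_pow (hN0 ω)]
    exact pow_le_pow_left₀ zero_le ENNReal.ofReal_toReal_le 2
  have hN2i : Integrable (fun ω => N ω ^ 2) P := by
    refine ⟨hNm.pow 2, ?_⟩
    rw [hasFiniteIntegral_iff_ofReal (ae_of_all _ fun ω => sq_nonneg _)]
    exact hN2.trans_lt ENNReal.ofReal_lt_top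
  have hN1i : Integrable N P := by
    refine Integrable.mono' ((integrable_const 1).add hN2i) hNm (ae_of_all _ fun ω => ?_)
    rw [Real.norm_of_nonneg (hN0 ω)]
    change N ω ≤ 1 + N ω ^ 2
    nlinarith [sq_nonneg (N ω - 1), sq_nonneg (N ω)]
  have hN2A : ∫ ω, N ω ^ 2 ∂P ≤ 2 * (2 + K) * Real.exp (8 * K) * S := by
    rw [integral_eq_lintegral_of_nonneg_ae (ae_of_all _ fun ω => sq_nonneg _) (hNm.pow 2)]
    exact ENNReal.toReal_le_of_le_ofReal (by positivity) hN2
  have hσsup : ∀ {γ : ℝ → ℝ} {c : ℝ≥0}, (∀ y, |γ y| ≤ c * (1 + |y|)) →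
      ∫⁻ ω, supNorm S (fun s ω => γ (Y s ω)) ω ^ 2 ∂P ≠ ∞ := by
    intro γ c hγ
    refine ne_top_of_le_ne_top (b := ∫⁻ ω, c ^ 2 * (2 * (1 + supNorm S Y ω ^ 2)) ∂P) ?_
      (lintegral_mono fun ω => ?_)
    · rw [lintegral_const_mul' _ _ (by simp), lintegral_const_mul' _ _ (by simp),
        lintegral_add_left' aemeasurable_const, lintegral_const, measure_univ, mul_one]
      exact ENNReal.mul_ne_top (by simp) (ENNReal.mul_ne_top (by simp)
        (ENNReal.add_ne_top.2 ⟨by simp, ne_top_of_le_ne_top ENNReal.ofReal_ne_top hsup⟩))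
    · refine supNorm_sq_le fun s hs => ?_
      have h1 : ‖γ (Y s ω)‖ₑ ≤ c * (1 + ‖Y s ω‖ₑ) := by
        rw [Real.enorm_eq_ofReal_abs, Real.enorm_eq_ofReal_abs]
        refine (ENNReal.ofReal_le_ofReal (hγ _)).trans (le_of_eq ?_)
        rw [ENNReal.ofReal_mul c.coe_nonneg, ENNReal.ofReal_add zero_le_one (abs_nonneg _),
          ENNReal.ofReal_coe_nnreal, ENNReal.ofReal_one]
      calc _ ≤ (c * (1 + supNorm S Y ω)) ^ 2 := pow_le_pow_left₀ zero_le
            (h1.trans (by gcongr; exact le_supNorm hs Y ω)) 2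
        _ = c ^ 2 * (1 + supNorm S Y ω) ^ 2 := by ring
        _ ≤ _ := by
          gcongr
          simpa using ennreal_add_sq_le 1 (supNorm S Y ω)
  have hHf := hσsup hσ.growth
  have hI0 : ∫ ω, I S ω ∂P = 0 := hI.integral_eq_zero hW hH hHf le_rfl
  have hIi : Integrable (I S) P :=
    (hI.memLp_two hW hH (lintegral_sqInt_ne_top hHf) le_rfl).integrable (by norm_num)
  -- the remainder of the stochastic integral
  have hR := hI.sub (isItoIntegral_const S (σ 0)) hH.ae_pathMeas
  have hRc : Caglad F P S (fun s ω => σ (Y s ω) - σ 0) :=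
    hH.sub (ContAdapted.const S (σ 0)).caglad
  have hL0 : 0 ≤ L := by simpa using (abs_nonneg _).trans (hμL 1)
  have hRsq : ∫⁻ ω, sqInt S (fun s ω => σ (Y s ω) - σ 0) ω ∂P ≤
      ENNReal.ofReal (S * L ^ 2 * ∫ ω, N ω ^ 2 ∂P) := by
    rw [← integral_const_mul, ofReal_integral_eq_lintegral_ofReal (hN2i.const_mul _)
      (ae_of_all _ fun ω => by positivity)]
    refine lintegral_mono_ae ?_
    filter_upwards [hNY] with ω hω
    have h1 : sqInt S (fun s ω => σ (Y s ω) - σ 0) ω ≤ S * ENNReal.ofReal (L * N ω) ^ 2 := by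
      refine sqInt_le fun u hu => ?_
      rw [Real.enorm_eq_ofReal_abs]
      exact ENNReal.ofReal_le_ofReal ((hσL _).trans (by gcongr; exact hω u hu.2))
    refine h1.trans (le_of_eq ?_)
    rw [← ENNReal.ofReal_pow (mul_nonneg hL0 (hN0 ω)), ← ENNReal.ofReal_coe_nnreal,
      ← ENNReal.ofReal_mul S.coe_nonneg]
    ring_nf
  have hRm := hR.memLp_two hW hRc (ne_top_of_le_ne_top ENNReal.ofReal_ne_top hRsq) le_rfl
  have hR2 : ∫ ω, (I S ω - σ 0 * (W S ω - W 0 ω)) ^ 2 ∂P ≤ 4 * (S * L ^ 2 * ∫ ω, N ω ^ 2 ∂P) := by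
    rw [integral_eq_lintegral_of_nonneg_ae (ae_of_all _ fun ω => sq_nonneg _)
      (hRm.1.pow 2)]
    have h0 : 0 ≤ S * L ^ 2 * ∫ ω, N ω ^ 2 ∂P :=
      mul_nonneg (by positivity) (integral_nonneg fun ω => sq_nonneg _)
    refine ENNReal.toReal_le_of_le_ofReal (by positivity) ?_
    rw [ENNReal.ofReal_mul (by norm_num)]
    calc _ ≤ ∫⁻ ω, supNorm S (fun s ω => I s ω - σ 0 * (W s ω - W 0 ω)) ω ^ 2 ∂P := by
          refine lintegral_mono fun ω => ?_
          rw [← sq_abs, ENNReal.ofReal_pow (abs_nonneg _), ← Real.enorm_eq_ofReal_abs]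
          exact pow_le_pow_left₀ zero_le
            (le_supNorm le_rfl (fun s ω => I s ω - σ 0 * (W s ω - W 0 ω)) ω) 2
      _ ≤ _ := (hR.lintegral_supNorm_sq_le hW hRc).trans (by rw [ENNReal.ofReal_ofNat]; gcongr)
  have hRi := hRm.integrable (by norm_num)
  refine ⟨N, hN0, hN1i, hN2i, hN2A, ?_, ?_⟩
  -- The inequality `0 ≤ Y S` is integrated: the stochastic integral is centred, and the drift
  -- differs from `μ 0 * S` by at most `L * S * N`.
  · have h1 : ∀ᵐ ω ∂P, 0 ≤ y + μ 0 * S + L * S * N ω + I S ω := by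
      filter_upwards [hYeq, hNY, hβ.ae_pathMeas, hβ.bdd] with ω h1 h2 h3 ⟨D, hD⟩
      obtain ⟨h4, h5⟩ := h1 S le_rfl
      have h6 := PathMeas.abs_integral_le (H := fun s ω => μ (Y s ω) - μ 0) (S := S) (ω := ω)
        (C := L * N ω) fun s hs => (hμL _).trans (by gcongr; exact h2 s hs)
      rw [intervalIntegral.integral_sub (h3.intervalIntegrable hD le_rfl)
        intervalIntegrable_const, intervalIntegral.integral_const, smul_eq_mul, sub_zero] at h6
      rw [h5] at h4
      linarith [(abs_le.1 h6).2]
    have h2 := integral_nonneg_of_ae h1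
    have h3 : Integrable (fun ω => L * S * N ω) P := hN1i.const_mul _
    have h4 : Integrable (fun ω => y + μ 0 * S + L * S * N ω) P := (integrable_const _).add h3
    rw [integral_add h4 hIi, integral_add (integrable_const _) h3, hI0, integral_const,
      integral_const_mul, add_zero] at h2
    simpa using h2
  -- Since `Y S ≥ 0`, the negative part of `I S` is at most `y` plus the drift, whence `|I S| ≤ I S
  -- + 2 (y + C (1 + N) S)`, whose expectation does not see `I S`. The difference between `I S` and
  -- `σ 0 (W S - W 0)` is handled by `|r| ≤ (S + r² / S) / 2`; for `S = 0` the quotient is `0` by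
  -- convention.
  · have h1 : ∀ᵐ ω ∂P, |σ 0| * |W S ω - W 0 ω| ≤ I S ω + 2 * (y + C * (1 + N ω) * S) +
        (S + (I S ω - σ 0 * (W S ω - W 0 ω)) ^ 2 / S) / 2 := by
      filter_upwards [hYeq, hNY] with ω h1 h2
      obtain ⟨h4, h5⟩ := h1 S le_rfl
      have h6 := PathMeas.abs_integral_le (H := fun s ω => μ (Y s ω)) (S := S) (ω := ω)
        (C := C * (1 + N ω)) fun s hs => (hμ.growth _).trans (by gcongr; exact h2 s hs)
      have h7 : 0 ≤ C * (1 + N ω) * S := mul_nonneg (mul_nonneg C.coe_nonneg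
        (by linarith [hN0 ω, show (0 : Ω → ℝ) ω = 0 from rfl])) S.coe_nonneg
      have h8 : |I S ω| ≤ I S ω + 2 * (y + C * (1 + N ω) * S) := by
        rw [h5] at h4
        exact abs_le.2 ⟨by linarith [(abs_le.1 h6).2], by linarith⟩
      have h9 : ∀ r : ℝ, 0 ≤ S → |r| ≤ (S + r ^ 2 / S) / 2 ∨ S = 0 := by
        intro r _
        rcases eq_or_ne S 0 with h0 | h0
        · exact Or.inr h0
        · left
          have hS0 : (0 : ℝ) < S := by positivity
          have : (S + r ^ 2 / S) / 2 - |r| = (|r| - S) ^ 2 / (2 * S) := by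
            rw [← sq_abs r]
            field_simp
            ring
          have h10 : 0 ≤ (|r| - S) ^ 2 / (2 * S) := by positivity
          linarith
      rw [← abs_mul]
      have h10 : |σ 0 * (W S ω - W 0 ω)| ≤ |I S ω| + |I S ω - σ 0 * (W S ω - W 0 ω)| := by
        have := abs_sub (I S ω) (I S ω - σ 0 * (W S ω - W 0 ω))
        rwa [sub_sub_cancel] at this
      rcases h9 (I S ω - σ 0 * (W S ω - W 0 ω)) zero_le with h | h
      · linarith
      · subst h
        have : 0 ≤ |I 0 ω| := abs_nonneg _
        simp only [sub_self, mul_zero, abs_zero, NNReal.coe_zero, div_zero, add_zero, zero_div]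
        simp only [NNReal.coe_zero, mul_zero, add_zero] at h8
        linarith
    have hWi : Integrable (fun ω => |σ 0| * |W S ω - W 0 ω|) P :=
      (hW.hasMoments_incr 0 S).integrable.abs.const_mul _
    have h1' : ∀ᵐ ω ∂P, |σ 0| * |W S ω - W 0 ω| ≤ I S ω + 2 * C * S * N ω +
        1 / (2 * S) * (I S ω - σ 0 * (W S ω - W 0 ω)) ^ 2 + (2 * y + 2 * C * S + S / 2) := by
      filter_upwards [h1] with ω hω
      refine hω.trans (le_of_eq ?_)
      ring
    have i1 : Integrable (fun ω => 2 * C * S * N ω) P := hN1i.const_mul _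
    have i2 : Integrable (fun ω => I S ω + 2 * C * S * N ω) P := hIi.add i1
    have i3 : Integrable (fun ω => 1 / (2 * S) * (I S ω - σ 0 * (W S ω - W 0 ω)) ^ 2) P :=
      hRm.integrable_sq.const_mul _
    have i4 : Integrable (fun ω => I S ω + 2 * C * S * N ω +
      1 / (2 * S) * (I S ω - σ 0 * (W S ω - W 0 ω)) ^ 2) P := i2.add i3
    have h2 := integral_mono_ae hWi (i4.add (integrable_const _)) h1'
    simp only [Pi.add_apply] at h2
    rw [integral_const_mul, hW.integral_abs, integral_add i4 (integrable_const _),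
      integral_add i2 i3, integral_add hIi i1, hI0, integral_const_mul, integral_const_mul] at h2
    simp only [integral_const, probReal_univ, smul_eq_mul, one_mul, zero_add] at h2
    refine h2.trans ?_
    have h3 : (∫ ω, (I S ω - σ 0 * (W S ω - W 0 ω)) ^ 2 ∂P) / S ≤ 4 * L ^ 2 * ∫ ω, N ω ^ 2 ∂P := by
      rcases eq_or_ne S 0 with h0 | h0
      · rw [h0, NNReal.coe_zero, div_zero]
        exact mul_nonneg (by positivity) (integral_nonneg fun ω => sq_nonneg _)
      · have hS0 : (0 : ℝ) < S := by positivity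
        rw [div_le_iff₀ hS0]
        linarith
    have h4 : 1 / (2 * (S : ℝ)) * ∫ ω, (I S ω - σ 0 * (W S ω - W 0 ω)) ^ 2 ∂P =
        (∫ ω, (I S ω - σ 0 * (W S ω - W 0 ω)) ^ 2 ∂P) / S / 2 := by ring
    rw [h4]
    linarith

theorem nonpos_of_forall_le_mul {a Q d : ℝ} (hd : 0 < d) (h : ∀ δ : ℝ, 0 < δ → δ ≤ d → a ≤ δ * Q) :
    a ≤ 0 := by
  by_contra! ha
  have hQ : 0 < Q := by
    by_contra! hQ
    have := h d hd le_rfl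
    nlinarith
  have h1 : 0 < min d (a / (2 * Q)) := lt_min hd (by positivity)
  have h2 := h _ h1 (min_le_left _ _)
  have h3 : min d (a / (2 * Q)) * Q ≤ a / (2 * Q) * Q := by gcongr; exact min_le_right _ _
  have h4 : a / (2 * Q) * Q = a / 2 := by field_simp
  linarith

/-- The local Lipschitz constant serves for `|y| ≤ 1`; for `|y| ≥ 1` linear growth gives `C (1 +
|y|) + C ≤ 3 C |y|`. -/
theorem LocLipGrowth.exists_lip_zero {C : ℝ≥0} {μ : ℝ → ℝ} (h : LocLipGrowth C μ) :
    ∃ L : ℝ≥0, ∀ y, |μ y - μ 0| ≤ L * |y| := by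
  obtain ⟨l, hl⟩ := h.lip 1
  refine ⟨l + 3 * C, fun y => ?_⟩
  have hC := C.coe_nonneg
  have hl0 := l.coe_nonneg
  have hy := abs_nonneg y
  push_cast
  rcases le_total |y| 1 with h1 | h1
  · have := hl y 0 h1 (by simp)
    rw [sub_zero] at this
    nlinarith
  · have h2 := h.growth y
    have h3 := h.growth 0
    have h4 := abs_sub (μ y) (μ 0)
    simp only [abs_zero, add_zero, mul_one] at h3
    nlinarith [mul_nonneg hC (sub_nonneg.2 h1), mul_nonneg hl0 hy]

/-- If `0` is not attained by the uncontrolled dynamics, then the diffusion coefficient vanishes at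
`0` and the drift does not point downwards. -/
theorem coeff_zero_of_nonneg_solutions [IsProbabilityMeasure P] (hW : IsFBrownian F P W)
    {μ σ : ℝ → ℝ} {C : ℝ≥0} (hμ : LocLipGrowth C μ) (hσ : LocLipGrowth C σ) {T : ℝ≥0} (hT : 0 < T)
    (h : ∀ y : ℝ, 0 < y → ∃ Y I : ℝ≥0 → Ω → ℝ, ContAdapted F P T Y ∧
      IsItoIntegral F P W T (fun u ω => σ (Y u ω)) I ∧
      ∀ᵐ ω ∂P, ∀ s ≤ T, 0 ≤ Y s ω ∧
        Y s ω = y + (∫ u in (0 : ℝ)..s, μ (Y u.toNNReal ω)) + I s ω) :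
    σ 0 = 0 ∧ 0 ≤ μ 0 := by
  obtain ⟨L₁, hL₁⟩ := hμ.exists_lip_zero
  obtain ⟨L₂, hL₂⟩ := hσ.exists_lip_zero
  set L : ℝ := L₁ + L₂ with hL
  have hL0 : 0 ≤ L := by positivity
  obtain ⟨A, hA, hmain⟩ := exists_moment_constant hW hμ hσ (L := L)
    (fun y => (hL₁ y).trans (by gcongr; simp [hL])) (fun y => (hL₂ y).trans (by gcongr; simp [hL]))
  -- The solution starts at `δ⁴` and is observed at time `δ²`. The noise is then of order `|σ 0| δ`
  -- against a drift of order `δ²`, and the starting point is negligible against both; dividing by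
  -- `δ` and by `δ²` isolates `σ 0` and `μ 0`.
  have key : ∀ δ : ℝ, 0 < δ → δ ≤ min 1 √T →
      |σ 0| * gaussAbs ≤ δ * (2 * (1 + C * (2 + A)) + (1 + 4 * L ^ 2 * A) / 2) ∧
      -μ 0 ≤ δ * (1 + L * (1 + A)) := by
    intro δ hδ hδ'
    have hδ1 : δ ≤ 1 := hδ'.trans (min_le_left _ _)
    set S : ℝ≥0 := ⟨δ ^ 2, sq_nonneg δ⟩ with hS
    have hSδ : (S : ℝ) = δ ^ 2 := rfl
    have hST : S ≤ T := by
      rw [← NNReal.coe_le_coe, hSδ, ← Real.sq_sqrt T.coe_nonneg]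
      exact pow_le_pow_left₀ hδ.le (hδ'.trans (min_le_right _ _)) 2
    have hS1 : S ≤ 1 := by
      rw [← NNReal.coe_le_coe, hSδ]
      exact pow_le_one₀ hδ.le hδ1
    obtain ⟨Y, I, hY, hI, hYI⟩ := h (δ ^ 4) (by positivity)
    obtain ⟨N, hN0, hNi, hN2i, hN2, h1, h2⟩ := hmain S (δ ^ 4) hS1 (by positivity)
      (by rw [hSδ]; exact pow_le_pow_of_le_one hδ.le hδ1 (by norm_num)) Y I (hY.mono hST)
      (hI.mono hST) (hYI.mono fun ω hω s hs => hω s (hs.trans hST))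
    have hN1 : ∫ ω, N ω ∂P ≤ δ * (1 + A) := by
      have h3 : ∫ ω, N ω ∂P ≤ ∫ ω, (δ + N ω ^ 2 / δ) ∂P := by
        refine integral_mono hNi ((integrable_const _).add (hN2i.div_const _)) fun ω => ?_
        change N ω ≤ δ + N ω ^ 2 / δ
        have h5 : δ + N ω ^ 2 / δ - N ω = ((N ω - δ) ^ 2 + N ω * δ) / δ := by
          field_simp
          ring
        have h6 : 0 ≤ ((N ω - δ) ^ 2 + N ω * δ) / δ :=
          div_nonneg (add_nonneg (sq_nonneg _) (mul_nonneg (hN0 ω) hδ.le)) hδ.le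
        linarith
      rw [integral_add (integrable_const _) (hN2i.div_const _), integral_div, integral_const,
        probReal_univ, one_smul] at h3
      refine h3.trans ?_
      have h4 : (∫ ω, N ω ^ 2 ∂P) / δ ≤ A * δ := by
        rw [div_le_iff₀ hδ]
        rw [hSδ] at hN2
        linarith
      linarith
    rw [hSδ, Real.sqrt_sq hδ.le] at h2
    rw [hSδ] at h1 hN2
    have hC := C.coe_nonneg
    have hδ2 : 0 < δ ^ 2 := by positivity
    constructor
    · have h3 : |σ 0| * (δ * gaussAbs) ≤
          2 * (δ ^ 4 + C * (1 + δ * (1 + A)) * δ ^ 2) + (δ ^ 2 + 4 * L ^ 2 * (A * δ ^ 2)) / 2 :=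
        h2.trans (by gcongr)
      have h4 : δ * (1 + A) ≤ 1 + A := mul_le_of_le_one_left (by positivity) hδ1
      have h5 : δ ^ 4 ≤ δ ^ 2 := pow_le_pow_of_le_one hδ.le hδ1 (by norm_num)
      have h6 : C * (1 + δ * (1 + A)) * δ ^ 2 ≤ C * (2 + A) * δ ^ 2 := by
        exact mul_le_mul_of_nonneg_right (mul_le_mul_of_nonneg_left (by linarith) hC) hδ2.le
      refine le_of_mul_le_mul_left ?_ hδ
      calc δ * (|σ 0| * gaussAbs) = |σ 0| * (δ * gaussAbs) := by ring
        _ ≤ 2 * (δ ^ 2 + C * (2 + A) * δ ^ 2) + (δ ^ 2 + 4 * L ^ 2 * (A * δ ^ 2)) / 2 := by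
            linarith
        _ = _ := by ring
    · have h3 : 0 ≤ δ ^ 4 + μ 0 * δ ^ 2 + L * δ ^ 2 * (δ * (1 + A)) := h1.trans (by gcongr)
      have h4 : 0 ≤ δ ^ 2 * (δ ^ 2 + μ 0 + L * (δ * (1 + A))) := by linarith
      have h5 := nonneg_of_mul_nonneg_right h4 hδ2
      have h6 : δ ^ 2 ≤ δ := by nlinarith
      linarith
  have hd : 0 < min 1 √(T : ℝ) := lt_min one_pos (Real.sqrt_pos.2 hT)
  have h1 := nonpos_of_forall_le_mul hd fun δ h0 h1 => (key δ h0 h1).1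
  have h2 := nonpos_of_forall_le_mul hd fun δ h0 h1 => (key δ h0 h1).2
  refine ⟨abs_eq_zero.1 (le_antisymm ?_ (abs_nonneg _)), by linarith⟩
  exact nonpos_of_mul_nonpos_left h1 gaussAbs_pos

/-! ### Inverse moments -/

theorem sqInt_after_le {u v : ℝ≥0} {c : Ω → ℝ} {H : ℝ≥0 → Ω → ℝ} {ω : Ω} {M : ℝ≥0∞}
    (h : ∀ r ∈ Ioc u v, ‖c ω * H r ω‖ₑ ^ 2 ≤ M) :
    sqInt v (fun s ω => if u < s then c ω * H s ω else 0) ω ≤ ENNReal.ofReal (v - u) * M := by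
  calc _ ≤ ∫⁻ r in Icc (0 : ℝ) v, (Ioc (u : ℝ) v).indicator (fun _ => M) r := by
        refine setLIntegral_mono' measurableSet_Icc fun r hr => ?_
        beta_reduce
        by_cases hur : u < r.toNNReal
        · have h1 : r ∈ Ioc (u : ℝ) v := ⟨Real.lt_toNNReal_iff_coe_lt.1 hur, hr.2⟩
          rw [Set.indicator_of_mem h1, if_pos hur]
          exact h _ ⟨hur, Real.toNNReal_le_iff_le_coe.2 hr.2⟩
        · rw [if_neg hur]
          simp
    _ ≤ ∫⁻ r, (Ioc (u : ℝ) v).indicator (fun _ => M) r := setLIntegral_le_lintegral _ _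
    _ = _ := by
        rw [lintegral_indicator measurableSet_Ioc, setLIntegral_const, Real.volume_Ioc, mul_comm]

/-- Here `w` is the square root of the time step. The cubic remainder is reduced to fourth moments
by `|Δ|³ ≤ w³ + Δ⁴ / w`; as the fourth moment of the martingale part is of order `w⁴`, the outcome
is of order `w³`. -/
theorem neg_cube_mul_le {b i p q e w C : ℝ} (hp0 : 0 < p) (hpe : p ≤ e) (hq0 : 0 < q) (hqe : q ≤ e)
    (hw : 0 < w) (hw1 : w ≤ 1) (hb : |b| ≤ C * w ^ 2) :
    -((b + i) ^ 3 * p ^ 3 * q) ≤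
      8 * e ^ 4 / w * i ^ 4 + w ^ 3 * (e ^ 4 * (1 + 8 * C ^ 4)) := by
  have he : 0 < e := hp0.trans_le hpe
  set Δ := b + i with hΔ
  have h0 := abs_nonneg Δ
  have a1 : -(Δ ^ 3 * p ^ 3 * q) ≤ |Δ| ^ 3 * e ^ 4 := by
    calc -(Δ ^ 3 * p ^ 3 * q) ≤ |Δ ^ 3 * p ^ 3 * q| := neg_le_abs _
      _ = |Δ| ^ 3 * (p ^ 3 * q) := by
        rw [abs_mul, abs_mul, abs_pow, abs_pow, abs_of_pos hp0, abs_of_pos hq0, mul_assoc]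
      _ ≤ |Δ| ^ 3 * (e ^ 3 * e) := by gcongr
      _ = _ := by ring
  have a2 : |Δ| ^ 3 ≤ w ^ 3 + Δ ^ 4 / w := by
    have e1 : Δ ^ 4 = |Δ| ^ 4 := by rw [Even.pow_abs ⟨2, rfl⟩]
    rw [e1]
    rcases le_total |Δ| w with hc | hc
    · exact (pow_le_pow_left₀ h0 hc 3).trans (le_add_of_nonneg_right (by positivity))
    · refine le_trans ?_ (le_add_of_nonneg_left (by positivity))
      rw [le_div_iff₀ hw, pow_succ |Δ| 3]
      exact mul_le_mul_of_nonneg_left hc (by positivity)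
  have a3 : Δ ^ 4 ≤ 8 * b ^ 4 + 8 * i ^ 4 := by
    have e1 : 8 * b ^ 4 + 8 * i ^ 4 - Δ ^ 4 =
        (b - i) ^ 2 * (Δ ^ 2 + 2 * (b ^ 2 + i ^ 2)) + 4 * (b ^ 2 - i ^ 2) ^ 2 := by
      rw [hΔ]
      ring
    have e2 : 0 ≤ (b - i) ^ 2 * (Δ ^ 2 + 2 * (b ^ 2 + i ^ 2)) + 4 * (b ^ 2 - i ^ 2) ^ 2 := by
      positivity
    linarith
  have a4 : b ^ 4 ≤ C ^ 4 * w ^ 4 := by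
    calc b ^ 4 = |b| ^ 4 := by rw [Even.pow_abs ⟨2, rfl⟩]
      _ ≤ (C * w ^ 2) ^ 4 := pow_le_pow_left₀ (abs_nonneg _) hb 4
      _ = C ^ 4 * w ^ 8 := by ring
      _ ≤ _ := mul_le_mul_of_nonneg_left (pow_le_pow_of_le_one hw.le hw1 (by norm_num))
        (by positivity)
  have a5 : Δ ^ 4 / w ≤ 8 * C ^ 4 * w ^ 3 + 8 * i ^ 4 / w := by
    have : 8 * C ^ 4 * w ^ 3 + 8 * i ^ 4 / w = (8 * (C ^ 4 * w ^ 4) + 8 * i ^ 4) / w := by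
      field_simp
    rw [this]
    exact div_le_div_of_nonneg_right (by linarith) hw.le
  calc _ ≤ |Δ| ^ 3 * e ^ 4 := a1
    _ ≤ (w ^ 3 + (8 * C ^ 4 * w ^ 3 + 8 * i ^ 4 / w)) * e ^ 4 :=
        mul_le_mul_of_nonneg_right (by linarith) (by positivity)
    _ = _ := by ring

/-- The starting point is the exact expansion `1 / (y + Δ) = p - Δ p² + Δ² p³ - Δ³ p³ / (y + Δ)`
with `p = 1 / y`. The lower bound on the drift turns `-b p²` into `L w² p` up to an error, and `-i
p²` is centred. Apart from `2 i² p³`, the rest becomes of order `w³` in expectation. -/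
theorem inv_taylor_bound {y y' p b i G L C e w : ℝ} (hy : 0 < y) (hp : p = y⁻¹) (hpe : p ≤ e)
    (hy' : 0 < y') (hpe' : y'⁻¹ ≤ e) (hyy : y' = y + (b + i)) (hL : 0 ≤ L)
    (hC : 0 ≤ C) (hw : 0 < w) (hw1 : w ≤ 1) (hG : 0 ≤ G) (hb : |b| ≤ C * w ^ 2)
    (hb' : -b ≤ L * w ^ 2 * (y + (C * w ^ 2 + G))) :
    y'⁻¹ ≤ p + L * w ^ 2 * p - i * p ^ 2 + 2 * (i ^ 2 * p ^ 3) + L * e ^ 2 * w * G ^ 2 +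
      8 * e ^ 4 / w * i ^ 4 +
      w ^ 3 * (L * e ^ 2 * (C + 1) + 2 * C ^ 2 * e ^ 3 + e ^ 4 * (1 + 8 * C ^ 4)) := by
  have hp0 : 0 < p := by rw [hp]; positivity
  have hpy : p * y = 1 := by rw [hp]; field_simp
  have he : 0 < e := hp0.trans_le hpe
  have hw2 : w ^ 4 ≤ w ^ 3 := pow_le_pow_of_le_one hw.le hw1 (by norm_num)
  set Δ := b + i with hΔ
  have h1 : y'⁻¹ = p - Δ * p ^ 2 + Δ ^ 2 * p ^ 3 - Δ ^ 3 * p ^ 3 * y'⁻¹ := by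
    have : y + Δ ≠ 0 := by rw [← hyy]; exact hy'.ne'
    rw [hyy, hp]
    field_simp
    ring
  have h2 : -(Δ * p ^ 2) ≤ L * w ^ 2 * p - i * p ^ 2 +
      (L * e ^ 2 * w * G ^ 2 + w ^ 3 * (L * e ^ 2 * (C + 1))) := by
    have a1 : -b * p ^ 2 ≤ L * w ^ 2 * (y + (C * w ^ 2 + G)) * p ^ 2 := by gcongr
    have a2 : L * w ^ 2 * (y + (C * w ^ 2 + G)) * p ^ 2 =
        L * w ^ 2 * p * (p * y) + L * w ^ 2 * (C * w ^ 2 + G) * p ^ 2 := by ring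
    have a3 : L * w ^ 2 * (C * w ^ 2 + G) * p ^ 2 ≤ L * w ^ 2 * (C * w ^ 2 + G) * e ^ 2 := by gcongr
    -- The running increment `G` is of order `w`, so both terms have expectation of order `w³`, and
    -- only the second moment of `G` is needed.
    have a4 : w ^ 2 * G ≤ w ^ 3 + w * G ^ 2 := by
      have e1 : 0 ≤ w * ((w - G) ^ 2 + w * G) := by positivity
      have e2 : w ^ 3 + w * G ^ 2 - w ^ 2 * G = w * ((w - G) ^ 2 + w * G) := by ring
      linarith
    have a5 : L * w ^ 2 * (C * w ^ 2 + G) * e ^ 2 ≤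
        L * e ^ 2 * (C * w ^ 3 + (w ^ 3 + w * G ^ 2)) := by
      calc L * w ^ 2 * (C * w ^ 2 + G) * e ^ 2 = L * e ^ 2 * (C * w ^ 4 + w ^ 2 * G) := by ring
        _ ≤ _ := by gcongr
    rw [hpy, mul_one] at a2
    rw [hΔ]
    linarith
  have hb2 : b ^ 2 ≤ C ^ 2 * w ^ 3 := by
    calc b ^ 2 = |b| ^ 2 := (sq_abs b).symm
      _ ≤ (C * w ^ 2) ^ 2 := by gcongr
      _ = C ^ 2 * w ^ 4 := by ring
      _ ≤ _ := by gcongr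
  have hpe3 : p ^ 3 ≤ e ^ 3 := by gcongr
  have h3 : Δ ^ 2 * p ^ 3 ≤ 2 * (i ^ 2 * p ^ 3) + w ^ 3 * (2 * C ^ 2 * e ^ 3) := by
    have a1 : Δ ^ 2 ≤ 2 * i ^ 2 + 2 * b ^ 2 := by
      have e1 : 2 * i ^ 2 + 2 * b ^ 2 - Δ ^ 2 = (b - i) ^ 2 := by rw [hΔ]; ring
      linarith [sq_nonneg (b - i)]
    have a2 : b ^ 2 * p ^ 3 ≤ C ^ 2 * w ^ 3 * e ^ 3 := by gcongr
    calc Δ ^ 2 * p ^ 3 ≤ (2 * i ^ 2 + 2 * b ^ 2) * p ^ 3 := by gcongr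
      _ = 2 * (i ^ 2 * p ^ 3) + 2 * (b ^ 2 * p ^ 3) := by ring
      _ ≤ _ := by linarith
  have h4 := neg_cube_mul_le (i := i) hp0 hpe (inv_pos.2 hy') hpe' hw hw1 hb
  rw [h1]
  linarith

/-- One time step in the estimate of `E[1 / Y]`, for an Itô process `Y` bounded away from `0` whose
coefficients are dominated by `Y`. -/
theorem integral_inv_step_le [IsProbabilityMeasure P] (hW : IsFBrownian F P W) {q S : ℝ≥0}
    {Y β H I : ℝ≥0 → Ω → ℝ} {ξ : Ω → ℝ} {ε L C : ℝ} (hε : 0 < ε) (hL : 0 ≤ L) (hC : 0 ≤ C)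
    (hY : ∀ s, q ≤ s → s ≤ S → Measurable[F s] (Y s)) (hβ : Caglad F P S β) (hH : Caglad F P S H)
    (hI : IsItoIntegral F P W S H I)
    (hYeq : ∀ᵐ ω ∂P, ∀ s ≤ S, Y s ω = ξ ω + (∫ u in (0 : ℝ)..s, β u.toNNReal ω) + I s ω)
    (hYε : ∀ᵐ ω ∂P, ∀ s ≤ S, ε ≤ Y s ω)
    (hβY : ∀ᵐ ω ∂P, ∀ s ≤ S, -(L * Y s ω) ≤ β s ω) (hHY : ∀ᵐ ω ∂P, ∀ s ≤ S, |H s ω| ≤ L * Y s ω)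
    (hβC : ∀ s ≤ S, ∀ ω, |β s ω| ≤ C) (hHC : ∀ s ≤ S, ∀ ω, |H s ω| ≤ C) :
    ∃ D : ℝ, 0 ≤ D ∧ ∀ (u v : ℝ≥0) (w : ℝ), q ≤ u → u ≤ v → v ≤ S → 0 < w → w ≤ 1 →
      (v : ℝ) - u = w ^ 2 →
      ∫ ω, (Y v ω)⁻¹ ∂P ≤ (∫ ω, (Y u ω)⁻¹ ∂P) * (1 + (L + 16 * L ^ 2) * w ^ 2) + D * w ^ 3 := by
  set e := ε⁻¹ with he
  have he0 : 0 < e := inv_pos.2 hε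
  have hgm := gaussMom4_nonneg
  set D₁ : ℝ := L * e ^ 2 * (C + 1) + 2 * C ^ 2 * e ^ 3 + e ^ 4 * (1 + 8 * C ^ 4) with hD₁
  set D : ℝ := D₁ + L * e ^ 2 * (4 * C ^ 2) + 8 * e ^ 4 * ((4 + 3 * gaussMom4) * C ^ 4) +
    160 * L ^ 2 * e ^ 3 * C ^ 2 with hD
  refine ⟨D, by positivity, fun u v w hqu huv hv hw hw1 hvu => ?_⟩
  have hu := huv.trans hv
  -- the state at time `u`
  set y : Ω → ℝ := fun ω => max (Y u ω) ε with hy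
  have hym : Measurable[F u] y := (hY u hqu hu).max measurable_const
  -- Taking the maximum with `ε` makes this bound hold at every `ω`, so `p` is a bounded factor
  -- known at time `u` and may be put inside stochastic integrals.
  have hyε : ∀ ω, ε ≤ y ω := fun ω => le_max_right _ _
  have hy0 : ∀ ω, 0 < y ω := fun ω => hε.trans_le (hyε ω)
  set p : Ω → ℝ := fun ω => (y ω)⁻¹ with hp
  have hpm : Measurable[F u] p := hym.inv
  have hp0 : ∀ ω, 0 < p ω := fun ω => inv_pos.2 (hy0 ω)
  have hpe : ∀ ω, p ω ≤ e := fun ω => inv_anti₀ hε (hyε ω)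
  -- the increment of the stochastic integral
  set i : Ω → ℝ := fun ω => I v ω - I u ω with hi
  have hafter : ∀ {c : Ω → ℝ}, Measurable[F u] c → (∃ M, ∀ ω, |c ω| ≤ M) →
      IsItoIntegral F P W v (fun s ω => if u < s then c ω * H s ω else 0)
        (fun s ω => c ω * (I s ω - I (min s u) ω)) := fun hc hb => (hI.mono hv).after hc hb
  have hafterC : ∀ {c : Ω → ℝ}, Measurable[F u] c →
      Caglad F P v (fun s ω => if u < s then c ω * H s ω else 0) := fun hc => (hH.mono hv).after hc
  have hafterf : ∀ {c : Ω → ℝ} {M : ℝ}, (∀ ω, |c ω| ≤ M) →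
      ∫⁻ ω, supNorm v (fun s ω => if u < s then c ω * H s ω else 0) ω ^ 2 ∂P ≠ ∞ := by
    intro c M hM
    refine ne_top_of_le_ne_top (b := ∫⁻ _, ENNReal.ofReal (M * C) ^ 2 ∂P) (by
      rw [lintegral_const, measure_univ, mul_one]
      exact ENNReal.pow_ne_top ENNReal.ofReal_ne_top)
      (lintegral_mono fun ω => pow_le_pow_left₀ zero_le (supNorm_le fun s hs => ?_) 2)
    split_ifs with h
    · rw [Real.enorm_eq_ofReal_abs, abs_mul]
      exact ENNReal.ofReal_le_ofReal (mul_le_mul (hM ω) (hHC s (hs.trans hv) ω) (abs_nonneg _)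
        ((abs_nonneg _).trans (hM ω)))
    · simp
  -- moments of the supremum of the increments
  set G' : Ω → ℝ≥0∞ := supNorm v (fun s ω => 1 * (I s ω - I (min s u) ω)) with hG'
  set G : Ω → ℝ := fun ω => (G' ω).toReal with hG
  have hG0 : ∀ ω, 0 ≤ G ω := fun ω => ENNReal.toReal_nonneg
  have h1m : Measurable[F u] fun _ : Ω => (1 : ℝ) := measurable_const
  have h1b : ∃ M, ∀ ω : Ω, |(fun _ => (1 : ℝ)) ω| ≤ M := ⟨1, by simp⟩
  have hG'2 : ∫⁻ ω, G' ω ^ 2 ∂P ≤ ENNReal.ofReal (4 * C ^ 2 * w ^ 2) := by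
    refine ((hafter h1m h1b).lintegral_supNorm_sq_le hW (hafterC h1m)).trans ?_
    calc _ ≤ 4 * ∫⁻ _, ENNReal.ofReal (v - u) * ENNReal.ofReal (C ^ 2) ∂P := by
          gcongr with ω
          refine sqInt_after_le fun r hr => ?_
          rw [one_mul, Real.enorm_eq_ofReal_abs, ← ENNReal.ofReal_pow (abs_nonneg _)]
          exact ENNReal.ofReal_le_ofReal
            (pow_le_pow_left₀ (abs_nonneg _) (hHC r (hr.2.trans hv) ω) 2)
      _ = _ := by
          rw [lintegral_const, measure_univ, mul_one, hvu, ← ENNReal.ofReal_mul (sq_nonneg _),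
            ← ENNReal.ofReal_ofNat, ← ENNReal.ofReal_mul (by norm_num)]
          ring_nf
  have hG'm : AEMeasurable G' P := by
    obtain ⟨J, -, hJc, -, hJ, -⟩ := (hafterC h1m).exists_isItoIntegral hW
    refine hJc.caglad.aemeasurable_supNorm.congr ?_
    filter_upwards [(hafter h1m h1b).ae_eq_of_eq hW hJ (hafterC h1m).ae_pathMeas] with ω hω
    exact iSup_congr fun s => iSup_congr fun hs => by
      beta_reduce
      rw [hω (fun _ _ => rfl) s hs.2]
  have hG't : ∀ᵐ ω ∂P, G' ω < ∞ := by
    filter_upwards [ae_lt_top' (hG'm.pow_const 2) (hG'2.trans_lt ENNReal.ofReal_lt_top).ne]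
      with ω hω
    by_contra h
    rw [not_lt_top_iff.1 h] at hω
    simp at hω
  have hGm : AEStronglyMeasurable G P := hG'm.ennreal_toReal.aestronglyMeasurable
  have hG2 : ∫⁻ ω, ENNReal.ofReal (G ω ^ 2) ∂P ≤ ENNReal.ofReal (4 * C ^ 2 * w ^ 2) := by
    refine le_trans (lintegral_mono fun ω => ?_) hG'2
    rw [ENNReal.ofReal_pow (hG0 ω)]
    exact pow_le_pow_left₀ zero_le ENNReal.ofReal_toReal_le 2
  have hG2i : Integrable (fun ω => G ω ^ 2) P := by
    refine ⟨hGm.pow 2, ?_⟩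
    rw [hasFiniteIntegral_iff_ofReal (ae_of_all _ fun ω => sq_nonneg _)]
    exact hG2.trans_lt ENNReal.ofReal_lt_top
  have hG2C : ∫ ω, G ω ^ 2 ∂P ≤ 4 * C ^ 2 * w ^ 2 := by
    rw [integral_eq_lintegral_of_nonneg_ae (ae_of_all _ fun ω => sq_nonneg _) (hGm.pow 2)]
    exact ENNReal.toReal_le_of_le_ofReal (by positivity) hG2
  have hGI : ∀ᵐ ω ∂P, ∀ r, u ≤ r → r ≤ v → |I r ω - I u ω| ≤ G ω := by
    filter_upwards [hG't] with ω hω r hr hrv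
    have h1 := le_supNorm hrv (fun s ω => 1 * (I s ω - I (min s u) ω)) ω
    beta_reduce at h1
    rw [min_eq_right hr, one_mul, Real.enorm_eq_ofReal_abs,
      ENNReal.ofReal_le_iff_le_toReal hω.ne] at h1
    exact h1
  have hdrift : ∀ᵐ ω ∂P, ∀ r, u ≤ r → r ≤ v → ∀ M m, (∀ s ∈ Ioc u r, |β s ω - m| ≤ M) →
      |(∫ s in (0 : ℝ)..r, β s.toNNReal ω) - (∫ s in (0 : ℝ)..u, β s.toNNReal ω) - m * (r - u)| ≤
        M * (r - u) := by
    filter_upwards [hβ.ae_pathMeas] with ω hm r hr hrv M m hM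
    have hru : (u : ℝ) ≤ r := by exact_mod_cast hr
    rw [intervalIntegral.integral_interval_sub_left
      (hm.intervalIntegrable (fun s hs => hβC s hs ω) (hrv.trans hv))
      (hm.intervalIntegrable (fun s hs => hβC s hs ω) hu)]
    have h1 : ∫ s in (u : ℝ)..r, (β s.toNNReal ω - m) =
        (∫ s in (u : ℝ)..r, β s.toNNReal ω) - m * (r - u) := by
      rw [intervalIntegral.integral_sub, intervalIntegral.integral_const, smul_eq_mul, mul_comm m]
      · exact (hm.intervalIntegrable (fun s hs => hβC s hs ω) hu).symm.trans
          (hm.intervalIntegrable (fun s hs => hβC s hs ω) (hrv.trans hv))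
      · exact intervalIntegrable_const
    rw [← h1]
    have h2 := intervalIntegral.norm_integral_le_of_norm_le_const (a := (u : ℝ)) (b := (r : ℝ))
      (f := fun s : ℝ => β s.toNNReal ω - m) (C := M) fun s hs => by
        rw [uIoc_of_le hru] at hs
        exact hM _ ⟨Real.lt_toNNReal_iff_coe_lt.2 hs.1, Real.toNNReal_le_iff_le_coe.2 hs.2⟩
    rwa [abs_of_nonneg (sub_nonneg.2 hru)] at h2
  have hyY : ∀ᵐ ω ∂P, y ω = Y u ω := by
    filter_upwards [hYε] with ω hω using max_eq_left (hω u hu)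
  have hYr : ∀ᵐ ω ∂P, ∀ r, u ≤ r → r ≤ v → Y r ω ≤ y ω + (C * w ^ 2 + G ω) := by
    filter_upwards [hdrift, hGI, hYeq, hyY] with ω h1 h2 h3 h4 r hr hrv
    have h5 := h1 r hr hrv C 0 fun s hs => by
      rw [sub_zero]
      exact hβC s (hs.2.trans (hrv.trans hv)) ω
    have h6 : (r : ℝ) - u ≤ w ^ 2 := by
      rw [← hvu]
      have : (r : ℝ) ≤ v := by exact_mod_cast hrv
      linarith
    have h7 : C * ((r : ℝ) - u) ≤ C * w ^ 2 := by gcongr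
    rw [h4, h3 r (hrv.trans hv), h3 u hu]
    rw [zero_mul, sub_zero] at h5
    linarith [(abs_le.1 h5).2, (abs_le.1 (h2 r hr hrv)).2]
  have hpt : ∀ᵐ ω ∂P, (Y v ω)⁻¹ ≤ p ω + L * w ^ 2 * p ω - i ω * p ω ^ 2 +
      2 * (i ω ^ 2 * p ω ^ 3) + L * e ^ 2 * w * G ω ^ 2 + 8 * e ^ 4 / w * i ω ^ 4 + w ^ 3 * D₁ := by
    filter_upwards [hdrift, hYeq, hyY, hYr, hYε, hβY] with ω h1 h2 h3 h4 h5 h6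
    have hyv := h5 v hv
    refine inv_taylor_bound (b := (∫ s in (0 : ℝ)..v, β s.toNNReal ω) -
      (∫ s in (0 : ℝ)..u, β s.toNNReal ω)) (hy0 ω) rfl (hpe ω) (hε.trans_le hyv)
      (inv_anti₀ hε hyv) ?_ hL hC hw hw1 (hG0 ω) ?_ ?_
    · rw [h3, h2 v hv, h2 u hu, hi]
      ring
    · have h7 := h1 v huv le_rfl C 0 fun s hs => by
        rw [sub_zero]
        exact hβC s (hs.2.trans hv) ω
      rwa [zero_mul, sub_zero, hvu] at h7
    · have hLG : 0 ≤ L * (y ω + (C * w ^ 2 + G ω)) :=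
        mul_nonneg hL (add_nonneg (hy0 ω).le (add_nonneg (by positivity) (hG0 ω)))
      -- The drift lies between `-L (y + C w² + G)` and `C`. Centring at the midpoint `m` with
      -- radius `M` extracts the one-sided bound from the two-sided `hdrift`.
      set M := (C + L * (y ω + (C * w ^ 2 + G ω))) / 2 with hM
      set m := (C - L * (y ω + (C * w ^ 2 + G ω))) / 2 with hm
      have h7 := h1 v huv le_rfl M m fun s hs => by
        have h8 := h6 s (hs.2.trans hv)
        have h9 := mul_le_mul_of_nonneg_left (h4 s hs.1.le hs.2) hL
        have h10 := (abs_le.1 (hβC s (hs.2.trans hv) ω)).2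
        rw [hM, hm]
        exact abs_le.2 ⟨by linarith, by linarith⟩
      rw [hvu] at h7
      have h8 := (abs_le.1 h7).1
      have h9 : M * w ^ 2 - m * w ^ 2 = L * w ^ 2 * (y ω + (C * w ^ 2 + G ω)) := by
        rw [hM, hm]
        ring
      linarith
  -- expectations
  have hpi : Integrable p P := by
    refine Integrable.of_bound ((hpm.mono (F.le u) le_rfl).aestronglyMeasurable) e
      (ae_of_all _ fun ω => ?_)
    rw [Real.norm_of_nonneg (hp0 ω).le]
    exact hpe ω
  have hip : Integrable (fun ω => i ω * p ω ^ 2) P ∧ ∫ ω, i ω * p ω ^ 2 ∂P = 0 := by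
    have hb : ∀ ω, |p ω ^ 2| ≤ e ^ 2 := fun ω => by
      rw [abs_of_nonneg (sq_nonneg _)]
      exact pow_le_pow_left₀ (hp0 ω).le (hpe ω) 2
    have h1 := (hafter (hpm.pow_const 2) ⟨_, hb⟩).integral_eq_zero hW (hafterC (hpm.pow_const 2))
      (hafterf hb) le_rfl
    have h2 := ((hafter (hpm.pow_const 2) ⟨_, hb⟩).memLp_two hW (hafterC (hpm.pow_const 2))
      (lintegral_sqInt_ne_top (hafterf hb)) le_rfl).integrable (by norm_num)
    simp only [min_eq_right huv] at h1 h2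
    exact ⟨by simpa only [mul_comm] using h2, by simpa only [mul_comm] using h1⟩
  have hi2 : Integrable (fun ω => i ω ^ 2 * p ω ^ 3) P ∧ ∫ ω, i ω ^ 2 * p ω ^ 3 ∂P ≤
      8 * L ^ 2 * w ^ 2 * (∫ ω, p ω ∂P) + 80 * L ^ 2 * e ^ 3 * C ^ 2 * w ^ 4 := by
    -- With this weight `i² p³` is the square of a stochastic integral started at `u`, to which
    -- Doob's inequality applies. Since `p³ y² = p`, the bound `|H| ≤ L Y` produces a multiple of
    -- `E[p]` that does not involve `ε`.
    set c : Ω → ℝ := fun ω => √(p ω ^ 3) with hc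
    have hcm : Measurable[F u] c := (hpm.pow_const 3).sqrt
    have hc2 : ∀ ω, c ω ^ 2 = p ω ^ 3 := fun ω => Real.sq_sqrt (pow_nonneg (hp0 ω).le 3)
    have hb : ∀ ω, |c ω| ≤ √(e ^ 3) := fun ω => by
      rw [abs_of_nonneg (Real.sqrt_nonneg _)]
      exact Real.sqrt_le_sqrt (pow_le_pow_left₀ (hp0 ω).le (hpe ω) 3)
    have h1 := (hafter hcm ⟨_, hb⟩).lintegral_supNorm_sq_le hW (hafterC hcm)
    have h2 := ((hafter hcm ⟨_, hb⟩).memLp_two hW (hafterC hcm)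
      (lintegral_sqInt_ne_top (hafterf hb)) le_rfl).integrable_sq
    simp only [min_eq_right huv, mul_pow, hc2] at h2
    have h2' : Integrable (fun ω => i ω ^ 2 * p ω ^ 3) P := by simpa only [mul_comm] using h2
    refine ⟨h2', ?_⟩
    have hRi : Integrable (fun ω => 2 * L ^ 2 * p ω + 2 * L ^ 2 * e ^ 3 *
        (2 * C ^ 2 * w ^ 4 + 2 * G ω ^ 2)) P :=
      (hpi.const_mul _).add (((integrable_const _).add (hG2i.const_mul 2)).const_mul _)
    have hR0 : ∀ ω, 0 ≤ 2 * L ^ 2 * p ω + 2 * L ^ 2 * e ^ 3 * (2 * C ^ 2 * w ^ 4 + 2 * G ω ^ 2) :=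
      fun ω => by
        have := (hp0 ω).le
        positivity
    have h3 : ∫⁻ ω, ENNReal.ofReal (i ω ^ 2 * p ω ^ 3) ∂P ≤ ENNReal.ofReal (4 * (w ^ 2 *
        ∫ ω, (2 * L ^ 2 * p ω + 2 * L ^ 2 * e ^ 3 * (2 * C ^ 2 * w ^ 4 + 2 * G ω ^ 2)) ∂P)) := by
      rw [ENNReal.ofReal_mul (by norm_num), ENNReal.ofReal_mul (sq_nonneg w),
        ofReal_integral_eq_lintegral_ofReal hRi (ae_of_all _ hR0), ENNReal.ofReal_ofNat,
        ← lintegral_const_mul' _ _ ENNReal.ofReal_ne_top]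
      calc _ ≤ ∫⁻ ω, supNorm v (fun s ω => c ω * (I s ω - I (min s u) ω)) ω ^ 2 ∂P := by
            refine lintegral_mono fun ω => ?_
            have h4 := le_supNorm le_rfl (fun s ω => c ω * (I s ω - I (min s u) ω)) ω (S := v)
            beta_reduce at h4
            rw [min_eq_right huv] at h4
            refine le_trans (le_of_eq ?_) (pow_le_pow_left₀ zero_le h4 2)
            rw [Real.enorm_eq_ofReal_abs, ← ENNReal.ofReal_pow (abs_nonneg _), sq_abs, mul_pow, hc2,
              mul_comm]
        _ ≤ _ := by
            refine h1.trans ?_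
            gcongr 4 * ?_
            refine lintegral_mono_ae ?_
            filter_upwards [hYr, hHY] with ω h5 h6
            rw [← hvu]
            refine sqInt_after_le fun r hr => ?_
            rw [Real.enorm_eq_ofReal_abs, ← ENNReal.ofReal_pow (abs_nonneg _), sq_abs, mul_pow, hc2]
            refine ENNReal.ofReal_le_ofReal ?_
            have h7 : |H r ω| ≤ L * (y ω + (C * w ^ 2 + G ω)) :=
              (h6 r (hr.2.trans hv)).trans (mul_le_mul_of_nonneg_left (h5 r hr.1.le hr.2) hL)
            have h8 : H r ω ^ 2 ≤ L ^ 2 * (2 * y ω ^ 2 + 2 * (2 * C ^ 2 * w ^ 4 + 2 * G ω ^ 2)) := by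
              rw [← sq_abs]
              calc _ ≤ (L * (y ω + (C * w ^ 2 + G ω))) ^ 2 := pow_le_pow_left₀ (abs_nonneg _) h7 2
                _ = L ^ 2 * (y ω + (C * w ^ 2 + G ω)) ^ 2 := by ring
                _ ≤ _ := by
                  gcongr
                  have e1 : 2 * y ω ^ 2 + 2 * (2 * C ^ 2 * w ^ 4 + 2 * G ω ^ 2) -
                      (y ω + (C * w ^ 2 + G ω)) ^ 2 =
                      (y ω - (C * w ^ 2 + G ω)) ^ 2 + 2 * (C * w ^ 2 - G ω) ^ 2 := by ring
                  have e2 : 0 ≤ (y ω - (C * w ^ 2 + G ω)) ^ 2 + 2 * (C * w ^ 2 - G ω) ^ 2 := by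
                    positivity
                  linarith
            have h9 : p ω * y ω = 1 := inv_mul_cancel₀ (hy0 ω).ne'
            have h10 : p ω ^ 3 ≤ e ^ 3 := pow_le_pow_left₀ (hp0 ω).le (hpe ω) 3
            calc p ω ^ 3 * H r ω ^ 2
                ≤ p ω ^ 3 * (L ^ 2 * (2 * y ω ^ 2 + 2 * (2 * C ^ 2 * w ^ 4 + 2 * G ω ^ 2))) :=
                  mul_le_mul_of_nonneg_left h8 (pow_nonneg (hp0 ω).le 3)
              _ = 2 * L ^ 2 * p ω * (p ω * y ω) ^ 2 +
                  2 * L ^ 2 * p ω ^ 3 * (2 * C ^ 2 * w ^ 4 + 2 * G ω ^ 2) := by ring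
              _ ≤ _ := by
                  rw [h9, one_pow, mul_one]
                  gcongr
    have h4 : ∫ ω, i ω ^ 2 * p ω ^ 3 ∂P ≤ 4 * (w ^ 2 *
        ∫ ω, (2 * L ^ 2 * p ω + 2 * L ^ 2 * e ^ 3 * (2 * C ^ 2 * w ^ 4 + 2 * G ω ^ 2)) ∂P) := by
      rw [integral_eq_lintegral_of_nonneg_ae (ae_of_all _ fun ω =>
        mul_nonneg (sq_nonneg _) (pow_nonneg (hp0 ω).le 3)) h2'.1]
      exact ENNReal.toReal_le_of_le_ofReal
        (mul_nonneg (by norm_num) (mul_nonneg (sq_nonneg _) (integral_nonneg hR0))) h3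
    have h5 : Integrable (fun ω => 2 * L ^ 2 * e ^ 3 * (2 * C ^ 2 * w ^ 4 + 2 * G ω ^ 2)) P :=
      ((integrable_const _).add (hG2i.const_mul 2)).const_mul _
    rw [integral_add (hpi.const_mul _) h5, integral_const_mul, integral_const_mul,
      integral_add (integrable_const _) (hG2i.const_mul 2), integral_const, probReal_univ,
      one_smul, integral_const_mul (2 : ℝ) fun ω => G ω ^ 2] at h4
    have hw4 : w ^ 4 ≤ w ^ 2 := pow_le_pow_of_le_one hw.le hw1 (by norm_num)
    have h6 : 2 * C ^ 2 * w ^ 4 + 2 * ∫ ω, G ω ^ 2 ∂P ≤ 10 * C ^ 2 * w ^ 2 := by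
      have := mul_le_mul_of_nonneg_left hw4 (show 0 ≤ 2 * C ^ 2 by positivity)
      linarith
    have h7 : 8 * w ^ 2 * (L ^ 2 * e ^ 3) * (2 * C ^ 2 * w ^ 4 + 2 * ∫ ω, G ω ^ 2 ∂P) ≤
        8 * w ^ 2 * (L ^ 2 * e ^ 3) * (10 * C ^ 2 * w ^ 2) :=
      mul_le_mul_of_nonneg_left h6 (by positivity)
    calc _ ≤ _ := h4
      _ = 8 * L ^ 2 * w ^ 2 * (∫ ω, p ω ∂P) +
          8 * w ^ 2 * (L ^ 2 * e ^ 3) * (2 * C ^ 2 * w ^ 4 + 2 * ∫ ω, G ω ^ 2 ∂P) := by ring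
      _ ≤ _ := by linarith
  have hi4 : Integrable (fun ω => i ω ^ 4) P ∧
      ∫ ω, i ω ^ 4 ∂P ≤ (4 + 3 * gaussMom4) * C ^ 4 * w ^ 4 := by
    have h1 := hI.lintegral_incr_pow_four_le hW hH hHC huv hv
    have h2 : ∫⁻ ω, ENNReal.ofReal (i ω ^ 4) ∂P ≤
        ENNReal.ofReal ((4 + 3 * gaussMom4) * C ^ 4 * w ^ 4) := by
      calc _ = ∫⁻ ω, ‖I v ω - I u ω‖ₑ ^ 4 ∂P := lintegral_congr fun ω => by
            rw [Real.enorm_eq_ofReal_abs, ← ENNReal.ofReal_pow (abs_nonneg _),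
              Even.pow_abs ⟨2, rfl⟩]
        _ ≤ _ := by
            refine h1.trans (le_of_eq ?_)
            rw [hvu]
            ring_nf
    have h4 : ∀ ω, 0 ≤ i ω ^ 4 := fun ω => Even.pow_nonneg ⟨2, rfl⟩ _
    have h3 : AEStronglyMeasurable (fun ω => i ω ^ 4) P :=
      ((hI.aestronglyMeasurable hW hv).sub (hI.aestronglyMeasurable hW hu)).pow 4
    constructor
    · refine ⟨h3, ?_⟩
      rw [hasFiniteIntegral_iff_ofReal (ae_of_all _ h4)]
      exact h2.trans_lt ENNReal.ofReal_lt_top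
    · rw [integral_eq_lintegral_of_nonneg_ae (ae_of_all _ h4) h3]
      exact ENNReal.toReal_le_of_le_ofReal (by positivity) h2
  have hYv : Integrable (fun ω => (Y v ω)⁻¹) P := by
    refine Integrable.of_bound
      (((hY v (hqu.trans huv) hv).mono (F.le v) le_rfl).inv.aestronglyMeasurable) e ?_
    filter_upwards [hYε] with ω hω
    rw [Real.norm_of_nonneg (inv_nonneg.2 (hε.le.trans (hω v hv)))]
    exact inv_anti₀ hε (hω v hv)
  have j1 : Integrable (fun ω => L * w ^ 2 * p ω) P := hpi.const_mul _
  have j2 : Integrable (fun ω => p ω + L * w ^ 2 * p ω) P := hpi.add j1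
  have j3 : Integrable (fun ω => p ω + L * w ^ 2 * p ω - i ω * p ω ^ 2) P := j2.sub hip.1
  have j4 : Integrable (fun ω => 2 * (i ω ^ 2 * p ω ^ 3)) P := hi2.1.const_mul _
  have j5 : Integrable (fun ω => p ω + L * w ^ 2 * p ω - i ω * p ω ^ 2 +
    2 * (i ω ^ 2 * p ω ^ 3)) P := j3.add j4
  have j6 : Integrable (fun ω => L * e ^ 2 * w * G ω ^ 2) P := hG2i.const_mul _
  have j7 : Integrable (fun ω => p ω + L * w ^ 2 * p ω - i ω * p ω ^ 2 +
    2 * (i ω ^ 2 * p ω ^ 3) + L * e ^ 2 * w * G ω ^ 2) P := j5.add j6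
  have j8 : Integrable (fun ω => 8 * e ^ 4 / w * i ω ^ 4) P := hi4.1.const_mul _
  have j9 : Integrable (fun ω => p ω + L * w ^ 2 * p ω - i ω * p ω ^ 2 +
    2 * (i ω ^ 2 * p ω ^ 3) + L * e ^ 2 * w * G ω ^ 2 + 8 * e ^ 4 / w * i ω ^ 4) P := j7.add j8
  have hfin := integral_mono_ae hYv (j9.add (integrable_const (w ^ 3 * D₁))) hpt
  simp only [Pi.add_apply] at hfin
  rw [integral_add j9 (integrable_const _), integral_add j7 j8, integral_add j5 j6,
    integral_add j3 j4, integral_sub j2 hip.1, integral_add hpi j1, hip.2, integral_const_mul,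
    integral_const_mul, integral_const_mul, integral_const_mul, integral_const, probReal_univ,
    one_smul, sub_zero] at hfin
  have hpY : ∫ ω, p ω ∂P = ∫ ω, (Y u ω)⁻¹ ∂P := by
    refine integral_congr_ae ?_
    filter_upwards [hyY] with ω hω
    simp only [hp, hω]
  rw [← hpY]
  refine hfin.trans ?_
  have k1 : L * e ^ 2 * w * ∫ ω, G ω ^ 2 ∂P ≤ L * e ^ 2 * w * (4 * C ^ 2 * w ^ 2) :=
    mul_le_mul_of_nonneg_left hG2C (by positivity)
  have k2 : 8 * e ^ 4 / w * ∫ ω, i ω ^ 4 ∂P ≤ 8 * e ^ 4 / w * ((4 + 3 * gaussMom4) * C ^ 4 * w ^ 4) :=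
    mul_le_mul_of_nonneg_left hi4.2 (by positivity)
  have k3 : 8 * e ^ 4 / w * ((4 + 3 * gaussMom4) * C ^ 4 * w ^ 4) =
      8 * e ^ 4 * ((4 + 3 * gaussMom4) * C ^ 4) * w ^ 3 := by
    field_simp
  have k4 : 160 * L ^ 2 * e ^ 3 * C ^ 2 * w ^ 4 ≤ 160 * L ^ 2 * e ^ 3 * C ^ 2 * w ^ 3 :=
    mul_le_mul_of_nonneg_left (pow_le_pow_of_le_one hw.le hw1 (by norm_num)) (by positivity)
  have k5 : D * w ^ 3 = w ^ 3 * D₁ + L * e ^ 2 * w * (4 * C ^ 2 * w ^ 2) +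
      8 * e ^ 4 * ((4 + 3 * gaussMom4) * C ^ 4) * w ^ 3 + 160 * L ^ 2 * e ^ 3 * C ^ 2 * w ^ 3 := by
    rw [hD]
    ring
  rw [k5]
  linarith [hi2.2]

/-- A bound for `E[1 / Y]` for an Itô process `Y` bounded away from `0` whose coefficients are
dominated by `Y`; the bound does not depend on the lower bound for `Y`. -/
theorem integral_inv_le [IsProbabilityMeasure P] (hW : IsFBrownian F P W) {q S : ℝ≥0}
    {Y β H I : ℝ≥0 → Ω → ℝ} {ξ : Ω → ℝ} {ε L C : ℝ} (hqS : q ≤ S) (hε : 0 < ε) (hL : 0 ≤ L)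
    (hC : 0 ≤ C) (hY : ∀ s, q ≤ s → s ≤ S → Measurable[F s] (Y s)) (hβ : Caglad F P S β)
    (hH : Caglad F P S H) (hI : IsItoIntegral F P W S H I)
    (hYeq : ∀ᵐ ω ∂P, ∀ s ≤ S, Y s ω = ξ ω + (∫ u in (0 : ℝ)..s, β u.toNNReal ω) + I s ω)
    (hYε : ∀ᵐ ω ∂P, ∀ s ≤ S, ε ≤ Y s ω)
    (hβY : ∀ᵐ ω ∂P, ∀ s ≤ S, -(L * Y s ω) ≤ β s ω) (hHY : ∀ᵐ ω ∂P, ∀ s ≤ S, |H s ω| ≤ L * Y s ω)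
    (hβC : ∀ s ≤ S, ∀ ω, |β s ω| ≤ C) (hHC : ∀ s ≤ S, ∀ ω, |H s ω| ≤ C) :
    ∫ ω, (Y S ω)⁻¹ ∂P ≤ Real.exp ((L + 16 * L ^ 2) * (S - q)) * ∫ ω, (Y q ω)⁻¹ ∂P := by
  obtain ⟨D, hD, hstep⟩ :=
    integral_inv_step_le hW hε hL hC hY hβ hH hI hYeq hYε hβY hHY hβC hHC
  rcases eq_or_lt_of_le hqS with rfl | hlt
  · simp
  set K := L + 16 * L ^ 2 with hK
  set a : ℝ≥0 → ℝ := fun s => ∫ ω, (Y s ω)⁻¹ ∂P with ha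
  have hK0 : 0 ≤ K := by positivity
  set ℓ : ℝ := S - q with hℓ
  have hℓ0 : 0 < ℓ := sub_pos.2 (NNReal.coe_lt_coe.2 hlt)
  -- With `n` steps of length `w² = ℓ / n`, the errors add up to `n D w³ = ℓ D w`, which vanishes as
  -- `n → ∞`. The constant `D` depends on `ε`, but it disappears in the limit.
  have key : ∀ n : ℕ, 0 < n → ℓ / n ≤ 1 → a S ≤ Real.exp (K * ℓ) * (a q + ℓ * D * √(ℓ / n)) := by
    intro n hn hn1
    have hn0 : (0 : ℝ) < n := Nat.cast_pos.2 hn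
    set w := √(ℓ / n) with hw
    have hw0 : 0 < w := Real.sqrt_pos.2 (by positivity)
    have hw2 : w ^ 2 = ℓ / n := Real.sq_sqrt (by positivity)
    have hw1 : w ≤ 1 := Real.sqrt_le_one.2 hn1
    obtain ⟨d, hd⟩ : ∃ d : ℝ≥0, (d : ℝ) = ℓ / n := ⟨(ℓ / n).toNNReal, Real.coe_toNNReal _ (by positivity)⟩
    set τ : ℕ → ℝ≥0 := fun i => q + i * d with hτ
    have hτn : τ n = S := by
      apply NNReal.coe_injective
      rw [hτ]
      push_cast
      rw [hd, mul_div_cancel₀ _ hn0.ne', hℓ]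
      ring
    have hτs : ∀ i, ((τ (i + 1) : ℝ≥0) : ℝ) - τ i = w ^ 2 := fun i => by
      rw [hτ, hw2]
      push_cast
      rw [hd]
      ring
    have hτm : Monotone τ := monotone_nat_of_le_succ fun i => by
      rw [← NNReal.coe_le_coe]
      linarith [hτs i, sq_nonneg w]
    have hind : ∀ i ≤ n, a (τ i) ≤ Real.exp (K * (i * w ^ 2)) * (a q + i * (D * w ^ 3)) := by
      intro i
      induction i with
      | zero => intro _; simp [hτ]
      | succ i ih =>
        intro hi
        have h1 := ih (by omega)
        have h2 := hstep (τ i) (τ (i + 1)) w (by simp [hτ]) (hτm (Nat.le_succ i))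
          (hτn ▸ hτm hi) hw0 hw1 (hτs i)
        have h3 : 1 + K * w ^ 2 ≤ Real.exp (K * w ^ 2) := by
          linarith [Real.add_one_le_exp (K * w ^ 2)]
        have h4 : 1 ≤ Real.exp (K * ((i + 1 : ℕ) * w ^ 2)) := Real.one_le_exp (by positivity)
        have h5 : Real.exp (K * ((i + 1 : ℕ) * w ^ 2)) =
            Real.exp (K * (i * w ^ 2)) * Real.exp (K * w ^ 2) := by
          rw [← Real.exp_add]
          push_cast
          ring_nf
        have haq : 0 ≤ a q := integral_nonneg_of_ae (by
          filter_upwards [hYε] with ω hω using inv_nonneg.2 (hε.le.trans (hω q hqS)))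
        have hD3 : 0 ≤ D * w ^ 3 := by positivity
        calc a (τ (i + 1)) ≤ a (τ i) * (1 + K * w ^ 2) + D * w ^ 3 := h2
          _ ≤ Real.exp (K * (i * w ^ 2)) * (a q + i * (D * w ^ 3)) * Real.exp (K * w ^ 2) +
              Real.exp (K * ((i + 1 : ℕ) * w ^ 2)) * (D * w ^ 3) := by
            refine add_le_add (mul_le_mul h1 h3 (by positivity) (by positivity)) ?_
            exact le_mul_of_one_le_left hD3 h4
          _ = _ := by
            rw [h5]
            push_cast
            ring
    have h6 := hind n le_rfl
    have h7 : n * w ^ 2 = ℓ := by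
      rw [hw2]
      field_simp
    rw [hτn, h7] at h6
    calc a S ≤ _ := h6
      _ = Real.exp (K * ℓ) * (a q + n * w ^ 2 * D * w) := by ring
      _ = _ := by rw [h7]
  have hlim : Tendsto (fun n : ℕ => Real.exp (K * ℓ) * (a q + ℓ * D * √(ℓ / n))) atTop
      (𝓝 (Real.exp (K * ℓ) * (a q + ℓ * D * √0))) :=
    (((tendsto_const_div_atTop_nhds_zero_nat ℓ).sqrt.const_mul _).const_add _).const_mul _
  rw [Real.sqrt_zero, mul_zero, add_zero] at hlim
  refine ge_of_tendsto hlim ?_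
  filter_upwards [eventually_gt_atTop 0,
    (tendsto_const_div_atTop_nhds_zero_nat ℓ).eventually_le_const one_pos] with n h1 h2
  exact key n h1 h2

/-! ### Locality in time, exit from an interval, and positivity of the reflected process. -/

theorem IsItoIntegral.ae_eq_of_zero [IsProbabilityMeasure P] (hW : IsFBrownian F P W) {S : ℝ≥0}
    {H I : ℝ≥0 → Ω → ℝ} (hI : IsItoIntegral F P W S H I) (hH : Caglad F P S H) :
    ∀ᵐ ω ∂P, ∀ u v, u ≤ v → v ≤ S → (∀ r ∈ Ioc u v, H r ω = 0) → I v ω = I u ω := by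
  -- For fixed endpoints this is locality applied to the integrand restarted at the left one. Dyadic
  -- endpoints share one null set, and continuity of `I` extends the statement to random `u` and
  -- `v`.
  have h1 : ∀ p p', ∀ᵐ ω ∂P, (∀ r ∈ Ioc (dyadic p * S) (dyadic p' * S), H r ω = 0) →
      dyadic p * S ≤ dyadic p' * S → I (dyadic p' * S) ω = I (dyadic p * S) ω := by
    intro p p'
    have hS' := dyadic_mul_le p' S
    have h2 := (((hI.mono hS').after (u := dyadic p * S) (c := fun _ => 1) measurable_const
      ⟨1, by simp⟩).ae_eq_of_eq hW (isItoIntegral_zero _)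
      ((hH.mono hS').after measurable_const).ae_pathMeas)
    filter_upwards [h2] with ω h2 h3 h4
    have h5 := h2 (fun r hr => by
      split_ifs with h
      · rw [h3 r ⟨h, hr.2⟩, mul_zero]
      · rfl) _ le_rfl
    rw [min_eq_right h4, one_mul] at h5
    linarith
  filter_upwards [ae_all_iff.2 fun p => ae_all_iff.2 (h1 p), hI.ae_continuousOn hW]
    with ω h1 hc u v huv hv h0
  rcases eq_or_lt_of_le huv with rfl | huv
  · rfl
  have hcl : ∀ s ≤ S, ∀ A ⊆ Icc 0 S, ContinuousWithinAt (fun s => I s ω) A s :=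
    fun s hs A hA => (hc s ⟨zero_le, hs⟩).mono hA
  by_contra hne
  have hd : 0 < |I v ω - I u ω| / 2 := by
    have := abs_pos.2 (sub_ne_zero.2 hne)
    linarith
  have hsub : Icc u v ⊆ Icc 0 S := Icc_subset_Icc zero_le hv
  have e1 : ∀ᶠ r in 𝓝[>] u, |I r ω - I u ω| < |I v ω - I u ω| / 2 := by
    have := Metric.tendsto_nhds.1 (hcl u (huv.le.trans hv) (Icc u v) hsub) _ hd
    rw [nhdsWithin_Icc_eq_nhdsGE huv] at this
    exact nhdsWithin_mono _ Ioi_subset_Ici_self this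
  have e2 : ∀ᶠ r in 𝓝[<] v, |I r ω - I v ω| < |I v ω - I u ω| / 2 := by
    have := Metric.tendsto_nhds.1 (hcl v hv (Icc u v) hsub) _ hd
    rw [nhdsWithin_Icc_eq_nhdsLE huv] at this
    exact nhdsWithin_mono _ Iio_subset_Iic_self this
  obtain ⟨b, hub, hb⟩ := (mem_nhdsGT_iff_exists_Ioo_subset' huv).1 e1
  obtain ⟨m, hum, hmb⟩ := exists_between (lt_min hub huv)
  obtain ⟨a, hav, ha⟩ := (mem_nhdsLT_iff_exists_Ioo_subset' (lt_of_lt_of_le hmb (min_le_right _ _))).1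
    e2
  obtain ⟨m', hm', hmv⟩ := exists_between (max_lt (lt_of_lt_of_le hmb (min_le_right _ _)) hav)
  obtain ⟨p, hp1, hp2⟩ := exists_dyadic_mul hum ((hmb.le.trans (min_le_right _ _)).trans hv)
  obtain ⟨p', hp1', hp2'⟩ := exists_dyadic_mul hm' (hmv.le.trans hv)
  have h3 := h1 p p' (fun r hr => h0 r ⟨hp1.trans hr.1, hr.2.trans (hp2'.trans hmv.le)⟩)
    (hp2.trans ((le_max_left _ _).trans hp1'.le))
  have h4 := hb ⟨hp1, hp2.trans_lt (hmb.trans_le (min_le_left _ _))⟩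
  have h5 := ha ⟨(le_max_right _ _).trans_lt hp1', hp2'.trans_lt hmv⟩
  simp only [mem_ofPred_eq] at h4 h5
  rw [h3] at h5
  have h6 := abs_sub_le (I v ω) (I (dyadic p * S) ω) (I u ω)
  rw [abs_sub_comm (I v ω) (I (dyadic p * S) ω)] at h6
  linarith

/-- The exit time of a continuous path from an interval. -/
theorem exists_exit_time {x : ℝ≥0 → ℝ} {q s : ℝ≥0} {a b : ℝ} (hx : ContinuousOn x (Icc q s))
    (hqs : q ≤ s) (hq : x q ∈ Icc a b) :
    ∃ τ ∈ Icc q s, (∀ u ∈ Icc q τ, x u ∈ Icc a b) ∧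
      ∀ r, τ < r → r ≤ s → ∃ u ∈ Ioc τ r, x u ∉ Icc a b := by
  set A : Set ℝ≥0 := {τ | τ ∈ Icc q s ∧ ∀ u ∈ Icc q τ, x u ∈ Icc a b} with hA
  have hqA : q ∈ A := ⟨⟨le_rfl, hqs⟩, fun u hu => by rwa [le_antisymm hu.2 hu.1]⟩
  have hbdd : BddAbove A := ⟨s, fun τ h => h.1.2⟩
  set τ := sSup A with hτ
  have hqτ : q ≤ τ := le_csSup hbdd hqA
  have hτs : τ ≤ s := csSup_le ⟨q, hqA⟩ fun τ h => h.1.2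
  have hlt : ∀ u ∈ Ico q τ, x u ∈ Icc a b := by
    intro u hu
    obtain ⟨r, hr, hur⟩ := exists_lt_of_lt_csSup ⟨q, hqA⟩ hu.2
    exact hr.2 u ⟨hu.1, hur.le⟩
  have hτx : x τ ∈ Icc a b := by
    rcases eq_or_lt_of_le hqτ with h | h
    · rwa [← h]
    · have h1 : τ ∈ closure (Ico q τ) := by
        rw [closure_Ico h.ne]
        exact ⟨hqτ, le_rfl⟩
      exact isClosed_Icc.closure_subset (((hx τ ⟨hqτ, hτs⟩).mono
        (Ico_subset_Icc_self.trans (Icc_subset_Icc_right hτs))).mem_closure h1 hlt)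
  have hτA : ∀ u ∈ Icc q τ, x u ∈ Icc a b := fun u hu => by
    rcases eq_or_lt_of_le hu.2 with h | h
    · rwa [h]
    · exact hlt u ⟨hu.1, h⟩
  refine ⟨τ, ⟨hqτ, hτs⟩, hτA, fun r hr hrs => ?_⟩
  by_contra! h
  have : r ∈ A := ⟨⟨hqτ.trans hr.le, hrs⟩, fun u hu => by
    rcases le_or_gt u τ with h1 | h1
    · exact hτA u ⟨hu.1, h1⟩
    · exact h u ⟨h1, hu.2⟩⟩
  exact absurd (le_csSup hbdd this) (not_le.2 hr)

/-- The increments of two Itô processes coincide where their coefficients do. -/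
theorem ae_increment_eq [IsProbabilityMeasure P] (hW : IsFBrownian F P W) {S : ℝ≥0}
    {β β' H H' I I' : ℝ≥0 → Ω → ℝ} (hβ : Caglad F P S β) (hβ' : Caglad F P S β')
    (hH : Caglad F P S H) (hH' : Caglad F P S H') (hI : IsItoIntegral F P W S H I)
    (hI' : IsItoIntegral F P W S H' I') :
    ∀ᵐ ω ∂P, ∀ u v : ℝ≥0, u ≤ v → v ≤ S → (∀ r ∈ Ioc u v, β r ω = β' r ω ∧ H r ω = H' r ω) →
      ((∫ r in (0 : ℝ)..v, β r.toNNReal ω) + I v ω) - ((∫ r in (0 : ℝ)..u, β r.toNNReal ω) + I u ω) =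
      ((∫ r in (0 : ℝ)..v, β' r.toNNReal ω) + I' v ω) -
        ((∫ r in (0 : ℝ)..u, β' r.toNNReal ω) + I' u ω) := by
  filter_upwards [(hI.sub hI' hH.ae_pathMeas).ae_eq_of_zero hW (hH.sub hH'), hβ.ae_pathMeas,
    hβ'.ae_pathMeas, hβ.bdd, hβ'.bdd] with ω h1 m m' ⟨C, hC⟩ ⟨C', hC'⟩ u v huv hv h
  have h2 := h1 u v huv hv fun r hr => sub_eq_zero.2 (h r hr).2
  have h3 : ((∫ r in (0 : ℝ)..v, β r.toNNReal ω) - ∫ r in (0 : ℝ)..u, β r.toNNReal ω) =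
      (∫ r in (0 : ℝ)..v, β' r.toNNReal ω) - ∫ r in (0 : ℝ)..u, β' r.toNNReal ω := by
    rw [intervalIntegral.integral_interval_sub_left (m.intervalIntegrable hC hv)
      (m.intervalIntegrable hC (huv.trans hv)), intervalIntegral.integral_interval_sub_left
      (m'.intervalIntegrable hC' hv) (m'.intervalIntegrable hC' (huv.trans hv))]
    refine intervalIntegral.integral_congr_ae (ae_of_all _ fun r hr => ?_)
    rw [uIoc_of_le (NNReal.coe_le_coe.2 huv)] at hr
    exact (h r.toNNReal ⟨Real.lt_toNNReal_iff_coe_lt.2 hr.1,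
      Real.toNNReal_le_iff_le_coe.2 hr.2⟩).1
  linarith

/-- While the reflected path stays `δ` below the boundary, `z u - g u ≤ k u - δ ≤ k s - δ`, so the
running maximum at `s` was already attained by time `q`. -/
theorem IsReflector.eq_of_add_le {S : ℝ≥0} {g z k : ℝ≥0 → ℝ} (h : IsReflector S g z k)
    {q s : ℝ≥0} (hqs : q ≤ s) (hs : s ≤ S) {δ : ℝ} (hδ : 0 < δ)
    (hlt : ∀ u ∈ Ioc q s, z u - k u + δ ≤ g u) : k s = k q := by
  refine le_antisymm ?_ (h.monotoneOn ⟨zero_le, hqs.trans hs⟩ ⟨zero_le, hs⟩ hqs)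
  have h1 : k s ≤ max (k q) (k s - δ) := h.le_of_forall hs fun u hu => by
    rcases le_or_gt u q with h1 | h1
    · exact le_max_of_le_left (h.le h1 (hqs.trans hs))
    · have h2 := h.monotoneOn ⟨zero_le, hu.trans hs⟩ ⟨zero_le, hs⟩ hu
      have h3 := hlt u ⟨h1, hu⟩
      have h4 := h.nonneg (hqs.trans hs)
      refine max_le (le_max_of_le_right (by linarith)) (le_max_of_le_left h4)
  rcases le_max_iff.1 h1 with h2 | h2
  · exact h2
  · linarith

/-- A path with increments those of `x` up to the exit time from `[ε, b]`, and constant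
afterwards. -/
theorem stopped_path {x y : ℝ≥0 → ℝ} {q S : ℝ≥0} {ε b : ℝ} (hx : ContinuousOn x (Icc q S))
    (hqS : q ≤ S) (hq : x q ∈ Icc ε b) (hyq : y q = x q) (hyq' : ∀ s ≤ q, y s = y q)
    (h1 : ∀ s, q ≤ s → s ≤ S → (∀ u ∈ Ioc q s, x u ∈ Icc ε b) → y s - y q = x s - x q)
    (h2 : ∀ u v, q ≤ u → u ≤ v → v ≤ S → (∀ r ∈ Ioc u v, ¬∀ u ∈ Ioc q r, x u ∈ Icc ε b) →
      y v = y u) :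
    (∀ s ≤ S, ε ≤ y s) ∧ (∀ s ≤ S, q < s → (∀ u ∈ Ioc q s, x u ∈ Icc ε b) → y s = x s) ∧
      ((∃ r ∈ Icc q S, x r < ε ∧ ∀ u ∈ Icc q r, x u ≤ b) → y S ≤ ε) := by
  obtain ⟨τ, hτ, hτ1, hτ2⟩ := exists_exit_time hx hqS hq
  have h3 : ∀ s ≤ S, τ ≤ s → y s = y τ := fun s hs hτs => h2 τ s hτ.1 hτs hs fun r hr hc => by
    obtain ⟨u, hu, hu'⟩ := hτ2 r hr.1 (hr.2.trans hs)
    exact hu' (hc u ⟨hτ.1.trans_lt hu.1, hu.2⟩)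
  have h4 : ∀ s ≤ τ, q ≤ s → y s = x s := fun s hs hqs => by
    have := h1 s hqs (hs.trans hτ.2) fun u hu => hτ1 u ⟨hu.1.le, hu.2.trans hs⟩
    linarith
  refine ⟨fun s hs => ?_, fun s hs hqs h => ?_, ?_⟩
  · rcases le_total τ s with h5 | h5
    · rw [h3 s hs h5, h4 τ le_rfl hτ.1]
      exact (hτ1 τ ⟨hτ.1, le_rfl⟩).1
    · rcases le_total q s with h6 | h6
      · rw [h4 s h5 h6]
        exact (hτ1 s ⟨h6, h5⟩).1
      · rw [hyq' s h6, hyq]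
        exact hq.1
  · have := h1 s hqs.le hs h
    linarith
  · rintro ⟨r, hr, hrε, hrb⟩
    rw [h3 S le_rfl hτ.2, h4 τ le_rfl hτ.1]
    have hτr : τ < r := by
      by_contra! h5
      exact absurd (hτ1 r ⟨hr.1, h5⟩).1 (not_le.2 hrε)
    -- If `x` were above `ε` at the exit time `τ`, it would remain above `ε` just afterwards, and it
    -- does not exceed `b` up to `r`; this contradicts the fact that `x` leaves `[ε, b]` immediately
    -- after `τ`.
    by_contra! h5
    have h6 : ∀ᶠ u in 𝓝[≥] τ, ε < x u := by
      have := ((hx τ hτ).mono (Icc_subset_Icc_left hτ.1)).eventually (lt_mem_nhds h5)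
      rwa [nhdsWithin_Icc_eq_nhdsGE (hτr.trans_le hr.2)] at this
    obtain ⟨v, hv, hv'⟩ := (mem_nhdsGE_iff_exists_Ico_subset' hτr).1 h6
    obtain ⟨w, hw1, hw2⟩ := exists_between (lt_min hv hτr)
    obtain ⟨u, hu, hu'⟩ := hτ2 w hw1 ((hw2.le.trans (min_le_right _ _)).trans hr.2)
    have h7 : ε < x u := hv' ⟨hu.1.le, hu.2.trans_lt (hw2.trans_le (min_le_left _ _))⟩
    exact hu' ⟨h7.le, hrb u ⟨hτ.1.trans hu.1.le, hu.2.trans (hw2.le.trans (min_le_right _ _))⟩⟩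

theorem abs_sub_half_le_iff {a b y : ℝ} : |y - (a + b) / 2| ≤ (b - a) / 2 ↔ y ∈ Icc a b := by
  rw [abs_le, mem_Icc]
  constructor <;> rintro ⟨h1, h2⟩ <;> constructor <;> linarith

/-- Before it exceeds a level below the barrier, a reflected process is unlikely to approach `0`. -/
theorem ReflStep.measure_exit_le [IsProbabilityMeasure P] (hW : IsFBrownian F P W) {S : ℝ≥0}
    {g : ℝ≥0 → ℝ} {x : ℝ} {μ σ : ℝ → ℝ} {X I K : ℝ≥0 → Ω → ℝ} {L : ℝ} {C : ℝ≥0}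
    (hL : 0 ≤ L) (hμ : LocLipGrowth C μ) (hσ : LocLipGrowth C σ)
    (hμL : ∀ y, 0 ≤ y → -(L * y) ≤ μ y) (hσL : ∀ y, 0 ≤ y → |σ y| ≤ L * y)
    (hX : ContAdapted F P S X)
    (h : ReflStep F P W S g x (fun s ω => μ (X s ω)) (fun s ω => σ (X s ω)) X I K)
    {q : ℝ≥0} (hqS : q ≤ S) {ε ε₀ b δ : ℝ} (hε : 0 < ε) (hεε : ε ≤ ε₀) (hεb : ε₀ ≤ b) (hδ : 0 < δ)
    (hb : ∀ s ≤ S, b + δ ≤ g s) :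
    P {ω | X q ω ∈ Icc ε₀ b ∧ ∃ r ∈ Icc q S, X r ω < ε ∧ ∀ u ∈ Icc q r, X u ω ≤ b} ≤
      ENNReal.ofReal (ε * (Real.exp ((L + 16 * L ^ 2) * (S - q)) / ε₀)) := by
  have hε₀ := hε.trans_le hεε
  have hC := C.coe_nonneg
  -- the indicator of the time before the exit from `[ε, b]`
  set A : ℝ≥0 → Ω → ℝ := fun s ω => if q < s then 1 * (X s ω - (ε + b) / 2) else 0 with hA
  have hAc : Caglad F P S A := (hX.sub (ContAdapted.const S ((ε + b) / 2))).caglad.after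
    measurable_const
  -- `A` is centred at the midpoint of `[ε, b]` and vanishes up to time `q`, so a bound on `|A|` by
  -- the half-length says that `X` has stayed in the interval since `q`.
  set J := levelInd A (ENNReal.ofReal ((b - ε) / 2)) with hJ
  have hJc : Caglad F P S J := hAc.levelInd _
  have hJ01 : ∀ s ω, J s ω = 0 ∨ J s ω = 1 := fun s ω => levelInd_eq_zero_or_one A _ s ω
  have hJX : ∀ s ω, q < s → J s ω = 1 → X s ω ∈ Icc ε b := by
    intro s ω hqs h1
    have h2 : dyadicSup A s ω ≤ ENNReal.ofReal ((b - ε) / 2) := by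
      by_contra h2
      rw [hJ, levelInd, if_neg h2] at h1
      exact zero_ne_one h1
    have h3 := (le_iSup (fun p => ‖A (dyadic p * s) ω‖ₑ) (0, 1)).trans h2
    rw [show dyadic (0, 1) = 1 by simp [dyadic], one_mul, hA] at h3
    simp only [if_pos hqs, one_mul] at h3
    rw [Real.enorm_eq_ofReal_abs, ENNReal.ofReal_le_ofReal_iff (by linarith)] at h3
    exact abs_sub_half_le_iff.1 h3
  -- the stopped process
  set E : Set Ω := {ω | X q ω ∈ Icc ε₀ b} with hE
  have hEm : MeasurableSet[F q] E := hX.adapted q hqS measurableSet_Icc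
  set c : Ω → ℝ := E.indicator fun _ => 1 with hc
  have hcm : Measurable[F q] c := measurable_const.indicator hEm
  have hloc : ∀ {φ : ℝ → ℝ}, LocLipGrowth C φ →
      Caglad F P S (fun s ω => if q < s then c ω * (J s ω * φ (X s ω)) else 0) := fun hφ =>
    (hJc.mul (hX.caglad.comp hφ.continuous)).after hcm
  have hlocC : ∀ {φ : ℝ → ℝ}, LocLipGrowth C φ → ∀ s ≤ S, ∀ ω,
      |if q < s then c ω * (J s ω * φ (X s ω)) else 0| ≤ C * (1 + b) := by
    intro φ hφ s hs ω
    have h0 : 0 ≤ C * (1 + b) := mul_nonneg hC (by linarith)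
    by_cases hqs : q < s
    · rw [if_pos hqs]
      by_cases hω : ω ∈ E
      · rw [hc, Set.indicator_of_mem hω, one_mul]
        rcases hJ01 s ω with h1 | h1
        · rw [h1, zero_mul, abs_zero]
          exact h0
        · rw [h1, one_mul]
          have h2 := hJX s ω hqs h1
          refine (hφ.growth _).trans (mul_le_mul_of_nonneg_left ?_ hC)
          rw [abs_of_nonneg (hε.le.trans h2.1)]
          linarith [h2.2]
      · rw [hc, Set.indicator_of_notMem hω, zero_mul, abs_zero]
        exact h0
    · rw [if_neg hqs, abs_zero]
      exact h0
  set β' : ℝ≥0 → Ω → ℝ := fun s ω => if q < s then c ω * (J s ω * μ (X s ω)) else 0 with hβ'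
  set H' : ℝ≥0 → Ω → ℝ := fun s ω => if q < s then c ω * (J s ω * σ (X s ω)) else 0 with hH'
  obtain ⟨I', -, hI'c, -, hI', -⟩ := (hloc hσ).exists_isItoIntegral hW
  obtain ⟨B, hBc, hB⟩ := (hloc hμ).exists_drift
  -- Off `E` the process `Y` is kept constant at `ε₀`, so that `ε ≤ Y` and `Y q ≥ ε₀` hold almost
  -- surely and not only on `E`.
  set ξ : Ω → ℝ := E.piecewise (X q) fun _ => ε₀ with hξ
  have hξm : Measurable[F q] ξ := (hX.adapted q hqS).piecewise hEm measurable_const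
  set Y : ℝ≥0 → Ω → ℝ := fun s ω => ξ ω + (B s ω + I' s ω) with hY
  have hYm : ∀ s, q ≤ s → s ≤ S → Measurable[F s] (Y s) := fun s hqs hs =>
    (hξm.mono (F.mono hqs) le_rfl).add ((hBc.adapted s hs).add (hI'c.adapted s hs))
  have hYeq : ∀ᵐ ω ∂P, ∀ s ≤ S,
      Y s ω = ξ ω + (∫ u in (0 : ℝ)..s, β' u.toNNReal ω) + I' s ω := by
    filter_upwards [hB] with ω h1 s hs
    simp only [hY, h1 s hs, add_assoc, hβ']
  have hpath : ∀ᵐ ω ∂P, Y q ω = ξ ω ∧ (∀ s ≤ S, ε ≤ Y s ω) ∧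
      (∀ s ≤ S, q < s → ω ∈ E → J s ω = 1 → Y s ω = X s ω) ∧
      (ω ∈ E → (∃ r ∈ Icc q S, X r ω < ε ∧ ∀ u ∈ Icc q r, X u ω ≤ b) → Y S ω ≤ ε) := by
    filter_upwards [hYeq, hI'.ae_eq_zero, hX.cont, h.eq, h.refl, hAc.levelInd_eq_one_iff
      (ENNReal.ofReal ((b - ε) / 2)), ae_increment_eq hW (hloc hμ) Caglad.zero (hloc hσ)
      Caglad.zero hI' (isItoIntegral_zero S), ae_increment_eq hW (hX.caglad.comp hμ.continuous)
      (hloc hμ) (hX.caglad.comp hσ.continuous) (hloc hσ) h.ito hI']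
      with ω e1 e2 e3 e4 e5 e6 e7 e8
    have hJiff : ∀ s ≤ S, J s ω = 1 ↔ ∀ u ∈ Ioc q s, X u ω ∈ Icc ε b := by
      intro s hs
      rw [hJ, e6 s hs]
      constructor
      · intro h1 u hu
        have h2 := (le_supNorm hu.2 A ω).trans h1
        rw [hA] at h2
        simp only [if_pos hu.1, one_mul] at h2
        rw [Real.enorm_eq_ofReal_abs, ENNReal.ofReal_le_ofReal_iff (by linarith)] at h2
        exact abs_sub_half_le_iff.1 h2
      · refine fun h1 => supNorm_le fun u hu => ?_
        rw [hA]
        by_cases hqu : q < u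
        · simp only [if_pos hqu, one_mul]
          rw [Real.enorm_eq_ofReal_abs]
          exact ENNReal.ofReal_le_ofReal (abs_sub_half_le_iff.2 (h1 u ⟨hqu, hu⟩))
        · simp [if_neg hqu]
    have hconst : ∀ u v, u ≤ v → v ≤ S → (∀ r ∈ Ioc u v, β' r ω = 0 ∧ H' r ω = 0) →
        Y v ω = Y u ω := by
      intro u v huv hv h0
      have h1 := e7 u v huv hv h0
      simp only [intervalIntegral.integral_zero, add_zero, sub_zero] at h1
      rw [e1 v hv, e1 u (huv.trans hv)]
      linarith
    have h0q : ∀ r, ¬q < r → β' r ω = 0 ∧ H' r ω = 0 := fun r hr =>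
      ⟨if_neg hr, if_neg hr⟩
    have hY0 : Y 0 ω = ξ ω := by
      rw [e1 0 zero_le, e2]
      simp
    have hYq : Y q ω = ξ ω := by
      rw [← hY0]
      exact hconst 0 q zero_le hqS fun r hr => h0q r (not_lt.2 hr.2)
    by_cases hω : ω ∈ E
    · have hcω : c ω = 1 := Set.indicator_of_mem hω _
      have hξω : ξ ω = X q ω := Set.piecewise_eq_of_mem _ _ _ hω
      obtain ⟨p1, p2, p3⟩ := stopped_path (x := fun s => X s ω) (y := fun s => Y s ω)
        (ε := ε) (b := b)
        (e3.mono (Icc_subset_Icc_left zero_le)) hqS ⟨hεε.trans hω.1, hω.2⟩ (hYq.trans hξω)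
        (fun s hs => (hconst s q hs hqS fun r hr => h0q r (not_lt.2 hr.2)).symm)
        (fun s hqs hs hX' => by
          have h1 := e8 q s hqs hs fun r hr => by
            have : J r ω = 1 := (hJiff r (hr.2.trans hs)).2 fun u hu => hX' u ⟨hu.1, hu.2.trans hr.2⟩
            simp only [if_pos hr.1, hcω, this, one_mul, and_self]
          -- Below `b ≤ g - δ` the reflection does not act, hence the increments of `X` are those of
          -- the unreflected Itô process.
          have h2 : K s ω = K q ω := e5.eq_of_add_le hqs hs hδ fun u hu => by
            rw [← e4 u (hu.2.trans hs)]
            linarith [(hX' u hu).2, hb u (hu.2.trans hs)]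
          have h3 := e4 s hs
          have h4 := e4 q hqS
          have h5 := e1 s hs
          have h6 := e1 q hqS
          simp only [hβ'] at h5 h6
          linarith)
        (fun u v hqu huv hv hX' => hconst u v huv hv fun r hr => by
          have : J r ω = 0 := (hJ01 r ω).resolve_right fun h1 =>
            hX' r hr ((hJiff r (hr.2.trans hv)).1 h1)
          simp only [hβ', hH', this, zero_mul, mul_zero, ite_self, and_self])
      exact ⟨hYq, p1, fun s hs hqs _ h1 => p2 s hs hqs ((hJiff s hs).1 h1), fun _ => p3⟩
    · have hcω : c ω = 0 := Set.indicator_of_notMem hω _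
      have hξω : ξ ω = ε₀ := Set.piecewise_eq_of_notMem _ _ _ hω
      refine ⟨hYq, fun s hs => ?_, fun _ _ _ h1 => absurd h1 hω, fun h1 => absurd h1 hω⟩
      rw [hconst 0 s zero_le hs fun r _ => by
        simp only [hβ', hH', hcω, zero_mul, ite_self, and_self], hY0, hξω]
      exact hεε
  have hcoef : ∀ᵐ ω ∂P, ∀ s ≤ S, -(L * Y s ω) ≤ β' s ω ∧ |H' s ω| ≤ L * Y s ω := by
    filter_upwards [hpath] with ω ⟨_, h1, h2, _⟩ s hs
    have h3 : 0 ≤ L * Y s ω := mul_nonneg hL (hε.le.trans (h1 s hs))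
    by_cases h4 : q < s ∧ ω ∈ E ∧ J s ω = 1
    · obtain ⟨h4, h5, h6⟩ := h4
      have hcω : c ω = 1 := Set.indicator_of_mem h5 _
      have h7 := h2 s hs h4 h5 h6
      have h8 : 0 ≤ X s ω := h7 ▸ hε.le.trans (h1 s hs)
      simp only [hβ', hH', if_pos h4, hcω, h6, one_mul, h7]
      exact ⟨hμL _ h8, hσL _ h8⟩
    · have h5 : β' s ω = 0 ∧ H' s ω = 0 := by
        by_cases h6 : q < s
        · by_cases h7 : ω ∈ E
          · have := (hJ01 s ω).resolve_right fun h8 => h4 ⟨h6, h7, h8⟩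
            simp only [hβ', hH', this, zero_mul, mul_zero, ite_self, and_self]
          · have hcω : c ω = 0 := Set.indicator_of_notMem h7 _
            simp only [hβ', hH', hcω, zero_mul, ite_self, and_self]
        · exact ⟨if_neg h6, if_neg h6⟩
      rw [h5.1, h5.2, abs_zero]
      exact ⟨by linarith, h3⟩
  have hmain := integral_inv_le hW hqS hε hL (mul_nonneg hC (by linarith : (0 : ℝ) ≤ 1 + b)) hYm
    (hloc hμ) (hloc hσ) hI' hYeq (hpath.mono fun ω h => h.2.1)
    (hcoef.mono fun ω h s hs => (h s hs).1) (hcoef.mono fun ω h s hs => (h s hs).2)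
    (hlocC hμ) (hlocC hσ)
  have hq : ∫ ω, (Y q ω)⁻¹ ∂P ≤ ε₀⁻¹ := by
    have h1 : ∀ᵐ ω ∂P, ‖(Y q ω)⁻¹‖ ≤ ε₀⁻¹ := by
      filter_upwards [hpath] with ω hω
      have h2 : ε₀ ≤ Y q ω := by
        rw [hω.1]
        by_cases h3 : ω ∈ E
        · rw [hξ, Set.piecewise_eq_of_mem _ _ _ h3]
          exact h3.1
        · rw [hξ, Set.piecewise_eq_of_notMem _ _ _ h3]
      rw [Real.norm_of_nonneg (inv_nonneg.2 (hε₀.le.trans h2))]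
      exact inv_anti₀ hε₀ h2
    have h2 := norm_integral_le_of_norm_le_const h1
    rw [probReal_univ, mul_one] at h2
    exact (le_abs_self _).trans h2
  have hYS0 : ∀ᵐ ω ∂P, 0 ≤ (Y S ω)⁻¹ := hpath.mono fun ω h =>
    inv_nonneg.2 (hε.le.trans (h.2.1 S le_rfl))
  have hYSi : Integrable (fun ω => (Y S ω)⁻¹) P := by
    refine Integrable.of_bound
      (((hYm S hqS le_rfl).mono (F.le S) le_rfl).inv.aestronglyMeasurable) ε⁻¹ ?_
    filter_upwards [hpath] with ω hω
    rw [Real.norm_of_nonneg (inv_nonneg.2 (hε.le.trans (hω.2.1 S le_rfl)))]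
    exact inv_anti₀ hε (hω.2.1 S le_rfl)
  have hmarkov := mul_meas_ge_le_integral_of_nonneg hYS0 hYSi ε⁻¹
  have hfin : P.real {ω | ε⁻¹ ≤ (Y S ω)⁻¹} ≤
      ε * (Real.exp ((L + 16 * L ^ 2) * (S - q)) / ε₀) := by
    rw [inv_mul_le_iff₀ hε] at hmarkov
    refine hmarkov.trans (mul_le_mul_of_nonneg_left (hmain.trans ?_) hε.le)
    rw [div_eq_mul_inv]
    exact mul_le_mul_of_nonneg_left hq (Real.exp_nonneg _)
  calc _ ≤ P {ω | ε⁻¹ ≤ (Y S ω)⁻¹} := by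
        refine measure_mono_ae ?_
        filter_upwards [hpath] with ω hω hω'
        exact inv_anti₀ (hε.trans_le (hω.2.1 S le_rfl)) (hω.2.2.2 hω'.1 hω'.2)
    _ ≤ _ := by
        rw [← ofReal_measureReal]
        exact ENNReal.ofReal_le_ofReal hfin

/-- A reflected process stays positive if its coefficients are dominated by the distance to `0`. -/
theorem ReflStep.ae_pos [IsProbabilityMeasure P] (hW : IsFBrownian F P W) {S : ℝ≥0}
    {g : ℝ≥0 → ℝ} {x : ℝ} {μ σ : ℝ → ℝ} {X I K : ℝ≥0 → Ω → ℝ} {L : ℝ} {C : ℝ≥0}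
    (hL : 0 ≤ L) (hμ : LocLipGrowth C μ) (hσ : LocLipGrowth C σ)
    (hμL : ∀ y, 0 ≤ y → -(L * y) ≤ μ y) (hσL : ∀ y, 0 ≤ y → |σ y| ≤ L * y)
    (hX : ContAdapted F P S X)
    (h : ReflStep F P W S g x (fun s ω => μ (X s ω)) (fun s ω => σ (X s ω)) X I K)
    (hg : MonotoneOn g (Icc 0 S)) (hg0 : 0 < g 0) (hx : 0 < x) :
    ∀ᵐ ω ∂P, ∀ s ≤ S, 0 < X s ω := by
  -- Half of `g 0` serves both as the level `b` and as the gap `δ` to the boundary, which never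
  -- falls below `g 0`.
  set b := g 0 / 2 with hb
  have hb0 : 0 < b := half_pos hg0
  have hbg : ∀ s ≤ S, b + b ≤ g s := fun s hs => by
    have := hg ⟨le_rfl, zero_le⟩ ⟨zero_le, hs⟩ (zero_le (a := s))
    linarith
  -- For a fixed starting time and level, the exit probability bound is linear in `ε`; letting `ε →
  -- 0` excludes reaching `0`. Only countably many starting times and levels are used.
  have hnull : ∀ (p : ℕ × ℕ) (n : ℕ), ∀ᵐ ω ∂P, ¬(X (dyadic p * S) ω ∈ Icc (b * (1 / (n + 1))) b ∧
      ∃ r ∈ Icc (dyadic p * S) S, X r ω ≤ 0 ∧ ∀ u ∈ Icc (dyadic p * S) r, X u ω ≤ b) := by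
    intro p n
    set ε₀ : ℝ := b * (1 / (n + 1)) with hε₀
    have hε0 : 0 < ε₀ := by positivity
    have hεb : ε₀ ≤ b := mul_le_of_le_one_right hb0.le
      ((div_le_one (by positivity)).2 (by linarith [n.cast_nonneg (α := ℝ)]))
    rw [ae_iff]
    simp only [not_not]
    set c : ℝ := Real.exp ((L + 16 * L ^ 2) * (S - (dyadic p * S : ℝ≥0))) / ε₀ with hc
    have hlim : Tendsto (fun ε : ℝ => ENNReal.ofReal (ε * c)) (𝓝[>] 0) (𝓝 0) := by
      have : Tendsto (fun ε : ℝ => ENNReal.ofReal (ε * c)) (𝓝 0) (𝓝 (ENNReal.ofReal (0 * c))) :=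
        (ENNReal.continuous_ofReal.comp (continuous_id.mul continuous_const)).tendsto 0
      rw [zero_mul, ENNReal.ofReal_zero] at this
      exact this.mono_left nhdsWithin_le_nhds
    refine le_zero_iff.1 (ge_of_tendsto hlim ?_)
    filter_upwards [Ioc_mem_nhdsGT hε0] with ε hε
    refine le_trans (measure_mono ?_) (h.measure_exit_le hW hL hμ hσ hμL hσL hX
      (dyadic_mul_le p S) hε.1 hε.2 hεb hb0 hbg)
    rintro ω ⟨h1, r, hr, h2, h3⟩
    exact ⟨h1, r, hr, h2.trans_lt hε.1, h3⟩
  filter_upwards [ae_all_iff.2 fun p => ae_all_iff.2 (hnull p), hX.cont, h.eq, h.refl,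
    h.ito.ae_eq_zero] with ω h1 hc h2 h3 h4 s hs
  have hX0 : 0 < X 0 ω := by
    rw [h2 0 zero_le, h3.apply_zero, h4]
    simp only [NNReal.coe_zero, intervalIntegral.integral_same, add_zero]
    rcases max_cases (x - g 0) 0 with h5 | h5 <;> linarith
  by_contra! hs0
  have hcs : ContinuousOn (fun u => X u ω) (Icc 0 s) := hc.mono (Icc_subset_Icc_right hs)
  set Z : Set ℝ≥0 := Icc 0 s ∩ (fun u => X u ω) ⁻¹' Iic 0 with hZ
  have hZc : IsClosed Z := hcs.preimage_isClosed_of_isClosed isClosed_Icc isClosed_Iic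
  have hZs : s ∈ Z := ⟨⟨zero_le, le_rfl⟩, hs0⟩
  have hr : sInf Z ∈ Z := hZc.csInf_mem ⟨s, hZs⟩ (OrderBot.bddBelow Z)
  set r := sInf Z with hrdef
  have hr0 : 0 < r := by
    rw [pos_iff_ne_zero]
    intro h5
    have h6 : X r ω ≤ 0 := hr.2
    rw [h5] at h6
    linarith
  have hlt : ∀ u < r, 0 < X u ω := by
    intro u hu
    by_contra! h5
    exact absurd (csInf_le (OrderBot.bddBelow Z) ⟨⟨zero_le, hu.le.trans hr.1.2⟩, h5⟩)
      (not_le.2 hu)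
  have hev : ∀ᶠ u in 𝓝[≤] r, X u ω < b := by
    have h6 : X r ω < b := lt_of_le_of_lt hr.2 hb0
    have := ((hcs r hr.1).mono (Icc_subset_Icc_right hr.1.2)).eventually (gt_mem_nhds h6)
    rwa [nhdsWithin_Icc_eq_nhdsLE hr0] at this
  -- Just before the first zero `r` the path lies in `(0, b)`. A dyadic starting time there, and `n`
  -- so large that the starting value exceeds `b / (n + 1)`, give one of the excluded events.
  obtain ⟨a, ha, ha'⟩ := (mem_nhdsLE_iff_exists_Ioc_subset' hr0).1 hev
  obtain ⟨m, ham, hmr⟩ := exists_between (mem_Iio.1 ha)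
  obtain ⟨p, hp1, hp2⟩ := exists_dyadic_mul ham ((hmr.le.trans hr.1.2).trans hs)
  have hp3 := hp2.trans_lt hmr
  obtain ⟨n, hn⟩ := exists_nat_one_div_lt (div_pos (hlt _ hp3) hb0)
  have hqb : X (dyadic p * S) ω < b := ha' ⟨hp1, hp3.le⟩
  refine h1 p n ⟨⟨?_, hqb.le⟩, r, ⟨hp3.le, hr.1.2.trans hs⟩, hr.2, fun u hu => ?_⟩
  · rw [lt_div_iff₀ hb0] at hn
    linarith
  · exact le_of_lt (ha' ⟨hp1.trans_le hu.1, hu.2⟩)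

/-! ### Solutions of the reflected equation -/

/-- A locally Lipschitz function is Lipschitz on compact sets, and composing with a contraction into
`D` that does not increase absolute values keeps both this and the linear growth. It moves the
equation from the closure of `O` to the whole line. -/
theorem locLipGrowth_comp_retraction {D : Set ℝ} (hD : IsClosed D) {μ π : ℝ → ℝ} {C : ℝ}
    (hμ : LocallyLipschitzOn D μ) (hC : ∀ y ∈ D, |μ y| ≤ C * (1 + |y|)) (hπD : ∀ y, π y ∈ D)
    (hπ : ∀ y z, |π y - π z| ≤ |y - z|) (hπ0 : ∀ y, |π y| ≤ |y|) :
    LocLipGrowth C.toNNReal (fun y => μ (π y)) where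
  lip R := by
    obtain ⟨L, hL⟩ := (hμ.mono (inter_subset_left (t := Icc (-R) R)))
      |>.exists_lipschitzOnWith_of_compact (isCompact_Icc.inter_left hD)
    have hmem : ∀ y, |y| ≤ R → π y ∈ D ∩ Icc (-R) R := fun y hy =>
      ⟨hπD y, abs_le.1 ((hπ0 y).trans hy)⟩
    exact ⟨L, fun y z hy hz => (hL.dist_le_mul _ (hmem y hy) _ (hmem z hz)).trans
      (mul_le_mul_of_nonneg_left (hπ y z) L.coe_nonneg)⟩
  growth y := by
    refine (hC _ (hπD y)).trans ?_
    exact mul_le_mul (Real.le_coe_toNNReal C) (by linarith [hπ0 y]) (by positivity)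
      (NNReal.coe_nonneg _)

theorem freePart_congr {S : ℝ≥0} {O : Set ℝ} {μ μ' : ℝ → ℝ} {x : ℝ} {X I : ℝ≥0 → Ω → ℝ} {ω : Ω}
    (hμ : EqOn μ μ' O) (hX : ∀ s ∈ Icc 0 S, X s ω ∈ O) {s : ℝ≥0} (hs : s ≤ S) :
    freePart μ x X I s ω = x + (∫ u in (0 : ℝ)..s, μ' (X u.toNNReal ω)) + I s ω := by
  unfold freePart
  congr 2
  refine intervalIntegral.integral_congr_ae (ae_of_all _ fun r hr => hμ (hX _ ⟨zero_le, ?_⟩))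
  rw [uIoc_of_le s.coe_nonneg] at hr
  exact (Real.toNNReal_le_iff_le_coe.2 hr.2).trans hs

section Solution

variable {O : Set ℝ} {μ σ μ' σ' : ℝ → ℝ} {T t : ℝ≥0} {f : ℝ≥0 → ℝ} {x : ℝ} {C : ℝ≥0}
  {X I K ν : ℝ≥0 → Ω → ℝ}

/-- The explicit running maximum satisfies the defining conditions of the control, by the Skorokhod
map. Changing coefficients off `O` is harmless because the path stays in `O`. -/
theorem isReflectedSolution_of_reflStep (hμ : EqOn μ μ' O) (hσ : EqOn σ σ' O)
    (hg : MonotoneOn (fun s => f (t + s)) (Icc 0 (T - t)))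
    (hgl : ∀ u ≤ T - t, ContinuousWithinAt (fun s => f (t + s)) (Iic u) u)
    (hX : ContAdapted F P (T - t) X) (hK : ContAdapted F P (T - t) K)
    (h : ReflStep F P W (T - t) (fun s => f (t + s)) x (fun s ω => μ' (X s ω))
      (fun s ω => σ' (X s ω)) X I K)
    (hXO : ∀ᵐ ω ∂P, ∀ s ∈ Icc 0 (T - t), X s ω ∈ O) :
    IsItoIntegral F P W (T - t) (fun u ω => σ (X u ω)) I ∧
      (∀ᵐ ω ∂P, ∀ s ∈ Icc 0 (T - t), X s ω = freePart μ x X I s ω + -K s ω ∧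
        IsLUB ((fun u => max (freePart μ x X I u ω - f (t + u)) 0) '' Icc 0 s) (- -K s ω)) ∧
      IsReflectedSolution F P W O μ σ T f t x X (fun s ω => -K s ω) := by
  have hito : IsItoIntegral F P W (T - t) (fun u ω => σ (X u ω)) I :=
    h.ito.congr (hXO.mono fun ω hω u hu => (hσ (hω u ⟨zero_le, hu.2⟩)).symm)
      (ae_of_all _ fun _ _ _ => rfl)
  have heq : ∀ᵐ ω ∂P, ∀ s ∈ Icc 0 (T - t), X s ω = freePart μ x X I s ω + -K s ω := by
    filter_upwards [h.eq, hXO] with ω h1 h2 s hs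
    rw [freePart_congr hμ h2 hs.2, h1 s hs.2, sub_eq_add_neg]
  have hrefl : ∀ᵐ ω ∂P, IsReflector (T - t) (fun s => f (t + s)) (fun s => freePart μ x X I s ω)
      fun s => K s ω := by
    filter_upwards [h.refl, hXO] with ω h1 h2
    exact h1.congr fun s hs => (freePart_congr hμ h2 hs).symm
  have hzero : ∀ᵐ ω ∂P, freePart μ x X I 0 ω = x := by
    filter_upwards [h.ito.ae_eq_zero] with ω h1
    simp [freePart, h1]
  refine ⟨hito, ?_, ?_⟩
  · filter_upwards [heq, hrefl] with ω h1 h2 s hs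
    exact ⟨h1 s hs, by rw [neg_neg]; exact h2 s hs.2⟩
  refine ⟨fun s hs => ⟨hX.adapted s hs.2, (hK.adapted s hs.2).neg⟩, ?_, hX.cont, hXO,
    ⟨I, hito, heq⟩, ?_, hK.cont.mono fun ω h1 => h1.neg,
    hrefl.mono fun ω h1 => h1.monotoneOn.neg, ?_, ?_⟩
  · filter_upwards [heq, hrefl, hzero] with ω h1 h2 h3
    have h4 := h2.apply_zero
    rw [add_zero, h3] at h4
    rw [h1 0 ⟨le_rfl, zero_le⟩, h3, h4]
    rcases le_total x (f t) with h5 | h5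
    · rw [min_eq_right h5, max_eq_right (by linarith)]
      ring
    · rw [min_eq_left h5, max_eq_left (by linarith)]
      ring
  · filter_upwards [hrefl, hzero] with ω h2 h3
    have h4 := h2.apply_zero
    rw [add_zero, h3] at h4
    rw [h4]
  · filter_upwards [heq, hrefl] with ω h1 h2 s hs
    rw [h1 s hs, ← sub_eq_add_neg]
    exact h2.sub_le hs.2
  · filter_upwards [heq, hrefl, hX.cont, hK.cont] with ω h1 h2 h3 h4
    have h5 : ContinuousOn (fun s => freePart μ x X I s ω) (Icc 0 (T - t)) :=
      (h3.add h4).congr fun s hs => by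
        change freePart μ x X I s ω = X s ω + K s ω
        linarith [h1 s hs]
    obtain ⟨G, hG, hG0⟩ := h2.minimal hg hgl h5
    refine ⟨G, fun s hs => by rw [hG s hs, neg_neg], ?_⟩
    rw [← hG0]
    refine setLIntegral_congr_fun measurableSet_Ioc fun s hs => ?_
    have h6 := h1 s (Ioc_subset_Icc_self hs)
    simp only [Set.indicator_apply, mem_ofPred_eq, h6, sub_eq_add_neg]

theorem IsReflectedSolution.contAdapted (h : IsReflectedSolution F P W O μ σ T f t x X ν) :
    ContAdapted F P (T - t) X :=
  ⟨fun s hs => (h.adapted s ⟨zero_le, hs⟩).1, h.X_cont⟩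

/-- Minimality forces `-ν` to be the running maximum, so uniqueness of reflected solutions reduces
to uniqueness of the fixed point. -/
theorem IsReflectedSolution.exists_reflStep (hμ : EqOn μ μ' O) (hσ : EqOn σ σ' O)
    (h : IsReflectedSolution F P W O μ σ T f t x X ν) :
    ∃ I, ReflStep F P W (T - t) (fun s => f (t + s)) x (fun s ω => μ' (X s ω))
      (fun s ω => σ' (X s ω)) X I (fun s ω => -ν s ω) := by
  obtain ⟨I, hI, heq⟩ := h.sde
  have hito : IsItoIntegral F P W (T - t) (fun u ω => σ' (X u ω)) I :=
    hI.congr (h.X_mem.mono fun ω hω u hu => hσ (hω u ⟨zero_le, hu.2⟩))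
      (ae_of_all _ fun _ _ _ => rfl)
  have heq' : ∀ᵐ ω ∂P, ∀ s ≤ T - t,
      X s ω = x + (∫ u in (0 : ℝ)..s, μ' (X u.toNNReal ω)) + I s ω - -ν s ω := by
    filter_upwards [heq, h.X_mem] with ω h1 h2 s hs
    rw [h1 s ⟨zero_le, hs⟩, freePart_congr hμ h2 hs, sub_neg_eq_add]
  refine ⟨I, hito, ?_, heq'⟩
  filter_upwards [heq', h.ν_zero, h.ν_cont, h.ν_anti, h.le_boundary, h.minimal, hito.ae_eq_zero]
    with ω h1 h2 h3 h4 h5 ⟨G, hG, hG0⟩ h6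
  refine IsReflector.of_minimal h4.neg h3.neg ?_ (fun s hs => ?_) G hG ?_
  · simp [h2, h6]
  · rw [← h1 s hs]
    exact h5 s ⟨zero_le, hs⟩
  · rw [← hG0]
    refine setLIntegral_congr_fun measurableSet_Ioc fun s hs => ?_
    simp only [Set.indicator_apply, mem_ofPred_eq, ← h1 s hs.2]

/-- Well-posedness of the reflected equation, given coefficients on the whole line for which the
reflected process stays in `O`. -/
theorem exists_unique_reflectedSolution [IsProbabilityMeasure P] (hW : IsFBrownian F P W)
    (hμ' : LocLipGrowth C μ') (hσ' : LocLipGrowth C σ') (hμ : EqOn μ μ' O) (hσ : EqOn σ σ' O)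
    (hg : MonotoneOn (fun s => f (t + s)) (Icc 0 (T - t)))
    (hgl : ∀ u ≤ T - t, ContinuousWithinAt (fun s => f (t + s)) (Iic u) u)
    (hO : ∀ X I K : ℝ≥0 → Ω → ℝ, ContAdapted F P (T - t) X →
      ReflStep F P W (T - t) (fun s => f (t + s)) x (fun s ω => μ' (X s ω))
        (fun s ω => σ' (X s ω)) X I K → ∀ᵐ ω ∂P, ∀ s ∈ Icc 0 (T - t), X s ω ∈ O) :
    ∃ X ν : ℝ≥0 → Ω → ℝ,
      IsReflectedSolution F P W O μ σ T f t x X ν ∧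
      (∀ X' ν' : ℝ≥0 → Ω → ℝ, IsReflectedSolution F P W O μ σ T f t x X' ν' →
        ∀ᵐ ω ∂P, ∀ s ∈ Icc 0 (T - t), X' s ω = X s ω ∧ ν' s ω = ν s ω) ∧
      (∃ I : ℝ≥0 → Ω → ℝ, IsItoIntegral F P W (T - t) (fun u ω => σ (X u ω)) I ∧
        ∀ᵐ ω ∂P, ∀ s ∈ Icc 0 (T - t),
          X s ω = freePart μ x X I s ω + ν s ω ∧
          IsLUB ((fun u => max (freePart μ x X I u ω - f (t + u)) 0) '' Icc 0 s) (-ν s ω)) ∧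
      (∫⁻ ω, (⨆ s ∈ Icc 0 (T - t), ‖X s ω‖ₑ ^ 2) ∂P) + (∫⁻ ω, ‖ν (T - t) ω‖ₑ ^ 2 ∂P) < ∞ := by
  obtain ⟨X, I, K, hX, hK, hXf, h⟩ := exists_reflStep hW hg hgl x hμ' hσ'
  obtain ⟨h1, h2, h3⟩ := isReflectedSolution_of_reflStep hμ hσ hg hgl hX hK h (hO X I K hX h)
  refine ⟨X, fun s ω => -K s ω, h3, fun X' ν' h' => ?_, ⟨I, h1, h2⟩, ?_⟩
  · obtain ⟨I', hs⟩ := h'.exists_reflStep hμ hσ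
    -- Once the two state processes agree, so do their drifts and, by locality, their stochastic
    -- integrals; the controls are then equal by subtraction.
    filter_upwards [hs.unique hW hμ' hσ' h'.contAdapted hX h, hs.eq, h.eq,
      hs.ito.ae_eq_of_eq hW h.ito (h'.contAdapted.comp hσ'.continuous).caglad.ae_pathMeas]
      with ω e1 e2 e3 e4 s hs'
    have e5 := e4 (fun u hu => by rw [e1 u hu.2]) s hs'.2
    have e6 : (∫ u in (0 : ℝ)..s, μ' (X' u.toNNReal ω)) = ∫ u in (0 : ℝ)..s, μ' (X u.toNNReal ω) := by
      refine intervalIntegral.integral_congr_ae (ae_of_all _ fun r hr => ?_)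
      rw [uIoc_of_le s.coe_nonneg] at hr
      rw [e1 _ ((Real.toNNReal_le_iff_le_coe.2 hr.2).trans hs'.2)]
    have e7 := e1 s hs'.2
    have e8 := e2 s hs'.2
    have e9 := e3 s hs'.2
    refine ⟨e7, ?_⟩
    rw [e6, e5] at e8
    linarith
  · refine ENNReal.add_lt_top.2 ⟨?_, ?_⟩
    · simp_rw [← supNorm_sq]
      exact hXf.lt_top
    · simp_rw [enorm_neg]
      exact (h.lintegral_reflector_sq_ne_top hW (hX.comp hμ'.continuous).caglad
        (hX.comp hσ'.continuous).caglad hX.caglad hXf (fun s ω => hμ'.growth _)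
        (fun s ω => hσ'.growth _)).lt_top

end Solution

/-- If the uncontrolled dynamics does not attain `0`, neither does the reflected process. -/
theorem NonAttainable.ae_pos [IsProbabilityMeasure P] (hW : IsFBrownian F P W)
    {μ σ μ' σ' : ℝ → ℝ} {T S : ℝ≥0} {C : ℝ≥0} (h : NonAttainable F P W (Ioi 0) μ σ T) (hT : 0 < T)
    (hμ' : LocLipGrowth C μ') (hσ' : LocLipGrowth C σ') (hμ : EqOn μ μ' (Ioi 0))
    (hσ : EqOn σ σ' (Ioi 0)) {g : ℝ≥0 → ℝ} {x : ℝ} (hg : MonotoneOn g (Icc 0 S)) (hg0 : 0 < g 0)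
    (hx : 0 < x) {X I K : ℝ≥0 → Ω → ℝ} (hX : ContAdapted F P S X)
    (hXI : ReflStep F P W S g x (fun s ω => μ' (X s ω)) (fun s ω => σ' (X s ω)) X I K) :
    ∀ᵐ ω ∂P, ∀ s ≤ S, 0 < X s ω := by
  obtain ⟨hσ0, hμ0⟩ := coeff_zero_of_nonneg_solutions hW hμ' hσ' hT fun y hy => by
    obtain ⟨Y, hYm, hY, I, hI, hYI⟩ := h y hy
    refine ⟨Y, I, ⟨fun s hs => hYm s ⟨zero_le, hs⟩, hY.mono fun ω h => h.1⟩, hI.congr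
      (hY.mono fun ω hω u hu => hσ (hω.2 u ⟨zero_le, hu.2⟩)) (ae_of_all _ fun _ _ _ => rfl), ?_⟩
    filter_upwards [hY, hYI] with ω h1 h2 s hs
    refine ⟨le_of_lt (h1.2 s ⟨zero_le, hs⟩), ?_⟩
    rw [h2 s ⟨zero_le, hs⟩, freePart_congr hμ h1.2 hs, add_zero]
  obtain ⟨L₁, hL₁⟩ := hμ'.exists_lip_zero
  obtain ⟨L₂, hL₂⟩ := hσ'.exists_lip_zero
  refine hXI.ae_pos (L := L₁ + L₂) hW (by positivity) hμ' hσ' (fun y hy => ?_) (fun y hy => ?_)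
    hX hg hg0 hx
  · have h1 := neg_le_of_abs_le (hL₁ y)
    rw [abs_of_nonneg hy] at h1
    linarith [mul_nonneg L₂.coe_nonneg hy]
  · have h1 := hL₂ y
    rw [abs_of_nonneg hy, hσ0, sub_zero] at h1
    linarith [mul_nonneg L₁.coe_nonneg hy]

end ReflSDE

/-! ### Well-posedness on the line and on the half-line. -/

theorem lemma5p2 {Ω : Type*} {mΩ : MeasurableSpace Ω} (P : Measure Ω) [IsProbabilityMeasure P]
    (F : Filtration ℝ≥0 mΩ) (W : ℝ≥0 → Ω → ℝ) (hW : ReflSDE.IsFBrownian F P W)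
    (O : Set ℝ) (μ σ : ℝ → ℝ) (T : ℝ≥0)
    (hO : O = univ ∨ (O = Ioi 0 ∧ ReflSDE.NonAttainable F P W O μ σ T))
    (hμ : LocallyLipschitzOn (closure O) μ) (hσ : LocallyLipschitzOn (closure O) σ)
    (hgrowth : ∃ C : ℝ, ∀ y ∈ closure O, |μ y| + |σ y| ≤ C * (1 + |y|))
    (f : ℝ≥0 → ℝ) (hfO : ∀ s ∈ Icc 0 T, f s ∈ O) (hfmono : MonotoneOn f (Icc 0 T))
    (hfleft : ∀ s ∈ Ioc 0 T, ContinuousWithinAt f (Iio s) s)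
    (t : ℝ≥0) (ht : t < T) (x : ℝ) (hx : x ∈ O) :
    ∃ X ν : ℝ≥0 → Ω → ℝ,
      ReflSDE.IsReflectedSolution F P W O μ σ T f t x X ν ∧
      (∀ X' ν' : ℝ≥0 → Ω → ℝ, ReflSDE.IsReflectedSolution F P W O μ σ T f t x X' ν' →
        ∀ᵐ ω ∂P, ∀ s ∈ Icc 0 (T - t), X' s ω = X s ω ∧ ν' s ω = ν s ω) ∧
      (∃ I : ℝ≥0 → Ω → ℝ, ReflSDE.IsItoIntegral F P W (T - t) (fun u ω => σ (X u ω)) I ∧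
        ∀ᵐ ω ∂P, ∀ s ∈ Icc 0 (T - t),
          X s ω = ReflSDE.freePart μ x X I s ω + ν s ω ∧
          IsLUB ((fun u => max (ReflSDE.freePart μ x X I u ω - f (t + u)) 0) '' Icc 0 s)
            (-ν s ω)) ∧
      (∫⁻ ω, (⨆ s ∈ Icc 0 (T - t), ‖X s ω‖ₑ ^ 2) ∂P) + (∫⁻ ω, ‖ν (T - t) ω‖ₑ ^ 2 ∂P) < ∞ := by
  have hS : t + (T - t) = T := add_tsub_cancel_of_le ht.le
  have hle : ∀ s ∈ Icc 0 (T - t), t + s ∈ Icc 0 T := fun s hs =>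
    ⟨zero_le, (add_le_add_right hs.2 t).trans hS.le⟩
  have hg : MonotoneOn (fun s => f (t + s)) (Icc 0 (T - t)) := fun a ha b hb hab =>
    hfmono (hle a ha) (hle b hb) (add_le_add_right hab t)
  -- At `u = 0` there are no points to the left, so nothing is asked of `f` before time `t`;
  -- elsewhere left-continuity on `Iio` is extended to `Iic` by adding the point itself.
  have hgl : ∀ u ≤ T - t, ContinuousWithinAt (fun s => f (t + s)) (Iic u) u := by
    intro u hu
    rcases eq_or_lt_of_le (zero_le (a := u)) with rfl | hu0
    · rw [show Iic (0 : ℝ≥0) = {0} from Iic_bot]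
      exact continuousWithinAt_singleton
    · rw [← Iio_insert, continuousWithinAt_insert_self]
      exact (hfleft (t + u) ⟨add_pos_of_nonneg_of_pos zero_le hu0, (hle u ⟨zero_le, hu⟩).2⟩).comp
        (continuous_const.add continuous_id).continuousWithinAt
        fun s hs => add_lt_add_right (mem_Iio.1 hs) t
  obtain ⟨C, hC⟩ := hgrowth
  have hCμ : ∀ y ∈ closure O, |μ y| ≤ C * (1 + |y|) := fun y hy =>
    (le_add_of_nonneg_right (abs_nonneg _)).trans (hC y hy)
  have hCσ : ∀ y ∈ closure O, |σ y| ≤ C * (1 + |y|) := fun y hy =>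
    (le_add_of_nonneg_left (abs_nonneg _)).trans (hC y hy)
  rcases hO with rfl | ⟨rfl, hna⟩
  · exact ReflSDE.exists_unique_reflectedSolution hW
      (ReflSDE.locLipGrowth_comp_retraction isClosed_closure hμ hCμ (π := id) (by simp)
        (fun _ _ => le_rfl) fun _ => le_rfl)
      (ReflSDE.locLipGrowth_comp_retraction isClosed_closure hσ hCσ (π := id) (by simp)
        (fun _ _ => le_rfl) fun _ => le_rfl) (fun _ _ => rfl) (fun _ _ => rfl) hg hgl
      fun _ _ _ _ _ => ae_of_all _ fun _ _ _ => mem_univ _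
  -- The retraction `y ↦ max y 0` lands in the closure of `O`, where the regularity of the
  -- coefficients is assumed; this is why it is assumed up to the end-point `0`.
  · have hπ : ∀ y : ℝ, max y 0 ∈ closure (Ioi (0 : ℝ)) := fun y => by
      rw [closure_Ioi]
      exact mem_Ici.2 (le_max_right _ _)
    have hπl : ∀ y z : ℝ, |max y 0 - max z 0| ≤ |y - z| := fun y z =>
      abs_max_sub_max_le_abs y z 0
    have hπ0 : ∀ y : ℝ, |max y 0| ≤ |y| := fun y => by simpa using hπl y 0
    have hEq : ∀ φ : ℝ → ℝ, EqOn φ (fun y => φ (max y 0)) (Ioi 0) := fun φ y hy => by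
      beta_reduce
      rw [max_eq_left (le_of_lt hy)]
    have hμ' := ReflSDE.locLipGrowth_comp_retraction isClosed_closure hμ hCμ hπ hπl hπ0
    have hσ' := ReflSDE.locLipGrowth_comp_retraction isClosed_closure hσ hCσ hπ hπl hπ0
    refine ReflSDE.exists_unique_reflectedSolution hW hμ' hσ' (hEq μ) (hEq σ) hg hgl
      fun X I K hX h => ?_
    exact (hna.ae_pos hW (zero_le.trans_lt ht) hμ' hσ' (hEq μ) (hEq σ) hg
      (hfO _ (hle 0 ⟨le_rfl, zero_le⟩)) hx hX h).mono fun ω h s hs => h s hs.2
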